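/- For an integer $n\ge 1$ let $\mathcal K_n$ be the Nichols Hopf algebra: the complex algebra generated by $K,\xi_1,\dots,\xi_n$ with relations $K^2=1$, $\xi_i^2=0$, $K\xi_i=-\xi_iK$, $\xi_i\xi_j=-\xi_j\xi_i$, and with $\Delta(K)=K\otimes K$, $\Delta(\xi_i)=K\otimes\xi_i+\xi_i\otimes 1$, $\varepsilon(K)=1$, $\varepsilon(\xi_i)=0$, $S(K)=K$, $S(\xi_i)=-K\xi_i$. For a finite-dimensional Hopf algebra $H$ let $DH=H^{*\mathrm{cop}}\bowtie H$ be its Drinfeld double, that is, the coalgebra $H^{*\mathrm{cop}}\otimes H$ with the multiplication $$(\varphi\otimes h)(\varphi'\otimes h')=\sum\varphi\,\varphi'\bigl(S^{-1}(h_{(3)})\,-\,h_{(1)}\bigr)\otimes h_{(2)}h'$$ and the canonical $R$-matrix $R=\sum_i(\varepsilon\otimes b_i)\otimes(b_i^*\otimes 1)$, where $(b_i)$ is a basis of $H$ with dual basis $(b_i^*)$. Let $D\mathcal K_n\text{-mod}$ be the category of finite-dimensional left $D\mathcal K_n$-modules. The total rank of an abelian category is the number of isomorphism classes of objects that are simple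 or projective indecomposable. A modular category is a ribbon finite tensor category over $\mathbb C$ (with simple unit object) that is non-degenerate, i.e. in which every object that centralizes all objects is a finite direct sum of copies of the unit object. 1. For all $n,m\ge 1$ with $n\ne m$, the categories $D\mathcal K_n\text{-mod}$ and $D\mathcal K_m\text{-mod}$ are not equivalent (as plain categories). 2. For every $n\ge 1$, the trivial $D\mathcal K_n$-module (of dimension one, with action given by the counit) has a projective cover $P_1$, and $n$ is the maximal size of a finite set of nilpotent elements of $\mathrm{End}(P_1)$ all of whose products of distinct members, in any order, are nonzero. 3. For every $n\ge 1$, $D\mathcal K_n\text{-mod}$ has total rank $6$. 4. For every even $n\ge 2$, $D\mathcal K_n\text{-mod}$, with the tensor product given by the comultiplication of $D\mathcal K_n$ and the braiding given by $R$, has a twist that makes it a modular category. 5. Hence there are infinitely many modular categories of total rank $6$ that are pairwise inequivalent, even as plain categories; so rank-finiteness fails for modular categories counted by total rank. -/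

import Mathlib

open scoped TensorProduct

noncomputable section

namespace NicholsDouble

open Coalgebra (comul counit)

/-! ## Hopf algebras with bijective antipode -/

section AntiComul
open TensorProduct WithConv HopfAlgebra

variable {k H : Type*} [CommRing k] [Ring H] [HopfAlgebra k H]

theorem comul_antipode_aux :
    (toConv (map (antipode k) (antipode k) ∘ₗ (TensorProduct.comm k H H).toLinearMap ∘ₗ comul) :
      WithConv (H →ₗ[k] H ⊗[k] H)) * toConv comul = 1 := by
  have h4 : map (comul (R := k) (A := H)) (comul (R := k) (A := H)) ∘ₗ comul =
      (TensorProduct.assoc k H H _).symm.toLinearMap ∘ₗ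
        map LinearMap.id (TensorProduct.assoc k _ _ _).toLinearMap ∘ₗ
        map LinearMap.id (map comul LinearMap.id) ∘ₗ map LinearMap.id comul ∘ₗ comul := by
    simp only [coassoc_simps]
  -- the map `a ⊗ ((b ⊗ c) ⊗ d) ↦ S(b) c ⊗ S(a) d`
  let Φ : H ⊗[k] ((H ⊗[k] H) ⊗[k] H) →ₗ[k] H ⊗[k] H :=
    LinearMap.mul' k (H ⊗[k] H) ∘ₗ
      map (map (antipode k) (antipode k) ∘ₗ (TensorProduct.comm k H H).toLinearMap) LinearMap.id ∘ₗ
      (TensorProduct.assoc k H H _).symm.toLinearMap ∘ₗ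
      map LinearMap.id (TensorProduct.assoc k _ _ _).toLinearMap
  have hΦ : ∀ (a d : H) (t : H ⊗[k] H), Φ (a ⊗ₜ (t ⊗ₜ d)) =
      LinearMap.mul' k H ((antipode k).rTensor H t) ⊗ₜ (antipode k a * d) := by
    intro a d t
    induction t with
    | zero => simp
    | add x y hx hy => simp only [tmul_add, add_tmul, map_add, hx, hy]
    | tmul b c => simp [Φ]
  have hΨ : ∀ t : H ⊗[k] (H ⊗[k] H), Φ (map LinearMap.id (map comul LinearMap.id) t) =
      1 ⊗ₜ LinearMap.mul' k H (map (antipode k) (TensorProduct.lid k H).toLinearMap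
        (map LinearMap.id (map (counit (R := k)) LinearMap.id) t)) := by
    intro t
    induction t with
    | zero => simp
    | add x y hx hy => simp only [map_add, tmul_add, hx, hy]
    | tmul a bc =>
    induction bc with
    | zero => simp
    | add x y hx hy => simp only [map_add, tmul_add, hx, hy]
    | tmul b c =>
      rw [map_tmul, map_tmul, LinearMap.id_apply, LinearMap.id_apply, hΦ,
        mul_antipode_rTensor_comul_apply, Algebra.algebraMap_eq_smul_one, smul_tmul]
      simp
  have hlid : ∀ t : H ⊗[k] H, map (antipode k) (TensorProduct.lid k H).toLinearMap
        (map LinearMap.id (map (counit (R := k)) LinearMap.id) (map LinearMap.id comul t)) =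
        (antipode k).rTensor H t := by
    intro t
    induction t with
    | zero => simp
    | add x y hx hy => simp only [map_add, hx, hy]
    | tmul a b =>
      have := Coalgebra.rTensor_counit_comul (R := k) b
      rw [LinearMap.rTensor] at this
      simp [this]
  have hG : ∀ t : H ⊗[k] H, LinearMap.mul' k (H ⊗[k] H) (map (map (antipode k) (antipode k) ∘ₗ
      (TensorProduct.comm k H H).toLinearMap ∘ₗ comul) comul t) =
      LinearMap.mul' k (H ⊗[k] H)
        (map (map (antipode k) (antipode k) ∘ₗ (TensorProduct.comm k H H).toLinearMap) LinearMap.id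
          (map comul comul t)) := by
    intro t
    induction t with
    | zero => simp
    | add x y hx hy => simp only [map_add, hx, hy]
    | tmul a b => simp
  apply WithConv.ext
  ext x
  simp only [LinearMap.convMul_def, LinearMap.convOne_def, LinearMap.comp_apply]
  have h4x := LinearMap.congr_fun h4 x
  simp only [LinearMap.comp_apply] at h4x
  rw [hG, h4x]
  refine (hΨ _).trans ?_
  rw [hlid, mul_antipode_rTensor_comul_apply]
  simp [Algebra.algebraMap_eq_smul_one, smul_tmul', Algebra.TensorProduct.one_def]

theorem comul_comp_antipode :
    (comul : H →ₗ[k] H ⊗[k] H) ∘ₗ antipode k =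
      map (antipode k) (antipode k) ∘ₗ (TensorProduct.comm k H H).toLinearMap ∘ₗ comul := by
  have h := left_inv_eq_right_inv (comul_antipode_aux (k := k) (H := H)) LinearMap.comul_right_inv
  exact (congrArg ofConv h).symm
end AntiComul

/-- Hopf algebras with bijective antipode. -/
class BijectiveAntipode (k H : Type*) [CommRing k] [Ring H] [HopfAlgebra k H] : Prop where
  bijective : Function.Bijective (HopfAlgebraStruct.antipode k : H →ₗ[k] H)

/-! ## The Drinfeld double of a Hopf algebra with bijective antipode -/

section Double
open TensorProduct HopfAlgebra

section Preliminaries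

variable (k H : Type*) [Field k] [Ring H] [HopfAlgebra k H]

/-- The (convolution) product of the dual: `(φψ)(x) = φ(x₁) ψ(x₂)`. -/
def dualMul : Module.Dual k H →ₗ[k] Module.Dual k H →ₗ[k] Module.Dual k H :=
  TensorProduct.curry ((comul : H →ₗ[k] H ⊗[k] H).dualMap ∘ₗ TensorProduct.dualDistrib k H H)

/-- `h ↦ h₁ ⊗ (h₂ ⊗ h₃)`. -/
def comul₃ : H →ₗ[k] H ⊗[k] (H ⊗[k] H) := map LinearMap.id comul ∘ₗ comul

/-- `φ ↦ (ψ ⊗ h ↦ φψ ⊗ h)`. -/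
def lmul : Module.Dual k H →ₗ[k] Module.End k (Module.Dual k H ⊗[k] H) :=
  LinearMap.rTensorHom H ∘ₗ dualMul k H

/-- `g ↦ (ψ ⊗ h ↦ ψ ⊗ hg)`. -/
def rmul : H →ₗ[k] Module.End k (Module.Dual k H ⊗[k] H) :=
  LinearMap.lTensorHom (Module.Dual k H) ∘ₗ (LinearMap.mul k H).flip

/-- The extension of `F` to `ψ ⊗ g ↦ F(ψ) g`. -/
def extR : (Module.Dual k H →ₗ[k] Module.Dual k H ⊗[k] H) →ₗ[k]
    Module.End k (Module.Dual k H ⊗[k] H) where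
  toFun F := TensorProduct.lift ((rmul k H).flip ∘ₗ F)
  map_add' _ _ := by ext; simp
  map_smul' _ _ := by ext; simp

variable {k H}

@[simp] theorem dualMul_apply (φ ψ : Module.Dual k H) (x : H) :
    dualMul k H φ ψ x = TensorProduct.dualDistrib k H H (φ ⊗ₜ ψ) (comul x) := rfl

theorem comul₃_mul (a b : H) : comul₃ k H (a * b) = comul₃ k H a * comul₃ k H b := by
  exact map_mul ((Algebra.TensorProduct.map (.id k H) (Bialgebra.comulAlgHom k H)).comp
    (Bialgebra.comulAlgHom k H)) a b

theorem comul₃_one : comul₃ k H 1 = 1 := by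
  exact map_one ((Algebra.TensorProduct.map (.id k H) (Bialgebra.comulAlgHom k H)).comp
    (Bialgebra.comulAlgHom k H))

@[simp] theorem lmul_tmul (φ ψ : Module.Dual k H) (h : H) :
    lmul k H φ (ψ ⊗ₜ h) = dualMul k H φ ψ ⊗ₜ h := rfl
@[simp] theorem rmul_tmul (ψ : Module.Dual k H) (g h : H) :
    rmul k H g (ψ ⊗ₜ h) = ψ ⊗ₜ (h * g) := rfl
@[simp] theorem extR_tmul (F : Module.Dual k H →ₗ[k] Module.Dual k H ⊗[k] H)
    (ψ : Module.Dual k H) (g : H) : extR k H F (ψ ⊗ₜ g) = rmul k H g (F ψ) := rfl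
theorem dualMul_eq (φ ψ : Module.Dual k H) :
    dualMul k H φ ψ = (WithConv.toConv φ * WithConv.toConv ψ).ofConv := by
  ext x
  rw [dualMul_apply, WithConv.ofConv, LinearMap.convMul_apply]
  generalize comul (R := k) x = t
  induction t with
  | zero => simp
  | add x y hx hy => simp only [map_add, hx, hy]
  | tmul a b => simp

theorem dualMul_assoc (φ ψ χ : Module.Dual k H) :
    dualMul k H (dualMul k H φ ψ) χ = dualMul k H φ (dualMul k H ψ χ) := by
  simp only [dualMul_eq, WithConv.toConv_ofConv, mul_assoc]

theorem counit_eq : (counit : Module.Dual k H) =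
    (1 : WithConv (H →ₗ[k] k)).ofConv := by
  ext x
  simp

theorem counit_dualMul (φ : Module.Dual k H) : dualMul k H counit φ = φ := by
  rw [dualMul_eq, counit_eq, WithConv.toConv_ofConv, one_mul]

theorem dualMul_counit (φ : Module.Dual k H) : dualMul k H φ counit = φ := by
  rw [dualMul_eq, counit_eq, WithConv.toConv_ofConv, mul_one]

theorem lmul_lmul (φ ψ : Module.Dual k H) (x : Module.Dual k H ⊗[k] H) :
    lmul k H φ (lmul k H ψ x) = lmul k H (dualMul k H φ ψ) x := by
  induction x with
  | zero => simp
  | add x y hx hy => simp only [map_add, hx, hy]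
  | tmul χ h => simp only [lmul_tmul, dualMul_assoc]

theorem lmul_counit (x : Module.Dual k H ⊗[k] H) : lmul k H counit x = x := by
  induction x with
  | zero => simp
  | add x y hx hy => simp only [map_add, hx, hy]
  | tmul χ h => simp only [lmul_tmul, counit_dualMul]

theorem rmul_one (x : Module.Dual k H ⊗[k] H) : rmul k H 1 x = x := by
  induction x with
  | zero => simp
  | add x y hx hy => simp only [map_add, hx, hy]
  | tmul χ h => simp

theorem rmul_rmul (g f : H) (x : Module.Dual k H ⊗[k] H) :
    rmul k H f (rmul k H g x) = rmul k H (g * f) x := by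
  induction x with
  | zero => simp
  | add x y hx hy => simp only [map_add, hx, hy]
  | tmul χ h => simp [mul_assoc]

theorem lmul_rmul (φ : Module.Dual k H) (g : H) (x : Module.Dual k H ⊗[k] H) :
    lmul k H φ (rmul k H g x) = rmul k H g (lmul k H φ x) := by
  induction x with
  | zero => simp
  | add x y hx hy => simp only [map_add, hx, hy]
  | tmul χ h => simp

theorem coassoc₅ : map (comul (R := k) (A := H)) (map LinearMap.id (comul (R := k) (A := H))) ∘ₗ comul₃ k H =
   (TensorProduct.assoc k H H _).symm.toLinearMap ∘ₗ
    map LinearMap.id (map LinearMap.id (TensorProduct.assoc k _ _ _).toLinearMap ∘ₗ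
      (TensorProduct.assoc k _ _ _).toLinearMap) ∘ₗ 
     map LinearMap.id (map (comul₃ k H) LinearMap.id) ∘ₗ comul₃ k H := by
  simp only [comul₃, coassoc_simps]


end Preliminaries

variable (k H : Type*) [Field k] [Ring H] [HopfAlgebra k H] [BijectiveAntipode k H]

/-- The inverse `S⁻¹` of the antipode. -/
def antipodeInv : H →ₗ[k] H :=
  (LinearEquiv.ofBijective (antipode k) BijectiveAntipode.bijective).symm.toLinearMap

variable {H}

@[simp] theorem antipode_antipodeInv (a : H) : antipode k (antipodeInv k H a) = a :=
  (LinearEquiv.ofBijective (antipode k) BijectiveAntipode.bijective).apply_symm_apply a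

@[simp] theorem antipodeInv_antipode (a : H) : antipodeInv k H (antipode k a) = a :=
  (LinearEquiv.ofBijective (antipode k) BijectiveAntipode.bijective).symm_apply_apply a

theorem antipodeInv_mul (a b : H) :
    antipodeInv k H (a * b) = antipodeInv k H b * antipodeInv k H a := by
  apply (BijectiveAntipode.bijective (k := k) (H := H)).1
  simp [antipode_mul_antidistrib]

@[simp] theorem antipodeInv_one : antipodeInv k H 1 = 1 := by
  apply (BijectiveAntipode.bijective (k := k) (H := H)).1
  simp

@[simp] theorem counit_antipodeInv (a : H) : counit (R := k) (antipodeInv k H a) = counit a := by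
  rw [← counit_antipode, antipode_antipodeInv]

theorem comul_antipodeInv (a : H) :
    comul (R := k) (antipodeInv k H a) =
      map (antipodeInv k H) (antipodeInv k H) (TensorProduct.comm k H H (comul a)) := by
  have h := LinearMap.congr_fun (comul_comp_antipode (k := k) (H := H)) (antipodeInv k H a)
  simp only [LinearMap.comp_apply, antipode_antipodeInv, LinearEquiv.coe_coe] at h
  rw [h]
  generalize comul (R := k) (antipodeInv k H a) = t
  induction t with
  | zero => simp
  | add x y hx hy => simp only [map_add, ← hx, ← hy]
  | tmul x y => simp

variable (H)

/-- `φ ↦ φ(S⁻¹(c) - a)` -/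
def sandwich : H →ₗ[k] H →ₗ[k] Module.Dual k H →ₗ[k] Module.Dual k H :=
  LinearMap.mk₂ k
    (fun a c => (LinearMap.mulLeft k (antipodeInv k H c) ∘ₗ LinearMap.mulRight k a).dualMap)
    (fun a a' c => by ext; simp [mul_add])
    (fun r a c => by ext; simp)
    (fun a c c' => by ext; simp [add_mul])
    (fun r a c => by ext; simp)

/-- `a ⊗ b ⊗ c ↦ (φ ↦ φ(S⁻¹(c) - a) ⊗ b)` -/
def crossAux : H ⊗[k] (H ⊗[k] H) →ₗ[k] Module.Dual k H →ₗ[k] Module.Dual k H ⊗[k] H :=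
  TensorProduct.lift (LinearMap.mk₂ k
      (fun (f : Module.Dual k H →ₗ[k] Module.Dual k H) (b : H) =>
        (TensorProduct.mk k (Module.Dual k H) H).flip b ∘ₗ f)
      (fun _ _ _ => by ext; simp) (fun _ _ _ => by ext; simp [smul_tmul'])
      (fun _ _ _ => by ext; simp) (fun _ _ _ => by ext; simp)) ∘ₗ
    map (TensorProduct.lift (sandwich k H)) LinearMap.id ∘ₗ
    (TensorProduct.assoc k H H H).symm.toLinearMap ∘ₗ
    map LinearMap.id (TensorProduct.comm k H H).toLinearMap

/-- `h ↦ (φ ↦ φ(S⁻¹(h₃) - h₁) ⊗ h₂)`. -/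
def cross : H →ₗ[k] Module.Dual k H →ₗ[k] Module.Dual k H ⊗[k] H := crossAux k H ∘ₗ comul₃ k H
/-- The multiplication `(φ ⊗ h)(ψ ⊗ g) = φ ψ(S⁻¹(h₃) - h₁) ⊗ h₂ g` of the Drinfeld double. -/
def doubleMul : Module.Dual k H ⊗[k] H →ₗ[k] Module.End k (Module.Dual k H ⊗[k] H) :=
  TensorProduct.lift ((LinearMap.mul k (Module.End k (Module.Dual k H ⊗[k] H))).compl₁₂
    (lmul k H) (extR k H ∘ₗ cross k H))
variable {H}

@[simp] theorem sandwich_apply (a c x : H) (φ : Module.Dual k H) :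
    sandwich k H a c φ x = φ (antipodeInv k H c * (x * a)) := rfl

@[simp] theorem crossAux_tmul (a b c : H) (φ : Module.Dual k H) :
    crossAux k H (a ⊗ₜ (b ⊗ₜ c)) φ = sandwich k H a c φ ⊗ₜ b := by
  simp [crossAux]

theorem doubleMul_tmul (φ ψ : Module.Dual k H) (h g : H) :
    doubleMul k H (φ ⊗ₜ h) (ψ ⊗ₜ g) = lmul k H φ (rmul k H g (cross k H h ψ)) := rfl
theorem doubleMul_tmul_left (φ : Module.Dual k H) (h : H) (x : Module.Dual k H ⊗[k] H) :
    doubleMul k H (φ ⊗ₜ h) x = lmul k H φ (extR k H (cross k H h) x) := rfl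

theorem doubleMul_lmul (φ : Module.Dual k H) (x y : Module.Dual k H ⊗[k] H) :
    doubleMul k H (lmul k H φ x) y = lmul k H φ (doubleMul k H x y) := by
  induction x with
  | zero => simp
  | add x y hx hy => simp only [map_add, hx, hy, LinearMap.add_apply]
  | tmul ψ h => rw [lmul_tmul, doubleMul_tmul_left, doubleMul_tmul_left, lmul_lmul]

theorem doubleMul_rmul (g : H) (x y : Module.Dual k H ⊗[k] H) :
    doubleMul k H x (rmul k H g y) = rmul k H g (doubleMul k H x y) := by
  induction x with
  | zero => simp
  | add x y hx hy => simp only [map_add, hx, hy, LinearMap.add_apply]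
  | tmul φ h =>
    induction y with
    | zero => simp
    | add x y hx hy => simp only [map_add, hx, hy]
    | tmul ψ f => rw [rmul_tmul, doubleMul_tmul, doubleMul_tmul, ← lmul_rmul, rmul_rmul]

theorem crossAux_mul (s t : H ⊗[k] (H ⊗[k] H)) (φ : Module.Dual k H) :
    crossAux k H (s * t) φ = extR k H (crossAux k H s) (crossAux k H t φ) := by
  induction s with
  | zero => simp
  | add x y hx hy => simp only [add_mul, map_add, LinearMap.add_apply, hx, hy]
  | tmul a bc =>
  induction bc with
  | zero => simp
  | add x y hx hy => simp only [tmul_add, add_mul, map_add, LinearMap.add_apply, hx, hy]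
  | tmul b c =>
  induction t with
  | zero => simp
  | add x y hx hy => simp only [mul_add, map_add, LinearMap.add_apply, hx, hy]
  | tmul a' bc =>
  induction bc with
  | zero => simp
  | add x y hx hy => simp only [tmul_add, mul_add, map_add, LinearMap.add_apply, hx, hy]
  | tmul b' c' =>
    simp only [Algebra.TensorProduct.tmul_mul_tmul, crossAux_tmul, extR_tmul, rmul_tmul]
    congr 1
    ext x
    simp [antipodeInv_mul, mul_assoc]

theorem cross_mul (h g : H) (ψ : Module.Dual k H) :
    cross k H (h * g) ψ = doubleMul k H (counit ⊗ₜ h) (cross k H g ψ) := by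
  rw [doubleMul_tmul_left, lmul_counit, cross, LinearMap.comp_apply, comul₃_mul, crossAux_mul]
  rfl

theorem cross_one (ψ : Module.Dual k H) : cross k H 1 ψ = ψ ⊗ₜ 1 := by
  rw [cross, LinearMap.comp_apply, comul₃_one, Algebra.TensorProduct.one_def,
    Algebra.TensorProduct.one_def, crossAux_tmul]
  congr 1
  ext x
  simp

theorem cross_counit (h : H) : cross k H h counit = counit ⊗ₜ h := by
  have key : ∀ t : H ⊗[k] (H ⊗[k] H), crossAux k H t counit =
      counit ⊗ₜ (TensorProduct.lid k H (map counit (TensorProduct.rid k H).toLinearMap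
        (map LinearMap.id (map LinearMap.id counit) t))) := by
    intro t
    induction t with
    | zero => simp
    | add x y hx hy => simp only [map_add, LinearMap.add_apply, hx, hy, tmul_add]
    | tmul a bc =>
    induction bc with
    | zero => simp
    | add x y hx hy => simp only [tmul_add, map_add, LinearMap.add_apply, hx, hy]
    | tmul b c =>
      have h : sandwich k H a c counit = (counit (R := k) a * counit (R := k) c) • counit := by
        ext x
        simp; ring
      rw [crossAux_tmul, h, smul_tmul]
      simp [← mul_smul, mul_comm]
  rw [cross, LinearMap.comp_apply, key]
  congr 1
  have h1 : ∀ t : H ⊗[k] H, map LinearMap.id (map LinearMap.id counit)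
      (map LinearMap.id (comul (R := k)) t) =
        map LinearMap.id (TensorProduct.rid k H).symm.toLinearMap t := by
    intro t
    induction t with
    | zero => simp
    | add x y hx hy => simp only [map_add, hx, hy]
    | tmul a b =>
      simp only [map_tmul]
      exact congrArg _ (Coalgebra.lTensor_counit_comul b)
  have h2 : ∀ t : H ⊗[k] H, map (counit (R := k)) (TensorProduct.rid k H).toLinearMap
      (map LinearMap.id (TensorProduct.rid k H).symm.toLinearMap t) =
        counit.rTensor H t := by
    intro t
    induction t with
    | zero => simp
    | add x y hx hy => simp only [map_add, hx, hy]
    | tmul a b => simp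
  rw [comul₃, LinearMap.comp_apply, h1, h2, Coalgebra.rTensor_counit_comul]
  simp

/-- An auxiliary map for the proof of associativity. -/
def fiveAux (ψ χ : Module.Dual k H) :
    H ⊗[k] ((H ⊗[k] (H ⊗[k] H)) ⊗[k] H) →ₗ[k] Module.Dual k H ⊗[k] H :=
  TensorProduct.lift (LinearMap.compl₂ (lmul k H ∘ₗ (TensorProduct.lift (sandwich k H)).flip ψ)
    ((crossAux k H).flip χ)) ∘ₗ
  (TensorProduct.assoc k H H _).symm.toLinearMap ∘ₗ
    map LinearMap.id (TensorProduct.comm k _ H).toLinearMap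

theorem fiveAux_tmul (ψ χ : Module.Dual k H) (a c : H) (u : H ⊗[k] (H ⊗[k] H)) :
    fiveAux k ψ χ (a ⊗ₜ (u ⊗ₜ c)) = lmul k H (sandwich k H a c ψ) (crossAux k H u χ) := by
  simp [fiveAux]

theorem cross_dualMul (h : H) (ψ χ : Module.Dual k H) :
    cross k H h (dualMul k H ψ χ) = doubleMul k H (cross k H h ψ) (χ ⊗ₜ 1) := by
  have key : ∀ t : H ⊗[k] (H ⊗[k] H), crossAux k H t (dualMul k H ψ χ) =
     fiveAux k ψ χ (map LinearMap.id (
       (TensorProduct.assoc k _ _ _).symm.toLinearMap ∘ₗ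
        map LinearMap.id (TensorProduct.assoc k _ _ _).symm.toLinearMap)
      (TensorProduct.assoc k _ _ _ (map (comul (R := k) (A := H)) (map LinearMap.id (comul (R := k) (A := H))) t))) := by
    have hΦ : ∀ (u v : H ⊗[k] H) (b : H),
        ((dualDistrib k H H (ψ ⊗ₜ χ)) ∘ₗ LinearMap.mulLeft k (map (antipodeInv k H)
          (antipodeInv k H) (TensorProduct.comm k H H v)) ∘ₗ LinearMap.mulRight k u ∘ₗ
            comul : Module.Dual k H) ⊗ₜ[k] b =
        fiveAux k ψ χ (map LinearMap.id (
          (TensorProduct.assoc k _ _ _).symm.toLinearMap ∘ₗ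
            map LinearMap.id (TensorProduct.assoc k _ _ _).symm.toLinearMap)
          (TensorProduct.assoc k _ _ _ (u ⊗ₜ (b ⊗ₜ v)))) := by
      intro u v b
      induction u with
      | zero => simp
      | add x y hx hy =>
        rw [add_tmul, map_add, map_add, map_add, ← hx, ← hy, ← add_tmul]
        congr 1
        ext x
        simp [mul_add]
      | tmul a₁ a₂ =>
      induction v with
      | zero => simp
      | add x y hx hy =>
        simp only [tmul_add, map_add]
        rw [← hx, ← hy, ← add_tmul]
        congr 1
        ext x
        simp [add_mul]
      | tmul c₁ c₂ =>
        simp only [assoc_tmul, map_tmul, LinearMap.comp_apply, LinearEquiv.coe_coe,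
          assoc_symm_tmul, LinearMap.id_apply, fiveAux_tmul, crossAux_tmul, lmul_tmul, comm_tmul]
        congr 1
        ext x
        simp only [LinearMap.comp_apply, dualMul_apply]
        generalize comul (R := k) x = t
        induction t with
        | zero => simp
        | add x y hx hy => simp only [map_add, hx, hy]
        | tmul y z => simp
    intro t
    induction t with
    | zero => simp
    | add x y hx hy => simp only [map_add, LinearMap.add_apply, hx, hy]
    | tmul a bc =>
    induction bc with
    | zero => simp
    | add x y hx hy => simp only [tmul_add, map_add, LinearMap.add_apply, hx, hy]
    | tmul b c =>
      rw [map_tmul, map_tmul, LinearMap.id_apply, ← hΦ, crossAux_tmul]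
      congr 1
      ext x
      simp [comul_antipodeInv]
  have key2 : ∀ t : H ⊗[k] (H ⊗[k] H), doubleMul k H (crossAux k H t ψ) (χ ⊗ₜ 1) =
     fiveAux k ψ χ (map LinearMap.id (map (comul₃ k H) LinearMap.id) t) := by
    intro t
    induction t with
    | zero => simp
    | add x y hx hy => simp only [map_add, LinearMap.add_apply, hx, hy]
    | tmul a bc =>
    induction bc with
    | zero => simp
    | add x y hx hy => simp only [tmul_add, map_add, LinearMap.add_apply, hx, hy]
    | tmul b c => 
      rw [crossAux_tmul, doubleMul_tmul, rmul_one, map_tmul, map_tmul, fiveAux_tmul]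
      rfl
  rw [cross, LinearMap.comp_apply, key, key2]
  have h5 := LinearMap.congr_fun (coassoc₅ (k := k) (H := H)) h
  simp only [LinearMap.comp_apply] at h5
  rw [h5]
  congr 1
  generalize map LinearMap.id (map (comul₃ k H) LinearMap.id) (comul₃ k H h) = t
  simp only [LinearEquiv.coe_coe, LinearEquiv.apply_symm_apply]
  rw [← LinearMap.comp_apply, ← map_comp]
  conv_rhs => rw [← LinearMap.id_apply (R := k) t, ← map_id]
  congr 2
  ext
  simp

theorem doubleMul_assoc (x y z : Module.Dual k H ⊗[k] H) :
    doubleMul k H (doubleMul k H x y) z = doubleMul k H x (doubleMul k H y z) := by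
  have hC : ∀ (X : Module.Dual k H ⊗[k] H) (g : H) (χ : Module.Dual k H),
      doubleMul k H (rmul k H g X) (χ ⊗ₜ 1) = doubleMul k H X (cross k H g χ) := by
    intro X g χ
    induction X with
    | zero => simp
    | add x y hx hy => simp only [map_add, hx, hy, LinearMap.add_apply]
    | tmul ψ h =>
      rw [rmul_tmul, doubleMul_tmul, rmul_one, cross_mul, ← doubleMul_lmul, lmul_tmul,
        dualMul_counit]
  have hX : ∀ (X : Module.Dual k H ⊗[k] H) (f : H) (χ : Module.Dual k H),
      doubleMul k H X (χ ⊗ₜ f) = rmul k H f (doubleMul k H X (χ ⊗ₜ 1)) := by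
    intro X f χ
    rw [← doubleMul_rmul, rmul_tmul, one_mul]
  have hD : ∀ (Y : Module.Dual k H ⊗[k] H) (h : H) (ψ : Module.Dual k H),
      doubleMul k H (counit ⊗ₜ h) (lmul k H ψ Y) = doubleMul k H (cross k H h ψ) Y := by
    intro Y h ψ
    induction Y with
    | zero => simp
    | add x y hx hy => simp only [map_add, hx, hy]
    | tmul χ g =>
      rw [lmul_tmul, doubleMul_tmul, lmul_counit, cross_dualMul, ← hX]
  have hL : ∀ (φ : Module.Dual k H) (h : H) (Y : Module.Dual k H ⊗[k] H),
      doubleMul k H (φ ⊗ₜ h) Y = lmul k H φ (doubleMul k H (counit ⊗ₜ h) Y) := by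
    intro φ h Y
    rw [← doubleMul_lmul, lmul_tmul, dualMul_counit]
  induction x with
  | zero => simp
  | add x y hx hy => simp only [map_add, LinearMap.add_apply, hx, hy]
  | tmul φ h =>
  induction y with
  | zero => simp
  | add x y hx hy => simp only [map_add, LinearMap.add_apply, hx, hy]
  | tmul ψ g =>
  induction z with
  | zero => simp
  | add x y hx hy => simp only [map_add, LinearMap.add_apply, hx, hy]
  | tmul χ f =>
    rw [doubleMul_tmul, doubleMul_lmul, hX, hC, doubleMul_tmul, hL, hD, lmul_rmul, doubleMul_rmul,
      lmul_rmul]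

theorem one_doubleMul (x : Module.Dual k H ⊗[k] H) : doubleMul k H (counit ⊗ₜ 1) x = x := by
  induction x with
  | zero => simp
  | add x y hx hy => simp only [map_add, hx, hy]
  | tmul ψ h => rw [doubleMul_tmul, cross_one, lmul_counit, rmul_tmul, one_mul]

theorem doubleMul_one (x : Module.Dual k H ⊗[k] H) : doubleMul k H x (counit ⊗ₜ 1) = x := by
  induction x with
  | zero => simp
  | add x y hx hy => simp only [map_add, hx, hy, LinearMap.add_apply]
  | tmul ψ h => rw [doubleMul_tmul, cross_counit, rmul_one, lmul_tmul, dualMul_counit]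

variable (H)

/-- The Drinfeld double `D(H) = H^{*cop} ⋈ H`, with underlying vector space `H^* ⊗ H`. -/
def DrinfeldDouble : Type _ := Module.Dual k H ⊗[k] H

namespace DrinfeldDouble

instance : AddCommGroup (DrinfeldDouble k H) :=
  inferInstanceAs (AddCommGroup (Module.Dual k H ⊗[k] H))

instance : Module k (DrinfeldDouble k H) :=
  inferInstanceAs (Module k (Module.Dual k H ⊗[k] H))

/-- The identification of `D(H)` with `H^* ⊗ H` as a vector space. -/
def equiv : Module.Dual k H ⊗[k] H ≃ₗ[k] DrinfeldDouble k H := LinearEquiv.refl k _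

instance : Ring (DrinfeldDouble k H) :=
  { (inferInstance : AddCommGroup (DrinfeldDouble k H)) with
    mul := fun x y => doubleMul k H x y
    one := equiv k H (counit ⊗ₜ 1)
    left_distrib := fun x y z => map_add (doubleMul k H x) y z
    right_distrib := fun x y z => LinearMap.map_add₂ (doubleMul k H) x y z
    zero_mul := fun x => LinearMap.map_zero₂ (doubleMul k H) x
    mul_zero := fun x => map_zero (doubleMul k H x)
    mul_assoc := doubleMul_assoc k
    one_mul := one_doubleMul k
    mul_one := doubleMul_one k }

instance : Algebra k (DrinfeldDouble k H) :=
  Algebra.ofModule (fun r x y => LinearMap.map_smul₂ (doubleMul k H) r x y)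
    (fun r x y => map_smul (doubleMul k H x) r y)

/-- The inclusion `φ ↦ φ ⊗ 1` of `H^{*cop}`. -/
def ofDual : Module.Dual k H →ₗ[k] DrinfeldDouble k H :=
  (equiv k H).toLinearMap ∘ₗ (TensorProduct.mk k (Module.Dual k H) H).flip 1

/-- The inclusion `h ↦ ε ⊗ h` of `H`. -/
def ofHopf : H →ₗ[k] DrinfeldDouble k H :=
  (equiv k H).toLinearMap ∘ₗ TensorProduct.mk k (Module.Dual k H) H counit

/-- The counit `φ ⊗ h ↦ φ(1) ε(h)` of the double. -/
def doubleCounit : DrinfeldDouble k H →ₗ[k] k :=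
  LinearMap.mul' k k ∘ₗ map (LinearMap.applyₗ (1 : H)) counit ∘ₗ (equiv k H).symm.toLinearMap

section FiniteDimensional

variable [Module.Finite k H]

instance : Module.Finite k (DrinfeldDouble k H) :=
  inferInstanceAs (Module.Finite k (Module.Dual k H ⊗[k] H))

instance : IsNoetherianRing (DrinfeldDouble k H) := IsNoetherianRing.of_finite k _

/-- The comultiplication of `H^{*cop}`: `φ ↦ φ₂ ⊗ φ₁`, where `φ(xy) = φ₁(x) φ₂(y)`. -/
def dualCoopComul : Module.Dual k H →ₗ[k] Module.Dual k H ⊗[k] Module.Dual k H :=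
  (TensorProduct.comm k _ _).toLinearMap ∘ₗ
    (TensorProduct.dualDistribEquiv k H H).symm.toLinearMap ∘ₗ (LinearMap.mul' k H).dualMap

/-- The comultiplication of the double, that of the tensor product coalgebra `H^{*cop} ⊗ H`. -/
def doubleComul : DrinfeldDouble k H →ₗ[k] DrinfeldDouble k H ⊗[k] DrinfeldDouble k H :=
  map (equiv k H).toLinearMap (equiv k H).toLinearMap ∘ₗ
    (TensorProduct.tensorTensorTensorComm k _ _ _ _).toLinearMap ∘ₗ
    map (dualCoopComul k H) comul ∘ₗ (equiv k H).symm.toLinearMap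

/-- The canonical `R`-matrix `∑ᵢ (ε ⊗ bᵢ) ⊗ (bᵢ^* ⊗ 1)` of the double, for a basis `(bᵢ)` of `H`. -/
def rMatrix : DrinfeldDouble k H ⊗[k] DrinfeldDouble k H :=
  map (ofHopf k H) (ofDual k H) (coevaluation k H 1)

end FiniteDimensional

end DrinfeldDouble

end Double

/-! ## The Nichols Hopf algebras -/

/-- The algebra generators `K, ξ₁, …, ξₙ`. -/
inductive NicholsGen (n : ℕ) : Type
  | K : NicholsGen n
  | xi : Fin n → NicholsGen n

/-- The defining relations `K² = 1`, `ξᵢ² = 0`, `K ξᵢ = - ξᵢ K`, `ξᵢ ξⱼ = - ξⱼ ξᵢ`. -/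
inductive NicholsRel (n : ℕ) :
    FreeAlgebra ℂ (NicholsGen n) → FreeAlgebra ℂ (NicholsGen n) → Prop
  | K_sq : NicholsRel n (FreeAlgebra.ι ℂ .K * FreeAlgebra.ι ℂ .K) 1
  | xi_sq (i : Fin n) : NicholsRel n (FreeAlgebra.ι ℂ (.xi i) * FreeAlgebra.ι ℂ (.xi i)) 0
  | K_xi (i : Fin n) : NicholsRel n (FreeAlgebra.ι ℂ .K * FreeAlgebra.ι ℂ (.xi i))
      (-(FreeAlgebra.ι ℂ (.xi i) * FreeAlgebra.ι ℂ .K))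
  | xi_xi (i j : Fin n) : NicholsRel n (FreeAlgebra.ι ℂ (.xi i) * FreeAlgebra.ι ℂ (.xi j))
      (-(FreeAlgebra.ι ℂ (.xi j) * FreeAlgebra.ι ℂ (.xi i)))

/-- The Nichols algebra `𝒦ₙ`: the complex algebra with these generators and relations. -/
def Nichols (n : ℕ) : Type := RingQuot (NicholsRel n)

instance (n : ℕ) : Ring (Nichols n) := inferInstanceAs (Ring (RingQuot (NicholsRel n)))
instance (n : ℕ) : Algebra ℂ (Nichols n) := inferInstanceAs (Algebra ℂ (RingQuot (NicholsRel n)))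

namespace Nichols
variable {n : ℕ}

/-- The projection from the free algebra. -/
def mk (n : ℕ) : FreeAlgebra ℂ (NicholsGen n) →ₐ[ℂ] Nichols n := RingQuot.mkAlgHom ℂ (NicholsRel n)

theorem mk_rel {a b : FreeAlgebra ℂ (NicholsGen n)} (h : NicholsRel n a b) : mk n a = mk n b :=
  RingQuot.mkAlgHom_rel ℂ h

/-- The generator `K`. -/
def K : Nichols n := mk n (FreeAlgebra.ι ℂ .K)
/-- The generator `ξᵢ`. -/
def xi (i : Fin n) : Nichols n := mk n (FreeAlgebra.ι ℂ (.xi i))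

@[simp] theorem K_mul_K : (K : Nichols n) * K = 1 := by
  simpa [K] using mk_rel (NicholsRel.K_sq (n := n))
@[simp] theorem xi_mul_self (i : Fin n) : xi i * xi i = 0 := by
  simpa [xi] using mk_rel (NicholsRel.xi_sq i)
theorem K_mul_xi (i : Fin n) : K * xi i = -(xi i * K) := by
  simpa [xi, K] using mk_rel (NicholsRel.K_xi i)
theorem xi_mul_xi (i j : Fin n) : xi i * xi j = -(xi j * xi i) := by
  simpa [xi] using mk_rel (NicholsRel.xi_xi i j)

/-- The universal property of `𝒦ₙ`. -/
def lift {A : Type*} [Ring A] [Algebra ℂ A] (k : A) (x : Fin n → A) (h1 : k * k = 1)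
    (h2 : ∀ i, x i * x i = 0) (h3 : ∀ i, k * x i = -(x i * k))
    (h4 : ∀ i j, x i * x j = -(x j * x i)) : Nichols n →ₐ[ℂ] A :=
  RingQuot.liftAlgHom ℂ ⟨FreeAlgebra.lift ℂ (fun g => NicholsGen.casesOn g k x), by
    rintro _ _ (_ | i | i | ⟨i, j⟩)
    · simpa using h1
    · simpa using h2 i
    · simpa using h3 i
    · simpa using h4 i j⟩

section
variable {A : Type*} [Ring A] [Algebra ℂ A] (k : A) (x : Fin n → A) (h1 : k * k = 1)
    (h2 : ∀ i, x i * x i = 0) (h3 : ∀ i, k * x i = -(x i * k))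
    (h4 : ∀ i j, x i * x j = -(x j * x i))
@[simp] theorem lift_K : lift k x h1 h2 h3 h4 K = k := by exact (RingQuot.liftAlgHom_mkAlgHom_apply ..).trans (by simp)
@[simp] theorem lift_xi (i : Fin n) : lift k x h1 h2 h3 h4 (xi i) = x i := by exact (RingQuot.liftAlgHom_mkAlgHom_apply ..).trans (by simp)
end

theorem algHom_ext {A : Type*} [Semiring A] [Algebra ℂ A] {f g : Nichols n →ₐ[ℂ] A}
    (hK : f K = g K) (hx : ∀ i, f (xi i) = g (xi i)) : f = g := by
  apply RingQuot.ringQuot_ext'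
  apply FreeAlgebra.hom_ext
  funext a
  cases a with
  | K => exact hK
  | xi i => exact hx i

theorem induction {P : Nichols n → Prop} (hc : ∀ c : ℂ, P (algebraMap ℂ _ c)) (hK : P K)
    (hx : ∀ i, P (xi i)) (hadd : ∀ a b, P a → P b → P (a + b))
    (hmul : ∀ a b, P a → P b → P (a * b)) (a : Nichols n) : P a := by
  obtain ⟨w, rfl⟩ : ∃ w, mk n w = a := RingQuot.mkAlgHom_surjective ℂ (NicholsRel n) a
  induction w using FreeAlgebra.induction with
  | grade0 r => rw [AlgHom.commutes]; exact hc r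
  | grade1 g =>
    cases g with
    | K => exact hK
    | xi i => exact hx i
  | mul u v hu hv => rw [map_mul]; exact hmul _ _ hu hv
  | add u v hu hv => rw [map_add]; exact hadd _ _ hu hv

/-- The comultiplication `Δ(K) = K ⊗ K`, `Δ(ξᵢ) = K ⊗ ξᵢ + ξᵢ ⊗ 1`. -/
def comulHom : Nichols n →ₐ[ℂ] Nichols n ⊗[ℂ] Nichols n :=
  lift (K ⊗ₜ K) (fun i => K ⊗ₜ xi i + xi i ⊗ₜ 1)
    (by simp [Algebra.TensorProduct.one_def])
    (fun i => by simp [mul_add, add_mul, K_mul_xi, TensorProduct.neg_tmul])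
    (fun i => by
      simp [mul_add, add_mul, K_mul_xi, TensorProduct.neg_tmul, TensorProduct.tmul_neg]
      abel)
    (fun i j => by
      simp [mul_add, add_mul, K_mul_xi, TensorProduct.neg_tmul]
      rw [xi_mul_xi i j, TensorProduct.neg_tmul, TensorProduct.tmul_neg]
      abel)

/-- The counit `ε(K) = 1`, `ε(ξᵢ) = 0`. -/
def counitHom : Nichols n →ₐ[ℂ] ℂ :=
  lift 1 (fun _ => 0) (by simp) (by simp) (by simp) (by simp)

instance : Bialgebra ℂ (Nichols n) :=
  Bialgebra.ofAlgHom comulHom counitHom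
    (by
      apply algHom_ext
      · simp [comulHom]
      · intro i
        simp [comulHom, TensorProduct.tmul_add, TensorProduct.add_tmul, Algebra.TensorProduct.one_def]
        abel)
    (by
      apply algHom_ext
      · simp [comulHom, counitHom]
      · intro i
        simp [comulHom, counitHom])
    (by
      apply algHom_ext
      · simp [comulHom, counitHom]
      · intro i
        simp [comulHom, counitHom])

@[simp] theorem comul_K : Coalgebra.comul (R := ℂ) (K : Nichols n) = K ⊗ₜ K :=
  lift_K ..
@[simp] theorem comul_xi (i : Fin n) :
    Coalgebra.comul (R := ℂ) (xi i : Nichols n) = K ⊗ₜ xi i + xi i ⊗ₜ 1 :=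
  lift_xi ..
@[simp] theorem counit_K : Coalgebra.counit (R := ℂ) (K : Nichols n) = 1 :=
  lift_K ..
@[simp] theorem counit_xi (i : Fin n) : Coalgebra.counit (R := ℂ) (xi i : Nichols n) = 0 :=
  lift_xi ..

theorem xi_mul_K (i : Fin n) : xi i * K = -(K * xi i) := by rw [K_mul_xi, neg_neg]

theorem K_mul_xi_mul_K (i : Fin n) : K * (xi i * K) = -xi i := by
  rw [xi_mul_K, mul_neg, ← mul_assoc, K_mul_K, one_mul]

theorem K_mul_xi_mul_K_mul_xi (i j : Fin n) : K * xi i * (K * xi j) = -(xi i * xi j) := by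
  rw [K_mul_xi, neg_mul, mul_assoc, ← mul_assoc K K, K_mul_K, one_mul]

open MulOpposite in
/-- The antipode as an algebra map to the opposite algebra, `S(K) = K`, `S(ξᵢ) = -K ξᵢ`. -/
def antipodeHom : Nichols n →ₐ[ℂ] (Nichols n)ᵐᵒᵖ :=
  lift (op K) (fun i => op (-(K * xi i)))
    (by rw [← op_mul, K_mul_K, op_one])
    (fun i => by rw [← op_mul, neg_mul_neg, K_mul_xi_mul_K_mul_xi]; simp)
    (fun i => by
      rw [← op_mul, ← op_mul, ← op_neg]
      congr 1
      rw [neg_mul, mul_neg, neg_neg, mul_assoc, K_mul_xi_mul_K, ← mul_assoc, K_mul_K, one_mul,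
        neg_neg])
    (fun i j => by
      rw [← op_mul, ← op_mul, ← op_neg, neg_mul_neg, neg_mul_neg, K_mul_xi_mul_K_mul_xi,
        K_mul_xi_mul_K_mul_xi, xi_mul_xi j i])

/-- The antipode `S` of `𝒦ₙ`. -/
def antipodeLin : Nichols n →ₗ[ℂ] Nichols n :=
  (MulOpposite.opLinearEquiv ℂ).symm.toLinearMap ∘ₗ antipodeHom.toLinearMap

theorem antipodeLin_mul (a b : Nichols n) :
    antipodeLin (a * b) = antipodeLin b * antipodeLin a := by
  simp [antipodeLin]

@[simp] theorem antipodeLin_K : antipodeLin (K : Nichols n) = K := by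
  simp [antipodeLin, antipodeHom]

@[simp] theorem antipodeLin_xi (i : Fin n) : antipodeLin (xi i) = -(K * xi i) := by
  simp [antipodeLin, antipodeHom]

theorem antipode_left (a : Nichols n) : ∀ t : Nichols n ⊗[ℂ] Nichols n,
    LinearMap.mul' ℂ _ (antipodeLin.rTensor _ (Coalgebra.comul (R := ℂ) a * t)) =
      Coalgebra.counit (R := ℂ) a • LinearMap.mul' ℂ _ (antipodeLin.rTensor _ t) := by
  induction a using induction with
  | hc c => intro t; rw [Bialgebra.comul_algebraMap, ← Algebra.smul_def]; simp
  | hK =>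
    intro t
    induction t with
    | zero => simp
    | add x y hx hy => rw [mul_add, map_add, map_add, hx, hy, map_add, map_add, smul_add]
    | tmul x y =>
      simp only [comul_K, Algebra.TensorProduct.tmul_mul_tmul, LinearMap.rTensor_tmul,
        LinearMap.mul'_apply, antipodeLin_mul, antipodeLin_K, counit_K, one_smul]
      rw [mul_assoc, ← mul_assoc K K, K_mul_K, one_mul]
  | hx i =>
    intro t
    induction t with
    | zero => simp
    | add x y hx hy => rw [mul_add, map_add, map_add, hx, hy, map_add, map_add, smul_add]
    | tmul x y =>
      simp only [comul_xi, add_mul, map_add, Algebra.TensorProduct.tmul_mul_tmul,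
        LinearMap.rTensor_tmul, LinearMap.mul'_apply, antipodeLin_mul, antipodeLin_K,
        antipodeLin_xi, counit_xi, zero_smul, one_mul]
      noncomm_ring
  | hadd a b ha hb => intro t; simp [add_mul, ha, hb, add_smul]
  | hmul a b ha hb => intro t; simp [mul_assoc, ha, hb, mul_smul]

theorem antipode_right (a : Nichols n) : ∀ t : Nichols n ⊗[ℂ] Nichols n,
    LinearMap.mul' ℂ _ (antipodeLin.lTensor _ (t * Coalgebra.comul (R := ℂ) a)) =
      Coalgebra.counit (R := ℂ) a • LinearMap.mul' ℂ _ (antipodeLin.lTensor _ t) := by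
  induction a using induction with
  | hc c => intro t; rw [Bialgebra.comul_algebraMap, ← Algebra.commutes, ← Algebra.smul_def]; simp
  | hK =>
    intro t
    induction t with
    | zero => simp
    | add x y hx hy => rw [add_mul, map_add, map_add, hx, hy, map_add, map_add, smul_add]
    | tmul x y =>
      simp only [comul_K, Algebra.TensorProduct.tmul_mul_tmul, LinearMap.lTensor_tmul,
        LinearMap.mul'_apply, antipodeLin_mul, antipodeLin_K, counit_K, one_smul]
      rw [mul_assoc, ← mul_assoc K K, K_mul_K, one_mul]
  | hx i =>
    intro t
    induction t with
    | zero => simp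
    | add x y hx hy => rw [add_mul, map_add, map_add, hx, hy, map_add, map_add, smul_add]
    | tmul x y =>
      simp only [comul_xi, mul_add, map_add, Algebra.TensorProduct.tmul_mul_tmul,
        LinearMap.lTensor_tmul, LinearMap.mul'_apply, antipodeLin_mul, antipodeLin_xi,
        counit_xi, zero_smul, mul_one]
      rw [mul_assoc, neg_mul, mul_neg, mul_assoc K, ← mul_assoc K K, K_mul_K, one_mul, mul_neg,
        mul_assoc, neg_add_cancel]
  | hadd a b ha hb => intro t; simp [mul_add, ha, hb, add_smul]
  | hmul a b ha hb => intro t; rw [Bialgebra.comul_mul, ← mul_assoc, hb, ha, Bialgebra.counit_mul, mul_comm, mul_smul]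

/-- The Nichols Hopf algebra `𝒦ₙ`. -/
instance : HopfAlgebra ℂ (Nichols n) where
  antipode := antipodeLin
  mul_antipode_rTensor_comul := by
    ext a
    have h := antipode_left a 1
    rw [mul_one, Algebra.TensorProduct.one_def] at h
    simpa [Algebra.algebraMap_eq_smul_one, antipodeLin] using h
  mul_antipode_lTensor_comul := by
    ext a
    have h := antipode_right a 1
    rw [one_mul, Algebra.TensorProduct.one_def] at h
    simpa [Algebra.algebraMap_eq_smul_one, antipodeLin] using h

theorem antipodeLin_four (a : Nichols n) :
    antipodeLin (antipodeLin (antipodeLin (antipodeLin a))) = a := by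
  induction a using induction with
  | hc c => simp [antipodeLin, Algebra.algebraMap_eq_smul_one]
  | hK => simp
  | hx i =>
    have h : antipodeLin (antipodeLin (xi i)) = -xi i := by
      rw [antipodeLin_xi, map_neg, antipodeLin_mul, antipodeLin_K, antipodeLin_xi, neg_mul, neg_neg,
        mul_assoc, K_mul_xi_mul_K]
    rw [h, map_neg, map_neg, h, neg_neg]
  | hadd a b ha hb => simp [ha, hb]
  | hmul a b ha hb => simp [antipodeLin_mul, ha, hb]

instance : BijectiveAntipode ℂ (Nichols n) where
  bijective := ⟨fun a b h => by
    have h' : antipodeLin a = antipodeLin b := h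
    rw [← antipodeLin_four a, h', antipodeLin_four],
   fun a => ⟨_, antipodeLin_four a⟩⟩

/-- An auxiliary increasing family of finite-dimensional subspaces exhausting `𝒦ₙ`. -/
def wordSpan : List (Fin n) → Submodule ℂ (Nichols n)
  | [] => Submodule.span ℂ {1, K}
  | i :: l => wordSpan l ⊔ (wordSpan l).map (LinearMap.mulLeft ℂ (xi i))

theorem wordSpan_finite (l : List (Fin n)) : Module.Finite ℂ (wordSpan l) := by
  induction l with
  | nil => exact Module.Finite.span_of_finite ℂ (by simp)
  | cons i l ih => rw [wordSpan]; infer_instance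

theorem one_mem_wordSpan (l : List (Fin n)) : 1 ∈ wordSpan l := by
  induction l with
  | nil => exact Submodule.subset_span (by simp)
  | cons i l ih => exact Submodule.mem_sup_left ih

theorem K_mul_mem_wordSpan (l : List (Fin n)) : ∀ a ∈ wordSpan l, K * a ∈ wordSpan l := by
  induction l with
  | nil =>
    intro a ha
    obtain ⟨c, d, rfl⟩ := Submodule.mem_span_pair.1 ha
    exact Submodule.mem_span_pair.2 ⟨d, c, by simp [mul_add, add_comm]⟩
  | cons i l ih =>
    intro a ha
    obtain ⟨b, hb, _, ⟨c, hc, rfl⟩, rfl⟩ := Submodule.mem_sup.1 ha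
    rw [mul_add]
    refine Submodule.add_mem_sup (ih b hb) ⟨-(K * c), neg_mem (ih c hc), ?_⟩
    simp [← mul_assoc, K_mul_xi]

theorem xi_mul_mem_wordSpan (l : List (Fin n)) (j : Fin n) (hj : j ∈ l) :
    ∀ a ∈ wordSpan l, xi j * a ∈ wordSpan l := by
  induction l with
  | nil => simp at hj
  | cons i l ih =>
    intro a ha
    obtain ⟨b, hb, _, ⟨c, hc, rfl⟩, rfl⟩ := Submodule.mem_sup.1 ha
    rw [mul_add]
    by_cases h : j = i
    · subst h
      simp only [LinearMap.mulLeft_apply, ← mul_assoc, xi_mul_self, zero_mul, add_zero]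
      exact Submodule.mem_sup_right ⟨b, hb, rfl⟩
    · have hj' : j ∈ l := by simpa [h] using hj
      refine Submodule.add_mem_sup (ih hj' b hb) ⟨-(xi j * c), neg_mem (ih hj' c hc), ?_⟩
      simp only [LinearMap.mulLeft_apply, ← mul_assoc, mul_neg]
      rw [xi_mul_xi j i, neg_mul]

instance : Module.Finite ℂ (Nichols n) := by
  have := wordSpan_finite (List.finRange n)
  have key : ∀ a : Nichols n, ∀ b ∈ wordSpan (List.finRange n), a * b ∈ wordSpan (List.finRange n) := by
    intro a
    induction a using induction with
    | hc c => intro b hb; rw [← Algebra.smul_def]; exact Submodule.smul_mem _ _ hb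
    | hK => exact K_mul_mem_wordSpan _
    | hx i => exact xi_mul_mem_wordSpan _ i (List.mem_finRange i)
    | hadd x y hx hy => intro b hb; rw [add_mul]; exact add_mem (hx b hb) (hy b hb)
    | hmul x y hx hy => intro b hb; rw [mul_assoc]; exact hx _ (hy b hb)
  have htop : wordSpan (List.finRange n) = ⊤ :=
    eq_top_iff.2 fun a _ => by simpa using key a 1 (one_mem_wordSpan _)
  exact Module.Finite.of_surjective (wordSpan (List.finRange n)).subtype
    (by rw [← LinearMap.range_eq_top, Submodule.range_subtype, htop])

end Nichols
/-- The doubled Nichols Hopf algebra `D𝒦ₙ`. -/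
abbrev DoubledNichols (n : ℕ) : Type := DrinfeldDouble ℂ (Nichols n)

/-! ## Modular categories -/

section Categories

open CategoryTheory Limits MonoidalCategory

attribute [local instance] Abelian.hasFiniteBiproducts

universe v u

/-- The total rank of a category: the number of isomorphism classes of objects that are simple or
projective indecomposable. -/
def totalRank (C : Type u) [Category.{v} C] [Abelian C] : ℕ∞ :=
  Set.encard {c : Quotient (isIsomorphicSetoid C) |
    ∃ X : C, Quotient.mk _ X = c ∧ (Simple X ∨ (Projective X ∧ Indecomposable X))}

/-- Finite tensor categories over `ℂ`: finite `ℂ`-linear abelian categories (finite-dimensional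
morphism spaces, all objects of finite length, enough projectives, finitely many simple objects up
to isomorphism) that are rigid monoidal with bilinear tensor product and simple unit object. -/
structure IsFiniteTensorCategory (C : Type u) [Category.{v} C] [Abelian C] [Linear ℂ C]
    [MonoidalCategory C] : Prop where
  finite_hom : ∀ X Y : C, Module.Finite ℂ (X ⟶ Y)
  noetherian : ∀ X : C, IsNoetherianObject X
  artinian : ∀ X : C, IsArtinianObject X
  enoughProjectives : EnoughProjectives C
  finite_simple : {c : Quotient (isIsomorphicSetoid C) |
    ∃ X : C, Quotient.mk _ X = c ∧ Simple X}.Finite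
  monoidalPreadditive : MonoidalPreadditive C
  monoidalLinear : MonoidalLinear ℂ C
  hasRightDual : ∀ X : C, Nonempty (HasRightDual X)
  hasLeftDual : ∀ X : C, Nonempty (HasLeftDual X)
  simple_unit : Simple (𝟙_ C)

/-- The structure of a modular category, i.e. of a non-degenerate ribbon finite tensor category, on
a `ℂ`-linear abelian category. Non-degeneracy is the triviality of the Müger centre: every object
that is transparent to all objects is a finite direct sum of copies of the unit object. -/
structure ModularStructure (C : Type u) [Category.{v} C] [Abelian C] [Linear ℂ C] where
  [monoidal : MonoidalCategory C]
  [braided : BraidedCategory C]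
  isFiniteTensorCategory : IsFiniteTensorCategory C
  twist : 𝟭 C ≅ 𝟭 C
  twist_tensor : ∀ X Y : C, twist.hom.app (tensorObj X Y) =
    tensorHom (twist.hom.app X) (twist.hom.app Y) ≫ (β_ X Y).hom ≫ (β_ Y X).hom
  twist_dual : ∀ (X : C) [HasRightDual X],
    rightAdjointMate (X := X) (Y := X) (twist.hom.app X) =
      twist.hom.app (HasRightDual.rightDual X)
  nondegenerate : ∀ X : C, (∀ Y : C, (β_ X Y).hom ≫ (β_ Y X).hom = 𝟙 (tensorObj X Y)) →
    ∃ m : ℕ, Nonempty (X ≅ ⨁ fun _ : Fin m => 𝟙_ C)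

set_option linter.checkUnivs false in
/-- A (bundled) modular category. -/
structure ModularCategory where
  carrier : Type u
  [category : Category.{v} carrier]
  [abelian : Abelian carrier]
  [linear : Linear ℂ carrier]
  modular : ModularStructure carrier

attribute [instance] ModularCategory.category ModularCategory.abelian ModularCategory.linear

/-- `π : P ⟶ V` is a projective cover: `P` is projective and `π` is an essential epimorphism. -/
def IsProjectiveCover {C : Type u} [Category.{v} C] {P V : C} (π : P ⟶ V) : Prop :=
  Projective P ∧ Epi π ∧ ∀ (Q : C) (g : Q ⟶ P), Epi (g ≫ π) → Epi g

/-- A finite set of nilpotent endomorphisms of `P` such that every product of distinct members, in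
any order, is nonzero. -/
def IsNilpotentProductSet {C : Type u} [Category.{v} C] [Preadditive C] {P : C}
    (S : Finset (End P)) : Prop :=
  (∀ f ∈ S, IsNilpotent f) ∧ ∀ l : List (End P), l.Nodup → (∀ f ∈ l, f ∈ S) → l.prod ≠ 0

end Categories

/-! ## Categories of finite-dimensional modules -/

section Modules

open scoped ModuleCat
open CategoryTheory MonoidalCategory

/-- Over a finite-dimensional algebra, the objects of `FGModuleCat` are the finite-dimensional
modules. -/
theorem finite_iff_finiteDimensional {A : Type} [Ring A] [Algebra ℂ A] [Module.Finite ℂ A]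
    (M : ModuleCat.{0} A) : Module.Finite A M ↔ Module.Finite ℂ M :=
  ⟨fun _ => Module.Finite.trans A M, fun _ => Module.Finite.of_restrictScalars_finite ℂ A M⟩

/-- The category `D𝒦ₙ`-mod of finite-dimensional left `D𝒦ₙ`-modules. -/
abbrev DKMod (n : ℕ) : Type 1 := FGModuleCat.{0} (DoubledNichols n)

variable {A : Type} [Ring A] [Algebra ℂ A]

/-- The action of `A ⊗ A` on the tensor product over `ℂ` of two `A`-modules. -/
def tensorAct (X Y : FGModuleCat.{0} A) : A ⊗[ℂ] A →ₗ[ℂ] Module.End ℂ (X ⊗[ℂ] Y) :=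
  TensorProduct.homTensorHomMap (.id ℂ) X Y X Y ∘ₗ
    TensorProduct.map (Algebra.lsmul ℂ ℂ X).toLinearMap (Algebra.lsmul ℂ ℂ Y).toLinearMap

/-- The braided monoidal structure on `A`-modules is the one given by the comultiplication `Δ`, the
counit `ε` and the `R`-matrix `R`: up to natural identifications, the tensor product of `X` and `Y`
is `X ⊗ Y` over `ℂ` with `a` acting by `Δ(a)`, the unit object is `ℂ` with `a` acting by `ε(a)`, the
associator and the unitors are the standard ones, and the braiding is
`x ⊗ y ↦ τ(R (x ⊗ y))`, with `τ` the flip. -/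
structure BraidedTensorData (Δ : A →ₗ[ℂ] A ⊗[ℂ] A) (ε : A →ₗ[ℂ] ℂ) (R : A ⊗[ℂ] A)
    [MonoidalCategory (FGModuleCat.{0} A)] [BraidedCategory (FGModuleCat.{0} A)] where
  tensorEquiv (X Y : FGModuleCat.{0} A) : X ⊗[ℂ] Y ≃ₗ[ℂ] (tensorObj X Y : FGModuleCat.{0} A)
  unitEquiv : ℂ ≃ₗ[ℂ] (𝟙_ (FGModuleCat.{0} A) : FGModuleCat.{0} A)
  smul_tensor (X Y : FGModuleCat.{0} A) (a : A) (t : X ⊗[ℂ] Y) :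
    a • tensorEquiv X Y t = tensorEquiv X Y (tensorAct X Y (Δ a) t)
  smul_unit (a : A) (c : ℂ) : a • unitEquiv c = unitEquiv (ε a * c)
  tensor_hom {X X' Y Y' : FGModuleCat.{0} A} (f : X ⟶ X') (g : Y ⟶ Y') (x : X) (y : Y) :
    (tensorHom f g).hom.hom (tensorEquiv X Y (x ⊗ₜ y)) =
      tensorEquiv X' Y' (f.hom.hom x ⊗ₜ g.hom.hom y)
  associator (X Y Z : FGModuleCat.{0} A) (x : X) (y : Y) (z : Z) :
    (α_ X Y Z).hom.hom.hom (tensorEquiv _ Z (tensorEquiv X Y (x ⊗ₜ y) ⊗ₜ z)) =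
      tensorEquiv X _ (x ⊗ₜ tensorEquiv Y Z (y ⊗ₜ z))
  leftUnitor (X : FGModuleCat.{0} A) (x : X) :
    (λ_ X).hom.hom.hom (tensorEquiv _ X (unitEquiv 1 ⊗ₜ x)) = x
  rightUnitor (X : FGModuleCat.{0} A) (x : X) :
    (ρ_ X).hom.hom.hom (tensorEquiv X _ (x ⊗ₜ unitEquiv 1)) = x
  braiding (X Y : FGModuleCat.{0} A) (t : X ⊗[ℂ] Y) :
    (β_ X Y).hom.hom.hom (tensorEquiv X Y t) =
      tensorEquiv Y X (TensorProduct.comm ℂ X Y (tensorAct X Y R t))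

/-- The one-dimensional module on which the double acts through its counit. -/
def IsTrivialModule {n : ℕ} (V : DKMod n) : Prop :=
  Module.finrank ℂ V = 1 ∧
    ∀ (a : DoubledNichols n) (v : V), a • v = DrinfeldDouble.doubleCounit ℂ (Nichols n) a • v

instance (n : ℕ) : Linear ℂ (DKMod n) := inferInstance

/-- The modular structure has as underlying braided tensor structure the one given by the
comultiplication, the counit and the canonical `R`-matrix of `D𝒦ₙ`. -/
def IsStandard {n : ℕ} (M : ModularStructure (DKMod n)) : Prop :=
  letI := M.monoidal
  letI := M.braided
  Nonempty (BraidedTensorData (DrinfeldDouble.doubleComul ℂ (Nichols n))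
    (DrinfeldDouble.doubleCounit ℂ (Nichols n)) (DrinfeldDouble.rMatrix ℂ (Nichols n)))

end Modules

end NicholsDouble

end

open CategoryTheory

/-!
The Drinfeld double `D = D𝒦ₙ` is generated by the grouplike elements `K` and `χ` (the character of
`𝒦ₙ` with `χ(K) = -1`) and by the `2 n` odd generators `ξᵢ` and `φᵢ`, where `φᵢ` is the skew
derivation of `𝒦ₙ` dual to `ξᵢ`. The odd generators anticommute with `K` and `χ` and with each
other, except that `ξᵢ φᵢ + φᵢ ξᵢ = 1 - C` for the central element `C = χ K`, with `C² = 1`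
(`DoubledNichols.xi_mul_phi`).

*Modules.* Where `C = 1` the odd generators span an exterior algebra. So this part of `D` has two
simple modules, of dimension one, told apart by the sign by which `K` acts (`charObj`), and their
projective covers are the left ideals of the idempotents onto the two weights (`projObj`), which
are free over the exterior algebra. Where `C = -1` the odd generators span a Clifford algebra,
which is a matrix algebra, and there are two simple modules, both projective (`steinbergObj`).
Hence there are `2 + 2` simple modules and two further projective indecomposable ones
(`simple_classification`, `projective_indecomposable_classification`, `totalRank_eq_six`).

*The invariant `n`.* An endomorphism of a cover `D e` with `C = 1` is given by a vector of the
same weight as `e`, and odd generators change the weight. So a nilpotent endomorphism raises the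
degree in the odd generators by at least two (`nilpotent_mem_wordSpan`), and a product of more
than `n` of them vanishes, as the degree is at most `2 n`. The right multiplications by the `φᵢ
ξᵢ` show that `n` is attained; their products do not vanish because ordered monomials in the
double do not (`monomial_ne_zero`). An equivalence of categories preserves projective covers of
non-projective simple objects and so preserves `n` (`le_of_equivalence`).

*The modular structure.* The comultiplication makes `D` a Hopf algebra, and the canonical element
`R = ∑ bᵢ ⊗ bᵢ^*` is a universal R-matrix (`isUniversalR`), which gives the braiding. For the
twist take the action of `t = ∑ bᵢ^* K bᵢ`. Splitting off one generator `ξⱼ` at a time shows that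
`t` is the product of `½ (1 + K + C - χ)` and the commuting factors `1 + C φⱼ ξⱼ`
(`twistAux_succ`). From this `t` is central and invertible, and `S(t) = Cⁿ t`, which is `t` for
even `n` (`antipode_twistElt`). As `K` is grouplike and `t` is central, the Yang–Baxter equation
gives `Δ(t) = R₂₁ R (t ⊗ t)` (`IsUniversalR.comul_sum`). Finally, the double braiding is the
action of `R₂₁ R = ∑ bᵢ^* bⱼ ⊗ bᵢ bⱼ^*`, where the first factors form a basis of `D`. So an object
whose double braiding with the regular module is trivial is acted on through the counit
(`smul_eq_counit_smul`), and the braiding is non-degenerate.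
-/

noncomputable section

namespace NicholsDouble

open Coalgebra (comul counit)

/-! ### The two factors of the Drinfeld double -/

theorem eq_zero_of_eq_neg {V : Type*} [AddCommGroup V] [Module ℂ V] {v : V} (h : v = -v) :
    v = 0 := by
  have h2 : (2 : ℂ) • v = 0 := by rw [two_smul]; nth_rw 2 [h]; exact add_neg_cancel v
  exact (smul_eq_zero.1 h2).resolve_left two_ne_zero

namespace DrinfeldDouble
open TensorProduct HopfAlgebra

section
variable {k H : Type*} [Field k] [Ring H] [HopfAlgebra k H] [BijectiveAntipode k H]

theorem equiv_mul_equiv (x y : Module.Dual k H ⊗[k] H) :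
    equiv k H x * equiv k H y = equiv k H (doubleMul k H x y) := rfl

theorem ofDual_apply (φ : Module.Dual k H) : ofDual k H φ = equiv k H (φ ⊗ₜ 1) := rfl

theorem ofHopf_apply (h : H) : ofHopf k H h = equiv k H (counit ⊗ₜ h) := rfl

/-- The triangular decomposition `D(H) = H^* ⊗ H` is multiplication. -/
theorem ofDual_mul_ofHopf (φ : Module.Dual k H) (h : H) :
    ofDual k H φ * ofHopf k H h = equiv k H (φ ⊗ₜ h) := by
  rw [ofDual_apply, ofHopf_apply, equiv_mul_equiv, doubleMul_tmul, cross_one, rmul_tmul, lmul_tmul,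
    dualMul_counit, one_mul]

theorem ofHopf_mul_ofDual (φ : Module.Dual k H) (h : H) :
    ofHopf k H h * ofDual k H φ = equiv k H (cross k H h φ) := by
  rw [ofDual_apply, ofHopf_apply, equiv_mul_equiv, doubleMul_tmul, rmul_one, lmul_counit]

theorem ofDual_mul_ofDual (φ ψ : Module.Dual k H) :
    ofDual k H φ * ofDual k H ψ = ofDual k H (dualMul k H φ ψ) := by
  rw [ofDual_apply, ofDual_apply, equiv_mul_equiv, doubleMul_tmul, cross_one, rmul_one, lmul_tmul]
  rfl

theorem ofHopf_mul_ofHopf (g h : H) : ofHopf k H g * ofHopf k H h = ofHopf k H (g * h) := by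
  rw [ofHopf_apply, ofHopf_apply, equiv_mul_equiv, doubleMul_tmul, cross_counit, rmul_tmul,
    lmul_counit]
  rfl

theorem ofHopf_one : ofHopf k H (1 : H) = 1 := rfl
theorem ofDual_counit : ofDual k H (counit : Module.Dual k H) = 1 := rfl

/-- A pure tensor `φ ⊗ h` vanishes only if a factor does. -/
theorem ofDual_mul_ofHopf_ne_zero {φ : Module.Dual k H} {h : H} (hφ : φ ≠ 0) (hh : h ≠ 0) :
    ofDual k H φ * ofHopf k H h ≠ 0 := by
  rw [ofDual_mul_ofHopf]
  obtain ⟨x, hx⟩ : ∃ x, φ x ≠ 0 := by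
    by_contra! hc
    exact hφ (LinearMap.ext hc)
  intro h0
  have h1 : φ ⊗ₜ[k] h = 0 := (equiv k H).map_eq_zero_iff.1 h0
  have h2 := congrArg (TensorProduct.lid k H ∘ (LinearMap.applyₗ x).rTensor H) h1
  simp at h2
  tauto

@[elab_as_elim]
theorem induction_on {P : DrinfeldDouble k H → Prop} (a : DrinfeldDouble k H)
    (hm : ∀ φ h, P (ofDual k H φ * ofHopf k H h)) (hadd : ∀ a b, P a → P b → P (a + b)) : P a := by
  obtain ⟨t, rfl⟩ := (equiv k H).surjective a
  induction t with
  | zero => simpa using hm 0 0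
  | add x y hx hy => rw [map_add]; exact hadd _ _ hx hy
  | tmul φ h => rw [← ofDual_mul_ofHopf]; exact hm φ h

end

end DrinfeldDouble

/-! ### Functionals on the Nichols algebra -/

namespace Nichols
open TensorProduct HopfAlgebra
variable {n : ℕ}

/-- The character `χ` of `𝒦ₙ` with `χ(K) = -1` and `χ(ξᵢ) = 0`. -/
def chi : Nichols n →ₐ[ℂ] ℂ := lift (-1) (fun _ => 0) (by simp) (by simp) (by simp) (by simp)

@[simp] theorem chi_K : chi (K : Nichols n) = -1 := lift_K ..
@[simp] theorem chi_xi (i : Fin n) : chi (xi i : Nichols n) = 0 := lift_xi ..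

/-- The two-dimensional representation of `𝒦ₙ` in which `K` acts by `diag(1, -1)`, `ξᵢ` by the
matrix unit `E₁₂` and the other `ξⱼ` by zero. -/
def matRep (i : Fin n) : Nichols n →ₐ[ℂ] Matrix (Fin 2) (Fin 2) ℂ :=
  lift !![1, 0; 0, -1] (fun j => if j = i then !![0, 1; 0, 0] else 0)
    (by ext a b; fin_cases a <;> fin_cases b <;> simp)
    (by intro j; split_ifs <;> ext a b <;> fin_cases a <;> fin_cases b <;> simp)
    (by intro j; split_ifs <;> ext a b <;> fin_cases a <;> fin_cases b <;> simp)
    (by intro j l; split_ifs <;> ext a b <;> fin_cases a <;> fin_cases b <;> simp)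

/-- The functional `φᵢ` on `𝒦ₙ`, an entry of `matRep i`. It is a skew derivation with
`φᵢ(K) = 0` and `φᵢ(ξⱼ) = δᵢⱼ`. -/
def phi (i : Fin n) : Module.Dual ℂ (Nichols n) where
  toFun a := matRep i a 0 1
  map_add' a b := by simp
  map_smul' c a := by simp

/-- `matRep i` is triangular with diagonal entries the characters `ε` and `χ`. -/
theorem matRep_eq (i : Fin n) (a : Nichols n) :
    matRep i a 0 0 = counit (R := ℂ) a ∧ matRep i a 1 0 = 0 ∧ matRep i a 1 1 = chi a := by
  induction a using induction with
  | hc c => simp [Matrix.algebraMap_matrix_apply]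
  | hK => simp [matRep]
  | hx j => simp only [matRep, lift_xi, counit_xi, chi_xi]; split_ifs <;> simp
  | hadd a b ha hb => simp [ha, hb]
  | hmul a b ha hb => simp [Matrix.mul_apply, ha, hb]

theorem phi_mul (i : Fin n) (a b : Nichols n) :
    phi i (a * b) = counit (R := ℂ) a * phi i b + phi i a * chi b := by
  simp [phi, Matrix.mul_apply, (matRep_eq i a).1, (matRep_eq i b).2.2]

@[simp] theorem phi_K (i : Fin n) : phi i K = 0 := by simp [phi, matRep]
@[simp] theorem phi_one (i : Fin n) : phi i 1 = 0 := by simp [phi]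
theorem phi_xi (i j : Fin n) : phi i (xi j) = if j = i then 1 else 0 := by
  simp only [phi, matRep, LinearMap.coe_mk, AddHom.coe_mk, lift_xi]
  split_ifs <;> simp

/-- Two functionals that satisfy the same skew Leibniz rule agree if they agree on the
generators. -/
theorem functional_ext {α : Nichols n →ₐ[ℂ] ℂ} {β : Nichols n →ₐ[ℂ] ℂ}
    {f g : Module.Dual ℂ (Nichols n)}
    (hf : ∀ a b, f (a * b) = α a * f b + f a * β b) (hg : ∀ a b, g (a * b) = α a * g b + g a * β b)
    (hK : f K = g K) (hx : ∀ i, f (xi i) = g (xi i)) : f = g := by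
  have h1 : f 1 = g 1 := by
    have := hf 1 1
    have := hg 1 1
    simp_all
  ext a
  induction a using induction with
  | hc c => rw [Algebra.algebraMap_eq_smul_one, map_smul, map_smul, h1]
  | hK => exact hK
  | hx i => exact hx i
  | hadd a b ha hb => simp [ha, hb]
  | hmul a b ha hb => simp [hf, hg, ha, hb]

/-- The product of two functionals that satisfy skew Leibniz rules. -/
theorem dualMul_leibniz {α φ β γ ψ δ : Module.Dual ℂ (Nichols n)}
    (hφ : ∀ a b, φ (a * b) = α a * φ b + φ a * β b)
    (hψ : ∀ a b, ψ (a * b) = γ a * ψ b + ψ a * δ b) (a b : Nichols n) :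
    dualMul ℂ _ φ ψ (a * b) =
      dualMul ℂ _ α γ a * dualMul ℂ _ φ ψ b + dualMul ℂ _ α ψ a * dualMul ℂ _ φ δ b +
      dualMul ℂ _ φ γ a * dualMul ℂ _ β ψ b + dualMul ℂ _ φ ψ a * dualMul ℂ _ β δ b := by
  simp only [dualMul_apply, Bialgebra.comul_mul]
  generalize comul (R := ℂ) a = s
  generalize comul (R := ℂ) b = t
  induction s with
  | zero => simp
  | add x y hx hy => simp only [add_mul, map_add, hx, hy]; ring
  | tmul a a' =>
    induction t with
    | zero => simp
    | add x y hx hy => simp only [mul_add, map_add, hx, hy]; ring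
    | tmul b b' =>
      simp only [Algebra.TensorProduct.tmul_mul_tmul, dualDistrib_apply, hφ, hψ]
      ring

theorem dualMul_K (φ ψ : Module.Dual ℂ (Nichols n)) : dualMul ℂ _ φ ψ K = φ K * ψ K := by simp

theorem dualMul_xi (φ ψ : Module.Dual ℂ (Nichols n)) (i : Fin n) :
    dualMul ℂ _ φ ψ (xi i) = φ K * ψ (xi i) + φ (xi i) * ψ 1 := by simp

theorem chi_mul' (a b : Nichols n) : chi.toLinearMap (a * b) =
    (0 : Module.Dual ℂ (Nichols n)) a * chi.toLinearMap b +
      chi.toLinearMap a * chi.toLinearMap b := by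
  simp

theorem phi_mul' (i : Fin n) (a b : Nichols n) :
    phi i (a * b) = (counit : Module.Dual ℂ (Nichols n)) a * phi i b +
      phi i a * chi.toLinearMap b :=
  phi_mul i a b

theorem chi_mul_chi : dualMul ℂ (Nichols n) chi.toLinearMap chi.toLinearMap = counit := by
  have h := dualMul_leibniz (n := n) chi_mul' chi_mul'
  simp only [map_zero, LinearMap.zero_apply, zero_mul, zero_add] at h
  ext a
  induction a using induction with
  | hc c => simp [Algebra.algebraMap_eq_smul_one, Algebra.TensorProduct.one_def]
  | hK => rw [dualMul_K]; simp
  | hx i => rw [dualMul_xi]; simp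
  | hadd a b ha hb => simp only [map_add, ha, hb]
  | hmul a b ha hb => rw [h, ha, hb, Bialgebra.counit_mul]

theorem chi_mul_phi (i : Fin n) : dualMul ℂ (Nichols n) chi.toLinearMap (phi i) =
    -dualMul ℂ (Nichols n) (phi i) chi.toLinearMap := by
  have h1 := dualMul_leibniz (chi_mul' (n := n)) (phi_mul' i)
  have h2 := dualMul_leibniz (phi_mul' i) (chi_mul' (n := n))
  refine functional_ext (α := chi) (β := Bialgebra.counitAlgHom ℂ _) ?_ ?_ ?_ ?_
  · intro a b
    rw [h1]
    simp only [map_zero, LinearMap.zero_apply, zero_mul, zero_add]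
    rw [dualMul_counit, chi_mul_chi]
    rfl
  · intro a b
    rw [LinearMap.neg_apply, LinearMap.neg_apply, LinearMap.neg_apply, h2]
    simp only [map_zero, LinearMap.zero_apply, zero_mul, zero_add, add_zero]
    rw [counit_dualMul, chi_mul_chi]
    simp only [AlgHom.toLinearMap_apply, Bialgebra.counitAlgHom_apply]
    ring
  · rw [LinearMap.neg_apply, dualMul_K, dualMul_K]; simp
  · intro j
    rw [LinearMap.neg_apply, dualMul_xi, dualMul_xi]; simp

theorem phi_mul_phi (i j : Fin n) : dualMul ℂ (Nichols n) (phi i) (phi j) =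
    -dualMul ℂ (Nichols n) (phi j) (phi i) := by
  rw [← add_eq_zero_iff_eq_neg]
  have h1 := dualMul_leibniz (phi_mul' i) (phi_mul' j)
  have h2 := dualMul_leibniz (phi_mul' j) (phi_mul' i)
  refine functional_ext (α := Bialgebra.counitAlgHom ℂ _) (β := Bialgebra.counitAlgHom ℂ _)
    ?_ (by simp) ?_ ?_
  · intro a b
    simp only [counit_dualMul, dualMul_counit, chi_mul_chi, chi_mul_phi, LinearMap.neg_apply]
      at h1 h2
    rw [LinearMap.add_apply, LinearMap.add_apply, LinearMap.add_apply, h1, h2,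
      Bialgebra.counitAlgHom_apply, Bialgebra.counitAlgHom_apply]
    ring
  · rw [LinearMap.add_apply, dualMul_K, dualMul_K]; simp
  · intro l
    rw [LinearMap.add_apply, dualMul_xi, dualMul_xi]; simp

theorem comul₃_K : comul₃ ℂ (Nichols n) K = K ⊗ₜ (K ⊗ₜ K) := by simp [comul₃]

theorem comul₃_xi (i : Fin n) : comul₃ ℂ (Nichols n) (xi i) =
    K ⊗ₜ (K ⊗ₜ xi i) + K ⊗ₜ (xi i ⊗ₜ 1) + xi i ⊗ₜ (1 ⊗ₜ 1) := by
  simp [comul₃, Algebra.TensorProduct.one_def, tmul_add]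

theorem antipode_eq : (antipode ℂ : Nichols n →ₗ[ℂ] Nichols n) = antipodeLin := rfl

@[simp] theorem antipodeInv_K : antipodeInv ℂ (Nichols n) K = K := by
  apply (BijectiveAntipode.bijective (k := ℂ) (H := Nichols n)).1
  rw [antipode_antipodeInv, antipode_eq, antipodeLin_K]

@[simp] theorem antipodeInv_xi (i : Fin n) : antipodeInv ℂ (Nichols n) (xi i) = K * xi i := by
  apply (BijectiveAntipode.bijective (k := ℂ) (H := Nichols n)).1
  rw [antipode_antipodeInv, antipode_eq, antipodeLin_mul, antipodeLin_xi, antipodeLin_K, neg_mul,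
    mul_assoc, K_mul_xi_mul_K, neg_neg]

end Nichols

/-! ### Generators and relations of the doubled Nichols algebra -/

namespace DoubledNichols
open TensorProduct DrinfeldDouble
variable {n : ℕ}

/-- The generator `K` of the double. -/
def K : DoubledNichols n := ofHopf ℂ _ Nichols.K
/-- The generator `ξᵢ` of the double. -/
def xi (i : Fin n) : DoubledNichols n := ofHopf ℂ _ (Nichols.xi i)
/-- The generator `χ` of the double, dual to `K`. -/
def chi : DoubledNichols n := ofDual ℂ _ Nichols.chi.toLinearMap
/-- The generator `φᵢ` of the double, dual to `ξᵢ`. -/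
def phi (i : Fin n) : DoubledNichols n := ofDual ℂ _ (Nichols.phi i)

theorem K_mul_K : (K : DoubledNichols n) * K = 1 := by
  rw [K, ofHopf_mul_ofHopf, Nichols.K_mul_K, ofHopf_one]

theorem xi_mul_self (i : Fin n) : xi i * xi i = 0 := by
  rw [xi, ofHopf_mul_ofHopf, Nichols.xi_mul_self, map_zero]

theorem K_mul_xi (i : Fin n) : K * xi i = -(xi i * K) := by
  rw [K, xi, ofHopf_mul_ofHopf, ofHopf_mul_ofHopf, Nichols.K_mul_xi, map_neg]

theorem xi_mul_xi (i j : Fin n) : xi i * xi j = -(xi j * xi i) := by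
  rw [xi, xi, ofHopf_mul_ofHopf, ofHopf_mul_ofHopf, Nichols.xi_mul_xi, map_neg]

theorem chi_mul_chi : (chi : DoubledNichols n) * chi = 1 := by
  rw [chi, ofDual_mul_ofDual, Nichols.chi_mul_chi, ofDual_counit]

theorem chi_mul_phi (i : Fin n) : chi * phi i = -(phi i * chi) := by
  rw [chi, phi, ofDual_mul_ofDual, ofDual_mul_ofDual, Nichols.chi_mul_phi, map_neg]

theorem phi_mul_phi (i j : Fin n) : phi i * phi j = -(phi j * phi i) := by
  rw [phi, phi, ofDual_mul_ofDual, ofDual_mul_ofDual, Nichols.phi_mul_phi, map_neg]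

theorem phi_mul_self (i : Fin n) : phi i * phi i = 0 :=
  eq_zero_of_eq_neg (phi_mul_phi i i)

theorem K_mul_ofDual (ψ : Module.Dual ℂ (Nichols n)) :
    K * ofDual ℂ _ ψ = ofDual ℂ _ (sandwich ℂ _ Nichols.K Nichols.K ψ) * K := by
  rw [K, ofHopf_mul_ofDual, cross, LinearMap.comp_apply, Nichols.comul₃_K, crossAux_tmul,
    ofDual_mul_ofHopf]

/-- The cross relation of the double for the generator `ξᵢ`. -/
theorem xi_mul_ofDual (i : Fin n) (ψ : Module.Dual ℂ (Nichols n)) :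
    xi i * ofDual ℂ _ ψ = ofDual ℂ _ (sandwich ℂ _ Nichols.K (Nichols.xi i) ψ) * K +
      ofDual ℂ _ (sandwich ℂ _ Nichols.K 1 ψ) * xi i +
      ofDual ℂ _ (sandwich ℂ _ (Nichols.xi i) 1 ψ) := by
  rw [K, xi, ofHopf_mul_ofDual, cross, LinearMap.comp_apply, Nichols.comul₃_xi, map_add, map_add,
    LinearMap.add_apply, LinearMap.add_apply, crossAux_tmul, crossAux_tmul, crossAux_tmul,
    ofDual_mul_ofHopf, ofDual_mul_ofHopf, map_add, map_add]
  rfl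

theorem K_mul_chi : (K : DoubledNichols n) * chi = chi * K := by
  rw [chi, K_mul_ofDual]
  congr 2
  ext a
  simp

theorem K_mul_phi (i : Fin n) : K * phi i = -(phi i * K) := by
  rw [phi, K_mul_ofDual, ← neg_mul, ← map_neg]
  congr 2
  ext a
  simp [Nichols.phi_mul]

theorem xi_mul_chi (i : Fin n) : xi i * chi = -(chi * xi i) := by
  have h1 : sandwich ℂ _ Nichols.K (Nichols.xi i) (Nichols.chi (n := n)).toLinearMap = 0 := by
    ext a; simp
  have h2 : sandwich ℂ _ Nichols.K 1 (Nichols.chi (n := n)).toLinearMap =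
      -Nichols.chi.toLinearMap := by
    ext a; simp
  have h3 : sandwich ℂ _ (Nichols.xi i) 1 (Nichols.chi (n := n)).toLinearMap = 0 := by
    ext a; simp
  rw [chi, xi_mul_ofDual, h1, h2, h3]
  simp

/-- The central grouplike element `C = χ K`. -/
def C : DoubledNichols n := chi * K

/-- The only relation between `𝒦ₙ` and its dual that is not a commutation up to sign. -/
theorem xi_mul_phi (i j : Fin n) :
    xi i * phi j = -(phi j * xi i) + if i = j then 1 - C else 0 := by
  have h1 : sandwich ℂ _ Nichols.K (Nichols.xi i) (Nichols.phi j) =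
      -(if i = j then (1 : ℂ) else 0) • Nichols.chi.toLinearMap := by
    ext a; split_ifs with h <;> simp [Nichols.phi_mul, Nichols.phi_xi, mul_assoc, h]
  have h2 : sandwich ℂ _ Nichols.K 1 (Nichols.phi j) = -Nichols.phi j := by
    ext a; simp [Nichols.phi_mul]
  have h3 : sandwich ℂ _ (Nichols.xi i) 1 (Nichols.phi j) =
      (if i = j then (1 : ℂ) else 0) • counit := by
    ext a; split_ifs with h <;> simp [Nichols.phi_mul, Nichols.phi_xi, h]
  rw [phi, xi_mul_ofDual, h1, h2, h3, C]
  split_ifs with h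
  · simp only [map_neg, one_smul, neg_smul, ofDual_counit, chi, neg_mul]
    abel
  · simp

end DoubledNichols

end NicholsDouble
end

noncomputable section

namespace NicholsDouble

open Coalgebra (comul counit)

/-! ### Factorization of the identity of the Nichols algebra -/

namespace Nichols
open TensorProduct HopfAlgebra
variable {n : ℕ}

/-- `x ↦ G(x₁) ψ(x₂)`. -/
def convRight (G : Nichols n →ₗ[ℂ] Nichols n) (ψ : Module.Dual ℂ (Nichols n)) :
    Nichols n →ₗ[ℂ] Nichols n :=
  (TensorProduct.rid ℂ (Nichols n)).toLinearMap ∘ₗ map G ψ ∘ₗ comul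

/-- `x ↦ ψ(x₁) G(x₂)`. -/
def convLeft (ψ : Module.Dual ℂ (Nichols n)) (G : Nichols n →ₗ[ℂ] Nichols n) :
    Nichols n →ₗ[ℂ] Nichols n :=
  (TensorProduct.lid ℂ (Nichols n)).toLinearMap ∘ₗ map ψ G ∘ₗ comul

theorem convRight_K (G : Nichols n →ₗ[ℂ] Nichols n) (ψ : Module.Dual ℂ (Nichols n)) :
    convRight G ψ K = ψ K • G K := by simp [convRight]

theorem convRight_xi (G : Nichols n →ₗ[ℂ] Nichols n) (ψ : Module.Dual ℂ (Nichols n)) (i : Fin n) :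
    convRight G ψ (xi i) = ψ (xi i) • G K + ψ 1 • G (xi i) := by simp [convRight]

theorem convRight_one (G : Nichols n →ₗ[ℂ] Nichols n) (ψ : Module.Dual ℂ (Nichols n)) :
    convRight G ψ 1 = ψ 1 • G 1 := by simp [convRight, Algebra.TensorProduct.one_def]

theorem convLeft_K (G : Nichols n →ₗ[ℂ] Nichols n) (ψ : Module.Dual ℂ (Nichols n)) :
    convLeft ψ G K = ψ K • G K := by simp [convLeft]

theorem convLeft_xi (G : Nichols n →ₗ[ℂ] Nichols n) (ψ : Module.Dual ℂ (Nichols n)) (i : Fin n) :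
    convLeft ψ G (xi i) = ψ K • G (xi i) + ψ (xi i) • G 1 := by simp [convLeft]

theorem convLeft_one (G : Nichols n →ₗ[ℂ] Nichols n) (ψ : Module.Dual ℂ (Nichols n)) :
    convLeft ψ G 1 = ψ 1 • G 1 := by simp [convLeft, Algebra.TensorProduct.one_def]

theorem convRight_counit (G : Nichols n →ₗ[ℂ] Nichols n) : convRight G counit = G := by
  ext x
  have h : ∀ t : Nichols n ⊗[ℂ] Nichols n, TensorProduct.rid ℂ _ (map G (counit (R := ℂ)) t) =
      G (TensorProduct.rid ℂ _ (counit.lTensor _ t)) := by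
    intro t
    induction t with
    | zero => simp
    | add x y hx hy => simp only [map_add, hx, hy]
    | tmul a b => simp
  simp [convRight, h]

/-- A skew Leibniz rule for `ψ` passes to the convolution of `ψ` with an algebra map. -/
theorem convRight_mul {α β ψ : Module.Dual ℂ (Nichols n)} (π : Nichols n →ₐ[ℂ] Nichols n)
    (hψ : ∀ a b, ψ (a * b) = α a * ψ b + ψ a * β b) (a b : Nichols n) :
    convRight π.toLinearMap ψ (a * b) =
      convRight π.toLinearMap α a * convRight π.toLinearMap ψ b +
      convRight π.toLinearMap ψ a * convRight π.toLinearMap β b := by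
  simp only [convRight, LinearMap.comp_apply, LinearEquiv.coe_coe, Bialgebra.comul_mul]
  generalize comul (R := ℂ) a = s
  generalize comul (R := ℂ) b = t
  induction s with
  | zero => simp
  | add x y hx hy => simp only [add_mul, map_add, hx, hy]; abel
  | tmul a a' =>
    induction t with
    | zero => simp
    | add x y hx hy => simp only [mul_add, map_add, hx, hy]; abel
    | tmul b b' =>
      simp [hψ, add_smul, mul_smul]
      module

theorem convLeft_mul {α β ψ : Module.Dual ℂ (Nichols n)} (π : Nichols n →ₐ[ℂ] Nichols n)
    (hψ : ∀ a b, ψ (a * b) = α a * ψ b + ψ a * β b) (a b : Nichols n) :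
    convLeft ψ π.toLinearMap (a * b) =
      convLeft α π.toLinearMap a * convLeft ψ π.toLinearMap b +
      convLeft ψ π.toLinearMap a * convLeft β π.toLinearMap b := by
  simp only [convLeft, LinearMap.comp_apply, LinearEquiv.coe_coe, Bialgebra.comul_mul]
  generalize comul (R := ℂ) a = s
  generalize comul (R := ℂ) b = t
  induction s with
  | zero => simp
  | add x y hx hy => simp only [add_mul, map_add, hx, hy]; abel
  | tmul a a' =>
    induction t with
    | zero => simp
    | add x y hx hy => simp only [mul_add, map_add, hx, hy]; abel
    | tmul b b' =>
      simp [hψ, add_smul, mul_smul]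
      module

theorem convLeft_counit (G : Nichols n →ₗ[ℂ] Nichols n) : convLeft counit G = G := by
  ext x
  have h : ∀ t : Nichols n ⊗[ℂ] Nichols n, TensorProduct.lid ℂ _ (map (counit (R := ℂ)) G t) =
      G (TensorProduct.lid ℂ _ (counit.rTensor _ t)) := by
    intro t
    induction t with
    | zero => simp
    | add x y hx hy => simp only [map_add, hx, hy]
    | tmul a b => simp
  simp [convLeft, h]

/-- The endomorphism of `𝒦ₙ` that fixes `K` and the `ξᵢ` with `i < j` and kills the other `ξᵢ`. -/
def trunc (j : ℕ) : Nichols n →ₐ[ℂ] Nichols n :=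
  lift K (fun i => if i.val < j then xi i else 0) (by simp) (fun i => by split_ifs <;> simp)
    (fun i => by split_ifs <;> simp [K_mul_xi]) (fun i l => by split_ifs <;> simp [← xi_mul_xi])

@[simp] theorem trunc_K (j : ℕ) : trunc j (K : Nichols n) = K := lift_K ..
@[simp] theorem trunc_xi (j : ℕ) (i : Fin n) :
    trunc j (xi i) = if i.val < j then xi i else 0 := lift_xi ..

theorem trunc_eq_id : trunc n = AlgHom.id ℂ (Nichols n) := by
  apply algHom_ext
  · simp
  · intro i; simp

theorem exists_mul_xi_eq (j : Fin n) (a : Nichols n) : ∃ b, a * xi j = xi j * b := by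
  induction a using induction with
  | hc c => exact ⟨algebraMap ℂ _ c, Algebra.commutes _ _⟩
  | hK => exact ⟨-K, by rw [K_mul_xi, mul_neg]⟩
  | hx i => exact ⟨-xi i, by rw [xi_mul_xi, mul_neg]⟩
  | hadd a b ha hb =>
    obtain ⟨a', ha⟩ := ha
    obtain ⟨b', hb⟩ := hb
    exact ⟨a' + b', by rw [add_mul, ha, hb, mul_add]⟩
  | hmul a b ha hb =>
    obtain ⟨a', ha⟩ := ha
    obtain ⟨b', hb⟩ := hb
    exact ⟨a' * b', by rw [mul_assoc, hb, ← mul_assoc, ha, mul_assoc]⟩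

theorem xi_mul_mul_xi (j : Fin n) (a : Nichols n) : xi j * a * xi j = 0 := by
  obtain ⟨b, hb⟩ := exists_mul_xi_eq j a
  rw [mul_assoc, hb, ← mul_assoc, xi_mul_self, zero_mul]

theorem convRight_trunc_chi_mul (j : ℕ) (a b : Nichols n) :
    convRight (trunc j).toLinearMap chi.toLinearMap (a * b) =
      convRight (trunc j).toLinearMap chi.toLinearMap a *
      convRight (trunc j).toLinearMap chi.toLinearMap b := by
  have h0 : convRight (n := n) (trunc j).toLinearMap 0 = 0 := by
    ext; simp [convRight]
  rw [convRight_mul (trunc j) chi_mul', h0]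
  simp

/-- The element `K ξⱼ` commutes with the subalgebra of the `ξᵢ`, `i < j`, and `K` up to the twist
by `χ`. -/
theorem convRight_trunc_chi (j : Fin n) (a : Nichols n) :
    convRight (trunc j).toLinearMap chi.toLinearMap a * (K * xi j) = K * xi j * trunc j a := by
  induction a using induction with
  | hc c => simp [Algebra.algebraMap_eq_smul_one, convRight_one]
  | hK =>
    rw [convRight_K, trunc_K, mul_assoc, xi_mul_K]
    simp
  | hx i =>
    rw [convRight_xi, trunc_xi]
    simp only [AlgHom.toLinearMap_apply, chi_xi, zero_smul, map_one, one_smul, trunc_xi, zero_add]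
    split_ifs
    · rw [← mul_assoc, xi_mul_K, neg_mul, mul_assoc, mul_assoc, xi_mul_xi j i, mul_neg]
    · simp
  | hadd a b ha hb => rw [map_add, map_add, add_mul, ha, hb, mul_add]
  | hmul a b ha hb =>
    rw [convRight_trunc_chi_mul, mul_assoc, hb, ← mul_assoc, ha, map_mul, mul_assoc]

/-- The identity of `𝒦ₙ` is built from the projection onto the group algebra by adding one
generator `ξⱼ` at a time. -/
theorem trunc_succ (j : Fin n) (a : Nichols n) :
    trunc (j + 1) a = trunc j a + convRight (trunc j).toLinearMap (phi j) a * (K * xi j) := by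
  have hL := convRight_mul (trunc (n := n) j) (phi_mul' j)
  rw [convRight_counit] at hL
  induction a using induction with
  | hc c => simp [Algebra.algebraMap_eq_smul_one, convRight_one]
  | hK => simp [convRight_K]
  | hx i =>
    rw [convRight_xi, trunc_xi, trunc_xi]
    by_cases h : i = j
    · subst h
      simp [phi_xi, ← mul_assoc]
    · have h1 : (i.val < j + 1) = (i.val < j) := by
        rw [Nat.lt_succ_iff, le_iff_lt_or_eq, Fin.val_inj]; simp [h]
      simp [phi_xi, h, h1]
  | hadd a b ha hb => rw [map_add, map_add, ha, hb, map_add, add_mul]; abel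
  | hmul a b ha hb =>
    -- the terms with two factors `ξⱼ` vanish
    have h0 : K * xi j * convRight (trunc j).toLinearMap (phi j) b * (K * xi j) = 0 := by
      have := xi_mul_mul_xi j (convRight (trunc j).toLinearMap (phi j) b * K)
      rw [mul_assoc K, mul_assoc K, mul_assoc (xi j), ← mul_assoc _ K, ← mul_assoc (xi j), this,
        mul_zero]
    rw [map_mul, ha, hb, hL, map_mul, add_mul (_ * _), mul_assoc _ _ (K * xi j),
      mul_assoc _ _ (K * xi j),
      convRight_trunc_chi, add_mul, mul_add, mul_add, mul_assoc _ (K * xi j),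
      mul_assoc _ (K * xi j), ← mul_assoc (K * xi j) _ (K * xi j), h0, AlgHom.toLinearMap_apply]
    simp only [mul_zero, add_zero]
    abel

/-- The factorization `trunc_succ`, rewritten with the functional on the left. -/
theorem convRight_trunc_phi (j : Fin n) (a : Nichols n) :
    convRight (trunc j).toLinearMap (phi j) a * K = convLeft (phi j) (trunc j).toLinearMap a := by
  have hL := convRight_mul (trunc (n := n) j) (phi_mul' j)
  have hR := convLeft_mul (trunc (n := n) j) (phi_mul' j)
  rw [convRight_counit] at hL
  rw [convLeft_counit] at hR
  have h0 : convLeft (n := n) 0 (trunc j).toLinearMap = 0 := by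
    ext; simp [convLeft]
  have h : ∀ a : Nichols n, convRight (trunc j).toLinearMap chi.toLinearMap a * K =
      K * convLeft chi.toLinearMap (trunc j).toLinearMap a := by
    intro a
    induction a using induction with
    | hc c => simp [Algebra.algebraMap_eq_smul_one, convRight_one, convLeft_one]
    | hK => rw [convRight_K, convLeft_K]; simp
    | hx i =>
      rw [convRight_xi, convLeft_xi]
      simp only [AlgHom.toLinearMap_apply, chi_xi, zero_smul, map_one, one_smul, trunc_xi, zero_add,
        chi_K, neg_smul, add_zero]
      split_ifs
      · rw [mul_neg, xi_mul_K]
      · simp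
    | hadd a b ha hb => rw [map_add, map_add, add_mul, ha, hb, mul_add]
    | hmul a b ha hb =>
      rw [convRight_trunc_chi_mul, mul_assoc, hb, ← mul_assoc, ha, convLeft_mul (trunc j) chi_mul',
        h0]
      simp [mul_assoc]
  induction a using induction with
  | hc c => simp [Algebra.algebraMap_eq_smul_one, convRight_one, convLeft_one]
  | hK => simp [convRight_K, convLeft_K]
  | hx i =>
    rw [convRight_xi, convLeft_xi]
    simp only [phi_xi, phi_K, phi_one]
    split_ifs <;> simp
  | hadd a b ha hb => rw [map_add, map_add, add_mul, ha, hb]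
  | hmul a b ha hb =>
    rw [hL, hR, add_mul, mul_assoc, hb, mul_assoc, h, ← mul_assoc, ha]

/-- The projection onto the group algebra, in terms of the characters `ε` and `χ`. -/
theorem trunc_zero (a : Nichols n) : trunc 0 a =
    ((counit (R := ℂ) a + chi a) / 2) • 1 + ((counit (R := ℂ) a - chi a) / 2) • K := by
  induction a using induction with
  | hc c => simp [Algebra.algebraMap_eq_smul_one]
  | hK => simp
  | hx i => simp
  | hadd a b ha hb => rw [map_add, ha, hb, map_add, map_add]; module
  | hmul a b ha hb =>
    rw [map_mul, ha, hb, Bialgebra.counit_mul, map_mul]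
    simp only [mul_add, add_mul, smul_mul_smul_comm, mul_one, one_mul, K_mul_K]
    module

/-- A functional composed with the projection onto the group algebra. -/
theorem comp_trunc_zero (ψ : Module.Dual ℂ (Nichols n)) :
    ψ ∘ₗ (trunc 0).toLinearMap =
      ((ψ 1 + ψ K) / 2) • counit + ((ψ 1 - ψ K) / 2) • chi.toLinearMap := by
  ext a
  simp only [LinearMap.comp_apply, AlgHom.toLinearMap_apply, trunc_zero, map_add, map_smul,
    LinearMap.add_apply, LinearMap.smul_apply, smul_eq_mul]
  ring

end Nichols

namespace DoubledNichols
open TensorProduct DrinfeldDouble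
variable {n : ℕ}

/-- The transpose of `trunc_succ`: a functional that ignores the `ξᵢ` with `i > j` is the sum of
one that also ignores `ξⱼ` and of a multiple of `φⱼ`. By induction the dual of `𝒦ₙ` is generated by
`χ` and the `φᵢ`. -/
theorem comp_trunc_succ (j : Fin n) (ψ : Module.Dual ℂ (Nichols n)) :
    ψ ∘ₗ (Nichols.trunc (j + 1)).toLinearMap = ψ ∘ₗ (Nichols.trunc j).toLinearMap +
      dualMul ℂ _ ((ψ ∘ₗ LinearMap.mulRight ℂ (Nichols.K * Nichols.xi j)) ∘ₗ
        (Nichols.trunc j).toLinearMap) (Nichols.phi j) := by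
  ext a
  simp only [LinearMap.comp_apply, AlgHom.toLinearMap_apply, Nichols.trunc_succ, map_add,
    LinearMap.add_apply, dualMul_apply, Nichols.convRight]
  congr 1
  generalize comul (R := ℂ) a = t
  induction t with
  | zero => simp
  | add x y hx hy => simp only [map_add, add_mul, hx, hy]
  | tmul a b => simp [mul_comm, mul_assoc]

/-- The double is generated as an algebra by `K`, `χ`, the `ξᵢ` and the `φᵢ`. -/
theorem induction {P : DoubledNichols n → Prop} (hc : ∀ c : ℂ, P (algebraMap ℂ _ c)) (hK : P K)
    (hchi : P chi) (hxi : ∀ i, P (xi i)) (hphi : ∀ i, P (phi i))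
    (hadd : ∀ a b, P a → P b → P (a + b)) (hmul : ∀ a b, P a → P b → P (a * b))
    (a : DoubledNichols n) : P a := by
  have hsmul : ∀ (c : ℂ) a, P a → P (c • a) := fun c a ha => by
    rw [Algebra.smul_def]; exact hmul _ _ (hc c) ha
  have h1 : P 1 := by simpa using hc 1
  -- the functionals that ignore the `ξᵢ` with `i ≥ j`, by induction on `j`
  have hd : ∀ j ≤ n, ∀ ψ : Module.Dual ℂ (Nichols n),
      P (ofDual ℂ _ (ψ ∘ₗ (Nichols.trunc j).toLinearMap)) := by
    intro j
    induction j with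
    | zero =>
      intro _ ψ
      rw [Nichols.comp_trunc_zero, map_add, map_smul, map_smul, ofDual_counit]
      exact hadd _ _ (hsmul _ _ h1) (hsmul _ _ hchi)
    | succ j ih =>
      intro hj ψ
      have := comp_trunc_succ (n := n) ⟨j, hj⟩ ψ
      rw [this, map_add, ← ofDual_mul_ofDual]
      exact hadd _ _ (ih (by omega) _) (hmul _ _ (ih (by omega) _) (hphi _))
  have hh : ∀ h : Nichols n, P (ofHopf ℂ _ h) := by
    intro h
    induction h using Nichols.induction with
    | hc c => rw [Algebra.algebraMap_eq_smul_one, map_smul, ofHopf_one]; exact hsmul _ _ h1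
    | hK => exact hK
    | hx i => exact hxi i
    | hadd a b ha hb => rw [map_add]; exact hadd _ _ ha hb
    | hmul a b ha hb => rw [← ofHopf_mul_ofHopf]; exact hmul _ _ ha hb
  induction a using DrinfeldDouble.induction_on with
  | hm φ h =>
    refine hmul _ _ ?_ (hh h)
    have := hd n le_rfl φ
    rwa [Nichols.trunc_eq_id] at this
  | hadd a b ha hb => exact hadd _ _ ha hb

end DoubledNichols
end NicholsDouble
end

noncomputable section

namespace NicholsDouble

open Coalgebra (comul counit)

/-! ### Nonvanishing of top monomials -/

namespace Nichols
open TensorProduct HopfAlgebra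
variable {n : ℕ}

/-- The functional `φ_{j₁} ⋯ φ_{jₘ} ρ` on `𝒦ₙ`. -/
def dualMonomial (l : List (Fin n)) (ρ : Module.Dual ℂ (Nichols n)) : Module.Dual ℂ (Nichols n) :=
  l.foldr (fun j ψ => dualMul ℂ _ (phi j) ψ) ρ

theorem chi_mul_dualMonomial (l : List (Fin n)) (ρ : Module.Dual ℂ (Nichols n)) :
    dualMul ℂ _ chi.toLinearMap (dualMonomial l ρ) =
      (-1 : ℂ) ^ l.length • dualMonomial l (dualMul ℂ _ chi.toLinearMap ρ) := by
  induction l with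
  | nil => simp [dualMonomial]
  | cons j l ih =>
    change dualMul ℂ _ chi.toLinearMap (dualMul ℂ _ (phi j) (dualMonomial l ρ)) =
      _ • dualMul ℂ _ (phi j) (dualMonomial l _)
    rw [← dualMul_assoc, chi_mul_phi, map_neg, LinearMap.neg_apply, dualMul_assoc, ih, map_smul,
      List.length_cons, pow_succ]
    simp

/-- A monomial without the factor `ξⱼ` is killed by the skew derivation `φⱼ`. -/
theorem convLeft_phi_eq_zero (j : Fin n) (l : List (Fin n)) (hj : j ∉ l) (c d : ℂ) :
    convLeft (phi j) LinearMap.id ((l.map xi).prod * (c • 1 + d • K)) = 0 := by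
  have hR := convLeft_mul (AlgHom.id ℂ (Nichols n)) (phi_mul' j)
  have hid : (AlgHom.id ℂ (Nichols n)).toLinearMap = LinearMap.id := rfl
  rw [convLeft_counit, hid] at hR
  induction l with
  | nil => simp [convLeft_K, convLeft_one]
  | cons i l ih =>
    rw [List.mem_cons, not_or] at hj
    rw [List.map_cons, List.prod_cons, mul_assoc, hR, ih hj.2, convLeft_xi, phi_xi,
      if_neg (Ne.symm hj.1)]
    simp

/-- Pairing `φⱼ ψ` with `ξⱼ a` removes `φⱼ` and `ξⱼ` at the cost of a factor `χ`. -/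
theorem dualMul_phi_xi (j : Fin n) (ψ : Module.Dual ℂ (Nichols n)) (a : Nichols n)
    (ha : convLeft (phi j) LinearMap.id a = 0) :
    dualMul ℂ _ (phi j) ψ (xi j * a) = dualMul ℂ _ chi.toLinearMap ψ a := by
  have h : ∀ t : Nichols n ⊗[ℂ] Nichols n,
      dualDistrib ℂ _ _ (phi j ⊗ₜ ψ) ((K ⊗ₜ xi j + xi j ⊗ₜ 1) * t) =
        ψ (xi j * TensorProduct.lid ℂ _ (map (phi j) LinearMap.id t)) +
        dualDistrib ℂ _ _ (chi.toLinearMap ⊗ₜ ψ) t := by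
    intro t
    induction t with
    | zero => simp
    | add x y hx hy => simp only [mul_add, map_add, hx, hy]; ring
    | tmul a b => simp [add_mul, phi_mul, phi_xi]
  rw [dualMul_apply, Bialgebra.comul_mul, comul_xi, h, dualMul_apply]
  change ψ (xi j * convLeft (phi j) LinearMap.id a) + _ = _
  rw [ha]
  simp

theorem dualMonomial_ne_zero_aux (l : List (Fin n)) (hl : l.Nodup) (ρ : Module.Dual ℂ (Nichols n))
    (τ σ : ℂ) (hρ : dualMul ℂ _ chi.toLinearMap ρ = τ • ρ) (hτ : τ * τ = 1)
    (h : ρ (1 + σ • K) ≠ 0) : dualMonomial l ρ ((l.map xi).prod * (1 + σ • K)) ≠ 0 := by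
  induction l with
  | nil => simpa [dualMonomial] using h
  | cons j l ih =>
    rw [List.nodup_cons] at hl
    rw [List.map_cons, List.prod_cons, mul_assoc]
    change dualMul ℂ _ (phi j) (dualMonomial l ρ) _ ≠ 0
    have h0 := convLeft_phi_eq_zero j l hl.1 1 σ
    rw [one_smul] at h0
    have hlin : dualMonomial l (τ • ρ) = τ • dualMonomial l ρ := by
      clear ih h0 hl
      induction l with
      | nil => rfl
      | cons i l ih =>
        change dualMul ℂ _ (phi i) (dualMonomial l _) = _ • dualMul ℂ _ (phi i) (dualMonomial l _)
        rw [ih, map_smul]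
    rw [dualMul_phi_xi j _ _ h0, chi_mul_dualMonomial, hρ, hlin, smul_smul, LinearMap.smul_apply]
    refine smul_ne_zero (mul_ne_zero (pow_ne_zero _ (by norm_num)) ?_) (ih hl.2)
    rintro rfl
    simp at hτ

/-- The monomial in the `φⱼ` pairs nontrivially with the monomial in the same `ξⱼ`. -/
theorem dualMonomial_apply_ne_zero (l : List (Fin n)) (hl : l.Nodup) {τ σ : ℂ} (hτ : τ * τ = 1)
    (hσ : σ * σ = 1) : dualMonomial l (counit + τ • chi.toLinearMap)
      ((l.map xi).prod * (1 + σ • K)) ≠ 0 := by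
  refine dualMonomial_ne_zero_aux l hl _ τ σ ?_ hτ ?_
  · rw [map_add, map_smul, dualMul_counit, chi_mul_chi, smul_add, smul_smul, hτ, one_smul, add_comm]
  · intro h
    simp at h
    -- squaring `1 + σ + τ - σ τ = 0` gives `4 σ τ = 0`, as `σ² = τ² = 1`
    have h2 : (σ + τ) ^ 2 = (1 - σ * τ) ^ 2 := by
      have : 1 + σ + τ - σ * τ = 0 := by linear_combination h
      have h3 : σ + τ = -(1 - σ * τ) := by linear_combination this
      rw [h3]; ring
    have h4 : (4 : ℂ) * (σ * τ) = 0 := by linear_combination h2 - hσ - hτ + σ * σ * hτ + hσ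
    rcases mul_eq_zero.1 h4 with h4 | h4
    · norm_num at h4
    · have := congrArg (fun x => x * (σ * τ)) h4
      have h5 : (σ * σ) * (τ * τ) = 0 := by linear_combination this
      rw [hσ, hτ] at h5
      norm_num at h5

end Nichols

namespace DoubledNichols
open TensorProduct DrinfeldDouble
variable {n : ℕ}

theorem C_comm (a : DoubledNichols n) : C * a = a * C := by
  induction a using induction with
  | hc c => exact (Algebra.commutes _ _).symm
  | hK => rw [C, mul_assoc, K_mul_K, ← mul_assoc, K_mul_chi, mul_assoc, K_mul_K]
  | hchi => rw [C, mul_assoc, K_mul_chi]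
  | hxi i => rw [C, mul_assoc, K_mul_xi, ← mul_assoc, xi_mul_chi]; simp [mul_assoc]
  | hphi i => rw [C, mul_assoc, K_mul_phi, ← mul_assoc, mul_neg, ← mul_assoc, chi_mul_phi]; simp
  | hadd a b ha hb => rw [mul_add, ha, hb, add_mul]
  | hmul a b ha hb => rw [← mul_assoc, ha, mul_assoc, hb, mul_assoc]

theorem C_mul_C : (C : DoubledNichols n) * C = 1 := by
  rw [C, mul_assoc, ← mul_assoc K, K_mul_chi, mul_assoc, K_mul_K, mul_one, chi_mul_chi]

theorem ofDual_dualMonomial (l : List (Fin n)) (ρ : Module.Dual ℂ (Nichols n)) :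
    ofDual ℂ _ (Nichols.dualMonomial l ρ) = (l.map phi).prod * ofDual ℂ _ ρ := by
  induction l with
  | nil => simp [Nichols.dualMonomial]
  | cons j l ih =>
    change ofDual ℂ _ (dualMul ℂ _ (Nichols.phi j) (Nichols.dualMonomial l ρ)) = _
    rw [← ofDual_mul_ofDual, ih, List.map_cons, List.prod_cons, mul_assoc]
    rfl

theorem ofHopf_monomial (l : List (Fin n)) :
    ofHopf ℂ _ (l.map Nichols.xi).prod = (l.map xi).prod := by
  induction l with
  | nil => exact ofHopf_one
  | cons j l ih =>
    rw [List.map_cons, List.prod_cons, ← ofHopf_mul_ofHopf, ih, List.map_cons, List.prod_cons]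
    rfl

/-- The monomials `φ_{j₁} ⋯ φ_{jₘ} (1 + τ χ) ξ_{i₁} ⋯ ξ_{iₗ} (1 + σ K)` without repeated factors
are nonzero. -/
theorem monomial_ne_zero {l l' : List (Fin n)} (hl : l.Nodup) (hl' : l'.Nodup) {τ σ : ℂ}
    (hτ : τ * τ = 1) (hσ : σ * σ = 1) :
    ((l.map phi).prod * (1 + τ • chi)) * ((l'.map xi).prod * (1 + σ • K)) ≠ 0 := by
  have h1 : (l.map phi).prod * (1 + τ • chi) =
      ofDual ℂ (Nichols n) (Nichols.dualMonomial l (counit + τ • Nichols.chi.toLinearMap)) := by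
    rw [ofDual_dualMonomial, map_add, map_smul, ofDual_counit]; rfl
  have h2 : (l'.map xi).prod * (1 + σ • K) =
      ofHopf ℂ (Nichols n) ((l'.map Nichols.xi).prod * (1 + σ • Nichols.K)) := by
    rw [← ofHopf_mul_ofHopf, ofHopf_monomial, map_add, map_smul, ofHopf_one]; rfl
  rw [h1, h2]
  apply ofDual_mul_ofHopf_ne_zero
  · intro h
    apply Nichols.dualMonomial_apply_ne_zero l hl hτ hσ
    rw [h, LinearMap.zero_apply]
  · intro h
    apply Nichols.dualMonomial_apply_ne_zero l' hl' hτ hσ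
    rw [h, map_zero]

end DoubledNichols
end NicholsDouble
end

noncomputable section

set_option linter.unusedSectionVars false

namespace NicholsDouble

open Coalgebra (comul counit)

/-! ### Left ideals generated by idempotents -/

section Idempotents

variable {A : Type*} [Ring A] {M : Type*} [AddCommGroup M] [Module A M]

/-- The left ideal `A e`. -/
abbrev leftIdeal (e : A) : Submodule A A := Submodule.span A {e}

/-- The generator `e` of `A e`. -/
def leftGen (e : A) : leftIdeal e := ⟨e, Submodule.mem_span_singleton_self e⟩

theorem coe_leftGen (e : A) : (leftGen e : A) = e := rfl

theorem span_leftGen (e : A) : Submodule.span A {leftGen e} = ⊤ := by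
  rw [eq_top_iff]
  rintro ⟨x, hx⟩ -
  obtain ⟨a, rfl⟩ := Submodule.mem_span_singleton.1 hx
  exact Submodule.mem_span_singleton.2 ⟨a, rfl⟩

theorem smul_leftGen {e : A} (he : e * e = e) : e • leftGen e = leftGen e := Subtype.ext he

theorem coe_smul_leftGen {e : A} (he : e * e = e) (x : leftIdeal e) :
    (x : A) • leftGen e = x := by
  obtain ⟨x, hx⟩ := x
  obtain ⟨a, rfl⟩ := Submodule.mem_span_singleton.1 hx
  apply Subtype.ext
  simp [coe_leftGen, mul_assoc, he]

/-- The map `A e → M` with `e ↦ m`, for `e m = m`. -/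
def leftLift (e : A) (m : M) : leftIdeal e →ₗ[A] M :=
  (LinearMap.toSpanSingleton A M m).domRestrict (leftIdeal e)

theorem leftLift_gen {e : A} {m : M} (h : e • m = m) : leftLift e m (leftGen e) = m := h

theorem leftIdeal_projective {e : A} (he : e * e = e) : Module.Projective A (leftIdeal e) := by
  refine Module.Projective.of_split (leftIdeal e).subtype
    (LinearMap.toSpanSingleton A (leftIdeal e) (leftGen e)) ?_
  ext x
  rw [LinearMap.comp_apply, LinearMap.toSpanSingleton_apply, Submodule.subtype_apply,
    coe_smul_leftGen he, LinearMap.id_apply]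

end Idempotents

namespace DoubledNichols
open TensorProduct DrinfeldDouble
variable {n : ℕ}

/-! ### Weight vectors -/

/-- The projection onto the vectors on which `K` and `χ` act by `σ` and `τ`. -/
def wt (n : ℕ) (σ τ : ℂ) : DoubledNichols n := (4⁻¹ : ℂ) • ((1 + σ • K) * (1 + τ • chi))

theorem K_mul_wt {σ : ℂ} (hσ : σ * σ = 1) (τ : ℂ) : K * wt n σ τ = σ • wt n σ τ := by
  have h : K * (1 + σ • (K : DoubledNichols n)) = σ • (1 + σ • K) := by
    rw [mul_add, mul_smul_comm, K_mul_K, smul_add, smul_smul, hσ, one_smul, mul_one, add_comm]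
  rw [wt, mul_smul_comm, ← mul_assoc, smul_comm, ← smul_mul_assoc σ, h]

theorem chi_mul_wt (σ : ℂ) {τ : ℂ} (hτ : τ * τ = 1) : chi * wt n σ τ = τ • wt n σ τ := by
  have h : (1 + σ • K) * (1 + τ • chi) = (1 + τ • chi) * (1 + σ • (K : DoubledNichols n)) := by
    simp only [mul_add, add_mul, one_mul, mul_one, smul_mul_smul_comm, K_mul_chi, mul_comm σ τ]
    abel
  have h' : chi * (1 + τ • (chi : DoubledNichols n)) = τ • (1 + τ • chi) := by
    rw [mul_add, mul_smul_comm, chi_mul_chi, smul_add, smul_smul, hτ, one_smul, mul_one, add_comm]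
  rw [wt, h, mul_smul_comm, ← mul_assoc, smul_comm, ← smul_mul_assoc τ, h']

/-- The `2 n` odd generators `ξᵢ` and `φᵢ`. -/
def odd : Fin n ⊕ Fin n → DoubledNichols n := Sum.elim xi phi

theorem K_mul_odd (a : Fin n ⊕ Fin n) : K * odd a = -(odd a * K) := by
  rcases a with i | i
  · exact K_mul_xi i
  · exact K_mul_phi i

theorem chi_mul_odd (a : Fin n ⊕ Fin n) : chi * odd a = -(odd a * chi) := by
  rcases a with i | i
  · simp only [odd, Sum.elim_inl]; rw [xi_mul_chi, neg_neg]
  · exact chi_mul_phi i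

theorem odd_mul_self (a : Fin n ⊕ Fin n) : odd a * odd a = 0 := by
  rcases a with i | i
  · exact xi_mul_self i
  · exact phi_mul_self i

/-- The odd generators anticommute up to multiples of the central element `1 - C`. -/
theorem odd_mul_odd (a b : Fin n ⊕ Fin n) :
    ∃ c : ℂ, odd a * odd b = -(odd b * odd a) + c • (1 - C) := by
  rcases a with i | i <;> rcases b with j | j <;> simp only [odd, Sum.elim_inl, Sum.elim_inr]
  · exact ⟨0, by rw [xi_mul_xi]; simp⟩
  · rw [xi_mul_phi]
    split_ifs
    · exact ⟨1, by simp⟩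
    · exact ⟨0, by simp⟩
  · rw [xi_mul_phi]
    split_ifs
    · exact ⟨1, by rw [one_smul]; abel⟩
    · exact ⟨0, by simp⟩
  · exact ⟨0, by rw [phi_mul_phi]; simp⟩

section Modules

variable {M : Type*} [AddCommGroup M] [Module ℂ M] [Module (DoubledNichols n) M]
  [IsScalarTower ℂ (DoubledNichols n) M]

/-- `v` is a vector on which `K` and `χ` act by `σ` and `τ`. -/
def IsWeight (σ τ : ℂ) (v : M) : Prop :=
  (K : DoubledNichols n) • v = σ • v ∧ (chi : DoubledNichols n) • v = τ • v

theorem smul_smul_comm' (c : ℂ) (a : DoubledNichols n) (v : M) : a • c • v = c • a • v := by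
  rw [← IsScalarTower.algebraMap_smul (DoubledNichols n) c v, smul_smul, ← Algebra.commutes,
    mul_smul, IsScalarTower.algebraMap_smul]

theorem IsWeight.smul {σ τ : ℂ} {v : M} (h : IsWeight (n := n) σ τ v) (c : ℂ) :
    IsWeight (n := n) σ τ (c • v) :=
  ⟨by rw [smul_smul_comm', h.1, smul_comm], by rw [smul_smul_comm', h.2, smul_comm]⟩

theorem isWeight_wt_smul {σ τ : ℂ} (hσ : σ * σ = 1) (hτ : τ * τ = 1) (v : M) :
    IsWeight (n := n) σ τ (wt n σ τ • v) :=
  ⟨by rw [smul_smul, K_mul_wt hσ, smul_assoc], by rw [smul_smul, chi_mul_wt _ hτ, smul_assoc]⟩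

theorem IsWeight.wt_smul {σ τ : ℂ} (hσ : σ * σ = 1) (hτ : τ * τ = 1) {v : M}
    (h : IsWeight (n := n) σ τ v) : wt n σ τ • v = v := by
  rw [wt, smul_assoc, mul_smul, add_smul, add_smul, one_smul, smul_assoc, h.2, smul_smul, hτ,
    one_smul, one_smul, smul_assoc, smul_add (K : DoubledNichols n), h.1, smul_add σ, smul_smul, hσ]
  module

theorem wt_mul_wt {σ τ : ℂ} (hσ : σ * σ = 1) (hτ : τ * τ = 1) :
    wt n σ τ * wt n σ τ = wt n σ τ := by
  have h := isWeight_wt_smul (n := n) hσ hτ (1 : DoubledNichols n)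
  have h2 := h.wt_smul hσ hτ
  rwa [smul_eq_mul, smul_eq_mul, mul_one] at h2

theorem IsWeight.C_smul {σ τ : ℂ} {v : M} (h : IsWeight (n := n) σ τ v) :
    (C : DoubledNichols n) • v = (σ * τ) • v := by
  rw [C, mul_smul, h.1, smul_smul_comm', h.2, smul_smul]

theorem IsWeight.odd_smul {σ τ : ℂ} {v : M} (h : IsWeight (n := n) σ τ v) (a : Fin n ⊕ Fin n) :
    IsWeight (n := n) (-σ) (-τ) (odd a • v) :=
  ⟨by rw [smul_smul, K_mul_odd, neg_smul, mul_smul, h.1, smul_smul_comm', neg_smul],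
   by rw [smul_smul, chi_mul_odd, neg_smul, mul_smul, h.2, smul_smul_comm', neg_smul]⟩

theorem C_smul_smul {c : ℂ} {v : M} (h : (C : DoubledNichols n) • v = c • v)
    (a : DoubledNichols n) : (C : DoubledNichols n) • a • v = c • a • v := by
  rw [smul_smul, C_comm, mul_smul, h, smul_smul_comm']

/-- A nonzero vector that is an eigenvector of `C` yields a weight vector. -/
theorem exists_isWeight {c : ℂ} {v : M} (hv : v ≠ 0)
    (h : (C : DoubledNichols n) • v = c • v) :
    ∃ σ : ℂ, σ * σ = 1 ∧ v + σ • (K : DoubledNichols n) • v ≠ 0 ∧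
      IsWeight (n := n) σ (c * σ) (v + σ • (K : DoubledNichols n) • v) := by
  have key : ∀ σ : ℂ, σ * σ = 1 →
      IsWeight (n := n) σ (c * σ) (v + σ • (K : DoubledNichols n) • v) := by
    intro σ hσ
    have h1 : (K : DoubledNichols n) • (v + σ • (K : DoubledNichols n) • v) =
        σ • (v + σ • (K : DoubledNichols n) • v) := by
      rw [smul_add, smul_smul_comm', smul_smul K, K_mul_K, one_smul, smul_add, smul_smul, hσ,
        one_smul, add_comm]
    have h2 : (C : DoubledNichols n) • (v + σ • (K : DoubledNichols n) • v) =
        c • (v + σ • (K : DoubledNichols n) • v) := by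
      rw [smul_add, smul_smul_comm', C_smul_smul h, h, smul_add, smul_comm]
    refine ⟨h1, ?_⟩
    have h3 : (chi : DoubledNichols n) = C * K := by rw [C, mul_assoc, K_mul_K, mul_one]
    rw [h3, mul_smul, h1, smul_smul_comm', h2, smul_smul, mul_comm]
  -- `v` is half the sum of its projections to the two eigenspaces of `K`, so one of them is nonzero
  by_cases h1 : v + (1 : ℂ) • (K : DoubledNichols n) • v = 0
  · refine ⟨-1, by norm_num, fun h2 => hv ?_, key _ (by norm_num)⟩
    have : (2 : ℂ) • v = 0 := by
      calc (2 : ℂ) • v = (v + (1 : ℂ) • (K : DoubledNichols n) • v) +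
          (v + (-1 : ℂ) • (K : DoubledNichols n) • v) := by
            generalize (K : DoubledNichols n) • v = u
            module
        _ = 0 := by rw [h1, h2, add_zero]
    exact (smul_eq_zero.1 this).resolve_left two_ne_zero
  · exact ⟨1, by norm_num, h1, key _ (by norm_num)⟩

/-- Square-zero operators that anticommute on a stable set have a common kernel vector. -/
theorem exists_forall_smul_eq_zero {ι : Type*} (T : ι → DoubledNichols n) (l : List ι)
    (S : M → Prop)
    (hS : ∀ i v, S v → S (T i • v)) (hT : ∀ i v, S v → T i • T i • v = 0)
    (hTT : ∀ i j v, S v → T i • T j • v = -(T j • T i • v)) {v : M} (hv : v ≠ 0) (hvS : S v) :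
    ∃ w : M, w ≠ 0 ∧ S w ∧ ∀ i ∈ l, T i • w = 0 := by
  induction l with
  | nil => exact ⟨v, hv, hvS, by simp⟩
  | cons i l ih =>
    obtain ⟨w, hw, hwS, hwl⟩ := ih
    by_cases h : T i • w = 0
    · exact ⟨w, hw, hwS, by simpa [h] using hwl⟩
    · refine ⟨T i • w, h, hS i w hwS, ?_⟩
      intro j hj
      rcases List.mem_cons.1 hj with rfl | hj
      · exact hT _ _ hwS
      · rw [hTT _ _ _ hwS, hwl j hj, smul_zero, neg_zero]

/-! ### Modules on which `C` is the identity -/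

/-- Where `C` is the identity, the odd generators act as an exterior algebra. -/
theorem odd_smul_odd_smul {v : M} (h : (C : DoubledNichols n) • v = v) (a b : Fin n ⊕ Fin n) :
    odd a • odd b • v = -(odd b • odd a • v) := by
  obtain ⟨c, hc⟩ := odd_mul_odd a b
  rw [smul_smul, hc, add_smul, neg_smul, mul_smul, smul_assoc, sub_smul, h]
  simp

/-- The monomial in the odd generators given by a word. -/
def word (w : List (Fin n ⊕ Fin n)) : DoubledNichols n := (w.map odd).prod

theorem word_cons (a : Fin n ⊕ Fin n) (w : List (Fin n ⊕ Fin n)) :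
    word (a :: w) = odd a * word w := by rw [word, List.map_cons, List.prod_cons, word]

theorem word_nil : word ([] : List (Fin n ⊕ Fin n)) = 1 := rfl

theorem IsWeight.word_smul {σ τ : ℂ} {v : M} (h : IsWeight (n := n) σ τ v)
    (w : List (Fin n ⊕ Fin n)) :
    IsWeight (n := n) ((-1) ^ w.length * σ) ((-1) ^ w.length * τ) (word w • v) := by
  induction w with
  | nil => simpa [word_nil] using h
  | cons a w ih =>
    rw [word_cons, mul_smul, List.length_cons, pow_succ]
    convert ih.odd_smul a using 1 <;> ring

theorem odd_smul_word_smul_of_mem {v : M} (h : (C : DoubledNichols n) • v = v) {a : Fin n ⊕ Fin n}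
    {w : List (Fin n ⊕ Fin n)} (ha : a ∈ w) : odd a • word w • v = 0 := by
  induction w with
  | nil => simp at ha
  | cons b w ih =>
    rw [word_cons, mul_smul]
    by_cases hab : a = b
    · subst hab
      rw [smul_smul, odd_mul_self, zero_smul]
    · have hC : (C : DoubledNichols n) • word w • v = word w • v := by
        simpa using C_smul_smul (c := 1) (by simpa using h) (word w)
      rw [odd_smul_odd_smul hC, ih (by simpa [hab] using ha), smul_zero, neg_zero]

/-- An exterior algebra on `2 n` generators vanishes in degrees above `2 n`. -/
theorem word_smul_eq_zero {v : M} (h : (C : DoubledNichols n) • v = v)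
    {w : List (Fin n ⊕ Fin n)} (hw : 2 * n < w.length) : word w • v = 0 := by
  have hw' : ¬ w.Nodup := fun hn => by
    have := hn.length_le_card
    simp at this
    omega
  clear hw
  induction w with
  | nil => simp at hw'
  | cons b w ih =>
    rw [word_cons, mul_smul]
    by_cases hb : b ∈ w
    · exact odd_smul_word_smul_of_mem h hb
    · rw [ih (by simpa [List.nodup_cons, hb] using hw'), smul_zero]

variable (n) in
/-- The span of the vectors obtained from `v` by applying at least `k` odd generators. -/
def wordSpan (v : M) (k : ℕ) : Submodule ℂ M :=
  Submodule.span ℂ {m | ∃ w : List (Fin n ⊕ Fin n), k ≤ w.length ∧ word w • v = m}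

theorem word_smul_mem {v : M} {k : ℕ} {w : List (Fin n ⊕ Fin n)} (hw : k ≤ w.length) :
    word w • v ∈ wordSpan n v k := Submodule.subset_span ⟨w, hw, rfl⟩

theorem self_mem_wordSpan (v : M) : v ∈ wordSpan n v 0 := by
  have := word_smul_mem (n := n) (v := v) (k := 0) (w := []) (by simp)
  rwa [word_nil, one_smul] at this

theorem wordSpan_anti (v : M) {k l : ℕ} (h : k ≤ l) : wordSpan n v l ≤ wordSpan n v k :=
  Submodule.span_mono fun _ ⟨w, hw, hm⟩ => ⟨w, h.trans hw, hm⟩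

theorem wordSpan_eq_bot {v : M} (h : (C : DoubledNichols n) • v = v) {k : ℕ} (hk : 2 * n < k) :
    wordSpan n v k = ⊥ := by
  rw [eq_bot_iff, wordSpan, Submodule.span_le]
  rintro _ ⟨w, hw, rfl⟩
  exact word_smul_eq_zero h (by omega)

theorem odd_smul_mem_wordSpan {v m : M} {k : ℕ} (hm : m ∈ wordSpan n v k) (a : Fin n ⊕ Fin n) :
    odd a • m ∈ wordSpan n v (k + 1) := by
  induction hm using Submodule.span_induction with
  | mem x hx =>
    obtain ⟨w, hw, rfl⟩ := hx
    rw [smul_smul, ← word_cons]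
    exact word_smul_mem (by simpa using hw)
  | zero => rw [smul_zero]; exact zero_mem _
  | add x y _ _ hx hy => rw [smul_add]; exact add_mem hx hy
  | smul c x _ hx => rw [smul_smul_comm']; exact Submodule.smul_mem _ _ hx

theorem word_smul_mem_wordSpan {v m : M} {k : ℕ} (hm : m ∈ wordSpan n v k)
    (w : List (Fin n ⊕ Fin n)) : word w • m ∈ wordSpan n v (k + w.length) := by
  induction w with
  | nil => rwa [word_nil, one_smul]
  | cons a w ih => rw [word_cons, mul_smul]; exact odd_smul_mem_wordSpan ih a

theorem smul_mem_wordSpan {σ τ : ℂ} {v : M} (h : IsWeight (n := n) σ τ v) {k : ℕ}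
    (a : DoubledNichols n) : ∀ m ∈ wordSpan n v k, a • m ∈ wordSpan n v k := by
  have hodd : ∀ (b : Fin n ⊕ Fin n), ∀ m ∈ wordSpan n v k, odd b • m ∈ wordSpan n v k :=
    fun b m hm => wordSpan_anti v (Nat.le_succ k) (odd_smul_mem_wordSpan hm b)
  have hgrp : ∀ (b : DoubledNichols n),
      (∀ w : List (Fin n ⊕ Fin n), ∃ c : ℂ, b • word w • v = c • word w • v) →
      ∀ m ∈ wordSpan n v k, b • m ∈ wordSpan n v k := by
    intro b hb m hm
    induction hm using Submodule.span_induction with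
    | mem x hx =>
      obtain ⟨w, hw, rfl⟩ := hx
      obtain ⟨c, hc⟩ := hb w
      rw [hc]
      exact Submodule.smul_mem _ _ (word_smul_mem hw)
    | zero => rw [smul_zero]; exact zero_mem _
    | add x y _ _ hx hy => rw [smul_add]; exact add_mem hx hy
    | smul c x _ hx => rw [smul_smul_comm']; exact Submodule.smul_mem _ _ hx
  induction a using induction with
  | hc c => intro m hm; rw [IsScalarTower.algebraMap_smul]; exact Submodule.smul_mem _ _ hm
  | hK => exact hgrp _ fun w => ⟨_, (h.word_smul w).1⟩
  | hchi => exact hgrp _ fun w => ⟨_, (h.word_smul w).2⟩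
  | hxi i => exact hodd (.inl i)
  | hphi i => exact hodd (.inr i)
  | hadd a b ha hb => intro m hm; rw [add_smul]; exact add_mem (ha m hm) (hb m hm)
  | hmul a b ha hb => intro m hm; rw [mul_smul]; exact ha _ (hb m hm)

/-- `wordSpan` of a weight vector as a submodule over the double. -/
def wordModule {σ τ : ℂ} {v : M} (h : IsWeight (n := n) σ τ v) (k : ℕ) :
    Submodule (DoubledNichols n) M where
  __ := (wordSpan n v k).toAddSubmonoid
  smul_mem' a m hm := smul_mem_wordSpan h a m hm

theorem wordModule_zero {σ τ : ℂ} {v : M} (h : IsWeight (n := n) σ τ v)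
    (hv : Submodule.span (DoubledNichols n) {v} = ⊤) : wordModule h 0 = ⊤ := by
  rw [eq_top_iff, ← hv, Submodule.span_le, Set.singleton_subset_iff]
  exact self_mem_wordSpan v

theorem exists_sub_mem_wordSpan_one {v m : M} (hm : m ∈ wordSpan n v 0) :
    ∃ c : ℂ, m - c • v ∈ wordSpan n v 1 := by
  induction hm using Submodule.span_induction with
  | mem x hx =>
    obtain ⟨w, -, rfl⟩ := hx
    rcases w with _ | ⟨a, w⟩
    · exact ⟨1, by rw [word_nil, one_smul, one_smul, sub_self]; exact zero_mem _⟩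
    · exact ⟨0, by rw [zero_smul, sub_zero]; exact word_smul_mem (by simp)⟩
  | zero => exact ⟨0, by simp⟩
  | add x y _ _ hx hy =>
    obtain ⟨c, hc⟩ := hx
    obtain ⟨d, hd⟩ := hy
    exact ⟨c + d, by convert add_mem hc hd using 1; module⟩
  | smul c x _ hx =>
    obtain ⟨d, hd⟩ := hx
    exact ⟨c * d, by convert Submodule.smul_mem _ c hd using 1; module⟩

/-- By parity, a vector of the same `K`-weight as `v` differs from a multiple of `v` by terms with
at least two odd generators. -/
theorem exists_sub_mem_wordSpan_two {σ τ : ℂ} (hσ : σ * σ = 1) {v m : M}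
    (h : IsWeight (n := n) σ τ v) (hm : m ∈ wordSpan n v 0)
    (hK : (K : DoubledNichols n) • m = σ • m) : ∃ c : ℂ, m - c • v ∈ wordSpan n v 2 := by
  -- the projection of `m` to the eigenspace of `K`, which kills the words of odd length
  suffices H : ∃ c : ℂ, (2⁻¹ : ℂ) • (m + σ • (K : DoubledNichols n) • m) - c • v ∈
      wordSpan n v 2 by
    rw [hK, smul_smul, hσ, one_smul, ← two_smul ℂ m, smul_smul, inv_mul_cancel₀ two_ne_zero,
      one_smul] at H
    exact H
  clear hK
  induction hm using Submodule.span_induction with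
  | mem x hx =>
    obtain ⟨w, -, rfl⟩ := hx
    rw [(h.word_smul w).1, smul_smul]
    rcases w with _ | ⟨a, w⟩
    · refine ⟨1, ?_⟩
      rw [word_nil, one_smul, List.length_nil, pow_zero, one_mul, hσ]
      have h0 : (2⁻¹ : ℂ) • (v + (1 : ℂ) • v) - (1 : ℂ) • v = 0 := by module
      rw [h0]
      exact zero_mem _
    · refine ⟨0, ?_⟩
      rcases w with _ | ⟨b, w⟩
      · have : σ * ((-1) ^ [a].length * σ) = -1 := by
          rw [List.length_singleton]; linear_combination -hσ
        rw [this]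
        simp
      · rw [zero_smul, sub_zero, ← Submodule.mem_toAddSubmonoid]
        exact Submodule.smul_mem _ _ (add_mem (word_smul_mem (by simp))
          (Submodule.smul_mem _ _ (word_smul_mem (by simp))))
  | zero => exact ⟨0, by simp⟩
  | add x y _ _ hx hy =>
    obtain ⟨c, hc⟩ := hx
    obtain ⟨d, hd⟩ := hy
    refine ⟨c + d, ?_⟩
    convert add_mem hc hd using 1
    rw [smul_add (K : DoubledNichols n)]
    generalize (K : DoubledNichols n) • x = x', (K : DoubledNichols n) • y = y'
    module
  | smul c x _ hx =>
    obtain ⟨d, hd⟩ := hx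
    refine ⟨c * d, ?_⟩
    convert Submodule.smul_mem _ c hd using 1
    rw [smul_smul_comm']
    generalize (K : DoubledNichols n) • x = x'
    module

end Modules

end DoubledNichols
end NicholsDouble
end

noncomputable section

set_option linter.unusedSectionVars false

namespace NicholsDouble

open Coalgebra (comul counit)

namespace DoubledNichols
open TensorProduct DrinfeldDouble
variable {n : ℕ}

/-! ### Modules on which `C` is minus the identity -/

/-- The product of the `ξᵢ φᵢ`, for `i` in a list. -/
def xiPhi (l : List (Fin n)) : DoubledNichols n := (l.map fun i => xi i * phi i).prod

theorem xiPhi_cons (i : Fin n) (l : List (Fin n)) : xiPhi (i :: l) = xi i * phi i * xiPhi l := by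
  rw [xiPhi, List.map_cons, List.prod_cons, xiPhi]

theorem xi_comm_xi_mul_phi {i j : Fin n} (h : i ≠ j) :
    xi i * (xi j * phi j) = xi j * phi j * xi i := by
  rw [← mul_assoc, xi_mul_xi, neg_mul, mul_assoc, xi_mul_phi, if_neg h, add_zero, mul_neg, neg_neg,
    mul_assoc]

theorem phi_comm_xi_mul_phi {i j : Fin n} (h : i ≠ j) :
    phi i * (xi j * phi j) = xi j * phi j * phi i := by
  have h1 : phi i * xi j = -(xi j * phi i) := by
    rw [xi_mul_phi, if_neg (Ne.symm h), add_zero, neg_neg]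
  rw [← mul_assoc, h1, neg_mul, mul_assoc, phi_mul_phi, mul_neg, neg_neg, mul_assoc]

theorem K_comm_xi_mul_phi (j : Fin n) : K * (xi j * phi j) = xi j * phi j * K := by
  rw [← mul_assoc, K_mul_xi, neg_mul, mul_assoc, K_mul_phi, mul_neg, neg_neg, mul_assoc]

theorem chi_comm_xi_mul_phi (j : Fin n) : chi * (xi j * phi j) = xi j * phi j * chi := by
  have h1 : chi * xi j = -(xi j * chi) := by rw [xi_mul_chi, neg_neg]
  rw [← mul_assoc, h1, neg_mul, mul_assoc, chi_mul_phi, mul_neg, neg_neg, mul_assoc]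

theorem comm_xiPhi {a : DoubledNichols n} {l : List (Fin n)}
    (h : ∀ i ∈ l, a * (xi i * phi i) = xi i * phi i * a) : a * xiPhi l = xiPhi l * a := by
  induction l with
  | nil => simp [xiPhi]
  | cons i l ih =>
    rw [xiPhi_cons, ← mul_assoc, h i (by simp), mul_assoc, ih fun j hj => h j (by simp [hj]),
      ← mul_assoc]

theorem xi_mul_xiPhi {i : Fin n} {l : List (Fin n)} (hi : i ∈ l) : xi i * xiPhi l = 0 := by
  induction l with
  | nil => simp at hi
  | cons j l ih =>
    rw [xiPhi_cons, ← mul_assoc]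
    by_cases h : i = j
    · subst h
      rw [← mul_assoc, xi_mul_self, zero_mul, zero_mul]
    · rw [xi_comm_xi_mul_phi h, mul_assoc, ih (by simpa [h] using hi), mul_zero]

theorem xiPhi_mul_phi {i : Fin n} {l : List (Fin n)} (hi : i ∈ l) : xiPhi l * phi i = 0 := by
  induction l with
  | nil => simp at hi
  | cons j l ih =>
    rw [xiPhi_cons, mul_assoc]
    by_cases h : i ∈ l
    · rw [ih h, mul_zero]
    · obtain rfl : i = j := by simpa [h] using hi
      rw [← comm_xiPhi (fun j hj => phi_comm_xi_mul_phi (by rintro rfl; exact h hj)), ← mul_assoc,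
        mul_assoc (xi i), phi_mul_self, mul_zero, zero_mul]

/-- The product of all `ξᵢ φᵢ`. -/
def xiPhiTop (n : ℕ) : DoubledNichols n := xiPhi (List.finRange n)

theorem xi_mul_xiPhiTop (i : Fin n) : xi i * xiPhiTop n = 0 := xi_mul_xiPhi (List.mem_finRange i)
theorem xiPhiTop_mul_phi (i : Fin n) : xiPhiTop n * phi i = 0 := xiPhi_mul_phi (List.mem_finRange i)
theorem K_mul_xiPhiTop : K * xiPhiTop n = xiPhiTop n * K :=
  comm_xiPhi fun j _ => K_comm_xi_mul_phi j
theorem chi_mul_xiPhiTop : chi * xiPhiTop n = xiPhiTop n * chi :=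
  comm_xiPhi fun j _ => chi_comm_xi_mul_phi j

theorem wt_mul_phi (σ τ : ℂ) (i : Fin n) : wt n σ τ * phi i = phi i * wt n (-σ) (-τ) := by
  simp only [wt, smul_mul_assoc, mul_smul_comm]
  congr 1
  have h1 : (1 + τ • chi) * phi i = phi i * (1 + -τ • chi) := by
    rw [add_mul, mul_add, one_mul, mul_one, smul_mul_assoc, chi_mul_phi, mul_smul_comm, smul_neg,
      neg_smul]
  have h2 : (1 + σ • K) * phi i = phi i * (1 + -σ • K) := by
    rw [add_mul, mul_add, one_mul, mul_one, smul_mul_assoc, K_mul_phi, mul_smul_comm, smul_neg,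
      neg_smul]
  rw [mul_assoc, h1, ← mul_assoc, h2, mul_assoc]

theorem wt_mul_K {σ : ℂ} (hσ : σ * σ = 1) (τ : ℂ) : wt n σ τ * K = σ • wt n σ τ := by
  have h : K * wt n σ τ = wt n σ τ * K :=
    ((((Commute.one_right _).add_right ((Commute.refl K).smul_right σ)).mul_right
      ((Commute.one_right _).add_right (Commute.smul_right K_mul_chi τ))).smul_right _).eq
  rw [← h, K_mul_wt hσ]

theorem wt_mul_chi (σ : ℂ) {τ : ℂ} (hτ : τ * τ = 1) : wt n σ τ * chi = τ • wt n σ τ := by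
  have h : chi * wt n σ τ = wt n σ τ * chi :=
    ((((Commute.one_right _).add_right (Commute.smul_right K_mul_chi.symm σ)).mul_right
      ((Commute.one_right _).add_right ((Commute.refl chi).smul_right τ))).smul_right _).eq
  rw [← h, chi_mul_wt _ hτ]

/-- The primitive idempotent whose left ideal is a projective simple module on which `C` is `-1`. -/
def idemSimple (n : ℕ) (σ : ℂ) : DoubledNichols n :=
  ((2 : ℂ)⁻¹ ^ n) • (xiPhiTop n * wt n σ (-σ))

section Modules

variable {M : Type*} [AddCommGroup M] [Module ℂ M] [Module (DoubledNichols n) M]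
  [IsScalarTower ℂ (DoubledNichols n) M]

variable (n) in
/-- `v` is killed by the `ξᵢ`, and `K` and `χ` act on it by `σ` and `-σ`. -/
def IsHighest (σ : ℂ) (v : M) : Prop :=
  IsWeight (n := n) σ (-σ) v ∧ ∀ i : Fin n, xi i • v = 0

theorem neg_mul_neg_eq_one {σ : ℂ} (hσ : σ * σ = 1) : -σ * -σ = 1 := by rw [neg_mul_neg, hσ]

theorem isHighest_idemSimple_smul {σ : ℂ} (hσ : σ * σ = 1) (v : M) :
    IsHighest n σ (idemSimple n σ • v) := by
  have h := isWeight_wt_smul (n := n) hσ (neg_mul_neg_eq_one hσ) v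
  have h1 : IsWeight (n := n) σ (-σ) (xiPhiTop n • wt n σ (-σ) • v) :=
    ⟨by rw [smul_smul, K_mul_xiPhiTop, mul_smul, h.1, smul_smul_comm'],
     by rw [smul_smul, chi_mul_xiPhiTop, mul_smul, h.2, smul_smul_comm']⟩
  rw [idemSimple, smul_assoc, mul_smul]
  refine ⟨h1.smul _, fun i => ?_⟩
  rw [smul_smul_comm', smul_smul, xi_mul_xiPhiTop, zero_smul, smul_zero]

theorem IsHighest.idemSimple_smul {σ : ℂ} (hσ : σ * σ = 1) {v : M} (h : IsHighest n σ v) :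
    idemSimple n σ • v = v := by
  have hC : (C : DoubledNichols n) • v = -v := by
    rw [h.1.C_smul, mul_neg, hσ, neg_one_smul]
  have key : ∀ l : List (Fin n), xiPhi l • v = (2 : ℂ) ^ l.length • v := by
    intro l
    induction l with
    | nil => simp [xiPhi]
    | cons i l ih =>
      rw [xiPhi_cons, mul_smul, ih, smul_smul_comm', xi_mul_phi, if_pos rfl, add_smul, neg_smul,
        mul_smul, h.2, smul_zero, neg_zero, zero_add, sub_smul, one_smul, hC, List.length_cons,
        pow_succ, mul_smul, two_smul, sub_neg_eq_add]
  rw [idemSimple, smul_assoc, mul_smul, h.1.wt_smul hσ (neg_mul_neg_eq_one hσ), xiPhiTop, key,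
    List.length_finRange, smul_smul, ← mul_pow, inv_mul_cancel₀ two_ne_zero, one_pow, one_smul]

theorem idemSimple_mul_self {σ : ℂ} (hσ : σ * σ = 1) :
    idemSimple n σ * idemSimple n σ = idemSimple n σ := by
  have h := (isHighest_idemSimple_smul (n := n) hσ (1 : DoubledNichols n)).idemSimple_smul hσ
  rwa [smul_eq_mul, smul_eq_mul, mul_one] at h

theorem idemSimple_mul_phi (σ : ℂ) (i : Fin n) : idemSimple n σ * phi i = 0 := by
  rw [idemSimple, smul_mul_assoc, mul_assoc, wt_mul_phi, ← mul_assoc, xiPhiTop_mul_phi, zero_mul,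
    smul_zero]

theorem idemSimple_mul_K {σ : ℂ} (hσ : σ * σ = 1) : idemSimple n σ * K = σ • idemSimple n σ := by
  rw [idemSimple, smul_mul_assoc, mul_assoc, wt_mul_K hσ, mul_smul_comm, smul_comm]

theorem idemSimple_mul_chi {σ : ℂ} (hσ : σ * σ = 1) :
    idemSimple n σ * chi = -σ • idemSimple n σ := by
  rw [idemSimple, smul_mul_assoc, mul_assoc, wt_mul_chi _ (neg_mul_neg_eq_one hσ), mul_smul_comm,
    smul_comm]

/-- The idempotent projects the submodule generated by a highest weight vector `v` to the multiples
of one vector: the `K`, `ξᵢ` act on `v` by scalars, and on the other side the idempotent absorbs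
the `χ`, `φᵢ`. -/
theorem idemSimple_smul_smul {σ τ : ℂ} (hσ : σ * σ = 1) {v : M}
    (hv : IsHighest n τ v) (a : DoubledNichols n) :
    ∃ c : ℂ, idemSimple n σ • a • v = c • idemSimple n σ • v := by
  -- `a` is a sum of products of a part generated by `χ, φᵢ` and a part generated by `K, ξᵢ`
  have hH : ∀ h : Nichols n, ∃ c : ℂ, ofHopf ℂ _ h • v = c • v := by
    intro h
    induction h using Nichols.induction with
    | hc c =>
      exact ⟨c, by rw [Algebra.algebraMap_eq_smul_one, map_smul, ofHopf_one, smul_assoc, one_smul]⟩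
    | hK => exact ⟨τ, hv.1.1⟩
    | hx i => exact ⟨0, by rw [zero_smul]; exact hv.2 i⟩
    | hadd a b ha hb =>
      obtain ⟨c, hc⟩ := ha
      obtain ⟨d, hd⟩ := hb
      exact ⟨c + d, by rw [map_add, add_smul, hc, hd, add_smul]⟩
    | hmul a b ha hb =>
      obtain ⟨c, hc⟩ := ha
      obtain ⟨d, hd⟩ := hb
      exact ⟨d * c, by rw [← ofHopf_mul_ofHopf, mul_smul, hd, smul_smul_comm', hc, smul_smul]⟩
  have hD : ∀ j ≤ n, ∀ ψ : Module.Dual ℂ (Nichols n), ∃ c : ℂ,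
      idemSimple n σ * ofDual ℂ _ (ψ ∘ₗ (Nichols.trunc j).toLinearMap) = c • idemSimple n σ := by
    intro j
    induction j with
    | zero =>
      intro _ ψ
      rw [Nichols.comp_trunc_zero, map_add, map_smul, map_smul, ofDual_counit, mul_add,
        mul_smul_comm, mul_smul_comm, mul_one]
      have := idemSimple_mul_chi (n := n) hσ
      rw [chi] at this
      rw [this, smul_smul, ← add_smul]
      exact ⟨_, rfl⟩
    | succ j ih =>
      intro hj ψ
      obtain ⟨c, hc⟩ := ih (by omega) ψ
      obtain ⟨d, hd⟩ := ih (by omega) (ψ ∘ₗ LinearMap.mulRight ℂ (Nichols.K * Nichols.xi ⟨j, hj⟩))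
      have := comp_trunc_succ (n := n) ⟨j, hj⟩ ψ
      refine ⟨c, ?_⟩
      simp only at this
      rw [this, map_add, ← ofDual_mul_ofDual, mul_add, hc, ← mul_assoc, hd, smul_mul_assoc,
        ← phi, idemSimple_mul_phi, smul_zero, add_zero]
  induction a using DrinfeldDouble.induction_on with
  | hm φ h =>
    obtain ⟨c, hc⟩ := hH h
    obtain ⟨d, hd⟩ := hD n le_rfl φ
    rw [Nichols.trunc_eq_id] at hd
    change idemSimple n σ * ofDual ℂ _ φ = _ at hd
    exact ⟨c * d, by rw [mul_smul, hc, smul_smul_comm', smul_smul_comm', smul_smul, hd, smul_assoc,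
      smul_smul]⟩
  | hadd a b ha hb =>
    obtain ⟨c, hc⟩ := ha
    obtain ⟨d, hd⟩ := hb
    exact ⟨c + d, by rw [add_smul, smul_add, hc, hd, add_smul]⟩

/-- A nonzero module on which `C` is `-1` contains a highest weight vector. -/
theorem exists_isHighest {v : M} (hv : v ≠ 0) (hC : (C : DoubledNichols n) • v = -v) :
    ∃ (σ : ℂ) (w : M), σ * σ = 1 ∧ w ≠ 0 ∧ IsHighest n σ w := by
  obtain ⟨w, hw, hwC, hwx⟩ := exists_forall_smul_eq_zero (xi (n := n)) (List.finRange n)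
    (fun v : M => (C : DoubledNichols n) • v = -v)
    (fun i v hv => by simpa using C_smul_smul (c := -1) (by simpa using hv) (xi i))
    (fun i v _ => by rw [smul_smul, xi_mul_self, zero_smul])
    (fun i j v _ => by rw [smul_smul, xi_mul_xi, neg_smul, mul_smul]) hv hC
  obtain ⟨σ, hσ, hne, hwt⟩ := exists_isWeight (c := -1) hw (by simpa using hwC)
  refine ⟨σ, _, hσ, hne, by simpa using hwt, fun i => ?_⟩
  have h0 := hwx i (List.mem_finRange i)
  rw [smul_add, smul_smul_comm', h0, zero_add, smul_smul, xi, K, ofHopf_mul_ofHopf,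
    Nichols.xi_mul_K, map_neg, ← ofHopf_mul_ofHopf, neg_smul, mul_smul, ← xi, h0]
  simp

end Modules

/-- The monomials in the `φᵢ ξᵢ` up to sign are the ordered monomials. -/
theorem phiXi_prod_eq (l : List (Fin n)) (hl : l.Nodup) : ∃ c : ℂ, c ≠ 0 ∧
    (l.map fun i => phi i * xi i).prod = c • ((l.map phi).prod * (l.map xi).prod) := by
  have hx : ∀ (i : Fin n) (l : List (Fin n)), i ∉ l → ∃ c : ℂ, c ≠ 0 ∧
      xi i * (l.map phi).prod = c • ((l.map phi).prod * xi i) := by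
    intro i l hi
    induction l with
    | nil => exact ⟨1, one_ne_zero, by simp⟩
    | cons j l ih =>
      rw [List.mem_cons, not_or] at hi
      obtain ⟨c, hc, h⟩ := ih hi.2
      refine ⟨-c, neg_ne_zero.2 hc, ?_⟩
      rw [List.map_cons, List.prod_cons, ← mul_assoc, xi_mul_phi, if_neg hi.1, add_zero, neg_mul,
        mul_assoc, h, mul_smul_comm, neg_smul, mul_assoc]
  induction l with
  | nil => exact ⟨1, one_ne_zero, by simp⟩
  | cons i l ih =>
    rw [List.nodup_cons] at hl
    obtain ⟨c, hc, h⟩ := ih hl.2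
    obtain ⟨d, hd, h'⟩ := hx i l hl.1
    refine ⟨c * d, mul_ne_zero hc hd, ?_⟩
    rw [List.map_cons, List.prod_cons, h, List.map_cons, List.prod_cons, List.map_cons,
      List.prod_cons, mul_smul_comm, mul_smul, mul_assoc, ← mul_assoc (xi i), h', smul_mul_assoc,
      mul_smul_comm, mul_assoc, mul_assoc]

theorem xi_prod_mul_chi (l : List (Fin n)) :
    (l.map xi).prod * chi = (-1 : ℂ) ^ l.length • (chi * (l.map xi).prod) := by
  induction l with
  | nil => simp
  | cons i l ih =>
    rw [List.map_cons, List.prod_cons, mul_assoc, ih, mul_smul_comm, ← mul_assoc, xi_mul_chi,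
      neg_mul, mul_assoc, smul_neg, List.length_cons, pow_succ, mul_neg_one, neg_smul]

theorem monomial_mul_wt_ne_zero {l l' : List (Fin n)} (hl : l.Nodup) (hl' : l'.Nodup) {σ τ : ℂ}
    (hσ : σ * σ = 1) (hτ : τ * τ = 1) :
    (l.map phi).prod * (l'.map xi).prod * wt n σ τ ≠ 0 := by
  have hcomm : (1 + σ • K) * (1 + τ • chi) = (1 + τ • chi) * (1 + σ • (K : DoubledNichols n)) := by
    simp only [mul_add, add_mul, one_mul, mul_one, smul_mul_smul_comm, K_mul_chi, mul_comm σ τ]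
    abel
  have hx : (l'.map xi).prod * (1 + τ • chi) =
      (1 + ((-1) ^ l'.length * τ) • chi) * (l'.map xi).prod := by
    rw [mul_add, mul_one, mul_smul_comm, xi_prod_mul_chi, add_mul, one_mul, smul_mul_assoc,
      smul_smul, mul_comm]
  rw [wt, mul_smul_comm, hcomm, mul_assoc, ← mul_assoc _ (1 + τ • chi), hx, mul_assoc, ← mul_assoc]
  refine smul_ne_zero (by norm_num) (monomial_ne_zero hl hl' ?_ hσ)
  rw [mul_mul_mul_comm, hτ, mul_one, ← mul_pow]
  norm_num

theorem phiXi_prod_mul_wt_ne_zero {l : List (Fin n)} (hl : l.Nodup) {σ τ : ℂ}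
    (hσ : σ * σ = 1) (hτ : τ * τ = 1) :
    (l.map fun i => phi i * xi i).prod * wt n σ τ ≠ 0 := by
  obtain ⟨c, hc, h⟩ := phiXi_prod_eq l hl
  rw [h, smul_mul_assoc]
  exact smul_ne_zero hc (monomial_mul_wt_ne_zero hl hl hσ hτ)

theorem wt_ne_zero {σ τ : ℂ} (hσ : σ * σ = 1) (hτ : τ * τ = 1) : wt n σ τ ≠ 0 := by
  have := phiXi_prod_mul_wt_ne_zero (n := n) (l := []) (by simp) hσ hτ
  simpa using this

theorem odd_mul_wt_ne_zero (a : Fin n ⊕ Fin n) {σ τ : ℂ} (hσ : σ * σ = 1) (hτ : τ * τ = 1) :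
    odd a * wt n σ τ ≠ 0 := by
  rcases a with i | i
  · simpa [odd] using
      monomial_mul_wt_ne_zero (n := n) (l := []) (l' := [i]) (by simp) (by simp) hσ hτ
  · simpa [odd] using
      monomial_mul_wt_ne_zero (n := n) (l := [i]) (l' := []) (by simp) (by simp) hσ hτ

theorem idemSimple_ne_zero {σ : ℂ} (hσ : σ * σ = 1) : idemSimple n σ ≠ 0 := by
  have hτ := neg_mul_neg_eq_one hσ
  -- multiplication by the `φᵢ` turns `ξᵢ φᵢ` into `2 φᵢ` where `C = -1`
  have hC : (C : DoubledNichols n) * wt n σ (-σ) = -wt n σ (-σ) := by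
    have h := (isWeight_wt_smul (n := n) hσ hτ (1 : DoubledNichols n)).C_smul
    simp only [smul_eq_mul, mul_one] at h
    rw [h, mul_neg, hσ, neg_one_smul]
  have key : ∀ l : List (Fin n), l.Nodup → ∃ c : ℂ, c ≠ 0 ∧
      (l.map phi).prod * xiPhi l * wt n σ (-σ) = c • ((l.map phi).prod * wt n σ (-σ)) := by
    intro l hl
    induction l with
    | nil => exact ⟨1, one_ne_zero, by simp [xiPhi]⟩
    | cons i l ih =>
      rw [List.nodup_cons] at hl
      obtain ⟨c, hc, h⟩ := ih hl.2
      have h1 : ∀ l : List (Fin n), i ∉ l →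
          (l.map phi).prod * (xi i * phi i) = xi i * phi i * (l.map phi).prod := by
        intro l hl
        induction l with
        | nil => simp
        | cons j l ih =>
          rw [List.mem_cons, not_or] at hl
          rw [List.map_cons, List.prod_cons, mul_assoc, ih hl.2, ← mul_assoc,
            phi_comm_xi_mul_phi (Ne.symm hl.1), mul_assoc]
      have h2 : phi i * (xi i * phi i) = phi i * (1 - C) := by
        rw [xi_mul_phi, if_pos rfl, mul_add, mul_neg, ← mul_assoc, phi_mul_self, zero_mul, neg_zero,
          zero_add]
      refine ⟨c * 2, mul_ne_zero hc two_ne_zero, ?_⟩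
      rw [List.map_cons, List.prod_cons, xiPhi_cons, mul_assoc (phi i),
        ← mul_assoc _ (xi i * phi i),
        h1 l hl.1, mul_assoc (xi i * phi i), ← mul_assoc, h2, mul_assoc, h, mul_smul_comm, mul_smul,
        mul_assoc (phi i), sub_mul, one_mul, ← mul_assoc C, C_comm, mul_assoc _ C, hC, mul_neg,
        sub_neg_eq_add, mul_add, ← two_smul ℂ, mul_assoc]
  obtain ⟨c, hc, h⟩ := key (List.finRange n) (List.nodup_finRange n)
  intro h0
  rw [idemSimple, smul_eq_zero, or_iff_right (pow_ne_zero _ (inv_ne_zero two_ne_zero))] at h0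
  rw [mul_assoc, ← xiPhiTop, h0, mul_zero] at h
  refine smul_ne_zero hc ?_ h.symm
  have := monomial_mul_wt_ne_zero (n := n) (l := List.finRange n) (l' := []) (List.nodup_finRange n)
    (by simp) hσ hτ
  simpa using this

end DoubledNichols
end NicholsDouble
end

noncomputable section

set_option linter.unusedSectionVars false

namespace NicholsDouble

/-! ### Finitely generated modules over a noetherian ring -/

section FGModules

open Limits

variable {A : Type} [Ring A] [IsNoetherianRing A]

theorem fg_epi_iff {X Y : FGModuleCat.{0} A} (f : X ⟶ Y) :
    Epi f ↔ Function.Surjective f.hom.hom := by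
  constructor
  · intro h
    have : Epi ((forget₂ (FGModuleCat.{0} A) (ModuleCat.{0} A)).map f) := inferInstance
    exact (ModuleCat.epi_iff_surjective _).1 this
  · intro h
    have : Epi ((forget₂ (FGModuleCat.{0} A) (ModuleCat.{0} A)).map f) :=
      (ModuleCat.epi_iff_surjective _).2 h
    exact (forget₂ (FGModuleCat.{0} A) (ModuleCat.{0} A)).epi_of_epi_map this

theorem fg_mono_iff {X Y : FGModuleCat.{0} A} (f : X ⟶ Y) :
    Mono f ↔ Function.Injective f.hom.hom := by
  constructor
  · intro h
    have : Mono ((forget₂ (FGModuleCat.{0} A) (ModuleCat.{0} A)).map f) := inferInstance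
    exact (ModuleCat.mono_iff_injective _).1 this
  · intro h
    have : Mono ((forget₂ (FGModuleCat.{0} A) (ModuleCat.{0} A)).map f) :=
      (ModuleCat.mono_iff_injective _).2 h
    exact (forget₂ (FGModuleCat.{0} A) (ModuleCat.{0} A)).mono_of_mono_map this

theorem fg_isZero_iff (X : FGModuleCat.{0} A) : IsZero X ↔ Subsingleton X := by
  constructor
  · intro h
    refine ⟨fun a b => ?_⟩
    have h1 := congrArg (fun f : X ⟶ X => f.hom.hom) (h.eq_of_src (𝟙 X) 0)
    have h2 : ∀ x : X, x = 0 := fun x => LinearMap.congr_fun h1 x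
    rw [h2 a, h2 b]
  · intro h
    rw [IsZero.iff_id_eq_zero]
    ext x
    exact Subsingleton.elim (α := X) _ _

/-- The inclusion of a submodule as a morphism. -/
def fgSub {X : FGModuleCat.{0} A} (N : Submodule A X) : FGModuleCat.of A N ⟶ X :=
  ⟨ModuleCat.ofHom N.subtype⟩

/-- A linear map as a morphism. -/
def fgHom {X Y : FGModuleCat.{0} A} (f : X →ₗ[A] Y) : X ⟶ Y := ⟨ModuleCat.ofHom f⟩

/-- A linear equivalence as an isomorphism. -/
def fgIso {X Y : FGModuleCat.{0} A} (e : X ≃ₗ[A] Y) : X ≅ Y where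
  hom := fgHom e.toLinearMap
  inv := fgHom e.symm.toLinearMap
  hom_inv_id := by ext x; exact e.symm_apply_apply x
  inv_hom_id := by ext x; exact e.apply_symm_apply x

instance fgSub_mono {X : FGModuleCat.{0} A} (N : Submodule A X) : Mono (fgSub N) :=
  (fg_mono_iff _).2 N.injective_subtype

theorem fg_simple_iff (X : FGModuleCat.{0} A) : Simple X ↔ IsSimpleModule A X := by
  constructor
  · intro h
    have : Nontrivial X := by
      by_contra hc
      rw [not_nontrivial_iff_subsingleton, ← fg_isZero_iff] at hc
      exact Simple.not_isZero X hc
    refine { eq_bot_or_eq_top := fun N => ?_ }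
    by_cases h0 : fgSub N = 0
    · left
      rw [eq_bot_iff]
      intro x hx
      have := congrArg (fun f => f.hom.hom ⟨x, hx⟩) h0
      exact this
    · right
      have := isIso_of_mono_of_nonzero h0
      have h2 := (fg_epi_iff (fgSub N)).1 inferInstance
      rw [eq_top_iff]
      intro x _
      obtain ⟨y, rfl⟩ := h2 x
      exact y.2
  · intro h
    refine ⟨fun {Y} f hf => ⟨?_, ?_⟩⟩
    · rintro hi rfl
      have h1 := (fg_epi_iff (0 : Y ⟶ X)).1 inferInstance
      have := IsSimpleModule.nontrivial A X
      obtain ⟨x, hx⟩ := exists_ne (0 : X)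
      obtain ⟨y, hy⟩ := h1 x
      exact hx hy.symm
    · intro h0
      have hr : LinearMap.range f.hom.hom = ⊤ := by
        refine (eq_bot_or_eq_top _).resolve_left fun hb => h0 ?_
        ext x
        exact LinearMap.congr_fun (LinearMap.range_eq_bot.1 hb) x
      have : Epi f := (fg_epi_iff f).2 (LinearMap.range_eq_top.1 hr)
      exact isIso_of_mono_of_epi f

theorem fg_projective_of_projective (X : FGModuleCat.{0} A) [Module.Projective A X] :
    Projective X where
  factors {E Y} f e he := by
    obtain ⟨g, hg⟩ := Module.projective_lifting_property e.hom.hom f.hom.hom ((fg_epi_iff e).1 he)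
    exact ⟨fgHom g, by ext x; exact LinearMap.congr_fun hg x⟩

theorem fg_enoughProjectives : EnoughProjectives (FGModuleCat.{0} A) where
  presentation X := by
    obtain ⟨m, f, hf⟩ := Module.Finite.exists_fin' A X
    have : Module.Projective A (FGModuleCat.of A (Fin m → A)) :=
      inferInstanceAs (Module.Projective A (Fin m → A))
    exact ⟨{
      p := FGModuleCat.of A (Fin m → A)
      projective := fg_projective_of_projective _
      f := fgHom (X := FGModuleCat.of A (Fin m → A)) f
      epi := (fg_epi_iff _).2 hf }⟩

/-- Every nonzero finitely generated module has a simple quotient. -/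
theorem fg_exists_simple_quotient (X : FGModuleCat.{0} A) (hX : ¬ IsZero X) :
    ∃ (V : FGModuleCat.{0} A) (f : X ⟶ V), Simple V ∧ Epi f := by
  rw [fg_isZero_iff, not_subsingleton_iff_nontrivial] at hX
  obtain ⟨N, hN⟩ := IsCoatomic.exists_coatom (Submodule A X)
  refine ⟨FGModuleCat.of A (X ⧸ N), fgHom N.mkQ, ?_, ?_⟩
  · rw [fg_simple_iff]
    exact isSimpleModule_iff_isCoatom.2 hN
  · rw [fg_epi_iff]
    exact N.mkQ_surjective

end FGModules

/-! ### Projective covers of simple objects -/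

section Covers

open Limits

attribute [local instance] Abelian.hasFiniteBiproducts

variable {C : Type*} [Category* C] [Abelian C]

/-- A projective cover of a simple object is indecomposable. -/
theorem IsProjectiveCover.indecomposable {P V : C} {π : P ⟶ V} (h : IsProjectiveCover π)
    [Simple V] :
    Indecomposable P := by
  obtain ⟨hP, hπ, hess⟩ := h
  have hπ0 : π ≠ 0 := fun h0 => by
    subst h0
    exact Simple.not_isZero V (IsZero.of_epi_eq_zero (0 : P ⟶ V) rfl)
  refine ⟨fun hz => hπ0 (hz.eq_of_src _ _), fun Y Z e => ?_⟩
  have key : ∀ (W W' : C) (i : W ⟶ P) (r : P ⟶ W'), i ≫ r = 0 → Epi r → i ≫ π ≠ 0 → IsZero W' := by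
    intro W W' i r hir hr hne
    have h1 : Epi (i ≫ π) := epi_of_nonzero_to_simple hne
    have h2 := hess W i h1
    exact IsZero.of_epi_eq_zero r ((cancel_epi i).1 (by rw [hir, comp_zero]))
  by_cases hY : biprod.inl ≫ e.inv ≫ π = 0
  · by_cases hZ : biprod.inr ≫ e.inv ≫ π = 0
    · exfalso
      apply hπ0
      have : e.inv ≫ π = 0 := biprod.hom_ext' _ _ (by rw [hY, comp_zero]) (by rw [hZ, comp_zero])
      rw [← cancel_epi e.inv, this, comp_zero]
    · left
      exact key Z Y (biprod.inr ≫ e.inv) (e.hom ≫ biprod.fst) (by simp) inferInstance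
        (by simpa using hZ)
  · right
    exact key Y Z (biprod.inl ≫ e.inv) (e.hom ≫ biprod.snd) (by simp) inferInstance
      (by simpa using hY)

/-- Over an object with a projective cover, every other projective object with an epimorphism to
that object has the cover as a direct summand. -/
theorem IsProjectiveCover.exists_split {P V Q : C} {π : P ⟶ V} (h : IsProjectiveCover π)
    [Projective Q] (q : Q ⟶ V) [Epi q] : ∃ (r : Q ⟶ P) (s : P ⟶ Q), s ≫ r = 𝟙 P ∧ r ≫ π = q := by
  obtain ⟨hP, hπ, hess⟩ := h
  have hr : Projective.factorThru q π ≫ π = q := Projective.factorThru_comp q π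
  have : Epi (Projective.factorThru q π) := hess Q _ (by rw [hr]; infer_instance)
  exact ⟨_, Projective.factorThru (𝟙 P) (Projective.factorThru q π),
    Projective.factorThru_comp _ _, hr⟩

/-- An indecomposable object with a nonzero retract is isomorphic to it. -/
theorem Indecomposable.isIso_of_split {Q P : C} (hQ : Indecomposable Q) (hP : ¬ IsZero P)
    (r : Q ⟶ P) (s : P ⟶ Q) (h : s ≫ r = 𝟙 P) : IsIso r := by
  have hs : IsSplitMono s := ⟨⟨r, h⟩⟩
  have hr : IsSplitEpi r := ⟨⟨s, h⟩⟩
  let e : Q ≅ P ⊞ kernel r :=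
    { hom := biprod.lift r (kernel.lift r (𝟙 Q - r ≫ s) (by simp [h]))
      inv := biprod.desc s (kernel.ι r)
      hom_inv_id := by simp
      inv_hom_id := by
        apply biprod.hom_ext' <;> apply biprod.hom_ext <;> simp [h] <;>
          rw [← cancel_mono (kernel.ι r)] <;> simp [reassoc_of% h] }
  have hk := (hQ.2 P (kernel r) e).resolve_left hP
  have : Mono r := Preadditive.mono_of_isZero_kernel r hk
  exact isIso_of_mono_of_epi r

/-- Projective covers of the same object are isomorphic. -/
theorem IsProjectiveCover.nonempty_iso {P V P' : C} {π : P ⟶ V} {π' : P' ⟶ V}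
    (h : IsProjectiveCover π) (h' : IsProjectiveCover π') : Nonempty (P' ≅ P) := by
  have := h'.1
  have := h'.2.1
  obtain ⟨r, s, hsr, hr⟩ := h.exists_split π'
  have hs : Epi s := h'.2.2 P s (by rw [← hr, ← Category.assoc, hsr, Category.id_comp]; exact h.2.1)
  have hs' : IsSplitMono s := ⟨⟨r, hsr⟩⟩
  have : IsIso s := isIso_of_epi_of_isSplitMono s
  exact ⟨(asIso s).symm⟩

theorem IsProjectiveCover.of_projective {V : C} [Projective V] : IsProjectiveCover (𝟙 V) :=
  ⟨inferInstance, inferInstance, fun _ g hg => by simpa using hg⟩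

theorem IsProjectiveCover.comp_iso {P V W : C} {π : P ⟶ V} (h : IsProjectiveCover π) (e : V ≅ W) :
    IsProjectiveCover (π ≫ e.hom) := by
  obtain ⟨h1, h2, h3⟩ := h
  refine ⟨h1, epi_comp _ _, fun Q g hg => h3 Q g ?_⟩
  have : g ≫ π = (g ≫ π ≫ e.hom) ≫ e.inv := by simp
  rw [this]
  infer_instance

end Covers

end NicholsDouble
end

noncomputable section

set_option linter.unusedSectionVars false

namespace NicholsDouble

namespace DoubledNichols
open scoped ModuleCat
open CategoryTheory.Limits
variable {n : ℕ}

/-! ### The simple and the projective indecomposable modules -/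

/-- The signs `1` and `-1`. -/
abbrev Sgn : Type := {σ : ℂ // σ * σ = 1}

/-- The sign `1`. -/
def Sgn.pos : Sgn := ⟨1, by norm_num⟩
/-- The sign `-1`. -/
def Sgn.neg : Sgn := ⟨-1, by norm_num⟩

theorem Sgn.eq_pos_or_eq_neg (s : Sgn) : s = Sgn.pos ∨ s = Sgn.neg := by
  obtain ⟨σ, hσ⟩ := s
  rcases mul_self_eq_one_iff.1 hσ with h | h
  · exact Or.inl (Subtype.ext h)
  · exact Or.inr (Subtype.ext h)

theorem Sgn.pos_ne_neg : Sgn.pos ≠ Sgn.neg := by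
  intro h
  have h1 : (1 : ℂ) = -1 := congrArg Subtype.val h
  norm_num at h1

/-- The primitive idempotent on which `K` and `χ` act by the sign `s`. -/
abbrev idemPos (n : ℕ) (s : Sgn) : DoubledNichols n := wt n s.1 s.1

theorem idemPos_mul_self (s : Sgn) : idemPos n s * idemPos n s = idemPos n s := wt_mul_wt s.2 s.2

theorem isWeight_leftGen (s : Sgn) : IsWeight (n := n) s.1 s.1 (leftGen (idemPos n s)) :=
  ⟨Subtype.ext (K_mul_wt s.2 _), Subtype.ext (chi_mul_wt _ s.2)⟩

theorem IsWeight.C_smul_self {M : Type*} [AddCommGroup M] [Module ℂ M] [Module (DoubledNichols n) M]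
    [IsScalarTower ℂ (DoubledNichols n) M] {s : Sgn} {v : M} (h : IsWeight (n := n) s.1 s.1 v) :
    (C : DoubledNichols n) • v = v := by
  rw [h.C_smul, s.2, one_smul]

/-- The radical of the left ideal generated by `idemPos n s`. -/
def radical (n : ℕ) (s : Sgn) : Submodule (DoubledNichols n) (leftIdeal (idemPos n s)) :=
  wordModule (isWeight_leftGen s) 1

theorem exists_sub_mem_radical {s : Sgn} (x : leftIdeal (idemPos n s)) :
    ∃ c : ℂ, x - c • leftGen (idemPos n s) ∈ radical n s := by
  have h : x ∈ wordModule (isWeight_leftGen (n := n) s) 0 := by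
    rw [wordModule_zero _ (span_leftGen _)]; trivial
  exact exists_sub_mem_wordSpan_one h

theorem leftGen_ne_zero {A : Type*} [Ring A] {e : A} (he : e ≠ 0) : leftGen e ≠ 0 :=
  fun h => he (congrArg Subtype.val h)

/-- A nonzero vector does not lie in the part that the odd generators produce from it, since that
part is obtained by nilpotent operators. -/
theorem notMem_wordSpan_one {M : Type*} [AddCommGroup M] [Module ℂ M] [Module (DoubledNichols n) M]
    [IsScalarTower ℂ (DoubledNichols n) M] {v : M} (hv : v ≠ 0)
    (hC : (C : DoubledNichols n) • v = v) : v ∉ wordSpan n v 1 := by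
  intro h
  -- if `v` is in degree one, then the degree `k` part is contained in the degree `k + 1` part
  have key : ∀ k, v ∈ wordSpan n v k := by
    intro k
    induction k with
    | zero => exact self_mem_wordSpan v
    | succ k ih =>
      have hle : wordSpan n v k ≤ wordSpan n v (k + 1) := by
        conv_lhs => rw [wordSpan]
        rw [Submodule.span_le]
        rintro _ ⟨w, hw, rfl⟩
        exact wordSpan_anti v (by omega) (word_smul_mem_wordSpan h w)
      exact hle ih
  have := key (2 * n + 1)
  rw [wordSpan_eq_bot hC (by omega), Submodule.mem_bot] at this
  exact hv this

theorem leftGen_notMem_radical (s : Sgn) : leftGen (idemPos n s) ∉ radical n s :=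
  notMem_wordSpan_one (leftGen_ne_zero (wt_ne_zero s.2 s.2)) (isWeight_leftGen s).C_smul_self

theorem odd_smul_mem_radical {s : Sgn} (a : Fin n ⊕ Fin n) (x : leftIdeal (idemPos n s)) :
    odd a • x ∈ radical n s := by
  have h : x ∈ wordModule (isWeight_leftGen (n := n) s) 0 := by
    rw [wordModule_zero _ (span_leftGen _)]; trivial
  exact odd_smul_mem_wordSpan h a

theorem radical_ne_bot (hn : 0 < n) (s : Sgn) : radical n s ≠ ⊥ := by
  intro h
  have h1 := odd_smul_mem_radical (s := s) (.inl ⟨0, hn⟩) (leftGen (idemPos n s))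
  rw [h, Submodule.mem_bot] at h1
  exact odd_mul_wt_ne_zero (.inl ⟨0, hn⟩) s.2 s.2 (congrArg Subtype.val h1)

/-- The projective indecomposable module with simple quotient of dimension one. -/
def projObj (n : ℕ) (s : Sgn) : DKMod n := FGModuleCat.of _ (leftIdeal (idemPos n s))

/-- The simple module of dimension one, on which `K` and `χ` act by the sign `s` and the odd
generators act by zero. -/
def charObj (n : ℕ) (s : Sgn) : DKMod n :=
  FGModuleCat.of _ (leftIdeal (idemPos n s) ⧸ radical n s)

/-- The projective simple module, generated by a highest weight vector on which `K` acts by `s`. -/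
def steinbergObj (n : ℕ) (s : Sgn) : DKMod n := FGModuleCat.of _ (leftIdeal (idemSimple n s.1))

/-- The projection of the projective indecomposable module to its simple quotient. -/
def coverMap (n : ℕ) (s : Sgn) : projObj n s ⟶ charObj n s :=
  fgHom (X := projObj n s) (Y := charObj n s) (radical n s).mkQ

theorem isSimpleModule_of_span_eq_top {A M : Type*} [Ring A] [AddCommGroup M] [Module A M]
    [Nontrivial M] (h : ∀ x : M, x ≠ 0 → Submodule.span A {x} = ⊤) : IsSimpleModule A M where
  eq_bot_or_eq_top N := by
    by_cases hN : N = ⊥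
    · exact Or.inl hN
    · obtain ⟨x, hx, hx0⟩ := N.ne_bot_iff.1 hN
      refine Or.inr (eq_top_iff.2 ?_)
      rw [← h x hx0, Submodule.span_le, Set.singleton_subset_iff]
      exact hx

theorem isSimpleModule_quotient_radical (s : Sgn) :
    IsSimpleModule (DoubledNichols n) (leftIdeal (idemPos n s) ⧸ radical n s) := by
  have : Nontrivial (leftIdeal (idemPos n s) ⧸ radical n s) := by
    refine ⟨(radical n s).mkQ (leftGen _), 0, fun h => leftGen_notMem_radical (n := n) s ?_⟩
    rwa [Submodule.mkQ_apply, Submodule.Quotient.mk_eq_zero] at h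
  refine isSimpleModule_of_span_eq_top fun x hx => ?_
  obtain ⟨x, rfl⟩ := (radical n s).mkQ_surjective x
  obtain ⟨c, hc⟩ := exists_sub_mem_radical x
  have hc' : (radical n s).mkQ x = (algebraMap ℂ (DoubledNichols n) c) •
      (radical n s).mkQ (leftGen _) := by
    rw [← map_smul, ← sub_eq_zero, ← map_sub, Submodule.mkQ_apply, Submodule.Quotient.mk_eq_zero,
      IsScalarTower.algebraMap_smul]
    exact hc
  have hc0 : c ≠ 0 := by
    rintro rfl
    rw [map_zero, zero_smul] at hc'
    exact hx hc'
  rw [eq_top_iff]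
  rintro y -
  obtain ⟨⟨y, hy⟩, rfl⟩ := (radical n s).mkQ_surjective y
  obtain ⟨a, rfl⟩ := Submodule.mem_span_singleton.1 hy
  refine Submodule.mem_span_singleton.2 ⟨a * algebraMap ℂ (DoubledNichols n) c⁻¹, ?_⟩
  rw [hc', smul_smul, mul_assoc, ← map_mul, inv_mul_cancel₀ hc0, map_one, mul_one, ← map_smul]
  rfl

instance simple_charObj (s : Sgn) : Simple (charObj n s) :=
  (fg_simple_iff _).2 (isSimpleModule_quotient_radical s)

theorem idemSimple_mul_of_ne {s t : Sgn} (h : s ≠ t) :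
    idemSimple n s.1 * idemSimple n t.1 = 0 := by
  have h1 := (isHighest_idemSimple_smul (n := n) t.2 (1 : DoubledNichols n)).1.1
  rw [smul_eq_mul, smul_eq_mul, mul_one] at h1
  have h2 : (s.1 - t.1) • (idemSimple n s.1 * idemSimple n t.1) = 0 := by
    rw [sub_smul, ← smul_mul_assoc, ← idemSimple_mul_K s.2, mul_assoc, h1, mul_smul_comm, sub_self]
  refine (smul_eq_zero.1 h2).resolve_left fun h0 => h (Subtype.ext (sub_eq_zero.1 h0))

theorem isHighest_leftGen (s : Sgn) : IsHighest n s.1 (leftGen (idemSimple n s.1)) := by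
  have h := isHighest_idemSimple_smul (n := n) s.2 (leftGen (idemSimple n s.1))
  rwa [smul_leftGen (idemSimple_mul_self s.2)] at h

/-- Highest weight vectors of the projective simple module are multiples of the generator. -/
theorem IsHighest.eq_smul_leftGen {s t : Sgn} {w : leftIdeal (idemSimple n s.1)}
    (hw : IsHighest n t.1 w) (hw0 : w ≠ 0) :
    s = t ∧ ∃ c : ℂ, c ≠ 0 ∧ w = c • leftGen (idemSimple n s.1) := by
  obtain ⟨c, hc⟩ := idemSimple_smul_smul t.2 (isHighest_leftGen (n := n) s) (w : DoubledNichols n)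
  rw [coe_smul_leftGen (idemSimple_mul_self s.2), hw.idemSimple_smul t.2] at hc
  by_cases h : t = s
  · subst h
    rw [smul_leftGen (idemSimple_mul_self t.2)] at hc
    refine ⟨rfl, c, ?_, hc⟩
    rintro rfl
    rw [zero_smul] at hc
    exact hw0 hc
  · exfalso
    have h0 : idemSimple n t.1 • leftGen (idemSimple n s.1) = 0 :=
      Subtype.ext (idemSimple_mul_of_ne h)
    rw [h0, smul_zero] at hc
    exact hw0 hc

theorem C_smul_leftIdeal (s : Sgn) (x : leftIdeal (idemSimple n s.1)) :
    (C : DoubledNichols n) • x = -x := by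
  have h : (C : DoubledNichols n) • leftGen (idemSimple n s.1) =
      (-1 : ℂ) • leftGen (idemSimple n s.1) := by
    rw [(isHighest_leftGen s).1.C_smul, mul_neg, s.2]
  rw [← coe_smul_leftGen (idemSimple_mul_self s.2) x, C_smul_smul h, neg_one_smul]

theorem isSimpleModule_steinberg (s : Sgn) :
    IsSimpleModule (DoubledNichols n) (leftIdeal (idemSimple n s.1)) := by
  have : Nontrivial (leftIdeal (idemSimple n s.1)) :=
    ⟨_, 0, leftGen_ne_zero (idemSimple_ne_zero s.2)⟩
  refine isSimpleModule_of_span_eq_top fun x hx => ?_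
  let N := Submodule.span (DoubledNichols n) {x}
  have hxN : x ∈ N := Submodule.mem_span_singleton_self x
  obtain ⟨τ, w, hτ, hw0, hw⟩ := exists_isHighest (n := n) (M := N) (v := ⟨x, hxN⟩)
    (fun h => hx (congrArg Subtype.val h)) (Subtype.ext (C_smul_leftIdeal s x))
  have hw' : IsHighest n τ (w : leftIdeal (idemSimple n s.1)) :=
    ⟨⟨congrArg Subtype.val hw.1.1, congrArg Subtype.val hw.1.2⟩,
      fun i => congrArg Subtype.val (hw.2 i)⟩
  obtain ⟨-, c, hc, hwc⟩ := IsHighest.eq_smul_leftGen (t := ⟨τ, hτ⟩) hw'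
    (fun h => hw0 (Subtype.ext h))
  have hg : leftGen (idemSimple n s.1) ∈ N := by
    have h1 : (algebraMap ℂ (DoubledNichols n) c⁻¹) • (w : leftIdeal (idemSimple n s.1)) ∈ N :=
      N.smul_mem _ w.2
    rwa [hwc, IsScalarTower.algebraMap_smul, smul_smul, inv_mul_cancel₀ hc, one_smul] at h1
  rw [eq_top_iff, ← span_leftGen, Submodule.span_le, Set.singleton_subset_iff]
  exact hg

instance simple_steinbergObj (s : Sgn) : Simple (steinbergObj n s) :=
  (fg_simple_iff _).2 (isSimpleModule_steinberg s)

instance projective_steinbergObj (s : Sgn) : Projective (steinbergObj n s) := by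
  have := leftIdeal_projective (idemSimple_mul_self (n := n) s.2)
  exact fg_projective_of_projective (FGModuleCat.of _ (leftIdeal (idemSimple n s.1)))

instance projective_projObj (s : Sgn) : Projective (projObj n s) := by
  have := leftIdeal_projective (idemPos_mul_self (n := n) s)
  exact fg_projective_of_projective (FGModuleCat.of _ (leftIdeal (idemPos n s)))

/-- The projection to the simple quotient is a projective cover, since the radical is nilpotent. -/
theorem isProjectiveCover_coverMap (s : Sgn) : IsProjectiveCover (coverMap n s) := by
  refine ⟨inferInstance, (fg_epi_iff _).2 (radical n s).mkQ_surjective, fun Q g hg => ?_⟩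
  rw [fg_epi_iff] at hg ⊢
  let v := leftGen (idemPos n s)
  let g' : Q →ₗ[DoubledNichols n] leftIdeal (idemPos n s) := g.hom.hom
  obtain ⟨q, hq⟩ := hg ((radical n s).mkQ v)
  have hq' : g' q - v ∈ wordSpan n v 1 :=
    (Submodule.Quotient.mk_eq_zero _).1 ((map_sub (radical n s).mkQ _ _).trans (sub_eq_zero.2 hq))
  -- Nakayama's lemma: the range of `g'` and the nilpotent radical together span the module
  let N : Submodule (DoubledNichols n) (leftIdeal (idemPos n s)) := LinearMap.range g'
  have hstep : ∀ k, wordSpan n v k ≤ N.restrictScalars ℂ ⊔ wordSpan n v (k + 1) := by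
    intro k
    conv_lhs => rw [wordSpan]
    rw [Submodule.span_le]
    rintro _ ⟨w, hw, rfl⟩
    have h1 : word w • v = word w • g' q - word w • (g' q - v) := by rw [smul_sub, sub_sub_cancel]
    rw [SetLike.mem_coe, h1]
    refine sub_mem (Submodule.mem_sup_left (N.smul_mem _ ⟨q, rfl⟩)) (Submodule.mem_sup_right ?_)
    exact wordSpan_anti v (by omega) (word_smul_mem_wordSpan hq' w)
  have hall : ∀ k, wordSpan n v 0 ≤ N.restrictScalars ℂ ⊔ wordSpan n v k := by
    intro k
    induction k with
    | zero => exact le_sup_right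
    | succ k ih => exact ih.trans (sup_le le_sup_left (hstep k))
  have hv := hall (2 * n + 1) (self_mem_wordSpan v)
  rw [wordSpan_eq_bot (isWeight_leftGen s).C_smul_self (by omega), sup_bot_eq] at hv
  have htop : N = ⊤ := by
    rw [eq_top_iff, ← span_leftGen, Submodule.span_le, Set.singleton_subset_iff]
    exact hv
  exact LinearMap.range_eq_top.1 htop

/-- Every simple module is of one of the two types. -/
theorem simple_classification (X : DKMod n) [hX : Simple X] :
    (∃ s, Nonempty (charObj n s ≅ X)) ∨ ∃ s, Nonempty (steinbergObj n s ≅ X) := by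
  have hS : IsSimpleModule (DoubledNichols n) X := (fg_simple_iff X).1 hX
  have hnt := IsSimpleModule.nontrivial (DoubledNichols n) X
  obtain ⟨x, hx⟩ := exists_ne (0 : X)
  -- `x + C x` is fixed by `C`; if it vanishes, then `C x = -x`
  by_cases h : x + (C : DoubledNichols n) • x = 0
  · right
    obtain ⟨σ, w, hσ, hw0, hw⟩ := exists_isHighest (n := n) hx (eq_neg_of_add_eq_zero_right h)
    refine ⟨⟨σ, hσ⟩, ?_⟩
    have := isSimpleModule_steinberg (n := n) ⟨σ, hσ⟩
    let f := leftLift (idemSimple n σ) w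
    have hf : f (leftGen _) = w := leftLift_gen (hw.idemSimple_smul hσ)
    have hf0 : f ≠ 0 := by
      intro h0
      rw [h0] at hf
      exact hw0 hf.symm
    exact ⟨fgIso (X := steinbergObj n ⟨σ, hσ⟩)
      (LinearEquiv.ofBijective f (LinearMap.bijective_of_ne_zero hf0))⟩
  · left
    have hC : (C : DoubledNichols n) • (x + (C : DoubledNichols n) • x) =
        x + (C : DoubledNichols n) • x := by
      rw [smul_add, smul_smul, C_mul_C, one_smul, add_comm]
    obtain ⟨u, hu, huC, hux⟩ := exists_forall_smul_eq_zero (odd (n := n)) (Finset.univ.toList)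
      (fun v : X => (C : DoubledNichols n) • v = v)
      (fun a v hv => by simpa using C_smul_smul (c := 1) (by simpa using hv) (odd a))
      (fun a v _ => by rw [smul_smul, odd_mul_self, zero_smul])
      (fun a b v hv => odd_smul_odd_smul hv a b) h hC
    obtain ⟨σ, hσ, hw0, hw⟩ := exists_isWeight (c := 1) hu (by simpa using huC)
    set w := u + σ • (K : DoubledNichols n) • u with hwdef
    rw [one_mul] at hw
    have hodd : ∀ a : Fin n ⊕ Fin n, odd a • w = 0 := by
      intro a
      have h0 := hux a (by simp)
      have h1 : odd a * K = -(K * odd a) := by rw [K_mul_odd, neg_neg]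
      rw [hwdef, smul_add, h0, zero_add, smul_smul_comm', smul_smul, h1, neg_smul, mul_smul, h0]
      simp
    refine ⟨⟨σ, hσ⟩, ?_⟩
    have := isSimpleModule_quotient_radical (n := n) ⟨σ, hσ⟩
    let f := leftLift (idemPos n ⟨σ, hσ⟩) w
    have hf : f (leftGen _) = w := leftLift_gen (hw.wt_smul hσ hσ)
    have hker : radical n ⟨σ, hσ⟩ ≤ LinearMap.ker f := by
      intro y hy
      change y ∈ wordSpan n _ 1 at hy
      induction hy using Submodule.span_induction with
      | mem y hy =>
        obtain ⟨l, hl, rfl⟩ := hy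
        rw [LinearMap.mem_ker, map_smul, hf]
        rcases List.eq_nil_or_concat l with rfl | ⟨l', b, rfl⟩
        · simp at hl
        · rw [List.concat_eq_append, word, List.map_append, List.prod_append, mul_smul,
            List.map_singleton, List.prod_singleton, hodd, smul_zero]
      | zero => exact zero_mem _
      | add y z _ _ hy hz => exact add_mem hy hz
      | smul c y _ hy =>
        rw [← IsScalarTower.algebraMap_smul (DoubledNichols n) c y]
        exact Submodule.smul_mem _ _ hy
    let f' := (radical n ⟨σ, hσ⟩).liftQ f hker
    have hf0 : f' ≠ 0 := by
      intro h0
      have h1 : f' ((radical n ⟨σ, hσ⟩).mkQ (leftGen _)) = w := hf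
      rw [h0] at h1
      exact hw0 h1.symm
    exact ⟨fgIso (X := charObj n ⟨σ, hσ⟩)
      (LinearEquiv.ofBijective f' (LinearMap.bijective_of_ne_zero hf0))⟩

end DoubledNichols

end NicholsDouble
end

noncomputable section

set_option linter.unusedSectionVars false

namespace NicholsDouble

namespace DoubledNichols
open scoped ModuleCat
open CategoryTheory.Limits
variable {n : ℕ}

/-! ### The total rank -/

theorem K_smul_charObj (s : Sgn) (x : leftIdeal (idemPos n s) ⧸ radical n s) :
    (K : DoubledNichols n) • x = algebraMap ℂ (DoubledNichols n) s.1 • x := by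
  obtain ⟨x, rfl⟩ := (radical n s).mkQ_surjective x
  obtain ⟨c, hc⟩ := exists_sub_mem_radical x
  have hc' : (radical n s).mkQ x = (radical n s).mkQ (c • leftGen (idemPos n s)) := by
    rw [← sub_eq_zero, ← map_sub]
    exact (Submodule.Quotient.mk_eq_zero _).2 hc
  rw [hc', ← map_smul, ← map_smul, smul_smul_comm', (isWeight_leftGen s).1,
    IsScalarTower.algebraMap_smul, smul_comm]

theorem C_smul_projObj (s : Sgn) (x : leftIdeal (idemPos n s)) :
    (C : DoubledNichols n) • x = x := by
  have h := (isWeight_leftGen (n := n) s).C_smul_self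
  rw [← coe_smul_leftGen (idemPos_mul_self s) x, smul_smul, C_comm, mul_smul, h]

theorem mkQ_leftGen_ne_zero (s : Sgn) : (radical n s).mkQ (leftGen (idemPos n s)) ≠ 0 :=
  fun h => leftGen_notMem_radical s ((Submodule.Quotient.mk_eq_zero _).1 h)

theorem sgn_eq_of_algebraMap_smul_eq {M : Type*} [AddCommGroup M] [Module ℂ M]
    [Module (DoubledNichols n) M] [IsScalarTower ℂ (DoubledNichols n) M] {s t : Sgn} {x : M}
    (hx : x ≠ 0)
    (h : algebraMap ℂ (DoubledNichols n) s.1 • x = algebraMap ℂ (DoubledNichols n) t.1 • x) :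
    s = t := by
  rw [IsScalarTower.algebraMap_smul, IsScalarTower.algebraMap_smul, ← sub_eq_zero, ← sub_smul,
    smul_eq_zero, or_iff_left hx, sub_eq_zero] at h
  exact Subtype.ext h

theorem charObj_injective {s t : Sgn} (f : charObj n s ≅ charObj n t) : s = t := by
  let e : (leftIdeal (idemPos n s) ⧸ radical n s) ≃ₗ[DoubledNichols n]
    (leftIdeal (idemPos n t) ⧸ radical n t) := FGModuleCat.isoToLinearEquiv f
  have h0 := mkQ_leftGen_ne_zero (n := n) s
  have h1 := K_smul_charObj t (e ((radical n s).mkQ (leftGen _)))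
  rw [← map_smul, K_smul_charObj, map_smul] at h1
  exact sgn_eq_of_algebraMap_smul_eq (e.map_ne_zero_iff.2 h0) h1

theorem projObj_injective {s t : Sgn} (f : projObj n s ≅ projObj n t) : s = t := by
  let e : leftIdeal (idemPos n s) ≃ₗ[DoubledNichols n] leftIdeal (idemPos n t) :=
    FGModuleCat.isoToLinearEquiv f
  -- the image of the generator in the simple quotient has both weights
  let g := (radical n t).mkQ ∘ₗ e.toLinearMap
  have hg : Function.Surjective g := (radical n t).mkQ_surjective.comp e.surjective
  have h0 : g (leftGen _) ≠ 0 := by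
    intro h
    obtain ⟨x, hx⟩ := hg ((radical n t).mkQ (leftGen _))
    rw [← coe_smul_leftGen (idemPos_mul_self s) x, map_smul, h, smul_zero] at hx
    exact mkQ_leftGen_ne_zero t hx.symm
  have h1 := K_smul_charObj t (g (leftGen _))
  rw [← map_smul, (isWeight_leftGen s).1, ← IsScalarTower.algebraMap_smul (DoubledNichols n) s.1,
    map_smul] at h1
  exact sgn_eq_of_algebraMap_smul_eq h0 h1

theorem steinbergObj_injective {s t : Sgn} (f : steinbergObj n s ≅ steinbergObj n t) : s = t := by
  let e : leftIdeal (idemSimple n s.1) ≃ₗ[DoubledNichols n] leftIdeal (idemSimple n t.1) :=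
    FGModuleCat.isoToLinearEquiv f
  have h0 : e (leftGen _) ≠ 0 := e.map_ne_zero_iff.2 (leftGen_ne_zero (idemSimple_ne_zero s.2))
  have hw := isHighest_idemSimple_smul (n := n) s.2 (e (leftGen (idemSimple n s.1)))
  rw [← map_smul, smul_leftGen (idemSimple_mul_self s.2)] at hw
  exact (hw.eq_smul_leftGen h0).1.symm

theorem isEmpty_charObj_iso_steinbergObj (s t : Sgn) :
    IsEmpty (charObj n s ≅ steinbergObj n t) := by
  refine ⟨fun f => ?_⟩
  let e : leftIdeal (idemSimple n t.1) ≃ₗ[DoubledNichols n]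
    (leftIdeal (idemPos n s) ⧸ radical n s) := FGModuleCat.isoToLinearEquiv f.symm
  have h0 : leftGen (idemSimple n t.1) ≠ 0 := leftGen_ne_zero (idemSimple_ne_zero t.2)
  obtain ⟨y, hy⟩ := (radical n s).mkQ_surjective (e (leftGen (idemSimple n t.1)))
  have h1 : (C : DoubledNichols n) • e (leftGen (idemSimple n t.1)) = e (leftGen _) := by
    rw [← hy, ← map_smul, C_smul_projObj]
  rw [← map_smul, C_smul_leftIdeal] at h1
  exact h0 (eq_zero_of_eq_neg (e.injective h1).symm)

theorem not_simple_projObj (hn : 0 < n) (s : Sgn) : ¬ Simple (projObj n s) := by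
  intro h
  have h' : IsSimpleModule (DoubledNichols n) (leftIdeal (idemPos n s)) := (fg_simple_iff _).1 h
  rcases eq_bot_or_eq_top (radical n s) with h1 | h1
  · exact radical_ne_bot hn s h1
  · apply leftGen_notMem_radical (n := n) s
    rw [h1]
    trivial

theorem not_projective_charObj (hn : 0 < n) (s : Sgn) : ¬ Projective (charObj n s) := by
  intro h
  obtain ⟨e⟩ := (isProjectiveCover_coverMap (n := n) s).nonempty_iso IsProjectiveCover.of_projective
  exact not_simple_projObj hn s (Simple.of_iso e.symm)

/-- A projective indecomposable object has a simple quotient, and it is the projective cover of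
that. -/
theorem projective_indecomposable_classification (X : DKMod n) (hX : Projective X)
    (hX' : Indecomposable X) :
    (∃ s, Nonempty (projObj n s ≅ X)) ∨ ∃ s, Nonempty (steinbergObj n s ≅ X) := by
  obtain ⟨V, f, hV, hf⟩ := fg_exists_simple_quotient X hX'.1
  have key : ∀ {P W : DKMod n} {π : P ⟶ W} (h : IsProjectiveCover π) (e : W ≅ V),
      ¬ IsZero P → Nonempty (P ≅ X) := by
    intro P W π h e hP
    obtain ⟨r, s, hsr, -⟩ := (h.comp_iso e).exists_split f
    have := Indecomposable.isIso_of_split hX' hP r s hsr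
    exact ⟨(asIso r).symm⟩
  rcases simple_classification V with ⟨s, ⟨e⟩⟩ | ⟨s, ⟨e⟩⟩
  · exact Or.inl ⟨s, key (isProjectiveCover_coverMap s) e
      (isProjectiveCover_coverMap s).indecomposable.1⟩
  · exact Or.inr ⟨s, key IsProjectiveCover.of_projective e (Simple.not_isZero _)⟩

theorem totalRank_eq_six (hn : 0 < n) : totalRank (DKMod n) = 6 := by
  let cl (X : DKMod n) : Quotient (isIsomorphicSetoid (DKMod n)) := Quotient.mk _ X
  have hcl : ∀ {X Y : DKMod n}, cl X = cl Y ↔ Nonempty (X ≅ Y) := fun {X Y} => Quotient.eq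
  -- the six classes
  let F : Sgn ⊕ Sgn ⊕ Sgn → Quotient (isIsomorphicSetoid (DKMod n)) :=
    Sum.elim (fun s => cl (charObj n s))
      (Sum.elim (fun s => cl (steinbergObj n s)) (fun s => cl (projObj n s)))
  have hset : {c : Quotient (isIsomorphicSetoid (DKMod n)) | ∃ X : DKMod n,
      Quotient.mk _ X = c ∧ (Simple X ∨ (Projective X ∧ Indecomposable X))} = Set.range F := by
    ext c
    constructor
    · rintro ⟨X, rfl, hX | ⟨hX, hX'⟩⟩
      · rcases simple_classification X with ⟨s, h⟩ | ⟨s, h⟩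
        · exact ⟨.inl s, hcl.2 h⟩
        · exact ⟨.inr (.inl s), hcl.2 h⟩
      · rcases projective_indecomposable_classification X hX hX' with ⟨s, h⟩ | ⟨s, h⟩
        · exact ⟨.inr (.inr s), hcl.2 h⟩
        · exact ⟨.inr (.inl s), hcl.2 h⟩
    · rintro ⟨s | s | s, rfl⟩
      · exact ⟨_, rfl, Or.inl inferInstance⟩
      · exact ⟨_, rfl, Or.inl inferInstance⟩
      · exact ⟨_, rfl, Or.inr ⟨inferInstance, (isProjectiveCover_coverMap s).indecomposable⟩⟩
  have hinj : Function.Injective F := by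
    have h1 : ∀ s t, ¬ Nonempty (charObj n s ≅ steinbergObj n t) := fun s t ⟨e⟩ =>
      (isEmpty_charObj_iso_steinbergObj s t).false e
    have h2 : ∀ s t, ¬ Nonempty (charObj n s ≅ projObj n t) := fun s t ⟨e⟩ =>
      not_simple_projObj hn t (Simple.of_iso e.symm)
    have h3 : ∀ s t, ¬ Nonempty (steinbergObj n s ≅ projObj n t) := fun s t ⟨e⟩ =>
      not_simple_projObj hn t (Simple.of_iso e.symm)
    rintro (s | s | s) (t | t | t) h
    · obtain ⟨e⟩ := hcl.1 h
      rw [charObj_injective e]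
    · exact (h1 _ _ (hcl.1 h)).elim
    · exact (h2 _ _ (hcl.1 h)).elim
    · exact (h1 _ _ (hcl.1 h.symm)).elim
    · obtain ⟨e⟩ := hcl.1 h
      rw [steinbergObj_injective e]
    · exact (h3 _ _ (hcl.1 h)).elim
    · exact (h2 _ _ (hcl.1 h.symm)).elim
    · exact (h3 _ _ (hcl.1 h.symm)).elim
    · obtain ⟨e⟩ := hcl.1 h
      rw [projObj_injective e]
  have huniv : (Set.univ : Set Sgn) = {Sgn.pos, Sgn.neg} := by
    ext s
    simpa using s.eq_pos_or_eq_neg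
  have hcard : ENat.card Sgn = 2 := by
    rw [← Set.encard_univ, huniv, Set.encard_pair Sgn.pos_ne_neg]
  rw [totalRank, hset, ← Set.image_univ, hinj.encard_image, Set.encard_univ, ENat.card_sum,
    ENat.card_sum, hcard]
  norm_num

/-! ### Nilpotent endomorphisms of projective covers -/

section EndomorphismBounds

variable {s : Sgn}

/-- Endomorphisms of the projective object as endomorphisms of the left ideal. -/
def endMap (g : End (projObj n s)) :
    leftIdeal (idemPos n s) →ₗ[DoubledNichols n] leftIdeal (idemPos n s) := g.hom.hom

theorem endMap_one : endMap (1 : End (projObj n s)) = LinearMap.id := rfl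
theorem endMap_zero : endMap (0 : End (projObj n s)) = 0 := rfl
theorem endMap_mul (g h : End (projObj n s)) : endMap (g * h) = endMap g ∘ₗ endMap h := rfl

theorem endMap_apply (g : End (projObj n s)) (x : leftIdeal (idemPos n s)) :
    endMap g x = (x : DoubledNichols n) • endMap g (leftGen (idemPos n s)) := by
  conv_lhs => rw [← coe_smul_leftGen (idemPos_mul_self s) x]
  exact map_smul _ _ _

theorem end_ext {g h : End (projObj n s)}
    (he : endMap g (leftGen (idemPos n s)) = endMap h (leftGen (idemPos n s))) : g = h := by
  apply FGModuleCat.hom_ext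
  change endMap g = endMap h
  ext1 x
  rw [endMap_apply, he, ← endMap_apply]

theorem endMap_smul (g : End (projObj n s)) (c : ℂ) (x : leftIdeal (idemPos n s)) :
    endMap g (c • x) = c • endMap g x := by
  rw [← IsScalarTower.algebraMap_smul (DoubledNichols n) c x, map_smul,
    IsScalarTower.algebraMap_smul]

theorem endMap_mem_wordSpan (g : End (projObj n s)) {k l : ℕ}
    (hg : endMap g (leftGen (idemPos n s)) ∈ wordSpan n (leftGen (idemPos n s)) k)
    {x : leftIdeal (idemPos n s)} (hx : x ∈ wordSpan n (leftGen (idemPos n s)) l) :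
    endMap g x ∈ wordSpan n (leftGen (idemPos n s)) (k + l) := by
  induction hx using Submodule.span_induction with
  | mem x hx =>
    obtain ⟨w, hw, rfl⟩ := hx
    rw [map_smul]
    exact wordSpan_anti _ (by omega) (word_smul_mem_wordSpan hg w)
  | zero => rw [map_zero]; exact zero_mem _
  | add x y _ _ hx hy => rw [map_add]; exact add_mem hx hy
  | smul c x _ hx => rw [endMap_smul]; exact Submodule.smul_mem _ _ hx

/-- A nilpotent endomorphism raises the number of odd generators by at least two: it preserves the
`K`-weight, so it has no part of degree one, and its part of degree zero is a nilpotent scalar. -/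
theorem nilpotent_mem_wordSpan (g : End (projObj n s)) (hg : IsNilpotent g) :
    endMap g (leftGen (idemPos n s)) ∈ wordSpan n (leftGen (idemPos n s)) 2 := by
  set v := leftGen (idemPos n s)
  have hv0 : endMap g v ∈ wordSpan n v 0 := by
    have : endMap g v ∈ wordModule (isWeight_leftGen (n := n) s) 0 := by
      rw [wordModule_zero _ (span_leftGen _)]; trivial
    exact this
  have hK : (K : DoubledNichols n) • endMap g v = s.1 • endMap g v := by
    rw [← map_smul, (isWeight_leftGen s).1, endMap_smul]
  obtain ⟨c, hc⟩ := exists_sub_mem_wordSpan_two s.2 (isWeight_leftGen s) hv0 hK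
  suffices c = 0 by
    subst this
    rw [zero_smul, sub_zero] at hc
    exact hc
  by_contra hc0
  -- the powers of `g` act on the simple quotient by the powers of `c`
  have hpow : ∀ m : ℕ, endMap (g ^ m) v - c ^ m • v ∈ wordSpan n v 1 := by
    intro m
    induction m with
    | zero =>
      rw [pow_zero, pow_zero, one_smul, endMap_one, LinearMap.id_apply, sub_self]
      exact zero_mem _
    | succ m ih =>
      have h1 := endMap_mem_wordSpan g hv0 ih
      have h2 : c ^ m • (endMap g v - c • v) ∈ wordSpan n v 1 :=
        Submodule.smul_mem _ _ (wordSpan_anti _ (by omega) hc)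
      have h3 : endMap (g ^ (m + 1)) v - c ^ (m + 1) • v =
          endMap g (endMap (g ^ m) v - c ^ m • v) + c ^ m • (endMap g v - c • v) := by
        rw [pow_succ', endMap_mul, LinearMap.comp_apply, map_sub, endMap_smul]
        module
      rw [h3]
      exact add_mem h1 h2
  obtain ⟨m, hm⟩ := hg
  have := hpow m
  rw [hm, endMap_zero, LinearMap.zero_apply, zero_sub, neg_mem_iff,
    Submodule.smul_mem_iff _ (pow_ne_zero _ hc0)] at this
  exact leftGen_notMem_radical s this

/-- A product of more than `n` nilpotent endomorphisms has degree above `2 n`, hence is zero. -/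
theorem card_le_of_isNilpotentProductSet (S : Finset (End (projObj n s)))
    (hS : IsNilpotentProductSet S) : S.card ≤ n := by
  by_contra hlt
  push Not at hlt
  apply hS.2 S.toList S.nodup_toList (by simp)
  have key : ∀ l : List (End (projObj n s)), (∀ g ∈ l, IsNilpotent g) →
      endMap l.prod (leftGen (idemPos n s)) ∈
        wordSpan n (leftGen (idemPos n s)) (2 * l.length) := by
    intro l hl
    induction l with
    | nil => exact self_mem_wordSpan _
    | cons g l ih =>
      rw [List.prod_cons, List.length_cons, show 2 * (l.length + 1) = 2 + 2 * l.length by ring]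
      exact endMap_mem_wordSpan g (nilpotent_mem_wordSpan g (hl g (by simp)))
        (ih fun g hg => hl g (by simp [hg]))
  have h := key S.toList fun g hg => hS.1 g (by simpa using hg)
  rw [wordSpan_eq_bot (isWeight_leftGen s).C_smul_self (by rw [Finset.length_toList]; omega),
    Submodule.mem_bot] at h
  exact end_ext (by rw [h, endMap_zero, LinearMap.zero_apply])

/-- Right multiplication by `φᵢ ξᵢ` on the projective object. -/
def mulPhiXi (s : Sgn) (i : Fin n) : End (projObj n s) :=
  fgHom (X := projObj n s) (Y := projObj n s)
    (leftLift (idemPos n s) ((phi i * xi i) • leftGen (idemPos n s)))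

theorem wt_comm_phi_mul_xi (σ τ : ℂ) (i : Fin n) :
    wt n σ τ * (phi i * xi i) = phi i * xi i * wt n σ τ := by
  have h1 : Commute K (phi i * xi i) := by
    rw [commute_iff_eq, ← mul_assoc, K_mul_phi, neg_mul, mul_assoc, K_mul_xi, mul_neg, neg_neg,
      mul_assoc]
  have h2 : Commute chi (phi i * xi i) := by
    rw [commute_iff_eq, ← mul_assoc, chi_mul_phi, neg_mul, mul_assoc, mul_assoc, xi_mul_chi,
      mul_neg]
  exact ((((Commute.one_left _).add_left (h1.smul_left σ)).mul_left
    ((Commute.one_left _).add_left (h2.smul_left τ))).smul_left _).eq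

theorem endMap_mulPhiXi (i : Fin n) : endMap (mulPhiXi s i) (leftGen (idemPos n s)) =
    (phi i * xi i) • leftGen (idemPos n s) := by
  have h : idemPos n s • (phi i * xi i) • leftGen (idemPos n s) =
      (phi i * xi i) • leftGen (idemPos n s) := by
    rw [smul_smul, wt_comm_phi_mul_xi, mul_smul, smul_leftGen (idemPos_mul_self s)]
  exact leftLift_gen h

theorem mulPhiXi_list_apply (l : List (Fin n)) :
    endMap (l.map (mulPhiXi s)).prod (leftGen (idemPos n s)) =
      (l.reverse.map fun i => phi i * xi i).prod • leftGen (idemPos n s) := by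
  induction l with
  | nil => exact (one_smul _ _).symm
  | cons i l ih =>
    rw [List.map_cons, List.prod_cons, endMap_mul, LinearMap.comp_apply, ih, List.reverse_cons,
      List.map_append, List.prod_append, mul_smul, List.map_singleton, List.prod_singleton,
      map_smul, endMap_mulPhiXi]

theorem mulPhiXi_list_prod_ne_zero {l : List (Fin n)} (hl : l.Nodup) :
    (l.map (mulPhiXi s)).prod ≠ 0 := by
  intro h
  have h1 := mulPhiXi_list_apply (s := s) l
  rw [h] at h1
  exact phiXi_prod_mul_wt_ne_zero (List.nodup_reverse.2 hl) s.2 s.2 (congrArg Subtype.val h1).symm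

theorem mulPhiXi_mul_self (i : Fin n) : mulPhiXi s i * mulPhiXi s i = 0 := by
  apply end_ext
  rw [endMap_mul, LinearMap.comp_apply, endMap_mulPhiXi, map_smul, endMap_mulPhiXi, endMap_zero,
    LinearMap.zero_apply]
  have hC : (C : DoubledNichols n) • xi i • leftGen (idemPos n s) =
      xi i • leftGen (idemPos n s) := by
    simpa using C_smul_smul (c := 1)
      (by simpa using (isWeight_leftGen (n := n) s).C_smul_self) (xi i)
  have h3 := odd_smul_odd_smul (n := n) hC (.inl i) (.inr i)
  change xi i • phi i • _ = -(phi i • xi i • _) at h3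
  rw [mul_smul, mul_smul, h3, smul_smul (xi i) (xi i), xi_mul_self, zero_smul, smul_zero, neg_zero,
    smul_zero]

theorem mulPhiXi_injective : Function.Injective (mulPhiXi (n := n) s) := by
  intro i j h
  by_contra hij
  have h1 := mulPhiXi_list_prod_ne_zero (s := s) (l := [i, j]) (by simpa using hij)
  have h4 : [i, j].map (mulPhiXi s) = [mulPhiXi s i, mulPhiXi s j] := rfl
  rw [h4, List.prod_cons, List.prod_singleton, ← h, mulPhiXi_mul_self] at h1
  exact h1 rfl

/-- The right multiplications by the `φᵢ ξᵢ` attain the bound: they square to zero, and their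
products are monomials in the `φᵢ` and `ξᵢ` without repeated factors. -/
theorem exists_isNilpotentProductSet (s : Sgn) :
    ∃ S : Finset (End (projObj n s)), S.card = n ∧ IsNilpotentProductSet S := by
  refine ⟨Finset.univ.map ⟨mulPhiXi s, mulPhiXi_injective⟩, by simp, ?_, ?_⟩
  · intro f hf
    obtain ⟨i, -, rfl⟩ := Finset.mem_map.1 hf
    exact ⟨2, by rw [pow_two]; exact mulPhiXi_mul_self i⟩
  · intro l hl hlS
    obtain ⟨l', rfl⟩ : ∃ l' : List (Fin n), l'.map (mulPhiXi s) = l := by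
      have : l ∈ Set.range (List.map (mulPhiXi s)) := by
        rw [Set.range_list_map]
        intro f hf
        obtain ⟨i, -, rfl⟩ := Finset.mem_map.1 (hlS f hf)
        exact ⟨i, rfl⟩
      exact this
    exact mulPhiXi_list_prod_ne_zero hl.of_map

theorem isGreatest_projObj (s : Sgn) : IsGreatest {k : ℕ | ∃ S : Finset (End (projObj n s)),
    S.card = k ∧ IsNilpotentProductSet S} n := by
  refine ⟨exists_isNilpotentProductSet s, ?_⟩
  rintro _ ⟨S, rfl, hS⟩
  exact card_le_of_isNilpotentProductSet S hS

end EndomorphismBounds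

end DoubledNichols

/-- An injective multiplicative map of endomorphism rings that preserves zero transports sets of
nilpotent elements with nonzero products. -/
theorem exists_isNilpotentProductSet_of_injective {C D : Type*} [Category* C] [Preadditive C]
    [Category* D] [Preadditive D] {P : C} {Q : D} (F : End P →* End Q)
    (hF : Function.Injective F) (h0 : F 0 = 0) {k : ℕ}
    (h : ∃ S : Finset (End P), S.card = k ∧ IsNilpotentProductSet S) :
    ∃ S : Finset (End Q), S.card = k ∧ IsNilpotentProductSet S := by
  obtain ⟨S, hS, hS1, hS2⟩ := h
  refine ⟨S.map ⟨F, hF⟩, by simpa using hS, ?_, ?_⟩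
  · intro f hf
    obtain ⟨g, hg, rfl⟩ := Finset.mem_map.1 hf
    obtain ⟨m, hm⟩ := hS1 g hg
    exact ⟨m, by change F g ^ m = 0; rw [← map_pow, hm, h0]⟩
  · intro l hl hlS
    obtain ⟨l', rfl⟩ : ∃ l' : List (End P), l'.map F = l := by
      have : l ∈ Set.range (List.map F) := by
        rw [Set.range_list_map]
        intro f hf
        obtain ⟨i, -, rfl⟩ := Finset.mem_map.1 (hlS f hf)
        exact ⟨i, rfl⟩
      exact this
    rw [← map_list_prod, ← h0]
    refine hF.ne (hS2 l' hl.of_map fun f hf => ?_)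
    obtain ⟨g, hg, hgf⟩ := Finset.mem_map.1 (hlS (F f) (List.mem_map_of_mem hf))
    rwa [← hF hgf]

namespace DoubledNichols
open CategoryTheory.Limits
variable {n : ℕ}

/-- The invariant `n`, for the projective cover of any simple object that is not projective. -/
theorem isGreatest_of_isProjectiveCover {V P : DKMod n} {π : P ⟶ V} (hπ : IsProjectiveCover π)
    [hV : Simple V] (hV' : ¬ Projective V) :
    IsGreatest {k : ℕ | ∃ S : Finset (End P), S.card = k ∧ IsNilpotentProductSet S} n := by
  rcases simple_classification V with ⟨s, ⟨e⟩⟩ | ⟨s, ⟨e⟩⟩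
  · obtain ⟨i⟩ := hπ.nonempty_iso ((isProjectiveCover_coverMap s).comp_iso e)
    have hset : {k : ℕ | ∃ S : Finset (End P), S.card = k ∧ IsNilpotentProductSet S} =
        {k : ℕ | ∃ S : Finset (End (projObj n s)), S.card = k ∧ IsNilpotentProductSet S} := by
      ext k
      constructor
      · exact exists_isNilpotentProductSet_of_injective i.symm.conj.toMonoidHom
          i.symm.conj.injective (by simp [Iso.conj_apply])
      · exact exists_isNilpotentProductSet_of_injective i.conj.toMonoidHom
          i.conj.injective (by simp [Iso.conj_apply])
    rw [hset]
    exact isGreatest_projObj s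
  · exact (hV' (Projective.of_iso e inferInstance)).elim

/-- An equivalence carries the projective cover of a non-projective simple object to such a cover,
and with it the invariant. -/
theorem le_of_equivalence {m : ℕ} (hn : 0 < n) (F : DKMod n ≌ DKMod m) : n ≤ m := by
  have h := isProjectiveCover_coverMap (n := n) Sgn.pos
  obtain ⟨hP, hπ, hess⟩ := h
  -- an equivalence preserves projective covers
  have hcov : IsProjectiveCover (F.functor.map (coverMap n Sgn.pos)) := by
    refine ⟨(F.map_projective_iff _).2 hP, inferInstance, fun Q g hg => ?_⟩
    have h1 : Epi (F.symm.functor.map (g ≫ F.functor.map (coverMap n Sgn.pos))) := inferInstance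
    have h2 := hess _ (F.inverse.map g ≫ F.unitInv.app _) (by
      have h3 : (F.inverse.map g ≫ F.unitInv.app _) ≫ coverMap n Sgn.pos =
          F.inverse.map (g ≫ F.functor.map (coverMap n Sgn.pos)) ≫ F.unitInv.app _ := by
        simp
      rw [h3]
      exact epi_comp' h1 inferInstance)
    have h4 : Epi (F.inverse.map g) := by
      have : F.inverse.map g = (F.inverse.map g ≫ F.unitInv.app _) ≫ F.unit.app _ := by simp
      rw [this]
      exact epi_comp _ _
    exact F.inverse.epi_of_epi_map h4
  have hS : Simple (F.functor.obj (charObj n Sgn.pos)) :=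
    simple_obj F.functor _
  have hnp : ¬ Projective (F.functor.obj (charObj n Sgn.pos)) := fun h =>
    not_projective_charObj hn _ ((F.map_projective_iff _).1 h)
  refine (isGreatest_of_isProjectiveCover hcov hnp).2 ?_
  exact exists_isNilpotentProductSet_of_injective (F.functor.mapEnd _)
    (fun f g hfg => F.functor.map_injective hfg) (F.functor.map_zero _ _)
    (exists_isNilpotentProductSet Sgn.pos)

end DoubledNichols

end NicholsDouble
end

noncomputable section
set_option linter.unusedSectionVars false

namespace NicholsDouble

open Coalgebra (comul counit)

/-! ### The comultiplication and the counit of the double are multiplicative -/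

namespace DrinfeldDouble
open TensorProduct HopfAlgebra

section
variable {k H : Type*} [Field k] [Ring H] [HopfAlgebra k H] [BijectiveAntipode k H]

theorem doubleCounit_mk (φ : Module.Dual k H) (h : H) :
    doubleCounit k H (ofDual k H φ * ofHopf k H h) = φ 1 * counit (R := k) h := by
  rw [ofDual_mul_ofHopf]
  simp [doubleCounit]

theorem doubleCounit_ofDual (φ : Module.Dual k H) : doubleCounit k H (ofDual k H φ) = φ 1 := by
  have := doubleCounit_mk φ (1 : H)
  rwa [ofHopf_one, mul_one, Bialgebra.counit_one, mul_one] at this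

theorem doubleCounit_ofHopf (h : H) :
    doubleCounit k H (ofHopf k H h) = counit (R := k) h := by
  have := doubleCounit_mk (k := k) counit h
  rwa [ofDual_counit, one_mul, Bialgebra.counit_one, one_mul] at this

variable [Module.Finite k H]

/-- The defining property of the coproduct of `H^{*cop}`. -/
theorem dualDistrib_dualCoopComul (φ : Module.Dual k H) (t : H ⊗[k] H) :
    dualDistrib k H H (TensorProduct.comm k _ _ (dualCoopComul k H φ)) t =
      φ (LinearMap.mul' k H t) := by
  simp only [dualCoopComul, LinearMap.comp_apply, LinearEquiv.coe_coe]
  rw [← LinearEquiv.trans_apply, TensorProduct.comm_trans_comm, LinearEquiv.refl_apply]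
  exact LinearMap.congr_fun ((dualDistribEquiv k H H).apply_symm_apply _) t

/-- An element of `H^* ⊗ H^*` is determined by its pairing with pure tensors, written with the
factors exchanged. -/
theorem dual_tensor_ext {s t : Module.Dual k H ⊗[k] Module.Dual k H}
    (h : ∀ x y : H, dualDistrib k H H (TensorProduct.comm k _ _ s) (x ⊗ₜ y) =
      dualDistrib k H H (TensorProduct.comm k _ _ t) (x ⊗ₜ y)) : s = t := by
  apply (TensorProduct.comm k _ _).injective
  apply (dualDistribEquiv k H H).injective
  exact TensorProduct.ext' h

theorem dualDistrib_comm_map (f g : Module.Dual k H →ₗ[k] Module.Dual k H) (f' g' : H →ₗ[k] H)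
    (hf : ∀ φ x, f φ x = φ (f' x)) (hg : ∀ φ x, g φ x = φ (g' x))
    (t : Module.Dual k H ⊗[k] Module.Dual k H) (x y : H) :
    dualDistrib k H H (TensorProduct.comm k _ _ (map f g t)) (x ⊗ₜ y) =
      dualDistrib k H H (TensorProduct.comm k _ _ t) (g' x ⊗ₜ f' y) := by
  induction t with
  | zero => simp
  | add s t hs ht => simp only [map_add, LinearMap.add_apply, hs, ht]
  | tmul φ ψ => simp [hf, hg]

theorem doubleComul_mk (φ : Module.Dual k H) (h : H) :
    doubleComul k H (ofDual k H φ * ofHopf k H h) =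
      map (ofDual k H) (ofDual k H) (dualCoopComul k H φ) *
        map (ofHopf k H) (ofHopf k H) (comul h) := by
  rw [ofDual_mul_ofHopf]
  simp only [doubleComul, LinearMap.comp_apply, LinearEquiv.coe_coe, LinearEquiv.symm_apply_apply,
    map_tmul]
  generalize dualCoopComul k H φ = s
  generalize comul (R := k) h = t
  induction s with
  | zero => simp
  | add x y hx hy => simp only [add_tmul, map_add, add_mul, hx, hy]
  | tmul φ ψ =>
    induction t with
    | zero => simp
    | add x y hx hy => simp only [tmul_add, map_add, mul_add, hx, hy]
    | tmul g h => simp [ofDual_mul_ofHopf]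

theorem dualCoopComul_counit :
    dualCoopComul k H (counit : Module.Dual k H) = counit ⊗ₜ counit := by
  apply dual_tensor_ext
  intro x y
  rw [dualDistrib_dualCoopComul]
  simp

theorem doubleComul_ofDual (φ : Module.Dual k H) :
    doubleComul k H (ofDual k H φ) = map (ofDual k H) (ofDual k H) (dualCoopComul k H φ) := by
  have := doubleComul_mk φ (1 : H)
  rwa [ofHopf_one, mul_one, Bialgebra.comul_one, Algebra.TensorProduct.one_def, map_tmul,
    ofHopf_one, ← Algebra.TensorProduct.one_def, mul_one] at this

theorem doubleComul_ofHopf (h : H) :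
    doubleComul k H (ofHopf k H h) = map (ofHopf k H) (ofHopf k H) (comul h) := by
  have := doubleComul_mk (k := k) counit h
  rwa [ofDual_counit, one_mul, dualCoopComul_counit, map_tmul, ofDual_counit,
    ← Algebra.TensorProduct.one_def, one_mul] at this

/-- The dual of the multiplicativity of the comultiplication of `H`. -/
theorem doubleComul_ofDual_mul_ofDual (φ ψ : Module.Dual k H) :
    doubleComul k H (ofDual k H φ * ofDual k H ψ) =
      doubleComul k H (ofDual k H φ) * doubleComul k H (ofDual k H ψ) := by
  have key : ∀ s t : Module.Dual k H ⊗[k] Module.Dual k H,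
      ∃ u, map (ofDual k H) (ofDual k H) s * map (ofDual k H) (ofDual k H) t =
        map (ofDual k H) (ofDual k H) u ∧ ∀ x y,
          dualDistrib k H H (TensorProduct.comm k _ _ u) (x ⊗ₜ y) =
          dualDistrib k (H ⊗[k] H) (H ⊗[k] H)
            (dualDistrib k H H (TensorProduct.comm k _ _ s) ⊗ₜ
              dualDistrib k H H (TensorProduct.comm k _ _ t))
            (TensorProduct.tensorTensorTensorComm k H H H H (comul x ⊗ₜ comul y)) := by
    intro s t
    induction s with
    | zero => exact ⟨0, by simp, by simp⟩
    | add s₁ s₂ h₁ h₂ =>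
      obtain ⟨u₁, e₁, f₁⟩ := h₁
      obtain ⟨u₂, e₂, f₂⟩ := h₂
      refine ⟨u₁ + u₂, by rw [map_add, map_add, add_mul, e₁, e₂], fun x y => ?_⟩
      simp only [map_add, LinearMap.add_apply, add_tmul, f₁, f₂]
    | tmul φ φ' =>
      induction t with
      | zero => exact ⟨0, by simp, by simp⟩
      | add s₁ s₂ h₁ h₂ =>
        obtain ⟨u₁, e₁, f₁⟩ := h₁
        obtain ⟨u₂, e₂, f₂⟩ := h₂
        refine ⟨u₁ + u₂, by rw [map_add, map_add, mul_add, e₁, e₂], fun x y => ?_⟩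
        simp only [map_add, LinearMap.add_apply, tmul_add, f₁, f₂]
      | tmul ψ ψ' =>
        refine ⟨dualMul k H φ ψ ⊗ₜ dualMul k H φ' ψ', ?_, fun x y => ?_⟩
        · simp [ofDual_mul_ofDual]
        · simp only [comm_tmul, dualDistrib_apply, dualMul_apply]
          generalize comul (R := k) x = a
          generalize comul (R := k) y = b
          induction a with
          | zero => simp
          | add x y hx hy => simp only [map_add, add_mul, add_tmul, hx, hy]
          | tmul x x' =>
            induction b with
            | zero => simp
            | add x y hx hy => simp only [map_add, mul_add, tmul_add, hx, hy]
            | tmul y y' => simp; ring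
  rw [ofDual_mul_ofDual, doubleComul_ofDual, doubleComul_ofDual, doubleComul_ofDual]
  obtain ⟨u, e, f⟩ := key (dualCoopComul k H φ) (dualCoopComul k H ψ)
  rw [e]
  congr 1
  apply dual_tensor_ext
  intro x y
  rw [dualDistrib_dualCoopComul, f, LinearMap.mul'_apply, dualMul_apply, Bialgebra.comul_mul]
  generalize comul (R := k) x = a
  generalize comul (R := k) y = b
  induction a with
  | zero => simp
  | add x y hx hy => simp only [map_add, add_mul, add_tmul, hx, hy]
  | tmul x x' =>
    induction b with
    | zero => simp
    | add x y hx hy => simp only [map_add, mul_add, tmul_add, hx, hy]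
    | tmul y y' => simp [dualDistrib_dualCoopComul]

theorem doubleComul_ofDual_mul (φ : Module.Dual k H) (a : DrinfeldDouble k H) :
    doubleComul k H (ofDual k H φ * a) = doubleComul k H (ofDual k H φ) * doubleComul k H a := by
  induction a using induction_on with
  | hm ψ h =>
    rw [← mul_assoc, ofDual_mul_ofDual, doubleComul_mk, ← doubleComul_ofDual, ← ofDual_mul_ofDual,
      doubleComul_ofDual_mul_ofDual, mul_assoc, doubleComul_ofDual ψ, ← doubleComul_mk]
  | hadd a b ha hb => rw [mul_add, map_add, map_add, mul_add, ha, hb]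

theorem doubleCounit_ofDual_mul (φ : Module.Dual k H) (a : DrinfeldDouble k H) :
    doubleCounit k H (ofDual k H φ * a) =
      doubleCounit k H (ofDual k H φ) * doubleCounit k H a := by
  induction a using induction_on with
  | hm ψ h =>
    rw [← mul_assoc, ofDual_mul_ofDual, doubleCounit_mk, doubleCounit_ofDual, doubleCounit_mk]
    simp [Algebra.TensorProduct.one_def, mul_assoc]
  | hadd a b ha hb => rw [mul_add, map_add, map_add, mul_add, ha, hb]

theorem map_ofHopf_mul (s t : H ⊗[k] H) : map (ofHopf k H) (ofHopf k H) (s * t) =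
    map (ofHopf k H) (ofHopf k H) s * map (ofHopf k H) (ofHopf k H) t := by
  induction s with
  | zero => simp
  | add x y hx hy => simp only [map_add, add_mul, hx, hy]
  | tmul x x' =>
    induction t with
    | zero => simp
    | add x y hx hy => simp only [map_add, mul_add, hx, hy]
    | tmul y y' => simp [ofHopf_mul_ofHopf]

end
end DrinfeldDouble

namespace DoubledNichols
open TensorProduct DrinfeldDouble
variable {n : ℕ}

theorem K_mul_map_ofDual (t : Module.Dual ℂ (Nichols n) ⊗[ℂ] Module.Dual ℂ (Nichols n)) :
    K ⊗ₜ K * map (ofDual ℂ _) (ofDual ℂ _) t = map (ofDual ℂ _) (ofDual ℂ _)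
      (map (sandwich ℂ _ Nichols.K Nichols.K) (sandwich ℂ _ Nichols.K Nichols.K) t) * K ⊗ₜ K := by
  induction t with
  | zero => simp
  | add x y hx hy => simp only [map_add, mul_add, add_mul, hx, hy]
  | tmul φ ψ => simp [K_mul_ofDual]

theorem xi_mul_map_ofDual (i : Fin n)
    (t : Module.Dual ℂ (Nichols n) ⊗[ℂ] Module.Dual ℂ (Nichols n)) :
    (K ⊗ₜ xi i + xi i ⊗ₜ 1) * map (ofDual ℂ _) (ofDual ℂ _) t =
      map (ofDual ℂ _) (ofDual ℂ _)
        (map (sandwich ℂ _ Nichols.K Nichols.K) (sandwich ℂ _ Nichols.K (Nichols.xi i)) t) *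
          K ⊗ₜ K +
      map (ofDual ℂ _) (ofDual ℂ _)
        (map (sandwich ℂ _ Nichols.K Nichols.K) (sandwich ℂ _ Nichols.K 1) t) * K ⊗ₜ xi i +
      map (ofDual ℂ _) (ofDual ℂ _) (map (sandwich ℂ _ Nichols.K 1) .id t) * xi i ⊗ₜ 1 +
      (map (ofDual ℂ _) (ofDual ℂ _)
        (map (sandwich ℂ _ Nichols.K Nichols.K) (sandwich ℂ _ (Nichols.xi i) 1) t) +
       map (ofDual ℂ _) (ofDual ℂ _) (map (sandwich ℂ _ Nichols.K (Nichols.xi i)) .id t)) *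
          K ⊗ₜ 1 +
      map (ofDual ℂ _) (ofDual ℂ _) (map (sandwich ℂ _ (Nichols.xi i) 1) .id t) := by
  induction t with
  | zero => simp
  | add x y hx hy => simp only [map_add, mul_add, add_mul, hx, hy]; abel
  | tmul φ ψ =>
    simp only [map_tmul, add_mul, Algebra.TensorProduct.tmul_mul_tmul, K_mul_ofDual, xi_mul_ofDual,
      tmul_add, add_tmul, mul_one, one_mul, LinearMap.id_apply]
    abel

theorem doubleComul_K : doubleComul ℂ (Nichols n) K = K ⊗ₜ K := by
  rw [K, doubleComul_ofHopf, Nichols.comul_K, map_tmul]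

theorem doubleComul_xi (i : Fin n) :
    doubleComul ℂ (Nichols n) (xi i) = K ⊗ₜ xi i + xi i ⊗ₜ 1 := by
  rw [K, xi, doubleComul_ofHopf, Nichols.comul_xi, map_add, map_tmul, map_tmul, ofHopf_one]

theorem doubleComul_mul_ofHopf (a : DoubledNichols n) (h : Nichols n) :
    doubleComul ℂ (Nichols n) (a * ofHopf ℂ _ h) =
      doubleComul ℂ (Nichols n) a * doubleComul ℂ (Nichols n) (ofHopf ℂ _ h) := by
  induction a using DrinfeldDouble.induction_on with
  | hm ψ g =>
    rw [mul_assoc, ofHopf_mul_ofHopf, doubleComul_mk, doubleComul_mk, doubleComul_ofHopf,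
      Bialgebra.comul_mul, map_ofHopf_mul, mul_assoc]
  | hadd a b ha hb => rw [add_mul, map_add, map_add, add_mul, ha, hb]

theorem doubleCounit_mul_ofHopf (a : DoubledNichols n) (h : Nichols n) :
    doubleCounit ℂ (Nichols n) (a * ofHopf ℂ _ h) =
      doubleCounit ℂ (Nichols n) a * doubleCounit ℂ (Nichols n) (ofHopf ℂ _ h) := by
  induction a using DrinfeldDouble.induction_on with
  | hm ψ g =>
    rw [mul_assoc, ofHopf_mul_ofHopf, doubleCounit_mk, doubleCounit_mk, doubleCounit_ofHopf,
      Bialgebra.counit_mul, mul_assoc]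
  | hadd a b ha hb => rw [add_mul, map_add, map_add, add_mul, ha, hb]

theorem doubleComul_K_mul_ofDual (ψ : Module.Dual ℂ (Nichols n)) :
    doubleComul ℂ (Nichols n) (K * ofDual ℂ _ ψ) =
      doubleComul ℂ (Nichols n) K * doubleComul ℂ (Nichols n) (ofDual ℂ _ ψ) := by
  rw [doubleComul_K, doubleComul_ofDual, K_mul_map_ofDual, K_mul_ofDual]
  conv_lhs => rw [K]
  rw [doubleComul_mul_ofHopf, doubleComul_ofDual, ← K, doubleComul_K]
  congr 2
  apply dual_tensor_ext
  intro x y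
  have h : ∀ (φ : Module.Dual ℂ (Nichols n)) x, sandwich ℂ _ Nichols.K Nichols.K φ x =
      φ ((LinearMap.mulLeft ℂ Nichols.K ∘ₗ LinearMap.mulRight ℂ Nichols.K) x) := by simp
  rw [dualDistrib_comm_map _ _ _ _ h h, dualDistrib_dualCoopComul, dualDistrib_dualCoopComul]
  simp only [LinearMap.comp_apply, LinearMap.mulLeft_apply, LinearMap.mulRight_apply,
    LinearMap.mul'_apply, sandwich_apply, Nichols.antipodeInv_K]
  simp only [mul_assoc, ← mul_assoc Nichols.K Nichols.K, Nichols.K_mul_K, one_mul]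

/-- The comultiplication respects the cross relation of `ξᵢ`. Of the terms in the coproduct, those
with `K ⊗ 1` on the right cancel. -/
theorem doubleComul_xi_mul_ofDual (i : Fin n) (ψ : Module.Dual ℂ (Nichols n)) :
    doubleComul ℂ (Nichols n) (xi i * ofDual ℂ _ ψ) =
      doubleComul ℂ (Nichols n) (xi i) * doubleComul ℂ (Nichols n) (ofDual ℂ _ ψ) := by
  rw [doubleComul_xi, doubleComul_ofDual, xi_mul_map_ofDual, xi_mul_ofDual, map_add, map_add]
  conv_lhs => rw [K, xi]
  rw [doubleComul_mul_ofHopf, doubleComul_mul_ofHopf, ← K, ← xi, doubleComul_K, doubleComul_xi,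
    doubleComul_ofDual, doubleComul_ofDual, doubleComul_ofDual]
  have hKK : ∀ (φ : Module.Dual ℂ (Nichols n)) x, sandwich ℂ _ Nichols.K Nichols.K φ x =
      φ ((LinearMap.mulLeft ℂ Nichols.K ∘ₗ LinearMap.mulRight ℂ Nichols.K) x) := by simp
  have hKx : ∀ (φ : Module.Dual ℂ (Nichols n)) x, sandwich ℂ _ Nichols.K (Nichols.xi i) φ x =
      φ ((LinearMap.mulLeft ℂ (Nichols.K * Nichols.xi i) ∘ₗ
        LinearMap.mulRight ℂ Nichols.K) x) := by simp [mul_assoc]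
  have hK1 : ∀ (φ : Module.Dual ℂ (Nichols n)) x, sandwich ℂ _ Nichols.K 1 φ x =
      φ (LinearMap.mulRight ℂ Nichols.K x) := by simp
  have hx1 : ∀ (φ : Module.Dual ℂ (Nichols n)) x, sandwich ℂ _ (Nichols.xi i) 1 φ x =
      φ (LinearMap.mulRight ℂ (Nichols.xi i) x) := by simp
  have hid : ∀ (φ : Module.Dual ℂ (Nichols n)) x, LinearMap.id (R := ℂ) φ x =
      φ (LinearMap.id (R := ℂ) x) := by simp
  have e1 : dualCoopComul ℂ _ (sandwich ℂ _ Nichols.K (Nichols.xi i) ψ) =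
      map (sandwich ℂ _ Nichols.K Nichols.K) (sandwich ℂ _ Nichols.K (Nichols.xi i))
        (dualCoopComul ℂ _ ψ) := by
    apply dual_tensor_ext
    intro x y
    rw [dualDistrib_comm_map _ _ _ _ hKK hKx, dualDistrib_dualCoopComul, dualDistrib_dualCoopComul]
    simp only [LinearMap.comp_apply, LinearMap.mulLeft_apply, LinearMap.mulRight_apply,
      LinearMap.mul'_apply, sandwich_apply, Nichols.antipodeInv_xi]
    simp only [mul_assoc, ← mul_assoc Nichols.K Nichols.K, Nichols.K_mul_K, one_mul]
  have e2 : dualCoopComul ℂ _ (sandwich ℂ _ Nichols.K 1 ψ) =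
      map (sandwich ℂ _ Nichols.K Nichols.K) (sandwich ℂ _ Nichols.K 1)
        (dualCoopComul ℂ _ ψ) := by
    apply dual_tensor_ext
    intro x y
    rw [dualDistrib_comm_map _ _ _ _ hKK hK1, dualDistrib_dualCoopComul, dualDistrib_dualCoopComul]
    simp only [LinearMap.comp_apply, LinearMap.mulLeft_apply, LinearMap.mulRight_apply,
      LinearMap.mul'_apply, sandwich_apply, antipodeInv_one]
    simp only [mul_assoc, ← mul_assoc Nichols.K Nichols.K, Nichols.K_mul_K, one_mul]
  have e3 : dualCoopComul ℂ _ (sandwich ℂ _ Nichols.K 1 ψ) =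
      map (sandwich ℂ _ Nichols.K 1) .id (dualCoopComul ℂ _ ψ) := by
    apply dual_tensor_ext
    intro x y
    rw [dualDistrib_comm_map _ _ _ _ hK1 hid, dualDistrib_dualCoopComul, dualDistrib_dualCoopComul]
    simp [mul_assoc]
  -- the two terms with `K ⊗ 1` on the right cancel, as `K` and `ξᵢ` anticommute
  have e4 : map (sandwich ℂ _ Nichols.K (Nichols.xi i)) .id (dualCoopComul ℂ _ ψ) =
      -map (sandwich ℂ _ Nichols.K Nichols.K) (sandwich ℂ _ (Nichols.xi i) 1)
        (dualCoopComul ℂ _ ψ) := by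
    apply dual_tensor_ext
    intro x y
    rw [map_neg, map_neg, LinearMap.neg_apply, dualDistrib_comm_map _ _ _ _ hKx hid,
      dualDistrib_comm_map _ _ _ _ hKK hx1, dualDistrib_dualCoopComul, dualDistrib_dualCoopComul,
      ← map_neg]
    simp only [LinearMap.comp_apply, LinearMap.mulLeft_apply, LinearMap.mulRight_apply,
      LinearMap.mul'_apply, LinearMap.id_apply]
    rw [Nichols.K_mul_xi]
    noncomm_ring
  have e5 : dualCoopComul ℂ _ (sandwich ℂ _ (Nichols.xi i) 1 ψ) =
      map (sandwich ℂ _ (Nichols.xi i) 1) .id (dualCoopComul ℂ _ ψ) := by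
    apply dual_tensor_ext
    intro x y
    rw [dualDistrib_comm_map _ _ _ _ hx1 hid, dualDistrib_dualCoopComul, dualDistrib_dualCoopComul]
    simp [mul_assoc]
  rw [e4, map_neg, add_neg_cancel, zero_mul, add_zero, ← e1, ← e2, ← e3, ← e5, mul_add]
  abel

theorem doubleCounit_K_mul_ofDual (ψ : Module.Dual ℂ (Nichols n)) :
    doubleCounit ℂ (Nichols n) (K * ofDual ℂ _ ψ) =
      doubleCounit ℂ (Nichols n) K * doubleCounit ℂ (Nichols n) (ofDual ℂ _ ψ) := by
  rw [K_mul_ofDual, K, doubleCounit_mul_ofHopf, doubleCounit_ofDual, doubleCounit_ofDual,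
    doubleCounit_ofHopf]
  simp

theorem doubleCounit_xi_mul_ofDual (i : Fin n) (ψ : Module.Dual ℂ (Nichols n)) :
    doubleCounit ℂ (Nichols n) (xi i * ofDual ℂ _ ψ) =
      doubleCounit ℂ (Nichols n) (xi i) * doubleCounit ℂ (Nichols n) (ofDual ℂ _ ψ) := by
  rw [xi_mul_ofDual, K, xi, map_add, map_add, doubleCounit_mul_ofHopf, doubleCounit_mul_ofHopf,
    doubleCounit_ofDual, doubleCounit_ofDual, doubleCounit_ofDual, doubleCounit_ofHopf,
    doubleCounit_ofHopf]
  simp [Nichols.K_mul_xi, mul_assoc]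

/-- As the double is generated by `K`, `χ`, `ξᵢ`, `φᵢ`, it is enough to multiply by these on the
left. -/
theorem doubleComul_mul (a b : DoubledNichols n) : doubleComul ℂ (Nichols n) (a * b) =
    doubleComul ℂ (Nichols n) a * doubleComul ℂ (Nichols n) b := by
  have hH : ∀ g : Nichols n, (∀ ψ, doubleComul ℂ (Nichols n) (ofHopf ℂ _ g * ofDual ℂ _ ψ) =
      doubleComul ℂ _ (ofHopf ℂ _ g) * doubleComul ℂ (Nichols n) (ofDual ℂ _ ψ)) →
      ∀ b, doubleComul ℂ (Nichols n) (ofHopf ℂ _ g * b) =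
        doubleComul ℂ _ (ofHopf ℂ _ g) * doubleComul ℂ (Nichols n) b := by
    intro g hg b
    induction b using DrinfeldDouble.induction_on with
    | hm ψ h => rw [← mul_assoc, doubleComul_mul_ofHopf, hg, mul_assoc, ← doubleComul_mul_ofHopf]
    | hadd a b ha hb => rw [mul_add, map_add, map_add, mul_add, ha, hb]
  induction a using induction generalizing b with
  | hc c =>
    rw [← Algebra.smul_def, map_smul, Algebra.algebraMap_eq_smul_one, map_smul, ← ofHopf_one,
      doubleComul_ofHopf]
    simp [Algebra.TensorProduct.one_def, ofHopf_one]
    rw [← Algebra.TensorProduct.one_def, smul_one_mul]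
  | hK => exact hH _ doubleComul_K_mul_ofDual b
  | hchi => exact doubleComul_ofDual_mul _ b
  | hxi i => exact hH _ (doubleComul_xi_mul_ofDual i) b
  | hphi i => exact doubleComul_ofDual_mul _ b
  | hadd x y hx hy => rw [add_mul, map_add, map_add, add_mul, hx, hy]
  | hmul x y hx hy => rw [mul_assoc, hx, hy, hx, mul_assoc]

theorem doubleCounit_mul (a b : DoubledNichols n) : doubleCounit ℂ (Nichols n) (a * b) =
    doubleCounit ℂ (Nichols n) a * doubleCounit ℂ (Nichols n) b := by
  have hH : ∀ g : Nichols n, (∀ ψ, doubleCounit ℂ (Nichols n) (ofHopf ℂ _ g * ofDual ℂ _ ψ) =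
      doubleCounit ℂ _ (ofHopf ℂ _ g) * doubleCounit ℂ (Nichols n) (ofDual ℂ _ ψ)) →
      ∀ b, doubleCounit ℂ (Nichols n) (ofHopf ℂ _ g * b) =
        doubleCounit ℂ _ (ofHopf ℂ _ g) * doubleCounit ℂ (Nichols n) b := by
    intro g hg b
    induction b using DrinfeldDouble.induction_on with
    | hm ψ h => rw [← mul_assoc, doubleCounit_mul_ofHopf, hg, mul_assoc, ← doubleCounit_mul_ofHopf]
    | hadd a b ha hb => rw [mul_add, map_add, map_add, mul_add, ha, hb]
  induction a using induction generalizing b with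
  | hc c =>
    rw [← Algebra.smul_def, map_smul, Algebra.algebraMap_eq_smul_one, map_smul, ← ofHopf_one,
      doubleCounit_ofHopf]
    simp
  | hK => exact hH _ doubleCounit_K_mul_ofDual b
  | hchi => exact doubleCounit_ofDual_mul _ b
  | hxi i => exact hH _ (doubleCounit_xi_mul_ofDual i) b
  | hphi i => exact doubleCounit_ofDual_mul _ b
  | hadd x y hx hy => rw [add_mul, map_add, map_add, add_mul, hx, hy]
  | hmul x y hx hy => rw [mul_assoc, hx, hy, hx, mul_assoc]

end DoubledNichols

end NicholsDouble
end

noncomputable section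
set_option linter.unusedSectionVars false

namespace NicholsDouble

open Coalgebra (comul counit)

/-! ### The Hopf algebra structure of the doubled Nichols algebra -/

namespace DoubledNichols
open TensorProduct DrinfeldDouble HopfAlgebra
variable {n : ℕ}

theorem doubleComul_chi : doubleComul ℂ (Nichols n) chi = chi ⊗ₜ chi := by
  rw [chi, doubleComul_ofDual, ← map_tmul]
  congr 1
  apply dual_tensor_ext
  intro x y
  rw [dualDistrib_dualCoopComul]
  simp

theorem doubleComul_phi (i : Fin n) :
    doubleComul ℂ (Nichols n) (phi i) = phi i ⊗ₜ 1 + chi ⊗ₜ phi i := by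
  rw [chi, phi, ← ofDual_counit, doubleComul_ofDual, ← map_tmul, ← map_tmul, ← map_add]
  congr 1
  apply dual_tensor_ext
  intro x y
  rw [dualDistrib_dualCoopComul]
  simp [Nichols.phi_mul]

theorem doubleCounit_K : doubleCounit ℂ (Nichols n) K = 1 := by
  rw [K, doubleCounit_ofHopf, Nichols.counit_K]

theorem doubleCounit_xi (i : Fin n) : doubleCounit ℂ (Nichols n) (xi i) = 0 := by
  rw [xi, doubleCounit_ofHopf, Nichols.counit_xi]

theorem doubleCounit_chi : doubleCounit ℂ (Nichols n) chi = 1 := by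
  rw [chi, doubleCounit_ofDual]; simp

theorem doubleCounit_phi (i : Fin n) : doubleCounit ℂ (Nichols n) (phi i) = 0 := by
  rw [phi, doubleCounit_ofDual]; simp

theorem doubleComul_one : doubleComul ℂ (Nichols n) 1 = 1 := by
  rw [← ofHopf_one, doubleComul_ofHopf]
  simp [Algebra.TensorProduct.one_def, ofHopf_one]

theorem doubleCounit_one : doubleCounit ℂ (Nichols n) 1 = 1 := by
  rw [← ofHopf_one, doubleCounit_ofHopf]
  simp

/-- The comultiplication of the double as an algebra map. -/
def comulHom : DoubledNichols n →ₐ[ℂ] DoubledNichols n ⊗[ℂ] DoubledNichols n :=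
  AlgHom.ofLinearMap (doubleComul ℂ _) doubleComul_one doubleComul_mul

/-- The counit of the double as an algebra map. -/
def counitHom : DoubledNichols n →ₐ[ℂ] ℂ :=
  AlgHom.ofLinearMap (doubleCounit ℂ _) doubleCounit_one doubleCounit_mul

theorem algHom_ext {A : Type*} [Ring A] [Algebra ℂ A] {f g : DoubledNichols n →ₐ[ℂ] A}
    (hK : f K = g K) (hchi : f chi = g chi) (hxi : ∀ i, f (xi i) = g (xi i))
    (hphi : ∀ i, f (phi i) = g (phi i)) : f = g := by
  ext a
  induction a using induction with
  | hc c => simp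
  | hK => exact hK
  | hchi => exact hchi
  | hxi i => exact hxi i
  | hphi i => exact hphi i
  | hadd a b ha hb => rw [map_add, map_add, ha, hb]
  | hmul a b ha hb => rw [map_mul, map_mul, ha, hb]

@[simp] theorem comulHom_apply (a : DoubledNichols n) : comulHom a = doubleComul ℂ _ a := rfl
@[simp] theorem counitHom_apply (a : DoubledNichols n) : counitHom a = doubleCounit ℂ _ a := rfl

/-- The double is a bialgebra; the coalgebra axioms are identities of algebra maps, checked on the
generators. -/
instance : Bialgebra ℂ (DoubledNichols n) :=
  Bialgebra.ofAlgHom comulHom counitHom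
    (by
      apply algHom_ext
      · simp [doubleComul_K]
      · simp [doubleComul_chi]
      · intro i
        simp [doubleComul_K, doubleComul_xi, tmul_add, add_tmul, Algebra.TensorProduct.one_def,
          doubleComul_one, add_assoc]
      · intro i
        simp [doubleComul_chi, doubleComul_phi, tmul_add, add_tmul, Algebra.TensorProduct.one_def,
          doubleComul_one, add_assoc])
    (by
      apply algHom_ext
      · simp [doubleComul_K, doubleCounit_K]
      · simp [doubleComul_chi, doubleCounit_chi]
      · intro i; simp [doubleComul_xi, doubleCounit_K, doubleCounit_xi]
      · intro i; simp [doubleComul_phi, doubleCounit_chi, doubleCounit_phi])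
    (by
      apply algHom_ext
      · simp [doubleComul_K, doubleCounit_K]
      · simp [doubleComul_chi, doubleCounit_chi]
      · intro i; simp [doubleComul_xi, doubleCounit_one, doubleCounit_xi]
      · intro i; simp [doubleComul_phi, doubleCounit_one, doubleCounit_phi])

theorem comul_eq : (comul : DoubledNichols n →ₗ[ℂ] _) = doubleComul ℂ (Nichols n) := rfl
theorem counit_eq : (counit : DoubledNichols n →ₗ[ℂ] ℂ) = doubleCounit ℂ (Nichols n) := rfl

/-- The antipode `φ ⊗ h ↦ S(h) (φ ∘ S⁻¹)` of the double. -/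
def antipodeLin : DoubledNichols n →ₗ[ℂ] DoubledNichols n :=
  TensorProduct.lift ((LinearMap.mul ℂ (DoubledNichols n)).flip.compl₁₂
    (ofDual ℂ _ ∘ₗ (antipodeInv ℂ (Nichols n)).dualMap) (ofHopf ℂ _ ∘ₗ antipode ℂ)) ∘ₗ
    (equiv ℂ (Nichols n)).symm.toLinearMap

theorem antipodeLin_mk (φ : Module.Dual ℂ (Nichols n)) (h : Nichols n) :
    antipodeLin (ofDual ℂ _ φ * ofHopf ℂ _ h) =
      ofHopf ℂ _ (antipode ℂ h) * ofDual ℂ _ (φ ∘ₗ antipodeInv ℂ _) := by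
  rw [ofDual_mul_ofHopf]
  simp [antipodeLin, LinearMap.dualMap_apply']

/-- The inverse of the antipode is an antipode for the opposite comultiplication. -/
theorem mul'_antipodeInv_left (x : Nichols n) :
    LinearMap.mul' ℂ _ (map .id (antipodeInv ℂ _) (TensorProduct.comm ℂ _ _ (comul x))) =
      algebraMap ℂ _ (counit (R := ℂ) x) := by
  apply (BijectiveAntipode.bijective (k := ℂ) (H := Nichols n)).1
  rw [Algebra.algebraMap_eq_smul_one, map_smul, antipode_one, ← Algebra.algebraMap_eq_smul_one,
    ← mul_antipode_lTensor_comul_apply]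
  generalize comul (R := ℂ) x = t
  induction t with
  | zero => simp
  | add x y hx hy => simp only [map_add, hx, hy]
  | tmul a b => simp [antipode_mul_antidistrib]

theorem mul'_antipodeInv_right (x : Nichols n) :
    LinearMap.mul' ℂ _ (map (antipodeInv ℂ _) .id (TensorProduct.comm ℂ _ _ (comul x))) =
      algebraMap ℂ _ (counit (R := ℂ) x) := by
  apply (BijectiveAntipode.bijective (k := ℂ) (H := Nichols n)).1
  rw [Algebra.algebraMap_eq_smul_one, map_smul, antipode_one, ← Algebra.algebraMap_eq_smul_one,
    ← mul_antipode_rTensor_comul_apply]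
  generalize comul (R := ℂ) x = t
  induction t with
  | zero => simp
  | add x y hx hy => simp only [map_add, hx, hy]
  | tmul a b => simp [antipode_mul_antidistrib]

/-- `φ₁ ⊗ φ₂ ↦ (φ₁ ∘ S⁻¹) φ₂` sends the coproduct of `φ` in `H^{*cop}` to `φ(1) ε`. -/
theorem antipodeInv_dual_left (φ : Module.Dual ℂ (Nichols n)) :
    TensorProduct.lift ((dualMul ℂ (Nichols n)).compl₁₂ (antipodeInv ℂ _).dualMap .id)
      (dualCoopComul ℂ _ φ) = φ 1 • counit := by
  ext x
  have h : ∀ (t : Module.Dual ℂ (Nichols n) ⊗[ℂ] Module.Dual ℂ (Nichols n)) (s),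
      dualDistrib ℂ _ _ (map ((antipodeInv ℂ (Nichols n)).dualMap) .id t) s =
      dualDistrib ℂ _ _ (TensorProduct.comm ℂ _ _ t)
        (map .id (antipodeInv ℂ _) (TensorProduct.comm ℂ _ _ s)) := by
    intro t s
    induction t with
    | zero => simp
    | add x y hx hy => simp only [map_add, LinearMap.add_apply, hx, hy]
    | tmul f g =>
      induction s with
      | zero => simp
      | add x y hx hy => simp only [map_add, hx, hy]
      | tmul a b => simp [mul_comm]
  have h2 : ∀ t : Module.Dual ℂ (Nichols n) ⊗[ℂ] Module.Dual ℂ (Nichols n),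
      TensorProduct.lift ((dualMul ℂ (Nichols n)).compl₁₂ (antipodeInv ℂ _).dualMap .id) t x =
      dualDistrib ℂ _ _ (map ((antipodeInv ℂ (Nichols n)).dualMap) .id t) (comul x) := by
    intro t
    induction t with
    | zero => simp
    | add x y hx hy => simp only [map_add, LinearMap.add_apply, hx, hy]
    | tmul f g => simp
  rw [h2, h, dualDistrib_dualCoopComul, mul'_antipodeInv_left, Algebra.algebraMap_eq_smul_one]
  simp [mul_comm]

theorem antipodeInv_dual_right (φ : Module.Dual ℂ (Nichols n)) :
    TensorProduct.lift ((dualMul ℂ (Nichols n)).compl₁₂ .id (antipodeInv ℂ _).dualMap)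
      (dualCoopComul ℂ _ φ) = φ 1 • counit := by
  ext x
  have h : ∀ (t : Module.Dual ℂ (Nichols n) ⊗[ℂ] Module.Dual ℂ (Nichols n)) (s),
      dualDistrib ℂ _ _ (map .id ((antipodeInv ℂ (Nichols n)).dualMap) t) s =
      dualDistrib ℂ _ _ (TensorProduct.comm ℂ _ _ t)
        (map (antipodeInv ℂ _) .id (TensorProduct.comm ℂ _ _ s)) := by
    intro t s
    induction t with
    | zero => simp
    | add x y hx hy => simp only [map_add, LinearMap.add_apply, hx, hy]
    | tmul f g =>
      induction s with
      | zero => simp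
      | add x y hx hy => simp only [map_add, hx, hy]
      | tmul a b => simp [mul_comm]
  have h2 : ∀ t : Module.Dual ℂ (Nichols n) ⊗[ℂ] Module.Dual ℂ (Nichols n),
      TensorProduct.lift ((dualMul ℂ (Nichols n)).compl₁₂ .id (antipodeInv ℂ _).dualMap) t x =
      dualDistrib ℂ _ _ (map .id ((antipodeInv ℂ (Nichols n)).dualMap) t) (comul x) := by
    intro t
    induction t with
    | zero => simp
    | add x y hx hy => simp only [map_add, LinearMap.add_apply, hx, hy]
    | tmul f g => simp
  rw [h2, h, dualDistrib_dualCoopComul, mul'_antipodeInv_right, Algebra.algebraMap_eq_smul_one]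
  simp [mul_comm]

theorem antipodeLin_rTensor (s : Module.Dual ℂ (Nichols n) ⊗[ℂ] Module.Dual ℂ (Nichols n))
    (t : Nichols n ⊗[ℂ] Nichols n) :
    LinearMap.mul' ℂ _ (antipodeLin.rTensor _
      (map (ofDual ℂ _) (ofDual ℂ _) s * map (ofHopf ℂ _) (ofHopf ℂ _) t)) =
    TensorProduct.lift ((LinearMap.mul ℂ (DoubledNichols n)).compl₁₂
      (LinearMap.mulRight ℂ (ofDual ℂ _ (TensorProduct.lift ((dualMul ℂ (Nichols n)).compl₁₂
        (antipodeInv ℂ _).dualMap .id) s)) ∘ₗ ofHopf ℂ _ ∘ₗ antipode ℂ) (ofHopf ℂ _)) t := by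
  induction t with
  | zero => simp
  | add x y hx hy => simp only [map_add, mul_add, hx, hy]
  | tmul a b =>
    induction s with
    | zero => simp
    | add x y hx hy => simp only [map_add, add_mul, hx, hy]; simp [mul_add]
    | tmul f g =>
      simp [antipodeLin_mk, LinearMap.dualMap_apply', ← ofDual_mul_ofDual, mul_assoc]

theorem antipodeLin_lTensor (s : Module.Dual ℂ (Nichols n) ⊗[ℂ] Module.Dual ℂ (Nichols n))
    (t : Nichols n ⊗[ℂ] Nichols n) :
    LinearMap.mul' ℂ _ (antipodeLin.lTensor _
      (map (ofDual ℂ _) (ofDual ℂ _) s * map (ofHopf ℂ _) (ofHopf ℂ _) t)) =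
    TensorProduct.lift ((LinearMap.mul ℂ (DoubledNichols n)).compl₁₂ (ofDual ℂ _)
      (LinearMap.mulLeft ℂ (ofHopf ℂ _ (LinearMap.mul' ℂ _ ((antipode ℂ).lTensor _ t))) ∘ₗ
        ofDual ℂ _ ∘ₗ (antipodeInv ℂ _).dualMap)) s := by
  induction s with
  | zero => simp
  | add x y hx hy => simp only [map_add, add_mul, hx, hy]
  | tmul f g =>
    induction t with
    | zero => simp
    | add x y hx hy => simp only [map_add, mul_add, hx, hy]; simp [add_mul, mul_add]
    | tmul a b =>
      simp [antipodeLin_mk, LinearMap.dualMap_apply', ← ofHopf_mul_ofHopf, mul_assoc]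

/-- The double is a Hopf algebra. -/
instance : HopfAlgebra ℂ (DoubledNichols n) where
  antipode := antipodeLin
  mul_antipode_rTensor_comul := by
    ext a
    simp only [LinearMap.comp_apply, comul_eq, counit_eq, Algebra.linearMap_apply]
    induction a using DrinfeldDouble.induction_on with
    | hm φ h =>
      rw [doubleComul_mk, antipodeLin_rTensor, antipodeInv_dual_left, doubleCounit_mk, map_mul,
        Algebra.algebraMap_eq_smul_one (φ 1), smul_one_mul, Algebra.algebraMap_eq_smul_one,
        ← ofHopf_one, ← map_smul (ofHopf ℂ (Nichols n)), ← Algebra.algebraMap_eq_smul_one,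
        ← mul_antipode_rTensor_comul_apply]
      generalize comul (R := ℂ) h = t
      induction t with
      | zero => simp
      | add x y hx hy => simp only [map_add, hx, hy, smul_add]
      | tmul a b => simp [← ofHopf_mul_ofHopf, ofDual_counit]
    | hadd a b ha hb => simp only [map_add, ha, hb]
  mul_antipode_lTensor_comul := by
    ext a
    simp only [LinearMap.comp_apply, comul_eq, counit_eq, Algebra.linearMap_apply]
    induction a using DrinfeldDouble.induction_on with
    | hm φ h =>
      rw [doubleComul_mk, antipodeLin_lTensor, mul_antipode_lTensor_comul_apply, doubleCounit_mk,
        mul_comm (φ 1), map_mul, Algebra.algebraMap_eq_smul_one (φ 1), ← ofDual_counit,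
        ← map_smul (ofDual ℂ (Nichols n)), ← antipodeInv_dual_right]
      generalize dualCoopComul ℂ _ φ = t
      induction t with
      | zero => simp
      | add x y hx hy => simp only [map_add, hx, hy, mul_add]
      | tmul a b =>
        simp [← ofDual_mul_ofDual, ofHopf_one, Algebra.algebraMap_eq_smul_one]
    | hadd a b ha hb => simp only [map_add, ha, hb]

theorem antipode_ofHopf (h : Nichols n) :
    antipode ℂ (ofHopf ℂ (Nichols n) h) = ofHopf ℂ _ (antipode ℂ h) := by
  have h1 := antipodeLin_mk counit h
  have h2 : (counit : Module.Dual ℂ (Nichols n)) ∘ₗ antipodeInv ℂ _ = counit := by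
    ext x; simp
  rwa [ofDual_counit, one_mul, h2, ofDual_counit, mul_one] at h1

theorem antipode_ofDual (φ : Module.Dual ℂ (Nichols n)) :
    antipode ℂ (ofDual ℂ (Nichols n) φ) = ofDual ℂ _ (φ ∘ₗ antipodeInv ℂ _) := by
  have h1 := antipodeLin_mk φ 1
  rwa [ofHopf_one, mul_one, antipode_one, ofHopf_one, one_mul] at h1

end DoubledNichols

end NicholsDouble
end

noncomputable section
set_option linter.unusedSectionVars false

namespace NicholsDouble

open Coalgebra (comul counit)

/-! ### The universal R-matrix -/

section
open TensorProduct

/-- `∑ xᵢ ⊗ yᵢ` is a universal R-matrix: it is invertible, it intertwines the comultiplication with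
its opposite, and it satisfies the two hexagon identities. -/
structure IsUniversalR {A : Type*} [Ring A] [Bialgebra ℂ A] {ι : Type*} [Fintype ι]
    (x y : ι → A) : Prop where
  isUnit : IsUnit (∑ i, x i ⊗ₜ[ℂ] y i)
  intertwine (a : A) : (∑ i, x i ⊗ₜ[ℂ] y i) * comul a =
    TensorProduct.comm ℂ A A (comul a) * ∑ i, x i ⊗ₜ[ℂ] y i
  comul_left : ∑ i, comul (R := ℂ) (x i) ⊗ₜ[ℂ] y i =
    ∑ i, ∑ j, (x i ⊗ₜ[ℂ] x j) ⊗ₜ[ℂ] (y i * y j)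
  comul_right : ∑ i, x i ⊗ₜ[ℂ] comul (R := ℂ) (y i) =
    ∑ i, ∑ j, (x i * x j) ⊗ₜ[ℂ] (y j ⊗ₜ[ℂ] y i)

end

namespace Nichols
open TensorProduct
variable {n : ℕ}

/-- A basis of the Nichols algebra. -/
abbrev basis (n : ℕ) := Module.Basis.ofVectorSpace ℂ (Nichols n)

/-- The index set of `basis n`. -/
abbrev BasisIndex (n : ℕ) := Module.Basis.ofVectorSpaceIndex ℂ (Nichols n)

variable {V W : Type*} [AddCommGroup V] [Module ℂ V] [AddCommGroup W] [Module ℂ W]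

/-- The canonical element `∑ bᵢ ⊗ bᵢ^*` turns an endomorphism into its transpose. -/
theorem sum_transpose (f : Nichols n →ₗ[ℂ] V) (g : Module.Dual ℂ (Nichols n) →ₗ[ℂ] W)
    (T : Nichols n →ₗ[ℂ] Nichols n) :
    ∑ i, f (T (basis n i)) ⊗ₜ[ℂ] g ((basis n).coord i) =
      ∑ i, f (basis n i) ⊗ₜ[ℂ] g ((basis n).coord i ∘ₗ T) := by
  have h1 : ∀ i, T (basis n i) = ∑ j, (basis n).coord j (T (basis n i)) • basis n j :=
    fun i => ((basis n).sum_repr _).symm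
  have h2 : ∀ j, (basis n).coord j ∘ₗ T =
      ∑ i, (basis n).coord j (T (basis n i)) • (basis n).coord i :=
    fun j => ((basis n).sum_dual_apply_smul_coord _).symm
  simp_rw [h2]
  conv_lhs => enter [2, i]; rw [h1]
  simp only [map_sum, map_smul, sum_tmul, tmul_sum, smul_tmul, tmul_smul]
  exact Finset.sum_comm

/-- The canonical element turns the comultiplication into the multiplication of the dual. -/
theorem sum_comul (f : Nichols n ⊗[ℂ] Nichols n →ₗ[ℂ] V)
    (g : Module.Dual ℂ (Nichols n) →ₗ[ℂ] W) :
    ∑ k, f (comul (basis n k)) ⊗ₜ[ℂ] g ((basis n).coord k) =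
      ∑ i, ∑ j, f (basis n i ⊗ₜ basis n j) ⊗ₜ[ℂ]
        g (dualMul ℂ _ ((basis n).coord i) ((basis n).coord j)) := by
  have h1 : ∀ t : Nichols n ⊗[ℂ] Nichols n, t = ∑ i, ∑ j,
      dualDistrib ℂ _ _ ((basis n).coord i ⊗ₜ (basis n).coord j) t • basis n i ⊗ₜ basis n j := by
    intro t
    induction t with
    | zero => simp
    | add x y hx hy =>
      conv_lhs => rw [hx, hy]
      simp only [map_add, add_smul, Finset.sum_add_distrib]
    | tmul x y =>
      conv_lhs => rw [← (basis n).sum_repr x, ← (basis n).sum_repr y]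
      simp only [sum_tmul, tmul_sum, smul_tmul_smul, dualDistrib_apply]
      rw [Finset.sum_comm]
      rfl
  have h2 : ∀ i j, dualMul ℂ _ ((basis n).coord i) ((basis n).coord j) =
      ∑ k, dualDistrib ℂ _ _ ((basis n).coord i ⊗ₜ (basis n).coord j) (comul (basis n k)) •
        (basis n).coord k :=
    fun i j => ((basis n).sum_dual_apply_smul_coord _).symm
  simp_rw [h2]
  conv_lhs => enter [2, i]; rw [h1 (comul (basis n i))]
  simp only [map_sum, map_smul, sum_tmul, tmul_sum, smul_tmul, tmul_smul]
  rw [Finset.sum_comm]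
  exact Finset.sum_congr rfl fun i _ => Finset.sum_comm

/-- The canonical element turns the comultiplication of `H^{*cop}` into the multiplication of `H`.
-/
theorem sum_dualCoopComul (f : Nichols n →ₗ[ℂ] V)
    (g : Module.Dual ℂ (Nichols n) ⊗[ℂ] Module.Dual ℂ (Nichols n) →ₗ[ℂ] W) :
    ∑ k, f (basis n k) ⊗ₜ[ℂ] g (DrinfeldDouble.dualCoopComul ℂ _ ((basis n).coord k)) =
      ∑ i, ∑ j, f (basis n i * basis n j) ⊗ₜ[ℂ]
        g ((basis n).coord j ⊗ₜ (basis n).coord i) := by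
  have h1 : ∀ φ : Module.Dual ℂ (Nichols n), DrinfeldDouble.dualCoopComul ℂ _ φ = ∑ i, ∑ j,
      φ (basis n i * basis n j) • (basis n).coord j ⊗ₜ (basis n).coord i := by
    intro φ
    apply DrinfeldDouble.dual_tensor_ext
    intro x y
    rw [DrinfeldDouble.dualDistrib_dualCoopComul, LinearMap.mul'_apply]
    conv_lhs => rw [← (basis n).sum_repr x, ← (basis n).sum_repr y]
    simp only [Finset.sum_mul, Finset.mul_sum, map_sum, map_smul, comm_tmul, LinearMap.sum_apply,
      LinearMap.smul_apply, dualDistrib_apply, smul_mul_smul_comm, smul_eq_mul]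
    rw [Finset.sum_comm]
    refine Finset.sum_congr rfl fun i _ => Finset.sum_congr rfl fun j _ => ?_
    simp only [Module.Basis.coord_apply]
    ring
  have h2 : ∀ i j, basis n i * basis n j =
      ∑ k, (basis n).coord k (basis n i * basis n j) • basis n k :=
    fun i j => ((basis n).sum_repr _).symm
  simp_rw [h1]
  conv_rhs => enter [2, i, 2, j]; rw [h2]
  simp only [map_sum, map_smul, sum_tmul, tmul_sum, smul_tmul, tmul_smul]
  rw [Finset.sum_comm]
  exact Finset.sum_congr rfl fun i _ => Finset.sum_comm

theorem sum_counit (g : Module.Dual ℂ (Nichols n) →ₗ[ℂ] W) :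
    ∑ k, counit (R := ℂ) (basis n k) • g ((basis n).coord k) = g counit := by
  conv_rhs => rw [← (basis n).sum_dual_apply_smul_coord counit]
  rw [map_sum]
  simp

/-- The left regular action of `χ` on the dual, in transposed form, is an algebra map. -/
theorem convLeft_chi_mul (a b : Nichols n) :
    convLeft chi.toLinearMap .id (a * b) =
      convLeft chi.toLinearMap .id a * convLeft chi.toLinearMap .id b := by
  have h0 : convLeft (n := n) 0 .id = 0 := by ext; simp [convLeft]
  have := convLeft_mul (AlgHom.id ℂ (Nichols n)) chi_mul' a b
  rw [AlgHom.toLinearMap_id] at this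
  rw [this, h0]
  simp

theorem convRight_chi_mul (a b : Nichols n) :
    convRight .id chi.toLinearMap (a * b) =
      convRight .id chi.toLinearMap a * convRight .id chi.toLinearMap b := by
  have h0 : convRight (n := n) .id 0 = 0 := by ext; simp [convRight]
  have := convRight_mul (AlgHom.id ℂ (Nichols n)) chi_mul' a b
  rw [AlgHom.toLinearMap_id] at this
  rw [this, h0]
  simp

theorem dualMul_eq_comp_convLeft (φ ψ : Module.Dual ℂ (Nichols n)) :
    dualMul ℂ _ φ ψ = ψ ∘ₗ convLeft φ .id := by
  ext x
  simp only [dualMul_apply, LinearMap.comp_apply, convLeft]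
  generalize comul (R := ℂ) x = t
  induction t with
  | zero => simp
  | add x y hx hy => simp only [map_add, hx, hy]
  | tmul a b => simp

theorem dualMul_eq_comp_convRight (φ ψ : Module.Dual ℂ (Nichols n)) :
    dualMul ℂ _ φ ψ = φ ∘ₗ convRight .id ψ := by
  ext x
  simp only [dualMul_apply, LinearMap.comp_apply, convRight]
  generalize comul (R := ℂ) x = t
  induction t with
  | zero => simp
  | add x y hx hy => simp only [map_add, hx, hy]
  | tmul a b => simp [mul_comm]

end Nichols

namespace DoubledNichols
open TensorProduct DrinfeldDouble HopfAlgebra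
variable {n : ℕ}

/-- The first tensor factors of the canonical R-matrix. -/
def rFst (i : Nichols.BasisIndex n) : DoubledNichols n := ofHopf ℂ _ (Nichols.basis n i)

/-- The second tensor factors of the canonical R-matrix. -/
def rSnd (i : Nichols.BasisIndex n) : DoubledNichols n := ofDual ℂ _ ((Nichols.basis n).coord i)

theorem rMatrix_eq : rMatrix ℂ (Nichols n) = ∑ i, rFst i ⊗ₜ rSnd i := by
  rw [rMatrix, coevaluation_apply_one]
  simp [rFst, rSnd]

theorem ofHopf_K : ofHopf ℂ (Nichols n) Nichols.K = K := rfl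
theorem ofHopf_xi (i : Fin n) : ofHopf ℂ (Nichols n) (Nichols.xi i) = xi i := rfl

theorem ofHopf_mul_chi (x : Nichols n) :
    ofHopf ℂ _ (Nichols.convRight .id Nichols.chi.toLinearMap x) * chi =
      chi * ofHopf ℂ _ (Nichols.convLeft Nichols.chi.toLinearMap .id x) := by
  induction x using Nichols.induction with
  | hc c =>
    simp [Algebra.algebraMap_eq_smul_one, Nichols.convRight_one, Nichols.convLeft_one, ofHopf_one]
  | hK =>
    rw [Nichols.convRight_K, Nichols.convLeft_K]
    simp [ofHopf_K, K_mul_chi]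
  | hx i =>
    rw [Nichols.convRight_xi, Nichols.convLeft_xi]
    simp [ofHopf_xi, xi_mul_chi]
  | hadd a b ha hb => simp only [map_add, add_mul, mul_add, ha, hb]
  | hmul a b ha hb =>
    rw [Nichols.convRight_chi_mul, Nichols.convLeft_chi_mul, ← ofHopf_mul_ofHopf,
      ← ofHopf_mul_ofHopf, mul_assoc, hb, ← mul_assoc, ha, mul_assoc]

/-- The cross relation of `φᵢ` with an arbitrary element of `𝒦ₙ`, in the form that makes `R`
intertwine the coproduct of `φᵢ` with its opposite. -/
theorem ofHopf_mul_phi (i : Fin n) (x : Nichols n) :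
    ofHopf ℂ _ x * phi i + ofHopf ℂ _ (Nichols.convRight .id (Nichols.phi i) x) * chi =
      ofHopf ℂ _ (Nichols.convLeft (Nichols.phi i) .id x) +
        phi i * ofHopf ℂ _ (Nichols.convLeft Nichols.chi.toLinearMap .id x) := by
  have hL := Nichols.convRight_mul (AlgHom.id ℂ (Nichols n)) (Nichols.phi_mul' i)
  have hR := Nichols.convLeft_mul (AlgHom.id ℂ (Nichols n)) (Nichols.phi_mul' i)
  rw [AlgHom.toLinearMap_id] at hL hR
  rw [Nichols.convRight_counit] at hL
  rw [Nichols.convLeft_counit] at hR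
  induction x using Nichols.induction with
  | hc c =>
    simp [Algebra.algebraMap_eq_smul_one, Nichols.convRight_one, Nichols.convLeft_one, ofHopf_one]
  | hK =>
    rw [Nichols.convRight_K, Nichols.convLeft_K, Nichols.convLeft_K]
    simp [ofHopf_K, K_mul_phi]
  | hx j =>
    rw [Nichols.convRight_xi, Nichols.convLeft_xi, Nichols.convLeft_xi]
    simp only [Nichols.phi_xi, Nichols.phi_K, Nichols.phi_one, Nichols.chi_K, Nichols.chi_xi,
      AlgHom.toLinearMap_apply, zero_smul, LinearMap.id_apply, map_smul, ofHopf_xi, ofHopf_K,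
      add_zero, zero_add, ofHopf_one, map_neg, neg_smul, one_smul, xi_mul_phi, C]
    split_ifs
    · simp only [one_smul, K_mul_chi, mul_neg]
      abel
    · simp
  | hadd a b ha hb =>
    simp only [map_add, add_mul, mul_add]
    rw [add_add_add_comm, ha, hb]
    abel
  | hmul a b ha hb =>
    rw [hL, hR, Nichols.convLeft_chi_mul]
    simp only [map_add, ← ofHopf_mul_ofHopf, add_mul, mul_assoc, LinearMap.id_apply, ofHopf_mul_chi]
    have h1 := congrArg (ofHopf ℂ (Nichols n) a * ·) hb
    have h2 :=
        congrArg (· * ofHopf ℂ (Nichols n) (Nichols.convLeft Nichols.chi.toLinearMap .id b)) ha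
    simp only [mul_add, add_mul, mul_assoc] at h1 h2
    rw [← add_assoc, h1, add_assoc, h2]
    abel

/-- On a generator, every term moves to one side of the canonical element by transposition
(`sum_transpose`), and what is left is the cross relation in the double. -/
theorem rMatrix_intertwine (a : DoubledNichols n) :
    (∑ i, rFst i ⊗ₜ[ℂ] rSnd i) * doubleComul ℂ _ a =
      TensorProduct.comm ℂ _ _ (doubleComul ℂ _ a) * ∑ i, rFst i ⊗ₜ[ℂ] rSnd i := by
  have tr := fun a b c d => Nichols.sum_transpose
    (LinearMap.mulLeft ℂ (a : DoubledNichols n) ∘ₗ LinearMap.mulRight ℂ b ∘ₗ ofHopf ℂ _)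
    (LinearMap.mulLeft ℂ (c : DoubledNichols n) ∘ₗ LinearMap.mulRight ℂ d ∘ₗ ofDual ℂ _)
  simp only [LinearMap.comp_apply, LinearMap.mulLeft_apply, LinearMap.mulRight_apply] at tr
  have hKK : ∀ φ : Module.Dual ℂ (Nichols n), sandwich ℂ _ Nichols.K Nichols.K φ =
      φ ∘ₗ (LinearMap.mulLeft ℂ Nichols.K ∘ₗ LinearMap.mulRight ℂ Nichols.K) := by
    intro φ; ext; simp
  have hKx : ∀ i (φ : Module.Dual ℂ (Nichols n)), sandwich ℂ _ Nichols.K (Nichols.xi i) φ =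
      φ ∘ₗ (LinearMap.mulLeft ℂ (Nichols.K * Nichols.xi i) ∘ₗ LinearMap.mulRight ℂ Nichols.K) := by
    intro i φ; ext; simp [mul_assoc]
  have hK1 : ∀ φ : Module.Dual ℂ (Nichols n), sandwich ℂ _ Nichols.K 1 φ =
      φ ∘ₗ LinearMap.mulRight ℂ Nichols.K := by intro φ; ext; simp
  have hx1 : ∀ i (φ : Module.Dual ℂ (Nichols n)), sandwich ℂ _ (Nichols.xi i) 1 φ =
      φ ∘ₗ LinearMap.mulRight ℂ (Nichols.xi i) := by intro i φ; ext; simp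
  induction a using induction with
  | hc c =>
    rw [Algebra.algebraMap_eq_smul_one, map_smul, doubleComul_one, Algebra.TensorProduct.one_def,
      map_smul, comm_tmul, ← Algebra.TensorProduct.one_def, smul_one_mul, mul_smul_one]
  | hK =>
    rw [doubleComul_K]
    simp only [comm_tmul, Finset.sum_mul, Finset.mul_sum, Algebra.TensorProduct.tmul_mul_tmul, rSnd,
      rFst, K_mul_ofDual, hKK]
    have := tr K 1 1 K (LinearMap.mulLeft ℂ Nichols.K ∘ₗ LinearMap.mulRight ℂ Nichols.K)
    simp only [mul_one, one_mul] at this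
    rw [← this]
    simp [← ofHopf_K, ofHopf_mul_ofHopf, ← mul_assoc]
  | hchi =>
    rw [doubleComul_chi]
    have e1 : ∀ φ : Module.Dual ℂ (Nichols n), ofDual ℂ _ φ * chi =
        ofDual ℂ _ (φ ∘ₗ Nichols.convRight .id Nichols.chi.toLinearMap) := by
      intro φ; rw [chi, ofDual_mul_ofDual, Nichols.dualMul_eq_comp_convRight]
    have e2 : ∀ φ : Module.Dual ℂ (Nichols n), chi * ofDual ℂ _ φ =
        ofDual ℂ _ (φ ∘ₗ Nichols.convLeft Nichols.chi.toLinearMap .id) := by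
      intro φ; rw [chi, ofDual_mul_ofDual, Nichols.dualMul_eq_comp_convLeft]
    simp only [comm_tmul, Finset.sum_mul, Finset.mul_sum, Algebra.TensorProduct.tmul_mul_tmul, rSnd,
      rFst, e1, e2]
    have h1 := tr 1 chi 1 1 (Nichols.convRight .id Nichols.chi.toLinearMap)
    have h2 := tr chi 1 1 1 (Nichols.convLeft Nichols.chi.toLinearMap .id)
    simp only [mul_one, one_mul] at h1 h2
    rw [← h1, ← h2]
    simp only [ofHopf_mul_chi]
  | hxi j =>
    rw [doubleComul_xi]
    simp only [comm_tmul, map_add, Finset.sum_mul, Finset.mul_sum, mul_add, add_mul,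
      Algebra.TensorProduct.tmul_mul_tmul, rSnd, rFst, K_mul_ofDual, xi_mul_ofDual, hKK, hKx, hK1,
      hx1, tmul_add, Finset.sum_add_distrib, one_mul, mul_one]
    have h1 := tr (xi j) 1 1 K (LinearMap.mulLeft ℂ Nichols.K ∘ₗ LinearMap.mulRight ℂ Nichols.K)
    have h2 := tr 1 1 1 K
      (LinearMap.mulLeft ℂ (Nichols.K * Nichols.xi j) ∘ₗ LinearMap.mulRight ℂ Nichols.K)
    have h3 := tr 1 1 1 (xi j) (LinearMap.mulRight ℂ Nichols.K)
    have h4 := tr 1 1 1 1 (LinearMap.mulRight ℂ (Nichols.xi j))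
    simp only [mul_one, one_mul] at h1 h2 h3 h4
    -- two of the terms cancel, as `K` and `ξⱼ` anticommute
    have h5 : ∀ x : Nichols n, xi j * ofHopf ℂ _ (Nichols.K * (x * Nichols.K)) +
        ofHopf ℂ _ (Nichols.K * Nichols.xi j * (x * Nichols.K)) = 0 := by
      intro x
      rw [← ofHopf_xi, ofHopf_mul_ofHopf, Nichols.K_mul_xi, ← map_add]
      simp [mul_assoc]
    rw [← h1, ← h2, ← h3, ← h4, ← add_assoc, ← add_assoc,
      ← Finset.sum_add_distrib (s := Finset.univ)
      (f := fun i => (xi j * ofHopf ℂ _ _) ⊗ₜ[ℂ] _)]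
    simp only [LinearMap.comp_apply, LinearMap.mulLeft_apply, LinearMap.mulRight_apply, ← add_tmul,
      h5, zero_tmul, Finset.sum_const_zero, zero_add]
    simp only [← ofHopf_K, ← ofHopf_xi, ofHopf_mul_ofHopf]
  | hphi j =>
    rw [doubleComul_phi]
    simp only [comm_tmul, map_add, Finset.sum_mul, Finset.mul_sum, mul_add, add_mul,
      Algebra.TensorProduct.tmul_mul_tmul, rSnd, rFst, Finset.sum_add_distrib, one_mul, mul_one]
    have h1 := tr 1 chi 1 1 (Nichols.convRight .id (Nichols.phi j))
    have h2 := tr 1 1 1 1 (Nichols.convLeft (Nichols.phi j) .id)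
    have h3 := tr (phi j) 1 1 1 (Nichols.convLeft Nichols.chi.toLinearMap .id)
    simp only [mul_one, one_mul] at h1 h2 h3
    have e1 : ∀ φ : Module.Dual ℂ (Nichols n), ofDual ℂ _ φ * phi j =
        ofDual ℂ _ (φ ∘ₗ Nichols.convRight .id (Nichols.phi j)) := by
      intro φ; rw [phi, ofDual_mul_ofDual, Nichols.dualMul_eq_comp_convRight]
    have e2 : ∀ φ : Module.Dual ℂ (Nichols n), phi j * ofDual ℂ _ φ =
        ofDual ℂ _ (φ ∘ₗ Nichols.convLeft (Nichols.phi j) .id) := by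
      intro φ; rw [phi, ofDual_mul_ofDual, Nichols.dualMul_eq_comp_convLeft]
    have e3 : ∀ φ : Module.Dual ℂ (Nichols n), chi * ofDual ℂ _ φ =
        ofDual ℂ _ (φ ∘ₗ Nichols.convLeft Nichols.chi.toLinearMap .id) := by
      intro φ; rw [chi, ofDual_mul_ofDual, Nichols.dualMul_eq_comp_convLeft]
    simp only [e1, e2, e3]
    rw [← h1, ← h2, ← h3, ← Finset.sum_add_distrib, ← Finset.sum_add_distrib]
    simp only [← add_tmul, ofHopf_mul_phi]
  | hadd a b ha hb => simp only [map_add, mul_add, add_mul, ha, hb]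
  | hmul a b ha hb =>
    have h : ∀ s t : DoubledNichols n ⊗[ℂ] DoubledNichols n, TensorProduct.comm ℂ _ _ (s * t) =
        TensorProduct.comm ℂ _ _ s * TensorProduct.comm ℂ _ _ t :=
      map_mul (Algebra.TensorProduct.comm ℂ (DoubledNichols n) (DoubledNichols n))
    rw [doubleComul_mul, ← mul_assoc, ha, mul_assoc, hb, h, mul_assoc]

theorem antipode_rMatrix_mul :
    (∑ i, antipode ℂ (rFst (n := n) i) ⊗ₜ[ℂ] rSnd i) * ∑ i, rFst i ⊗ₜ[ℂ] rSnd i = 1 := by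
  have h := Nichols.sum_comul (n := n)
    (ofHopf ℂ _ ∘ₗ LinearMap.mul' ℂ _ ∘ₗ (antipode ℂ).rTensor _) (ofDual ℂ _)
  simp only [Finset.sum_mul, Finset.mul_sum, Algebra.TensorProduct.tmul_mul_tmul, rFst, rSnd,
    antipode_ofHopf, ofDual_mul_ofDual, ofHopf_mul_ofHopf]
  simp only [LinearMap.comp_apply, LinearMap.rTensor_tmul, LinearMap.mul'_apply,
    mul_antipode_rTensor_comul_apply, Algebra.algebraMap_eq_smul_one, map_smul, ofHopf_one,
    smul_tmul, ← tmul_sum, Nichols.sum_counit, ofDual_counit] at h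
  rw [Finset.sum_comm, ← h]
  rw [Algebra.TensorProduct.one_def]

theorem rMatrix_mul_antipode :
    (∑ i, rFst i ⊗ₜ[ℂ] rSnd i) * (∑ i, antipode ℂ (rFst (n := n) i) ⊗ₜ[ℂ] rSnd i) = 1 := by
  have h := Nichols.sum_comul (n := n)
    (ofHopf ℂ _ ∘ₗ LinearMap.mul' ℂ _ ∘ₗ (antipode ℂ).lTensor _) (ofDual ℂ _)
  simp only [Finset.sum_mul, Finset.mul_sum, Algebra.TensorProduct.tmul_mul_tmul, rFst, rSnd,
    antipode_ofHopf, ofDual_mul_ofDual, ofHopf_mul_ofHopf]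
  simp only [LinearMap.comp_apply, LinearMap.lTensor_tmul, LinearMap.mul'_apply,
    mul_antipode_lTensor_comul_apply, Algebra.algebraMap_eq_smul_one, map_smul, ofHopf_one,
    smul_tmul, ← tmul_sum, Nichols.sum_counit, ofDual_counit] at h
  rw [Finset.sum_comm, ← h]
  rw [Algebra.TensorProduct.one_def]

/-- The canonical R-matrix of the double; its inverse is `∑ S(bᵢ) ⊗ bᵢ^*`. -/
theorem isUniversalR : IsUniversalR (rFst (n := n)) rSnd where
  isUnit := ⟨⟨_, _, rMatrix_mul_antipode, antipode_rMatrix_mul⟩, rfl⟩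
  intertwine := rMatrix_intertwine
  comul_left := by
    have h := Nichols.sum_comul (n := n) (map (ofHopf ℂ _) (ofHopf ℂ _)) (ofDual ℂ _)
    simp only [comul_eq, rFst, doubleComul_ofHopf, rSnd, h, map_tmul, ofDual_mul_ofDual]
  comul_right := by
    have h := Nichols.sum_dualCoopComul (n := n) (ofHopf ℂ _) (map (ofDual ℂ _) (ofDual ℂ _))
    simp only [comul_eq, rFst, doubleComul_ofDual, rSnd, h, map_tmul, ofHopf_mul_ofHopf]

end DoubledNichols

end NicholsDouble
end

noncomputable section
set_option linter.unusedSectionVars false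

namespace NicholsDouble

open Coalgebra (comul counit)

/-! ### The twist element -/

section
open TensorProduct

variable {A : Type*} [Ring A] [Bialgebra ℂ A] {ι : Type*} [Fintype ι] {x y : ι → A}

/-- The Yang–Baxter equation `R₁₂ R₁₃ R₂₃ = R₂₃ R₁₃ R₁₂`. -/
theorem IsUniversalR.yangBaxter (h : IsUniversalR x y) :
    ∑ i, ∑ k, ∑ l, ((x i * x k) ⊗ₜ[ℂ] (y i * x l)) ⊗ₜ[ℂ] (y k * y l) =
      ∑ i, ∑ k, ∑ l, ((x k * x i) ⊗ₜ[ℂ] (x l * y i)) ⊗ₜ[ℂ] (y l * y k) := by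
  have h1 := congrArg ((LinearMap.mulLeft ℂ (∑ i, x i ⊗ₜ[ℂ] y i)).rTensor A) h.comul_left
  have h2 := congrArg (((LinearMap.mulRight ℂ (∑ i, x i ⊗ₜ[ℂ] y i)) ∘ₗ
    (TensorProduct.comm ℂ A A).toLinearMap).rTensor A) h.comul_left
  simp only [map_sum, LinearMap.rTensor_tmul, LinearMap.mulLeft_apply, LinearMap.mulRight_apply,
    LinearMap.comp_apply, LinearEquiv.coe_coe, comm_tmul, h.intertwine] at h1 h2
  rw [h1] at h2
  simp only [Finset.sum_mul, Finset.mul_sum, Algebra.TensorProduct.tmul_mul_tmul, sum_tmul] at h2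
  -- both sides compute `R₁₂ (Δ ⊗ id)(R) = (Δᵒᵖ ⊗ id)(R) R₁₂`
  have h3 : ∀ f : ι → ι → ι → (A ⊗[ℂ] A) ⊗[ℂ] A,
      ∑ i, ∑ j, ∑ k, f i j k = ∑ k, ∑ i, ∑ j, f i j k := by
    intro f
    rw [Finset.sum_comm]
    rw [Finset.sum_congr rfl fun j _ => Finset.sum_comm]
    rw [Finset.sum_comm]
    exact Finset.sum_congr rfl fun k _ => Finset.sum_comm
  rw [h3] at h2
  rw [h2, h3]
  exact Finset.sum_congr rfl fun k _ => Finset.sum_comm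

/-- If `g` is grouplike and `t = ∑ yᵢ g xᵢ` is central, then `Δ(t) = R₂₁ R (t ⊗ t)`. -/
theorem IsUniversalR.comul_sum (h : IsUniversalR x y) {g t : A} (hg : comul (R := ℂ) g = g ⊗ₜ g)
    (ht : t = ∑ i, y i * g * x i) (hc : ∀ a, a * t = t * a) :
    comul (R := ℂ) t =
      (∑ i, y i ⊗ₜ[ℂ] x i) * (∑ i, x i ⊗ₜ[ℂ] y i) * t ⊗ₜ t := by
  -- `Δ(t)` by the formula for `(Δ ⊗ id)(R)`
  have e1 : comul (R := ℂ) t =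
      ∑ i, ∑ j, comul (y i) * (comul (y j) * ((g * x i) ⊗ₜ[ℂ] (g * x j))) := by
    have h1 := congrArg (TensorProduct.lift ((LinearMap.mul ℂ (A ⊗[ℂ] A)).flip.compl₂
      (LinearMap.mulRight ℂ (g ⊗ₜ[ℂ] g) ∘ₗ comul))) h.comul_left
    simp only [map_sum, TensorProduct.lift.tmul, LinearMap.compl₂_apply, LinearMap.flip_apply,
      LinearMap.mul_apply', LinearMap.comp_apply, LinearMap.mulRight_apply,
      Bialgebra.comul_mul] at h1
    rw [ht, map_sum]
    simp only [Bialgebra.comul_mul, hg, mul_assoc, Algebra.TensorProduct.tmul_mul_tmul] at h1 ⊢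
    exact h1
  -- the formula for `(id ⊗ Δ)(R)`, used for each of the two remaining coproducts
  have e2 : ∀ s : A, ∑ j, comul (R := ℂ) (y j) * (s ⊗ₜ[ℂ] (g * x j)) =
      ∑ l, (y l * s) ⊗ₜ[ℂ] (t * x l) := by
    intro s
    have h1 := congrArg (TensorProduct.lift ((LinearMap.mul ℂ (A ⊗[ℂ] A)).flip ∘ₗ
      (TensorProduct.mk ℂ A A s ∘ₗ LinearMap.mulLeft ℂ g))) h.comul_right
    simp only [map_sum, TensorProduct.lift.tmul, LinearMap.flip_apply, mk_apply,
      LinearMap.mul_apply', LinearMap.comp_apply, LinearMap.mulLeft_apply,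
      Algebra.TensorProduct.tmul_mul_tmul] at h1
    rw [h1, Finset.sum_comm, ht]
    simp only [Finset.sum_mul, tmul_sum, mul_assoc]
  have e3 : ∀ s r : A, ∑ i, comul (R := ℂ) (y i) * ((s * x i) ⊗ₜ[ℂ] r) =
      ∑ i, ∑ k, (y k * (s * (x i * x k))) ⊗ₜ[ℂ] (y i * r) := by
    intro s r
    have h1 := congrArg (TensorProduct.lift ((LinearMap.mul ℂ (A ⊗[ℂ] A)).flip ∘ₗ
      ((TensorProduct.mk ℂ A A).flip r ∘ₗ LinearMap.mulLeft ℂ s))) h.comul_right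
    simpa only [map_sum, TensorProduct.lift.tmul, LinearMap.flip_apply, mk_apply,
      LinearMap.mul_apply', LinearMap.comp_apply, LinearMap.mulLeft_apply,
      Algebra.TensorProduct.tmul_mul_tmul] using h1
  have e4 : comul (R := ℂ) t = ∑ i, ∑ k, ∑ l,
      (y k * y l * g * (x i * x k)) ⊗ₜ[ℂ] (t * (y i * x l)) := by
    rw [e1]
    simp only [← Finset.mul_sum, e2]
    simp only [Finset.mul_sum]
    rw [Finset.sum_comm]
    simp only [← mul_assoc (y _) g, e3]
    rw [Finset.sum_comm]
    refine Finset.sum_congr rfl fun i _ => ?_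
    rw [Finset.sum_comm]
    refine Finset.sum_congr rfl fun k _ => Finset.sum_congr rfl fun l _ => ?_
    rw [← mul_assoc (y i) t, hc]
    simp only [mul_assoc]
  -- the Yang–Baxter equation, contracted so that its third factor meets the first through `g`
  have h5 := congrArg (TensorProduct.lift ((LinearMap.mul ℂ (A ⊗[ℂ] A)).flip.compl₂
    ((TensorProduct.mk ℂ A A).flip t ∘ₗ LinearMap.mulRight ℂ g))) h.yangBaxter
  simp only [map_sum, TensorProduct.lift.tmul, LinearMap.flip_apply, mk_apply,
    LinearMap.compl₂_apply, LinearMap.mul_apply', LinearMap.comp_apply, LinearMap.mulRight_apply,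
    Algebra.TensorProduct.tmul_mul_tmul] at h5
  rw [e4, h5]
  simp only [Finset.sum_mul, Finset.mul_sum, Algebra.TensorProduct.tmul_mul_tmul]
  refine Finset.sum_congr rfl fun i _ => ?_
  rw [Finset.sum_comm]
  refine Finset.sum_congr rfl fun l _ => ?_
  rw [← sum_tmul, ← hc (x l * y i)]
  congr 1
  rw [mul_assoc, hc, ht]
  simp only [Finset.sum_mul, Finset.mul_sum, mul_assoc]

end

namespace DoubledNichols
open TensorProduct DrinfeldDouble HopfAlgebra
variable {n : ℕ}

/-- The partial sums `∑ bᵢ^* K πⱼ(bᵢ)`, where `πⱼ` kills the generators from `ξⱼ` on. -/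
def twistAux (n j : ℕ) : DoubledNichols n :=
  ∑ i, rSnd i * K * ofHopf ℂ _ (Nichols.trunc j (Nichols.basis n i))

/-- The central element `t = ∑ bᵢ^* K bᵢ` whose action is the twist. -/
def twistElt (n : ℕ) : DoubledNichols n := ∑ i, rSnd i * K * rFst i

theorem twistElt_eq : twistElt n = twistAux n n := by
  simp [twistElt, twistAux, Nichols.trunc_eq_id, rFst]

/-- The part of the twist element that comes from the group algebra of `K`. -/
theorem twistAux_zero : twistAux n 0 = (1 / 2 : ℂ) • (1 + K + C - chi) := by
  have h : ∀ ψ : Module.Dual ℂ (Nichols n), ∑ i, ψ (Nichols.basis n i) • rSnd i = ofDual ℂ _ ψ := by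
    intro ψ
    conv_rhs => rw [← (Nichols.basis n).sum_dual_apply_smul_coord ψ]
    simp [rSnd]
  have h1 := h counit
  have h2 := h Nichols.chi.toLinearMap
  rw [ofDual_counit] at h1
  have h3 : ∀ i : Nichols.BasisIndex n,
      rSnd i * K * ofHopf ℂ _ (Nichols.trunc 0 (Nichols.basis n i)) =
      (1 / 2 : ℂ) • (counit (R := ℂ) (Nichols.basis n i) • rSnd i * (K + 1) +
        Nichols.chi.toLinearMap (Nichols.basis n i) • rSnd i * (K - 1)) := by
    intro i
    rw [Nichols.trunc_zero, map_add, map_smul, map_smul, ofHopf_one, ofHopf_K]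
    simp only [mul_add, mul_sub, mul_smul_comm, mul_one, mul_assoc _ K K, K_mul_K, smul_mul_assoc,
      AlgHom.toLinearMap_apply]
    module
  rw [twistAux, Finset.sum_congr rfl fun i _ => h3 i, ← Finset.smul_sum, Finset.sum_add_distrib,
    ← Finset.sum_mul, ← Finset.sum_mul, h1, h2, ← chi, C]
  congr 1
  noncomm_ring

/-- Adding the generator `ξⱼ`, by the factorization of the identity of `𝒦ₙ`. -/
theorem twistAux_succ_aux (j : Fin n) :
    twistAux n (j + 1) = twistAux n j + phi j * twistAux n j * xi j := by
  have h1 : ∀ i : Nichols.BasisIndex n,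
      rSnd i * K * ofHopf ℂ _ (Nichols.trunc (j + 1) (Nichols.basis n i)) =
      rSnd i * K * ofHopf ℂ _ (Nichols.trunc j (Nichols.basis n i)) +
      rSnd i * K * ofHopf ℂ _
        (Nichols.trunc j (Nichols.convLeft (Nichols.phi j) .id (Nichols.basis n i))) * xi j := by
    intro i
    have h : ∀ a : Nichols n, Nichols.convLeft (Nichols.phi j) (Nichols.trunc j).toLinearMap a =
        Nichols.trunc j (Nichols.convLeft (Nichols.phi j) .id a) := by
      intro a
      simp only [Nichols.convLeft, LinearMap.comp_apply]
      generalize comul (R := ℂ) a = t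
      induction t with
      | zero => simp
      | add x y hx hy => simp only [map_add, hx, hy]
      | tmul a b => simp
    rw [Nichols.trunc_succ, ← mul_assoc, Nichols.convRight_trunc_phi, map_add, mul_add,
      ← ofHopf_mul_ofHopf, ofHopf_xi, ← mul_assoc, h]
  have h2 := congrArg (TensorProduct.lift ((LinearMap.mul ℂ (DoubledNichols n)).flip))
    (Nichols.sum_transpose (ofHopf ℂ _ ∘ₗ (Nichols.trunc (n := n) j).toLinearMap)
      (LinearMap.mulRight ℂ (K : DoubledNichols n) ∘ₗ ofDual ℂ _)
      (Nichols.convLeft (Nichols.phi j) .id))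
  simp only [map_sum, TensorProduct.lift.tmul, LinearMap.flip_apply, LinearMap.mul_apply',
    LinearMap.comp_apply, LinearMap.mulRight_apply, AlgHom.toLinearMap_apply,
    ← Nichols.dualMul_eq_comp_convLeft, ← ofDual_mul_ofDual] at h2
  rw [twistAux, Finset.sum_congr rfl fun i _ => h1 i, Finset.sum_add_distrib, ← Finset.sum_mul]
  rw [twistAux, Finset.mul_sum]
  congr 2
  simp only [rSnd, h2]
  simp only [phi, mul_assoc]

theorem C_mul_K : (C : DoubledNichols n) * K = chi := by
  rw [C, mul_assoc, K_mul_K, mul_one]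

theorem C_mul_chi : (C : DoubledNichols n) * chi = K := by
  rw [C, mul_assoc, K_mul_chi, ← mul_assoc, chi_mul_chi, one_mul]

/-- The factor `1 + C φⱼ ξⱼ` of the twist element. -/
def twistFactor (j : Fin n) : DoubledNichols n := 1 + C * (phi j * xi j)

theorem K_mul_twistFactor (j : Fin n) : K * twistFactor j = twistFactor j * K := by
  have h : K * (phi j * xi j) = phi j * xi j * K := by
    rw [← mul_assoc, K_mul_phi, neg_mul, mul_assoc, K_mul_xi, mul_neg, neg_neg, mul_assoc]
  rw [twistFactor, mul_add, add_mul, ← mul_assoc, ← C_comm, mul_assoc, h]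
  noncomm_ring

theorem chi_mul_twistFactor (j : Fin n) : chi * twistFactor j = twistFactor j * chi := by
  have h : chi * (phi j * xi j) = phi j * xi j * chi := by
    rw [← mul_assoc, chi_mul_phi, neg_mul, mul_assoc, mul_assoc, xi_mul_chi, mul_neg]
  rw [twistFactor, mul_add, add_mul, ← mul_assoc, ← C_comm, mul_assoc, h]
  noncomm_ring

theorem phi_mul_twistFactor {j k : Fin n} (h : k ≠ j) :
    phi k * twistFactor j = twistFactor j * phi k := by
  have h : phi k * (phi j * xi j) = phi j * xi j * phi k := by
    rw [← mul_assoc, phi_mul_phi, neg_mul, mul_assoc, mul_assoc, xi_mul_phi j k, if_neg h.symm,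
      add_zero, mul_neg]
  rw [twistFactor, mul_add, add_mul, ← mul_assoc, ← C_comm, mul_assoc, h]
  noncomm_ring

theorem xi_mul_twistFactor {j k : Fin n} (h : k ≠ j) :
    xi k * twistFactor j = twistFactor j * xi k := by
  have h : xi k * (phi j * xi j) = phi j * xi j * xi k := by
    rw [← mul_assoc, xi_mul_phi, if_neg h, add_zero, neg_mul, mul_assoc, mul_assoc, xi_mul_xi k,
      mul_neg, neg_neg]
  rw [twistFactor, mul_add, add_mul, ← mul_assoc, ← C_comm, mul_assoc, h]
  noncomm_ring

theorem phi_mul_twistFactor_self (j : Fin n) :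
    phi j * twistFactor j = C * (twistFactor j * phi j) := by
  have h1 : phi j * (C * (phi j * xi j)) = 0 := by
    rw [← mul_assoc, ← C_comm, mul_assoc, ← mul_assoc (phi j), phi_mul_self, zero_mul, mul_zero]
  have h2 : phi j * xi j * phi j = phi j - C * phi j := by
    rw [mul_assoc, xi_mul_phi, if_pos rfl, mul_add, mul_neg, ← mul_assoc, phi_mul_self, C_comm]
    noncomm_ring
  rw [twistFactor, mul_add, mul_one, h1, add_mul, one_mul, mul_assoc C, h2, mul_sub, mul_add,
    mul_sub, ← mul_assoc C C, C_mul_C]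
  simp only [one_mul]
  abel

theorem xi_mul_twistFactor_self (j : Fin n) :
    xi j * twistFactor j = C * (twistFactor j * xi j) := by
  have h1 : C * (phi j * xi j) * xi j = 0 := by
    rw [mul_assoc, mul_assoc (phi j), xi_mul_self, mul_zero, mul_zero]
  have h2 : xi j * (phi j * xi j) = xi j - C * xi j := by
    rw [← mul_assoc, xi_mul_phi, if_pos rfl, add_mul, neg_mul, mul_assoc, xi_mul_self]
    noncomm_ring
  rw [twistFactor, mul_add, mul_one, add_mul, h1, ← mul_assoc, ← C_comm, mul_assoc, h2, mul_sub,
    ← mul_assoc C C, C_mul_C]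
  noncomm_ring

theorem isUnit_twistFactor (j : Fin n) : IsUnit (twistFactor j) := by
  have h : phi j * xi j * (phi j * xi j) = phi j * xi j - C * (phi j * xi j) := by
    rw [mul_assoc, ← mul_assoc (xi j), xi_mul_phi, if_pos rfl, add_mul, neg_mul, mul_assoc (phi j),
      xi_mul_self, sub_mul, mul_zero, neg_zero, zero_add, mul_sub, one_mul, ← mul_assoc _ C,
      ← C_comm, mul_assoc C]
  have h2 : C * (C * (phi j * xi j)) = phi j * xi j := by rw [← mul_assoc, C_mul_C, one_mul]
  -- with `p = φⱼ ξⱼ` one has `p² = p - C p`, hence `(1 + C p) (1 - p) = 1`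
  refine ⟨⟨twistFactor j, 1 - phi j * xi j, ?_, ?_⟩, rfl⟩
  · rw [twistFactor, mul_sub, mul_one, add_mul, one_mul, mul_assoc C, h, mul_sub, h2]
    abel
  · rw [twistFactor, sub_mul, one_mul, mul_add, mul_one, ← mul_assoc _ C, ← C_comm, mul_assoc C, h,
      mul_sub, h2]
    abel

/-- The commutation relations of `twistAux n j`; for `j = n` it is central. -/
theorem twistAux_comm (j : ℕ) (hj : j ≤ n) :
    K * twistAux n j = twistAux n j * K ∧ chi * twistAux n j = twistAux n j * chi ∧
    (∀ k : Fin n, k.val < j → phi k * twistAux n j = twistAux n j * phi k ∧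
      xi k * twistAux n j = twistAux n j * xi k) ∧
    ∀ k : Fin n, j ≤ k.val → phi k * twistAux n j = C * (twistAux n j * phi k) ∧
      xi k * twistAux n j = C * (twistAux n j * xi k) := by
  have comm : ∀ a : DoubledNichols n, a * C = C * a := fun a => (C_comm a).symm
  induction j with
  | zero =>
    rw [twistAux_zero]
    have hK : (K : DoubledNichols n) * (1 + K + C - chi) = (1 + K + C - chi) * K := by
      simp only [mul_add, add_mul, mul_sub, sub_mul, comm, K_mul_chi, mul_one, one_mul]
    have hc : (chi : DoubledNichols n) * (1 + K + C - chi) = (1 + K + C - chi) * chi := by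
      simp only [mul_add, add_mul, mul_sub, sub_mul, comm, K_mul_chi, mul_one, one_mul]
    have hp : ∀ a : DoubledNichols n, K * a = -(a * K) → chi * a = -(a * chi) →
        a * (1 + K + C - chi) = C * ((1 + K + C - chi) * a) := by
      intro a h1 h2
      have h3 : C * (K * a) = -(a * chi) := by rw [← mul_assoc, C_mul_K, h2]
      have h4 : C * (chi * a) = -(a * K) := by rw [← mul_assoc, C_mul_chi, h1]
      have h5 : C * (C * a) = a := by rw [← mul_assoc, C_mul_C, one_mul]
      simp only [mul_add, add_mul, mul_sub, sub_mul, comm, mul_one, one_mul, h3, h4, h5]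
      abel
    simp only [mul_smul_comm, smul_mul_assoc, hK, hc, true_and]
    refine ⟨fun k hk => absurd hk (Nat.not_lt_zero _), fun k _ => ⟨?_, ?_⟩⟩
    · rw [hp _ (K_mul_phi k) (chi_mul_phi k)]
    · rw [hp _ (K_mul_xi k) (by rw [xi_mul_chi, neg_neg])]
  | succ j ih =>
    obtain ⟨iK, ic, il, ig⟩ := ih (by omega)
    have hs := twistAux_succ_aux (n := n) ⟨j, hj⟩
    have hs' : twistAux n (j + 1) = twistAux n j * twistFactor ⟨j, hj⟩ := by
      rw [hs, (ig ⟨j, hj⟩ le_rfl).1, twistFactor, mul_add, mul_one, ← mul_assoc _ C, comm,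
        mul_assoc C, mul_assoc C, mul_assoc (twistAux n j)]
    rw [hs']
    refine ⟨?_, ?_, fun k hk => ?_, fun k hk => ?_⟩
    · rw [← mul_assoc, iK, mul_assoc, K_mul_twistFactor, mul_assoc]
    · rw [← mul_assoc, ic, mul_assoc, chi_mul_twistFactor, mul_assoc]
    · rcases eq_or_ne k ⟨j, hj⟩ with rfl | hne
      · have h := ig ⟨j, hj⟩ le_rfl
        constructor
        · rw [← mul_assoc, h.1, mul_assoc, mul_assoc, phi_mul_twistFactor_self, ← mul_assoc _ C,
            comm, mul_assoc, ← mul_assoc C C, C_mul_C, one_mul, mul_assoc]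
        · rw [← mul_assoc, h.2, mul_assoc, mul_assoc, xi_mul_twistFactor_self, ← mul_assoc _ C,
            comm, mul_assoc, ← mul_assoc C C, C_mul_C, one_mul, mul_assoc]
      · have h := il k (by rw [ne_eq, Fin.ext_iff] at hne; simp only at hne; omega)
        constructor
        · rw [← mul_assoc, h.1, mul_assoc, phi_mul_twistFactor hne, mul_assoc]
        · rw [← mul_assoc, h.2, mul_assoc, xi_mul_twistFactor hne, mul_assoc]
    · have hne : k ≠ ⟨j, hj⟩ := by rintro rfl; simp at hk
      have h := ig k (by omega)
      constructor
      · rw [← mul_assoc, h.1, mul_assoc, mul_assoc, phi_mul_twistFactor hne, mul_assoc]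
      · rw [← mul_assoc, h.2, mul_assoc, mul_assoc, xi_mul_twistFactor hne, mul_assoc]

theorem twistAux_succ (j : Fin n) : twistAux n (j + 1) = twistAux n j * twistFactor j := by
  rw [twistAux_succ_aux, ((twistAux_comm j j.2.le).2.2.2 j le_rfl).1, twistFactor, mul_add, mul_one,
    ← mul_assoc _ C, ← C_comm, mul_assoc C, mul_assoc C, mul_assoc (twistAux n j)]

theorem mul_twistElt (a : DoubledNichols n) : a * twistElt n = twistElt n * a := by
  rw [twistElt_eq]
  obtain ⟨hK, hc, h, -⟩ := twistAux_comm n le_rfl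
  induction a using induction with
  | hc c => exact Algebra.commutes _ _
  | hK => exact hK
  | hchi => exact hc
  | hxi i => exact (h i i.2).2
  | hphi i => exact (h i i.2).1
  | hadd a b ha hb => rw [add_mul, ha, hb, mul_add]
  | hmul a b ha hb => rw [mul_assoc, hb, ← mul_assoc, ha, mul_assoc]

theorem isUnit_twistElt (n : ℕ) : IsUnit (twistElt n) := by
  rw [twistElt_eq]
  have h : ∀ j ≤ n, IsUnit (twistAux n j) := by
    intro j
    induction j with
    | zero =>
      intro _
      -- `½ (1 + K + C - χ)` is `1` or `-1` on each weight space, so it is its own inverse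
      have h : twistAux n 0 * twistAux n 0 = 1 := by
        rw [twistAux_zero, smul_mul_smul_comm]
        have h2 : (1 + K + C - chi : DoubledNichols n) * (1 + K + C - chi) = (4 : ℂ) • 1 := by
          simp only [mul_add, add_mul, mul_sub, sub_mul, ← C_comm, K_mul_chi, mul_one, one_mul,
            C_mul_C, C_mul_K, C_mul_chi, K_mul_K, chi_mul_chi,
            show (chi : DoubledNichols n) * K = C from rfl]
          module
        rw [h2, smul_smul]
        norm_num
      exact ⟨⟨_, _, h, h⟩, rfl⟩
    | succ j ih =>
      intro hj
      rw [twistAux_succ ⟨j, hj⟩]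
      exact (ih (by omega)).mul (isUnit_twistFactor _)
  exact h n le_rfl

theorem antipode_K : antipode ℂ (K : DoubledNichols n) = K := by
  rw [← ofHopf_K, antipode_ofHopf, Nichols.antipode_eq, Nichols.antipodeLin_K]

theorem antipode_chi : antipode ℂ (chi : DoubledNichols n) = chi := by
  rw [chi, antipode_ofDual]
  congr 1
  ext x
  have h : ∀ x : Nichols n, Nichols.chi (antipode ℂ x) = Nichols.chi x := by
    intro x
    induction x using Nichols.induction with
    | hc c => simp [Algebra.algebraMap_eq_smul_one]
    | hK => simp [Nichols.antipode_eq]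
    | hx i => simp [Nichols.antipode_eq]
    | hadd a b ha hb => simp [ha, hb]
    | hmul a b ha hb => rw [antipode_mul_antidistrib, map_mul, map_mul, ha, hb, mul_comm]
  have := h (antipodeInv ℂ _ x)
  rw [antipode_antipodeInv] at this
  simp [this]

theorem antipode_C : antipode ℂ (C : DoubledNichols n) = C := by
  rw [C, antipode_mul_antidistrib, antipode_K, antipode_chi, K_mul_chi]

theorem antipode_phi (i : Fin n) : antipode ℂ (phi i) = -(chi * phi i) := by
  have h := mul_antipode_rTensor_comul_apply (R := ℂ) (phi i)
  rw [comul_eq, counit_eq, doubleComul_phi, doubleCounit_phi] at h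
  simp only [map_add, LinearMap.rTensor_tmul, LinearMap.mul'_apply, mul_one, map_zero,
    antipode_chi] at h
  exact eq_neg_of_add_eq_zero_left h

theorem antipode_xi (i : Fin n) : antipode ℂ (xi i) = -(K * xi i) := by
  rw [← ofHopf_xi, antipode_ofHopf, Nichols.antipode_eq, Nichols.antipodeLin_xi, map_neg,
    ← ofHopf_mul_ofHopf, ofHopf_K]

theorem antipode_twistFactor (j : Fin n) :
    antipode ℂ (twistFactor j) = C * twistFactor j := by
  have h : antipode ℂ (phi j * xi j) = C * (phi j * xi j) + 1 - C := by
    rw [antipode_mul_antidistrib, antipode_phi, antipode_xi, neg_mul_neg, mul_assoc,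
      ← mul_assoc (xi j), xi_mul_chi, neg_mul, mul_neg, mul_assoc, ← mul_assoc K, K_mul_chi, ← C,
      xi_mul_phi, if_pos rfl, mul_add, mul_neg, mul_sub, C_mul_C]
    noncomm_ring
  rw [twistFactor, map_add, antipode_one, antipode_mul_antidistrib, antipode_C, h, ← C_comm,
    mul_sub, mul_add, mul_add, C_mul_C, mul_one]
  abel

/-- The antipode multiplies each factor `1 + C φⱼ ξⱼ` of the twist element by `C`, so it multiplies
the twist element by `C ^ n`, which is `1` when `n` is even. -/
theorem antipode_twistElt (hn : Even n) : antipode ℂ (twistElt n) = twistElt n := by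
  have h : ∀ j ≤ n, antipode ℂ (twistAux n j) = C ^ j * twistAux n j := by
    intro j
    induction j with
    | zero =>
      intro _
      rw [twistAux_zero, map_smul, map_sub, map_add, map_add, antipode_one, antipode_K, antipode_C,
        antipode_chi, pow_zero, one_mul]
    | succ j ih =>
      intro hj
      have hc : twistFactor ⟨j, hj⟩ * twistAux n j = twistAux n j * twistFactor ⟨j, hj⟩ := by
        obtain ⟨h1, h2⟩ := (twistAux_comm j (by omega)).2.2.2 ⟨j, hj⟩ le_rfl
        have h3 : phi ⟨j, hj⟩ * xi ⟨j, hj⟩ * twistAux n j =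
            twistAux n j * (phi ⟨j, hj⟩ * xi ⟨j, hj⟩) := by
          rw [mul_assoc, h2, ← mul_assoc, ← C_comm, mul_assoc, ← mul_assoc (phi _), h1, mul_assoc C,
            ← mul_assoc C C, C_mul_C, one_mul, mul_assoc]
        rw [twistFactor, add_mul, one_mul, mul_add, mul_one, mul_assoc, h3, ← mul_assoc _ C,
          ← C_comm, mul_assoc]
      rw [twistAux_succ ⟨j, hj⟩, antipode_mul_antidistrib, ih (by omega), antipode_twistFactor,
        mul_assoc, ← mul_assoc _ (C ^ j), ← (Commute.pow_left (C_comm (twistFactor ⟨j, hj⟩)) j).eq,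
        mul_assoc (C ^ j), hc, ← mul_assoc C, ← pow_succ']
  rw [twistElt_eq, h n le_rfl]
  obtain ⟨m, rfl⟩ := hn
  rw [← two_mul, pow_mul, pow_two, C_mul_C, one_pow, one_mul]

/-- The formula for the coproduct that makes the action of `t` a twist. -/
theorem comul_twistElt (n : ℕ) : comul (R := ℂ) (twistElt n) =
    (∑ i, rSnd i ⊗ₜ[ℂ] rFst i) * (∑ i, rFst i ⊗ₜ[ℂ] rSnd i) * twistElt n ⊗ₜ twistElt n :=
  isUniversalR.comul_sum doubleComul_K rfl mul_twistElt

end DoubledNichols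

end NicholsDouble
end

noncomputable section
set_option linter.unusedSectionVars false

namespace NicholsDouble

open Coalgebra (comul counit)

/-! ### The braided tensor category of modules over a quasitriangular bialgebra -/

namespace HopfModule
open TensorProduct MonoidalCategory
open scoped ModuleCat

section
variable {A : Type} [Ring A] [Algebra ℂ A]

/-- A morphism as a `ℂ`-linear map. -/
def lin {X Y : FGModuleCat.{0} A} (f : X ⟶ Y) : X →ₗ[ℂ] Y := f.hom.hom.restrictScalars ℂ

@[simp] theorem lin_apply {X Y : FGModuleCat.{0} A} (f : X ⟶ Y) (x : X) :
    lin f x = f.hom.hom x := rfl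

/-- A `ℂ`-linear map that commutes with the action, as a morphism. -/
def mkHom {X Y : FGModuleCat.{0} A} (f : X →ₗ[ℂ] Y) (h : ∀ (a : A) x, f (a • x) = a • f x) :
    X ⟶ Y :=
  ⟨ModuleCat.ofHom { toFun := f, map_add' := map_add f, map_smul' := h }⟩

@[simp] theorem mkHom_apply {X Y : FGModuleCat.{0} A} (f : X →ₗ[ℂ] Y)
    (h : ∀ (a : A) x, f (a • x) = a • f x) (x : X) : (mkHom f h).hom.hom x = f x := rfl

/-- A `ℂ`-linear equivalence that commutes with the action, as an isomorphism. -/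
def mkIso {X Y : FGModuleCat.{0} A} (e : X ≃ₗ[ℂ] Y) (h : ∀ (a : A) x, e (a • x) = a • e x) :
    X ≅ Y where
  hom := mkHom e.toLinearMap h
  inv := mkHom e.symm.toLinearMap fun a y => by
    apply e.injective
    simp [h]
  hom_inv_id := by ext x; exact e.symm_apply_apply x
  inv_hom_id := by ext x; exact e.apply_symm_apply x

@[simp] theorem mkIso_hom_apply {X Y : FGModuleCat.{0} A} (e : X ≃ₗ[ℂ] Y)
    (h : ∀ (a : A) x, e (a • x) = a • e x) (x : X) : (mkIso e h).hom.hom.hom x = e x := rfl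

@[simp] theorem tensorAct_tmul (X Y : FGModuleCat.{0} A) (a b : A) (x : X) (y : Y) :
    tensorAct X Y (a ⊗ₜ b) (x ⊗ₜ y) = (a • x) ⊗ₜ (b • y) := by
  simp [tensorAct]

theorem tensorAct_mul (X Y : FGModuleCat.{0} A) (s u : A ⊗[ℂ] A) (t : X ⊗[ℂ] Y) :
    tensorAct X Y (s * u) t = tensorAct X Y s (tensorAct X Y u t) := by
  induction s with
  | zero => simp
  | add s₁ s₂ h₁ h₂ => simp only [add_mul, map_add, LinearMap.add_apply, h₁, h₂]
  | tmul a b =>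
    induction u with
    | zero => simp
    | add s₁ s₂ h₁ h₂ => simp only [mul_add, map_add, LinearMap.add_apply, h₁, h₂]
    | tmul c d =>
      induction t with
      | zero => simp
      | add s₁ s₂ h₁ h₂ => simp only [map_add, h₁, h₂]
      | tmul x y => simp [mul_smul]

theorem tensorAct_one (X Y : FGModuleCat.{0} A) (t : X ⊗[ℂ] Y) : tensorAct X Y 1 t = t := by
  induction t with
  | zero => simp
  | add s₁ s₂ h₁ h₂ => rw [map_add, h₁, h₂]
  | tmul x y => rw [Algebra.TensorProduct.one_def, tensorAct_tmul, one_smul, one_smul]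

theorem map_tensorAct {X X' Y Y' : FGModuleCat.{0} A} (f : X ⟶ X') (g : Y ⟶ Y') (s : A ⊗[ℂ] A)
    (t : X ⊗[ℂ] Y) :
    map (lin f) (lin g) (tensorAct X Y s t) = tensorAct X' Y' s (map (lin f) (lin g) t) := by
  induction s with
  | zero => simp
  | add s₁ s₂ h₁ h₂ => simp only [map_add, LinearMap.add_apply, h₁, h₂]
  | tmul a b =>
    induction t with
    | zero => simp
    | add s₁ s₂ h₁ h₂ => simp only [map_add, h₁, h₂]
    | tmul x y => simp

theorem comm_tensorAct (X Y : FGModuleCat.{0} A) (s : A ⊗[ℂ] A) (t : X ⊗[ℂ] Y) :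
    TensorProduct.comm ℂ X Y (tensorAct X Y s t) =
      tensorAct Y X (TensorProduct.comm ℂ A A s) (TensorProduct.comm ℂ X Y t) := by
  induction s with
  | zero => simp
  | add s₁ s₂ h₁ h₂ => simp only [map_add, LinearMap.add_apply, h₁, h₂]
  | tmul a b =>
    induction t with
    | zero => simp
    | add s₁ s₂ h₁ h₂ => simp only [map_add, h₁, h₂]
    | tmul x y => simp

end

variable {A : Type} [Ring A] [Bialgebra ℂ A] [Module.Finite ℂ A]

theorem tensorAct_comul_algebraMap (X Y : FGModuleCat.{0} A) (c : ℂ) (t : X ⊗[ℂ] Y) :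
    tensorAct X Y (comul (algebraMap ℂ A c)) t = c • t := by
  rw [Bialgebra.comul_algebraMap, Algebra.algebraMap_eq_smul_one, map_smul,
    LinearMap.smul_apply, tensorAct_one]

/-- The action of a bialgebra on a tensor product through the comultiplication. -/
@[reducible]
def tensorModule (X Y : FGModuleCat.{0} A) : Module A (X ⊗[ℂ] Y) where
  smul a t := tensorAct X Y (comul a) t
  one_smul t := by
    change tensorAct X Y (comul 1) t = t
    rw [Bialgebra.comul_one, tensorAct_one]
  mul_smul a b t := by
    change tensorAct X Y (comul (a * b)) t = tensorAct X Y (comul a) (tensorAct X Y (comul b) t)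
    rw [Bialgebra.comul_mul, tensorAct_mul]
  smul_zero a := map_zero (tensorAct X Y (comul a))
  smul_add a s t := map_add (tensorAct X Y (comul a)) s t
  add_smul a b t := by
    change tensorAct X Y (comul (a + b)) t = tensorAct X Y (comul a) t + tensorAct X Y (comul b) t
    rw [map_add, map_add, LinearMap.add_apply]
  zero_smul t := by
    change tensorAct X Y (comul 0) t = 0
    rw [map_zero, map_zero, LinearMap.zero_apply]

theorem finite_of_algebraMap_smul {V : Type} [AddCommGroup V] [Module ℂ V] [Module A V]
    [Module.Finite ℂ V] (h : ∀ (c : ℂ) (v : V), algebraMap ℂ A c • v = c • v) :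
    Module.Finite A V :=
  have := IsScalarTower.of_algebraMap_smul h
  .of_restrictScalars_finite ℂ A V

theorem finite_complex (X : FGModuleCat.{0} A) : Module.Finite ℂ X := Module.Finite.trans A X

/-- The vector space underlying the tensor product of two modules. -/
def TensorCarrier (X Y : FGModuleCat.{0} A) : Type := X ⊗[ℂ] Y

instance (X Y : FGModuleCat.{0} A) : AddCommGroup (TensorCarrier X Y) :=
  inferInstanceAs (AddCommGroup (X ⊗[ℂ] Y))

instance (X Y : FGModuleCat.{0} A) : Module A (TensorCarrier X Y) := tensorModule X Y

instance (X Y : FGModuleCat.{0} A) : Module.Finite A (TensorCarrier X Y) :=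
  have := finite_complex X
  have := finite_complex Y
  @finite_of_algebraMap_smul A _ _ _ (X ⊗[ℂ] Y) _ _ (tensorModule X Y) _
    (tensorAct_comul_algebraMap X Y)

/-- The tensor product of two modules. -/
def tObj (X Y : FGModuleCat.{0} A) : FGModuleCat.{0} A := FGModuleCat.of A (TensorCarrier X Y)

/-- The identification of the tensor product of two modules with the tensor product of vector
spaces. -/
def tEquiv (X Y : FGModuleCat.{0} A) : X ⊗[ℂ] Y ≃ₗ[ℂ] tObj X Y where
  toFun t := t
  invFun t := t
  left_inv _ := rfl
  right_inv _ := rfl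
  map_add' _ _ := rfl
  map_smul' c t := by
    change c • t = tensorAct X Y (comul (algebraMap ℂ A c)) t
    rw [tensorAct_comul_algebraMap]

theorem smul_tEquiv (X Y : FGModuleCat.{0} A) (a : A) (t : X ⊗[ℂ] Y) :
    a • tEquiv X Y t = tEquiv X Y (tensorAct X Y (comul a) t) := rfl

/-- A pure tensor. -/
def tmk {X Y : FGModuleCat.{0} A} (x : X) (y : Y) : tObj X Y := tEquiv X Y (x ⊗ₜ y)

theorem tEquiv_tmul {X Y : FGModuleCat.{0} A} (x : X) (y : Y) : tEquiv X Y (x ⊗ₜ y) = tmk x y := rfl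

theorem tEquiv_symm_tmk {X Y : FGModuleCat.{0} A} (x : X) (y : Y) :
    (tEquiv X Y).symm (tmk x y) = x ⊗ₜ y := (tEquiv X Y).symm_apply_apply _

@[elab_as_elim]
theorem tObj_induction {X Y : FGModuleCat.{0} A} {P : tObj X Y → Prop} (t : tObj X Y)
    (h : ∀ x y, P (tmk x y)) (hadd : ∀ s t, P s → P t → P (s + t)) : P t := by
  obtain ⟨t, rfl⟩ := (tEquiv X Y).surjective t
  induction t with
  | zero => simpa [tmk] using h 0 0
  | add x y hx hy => rw [map_add]; exact hadd _ _ hx hy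
  | tmul x y => exact h x y

theorem tObj_hom_ext {X Y Z : FGModuleCat.{0} A} {f g : tObj X Y ⟶ Z}
    (h : ∀ x y, f.hom.hom (tmk x y) = g.hom.hom (tmk x y)) : f = g := by
  ext t
  refine tObj_induction (P := fun t => f.hom.hom t = g.hom.hom t) t h fun s t hs ht => ?_
  rw [map_add, map_add, hs, ht]

theorem tObj_hom_ext₃ {X Y Z W : FGModuleCat.{0} A} {f g : tObj (tObj X Y) Z ⟶ W}
    (h : ∀ x y z, f.hom.hom (tmk (tmk x y) z) = g.hom.hom (tmk (tmk x y) z)) : f = g := by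
  refine tObj_hom_ext fun t z => ?_
  refine tObj_induction (P := fun t => f.hom.hom (tmk t z) = g.hom.hom (tmk t z)) t
    (fun x y => h x y z) fun s t hs ht => ?_
  have : tmk (s + t) z = tmk s z + tmk t z := by simp [tmk, add_tmul]
  rw [this, map_add, map_add, hs, ht]

theorem tObj_hom_ext₃' {X Y Z W : FGModuleCat.{0} A} {f g : tObj X (tObj Y Z) ⟶ W}
    (h : ∀ x y z, f.hom.hom (tmk x (tmk y z)) = g.hom.hom (tmk x (tmk y z))) : f = g := by
  refine tObj_hom_ext fun x t => ?_
  refine tObj_induction (P := fun t => f.hom.hom (tmk x t) = g.hom.hom (tmk x t)) t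
    (fun y z => h x y z) fun s t hs ht => ?_
  have : tmk x (s + t) = tmk x s + tmk x t := by simp [tmk, tmul_add]
  rw [this, map_add, map_add, hs, ht]

theorem tObj_hom_ext₄ {X Y Z V W : FGModuleCat.{0} A} {f g : tObj (tObj (tObj X Y) Z) V ⟶ W}
    (h : ∀ x y z v, f.hom.hom (tmk (tmk (tmk x y) z) v) = g.hom.hom (tmk (tmk (tmk x y) z) v)) :
    f = g := by
  refine tObj_hom_ext₃ fun t z v => ?_
  refine tObj_induction (P := fun t => f.hom.hom (tmk (tmk t z) v) = g.hom.hom (tmk (tmk t z) v)) t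
    (fun x y => h x y z v) fun s t hs ht => ?_
  have : tmk (tmk (s + t) z) v = tmk (tmk s z) v + tmk (tmk t z) v := by simp [tmk, add_tmul]
  rw [this, map_add, map_add, hs, ht]

variable (A) in
/-- The action of a bialgebra on the base field through the counit. -/
@[reducible]
def unitModule : Module A ℂ := Module.compHom ℂ (Bialgebra.counitAlgHom ℂ A).toRingHom

/-- The one-dimensional vector space underlying the unit object. -/
def UnitCarrier (_ : Type) : Type := ℂ

instance : AddCommGroup (UnitCarrier A) := inferInstanceAs (AddCommGroup ℂ)

instance : Module A (UnitCarrier A) := unitModule A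

instance : Module.Finite A (UnitCarrier A) :=
  @finite_of_algebraMap_smul A _ _ _ ℂ _ _ (unitModule A) _ fun c d => by
    change counit (R := ℂ) (algebraMap ℂ A c) * d = c * d
    simp

variable (A) in
/-- The unit object. -/
def uObj : FGModuleCat.{0} A := FGModuleCat.of A (UnitCarrier A)

variable (A) in
/-- The identification of the unit object with `ℂ`. -/
def uEquiv : ℂ ≃ₗ[ℂ] uObj A where
  toFun c := c
  invFun c := c
  left_inv _ := rfl
  right_inv _ := rfl
  map_add' _ _ := rfl
  map_smul' c d := by
    change c * d = counit (R := ℂ) (algebraMap ℂ A c) * d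
    simp

theorem smul_uEquiv (a : A) (c : ℂ) : a • uEquiv A c = uEquiv A (counit (R := ℂ) a * c) := rfl

/-- The tensor product of two morphisms. -/
def tHom {X X' Y Y' : FGModuleCat.{0} A} (f : X ⟶ X') (g : Y ⟶ Y') : tObj X Y ⟶ tObj X' Y' :=
  mkHom ((tEquiv X' Y').toLinearMap ∘ₗ map (lin f) (lin g) ∘ₗ (tEquiv X Y).symm.toLinearMap)
    fun a t => by
      obtain ⟨t, rfl⟩ := (tEquiv X Y).surjective t
      simp only [LinearMap.comp_apply, LinearEquiv.coe_coe, smul_tEquiv,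
        LinearEquiv.symm_apply_apply, map_tensorAct]

@[simp] theorem tHom_tmk {X X' Y Y' : FGModuleCat.{0} A} (f : X ⟶ X') (g : Y ⟶ Y') (x : X) (y : Y) :
    (tHom f g).hom.hom (tmk x y) = tmk (f.hom.hom x) (g.hom.hom y) := by
  simp [tHom, tmk]

/-- The standard associativity equivalence. -/
def assocEquiv (X Y Z : FGModuleCat.{0} A) : tObj (tObj X Y) Z ≃ₗ[ℂ] tObj X (tObj Y Z) :=
  (tEquiv _ _).symm ≪≫ₗ congr (tEquiv X Y).symm (.refl ℂ Z) ≪≫ₗ TensorProduct.assoc ℂ X Y Z ≪≫ₗ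
    congr (.refl ℂ X) (tEquiv Y Z) ≪≫ₗ tEquiv _ _

theorem assocEquiv_tmk {X Y Z : FGModuleCat.{0} A} (x : X) (y : Y) (z : Z) :
    assocEquiv X Y Z (tmk (tmk x y) z) = tmk x (tmk y z) := by
  simp [assocEquiv, tEquiv_symm_tmk, tEquiv_tmul]

/-- `a ↦ a x`, as a linear map. -/
def actOn {X : FGModuleCat.{0} A} (x : X) : A →ₗ[ℂ] X :=
  LinearMap.applyₗ x ∘ₗ (Algebra.lsmul ℂ ℂ X).toLinearMap

@[simp] theorem actOn_apply {X : FGModuleCat.{0} A} (x : X) (a : A) : actOn x a = a • x := rfl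

/-- `a ⊗ b ↦ a x ⊗ b y`. -/
def act₂ {X Y : FGModuleCat.{0} A} (x : X) (y : Y) : A ⊗[ℂ] A →ₗ[ℂ] tObj X Y :=
  (tEquiv X Y).toLinearMap ∘ₗ map (actOn x) (actOn y)

@[simp] theorem act₂_tmul {X Y : FGModuleCat.{0} A} (x : X) (y : Y) (a b : A) :
    act₂ x y (a ⊗ₜ b) = tmk (a • x) (b • y) := rfl

theorem tEquiv_tensorAct {X Y : FGModuleCat.{0} A} (x : X) (y : Y) (s : A ⊗[ℂ] A) :
    tEquiv X Y (tensorAct X Y s (x ⊗ₜ y)) = act₂ x y s := by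
  induction s with
  | zero => simp
  | add s₁ s₂ h₁ h₂ => simp only [map_add, LinearMap.add_apply, h₁, h₂]
  | tmul a b => rw [tensorAct_tmul]; rfl

theorem smul_tmk {X Y : FGModuleCat.{0} A} (a : A) (x : X) (y : Y) :
    a • tmk x y = act₂ x y (comul a) := by
  rw [tmk, smul_tEquiv, tEquiv_tensorAct]

/-- `a ⊗ (b ⊗ c) ↦ a x ⊗ (b y ⊗ c z)`. -/
def act₃ {X Y Z : FGModuleCat.{0} A} (x : X) (y : Y) (z : Z) :
    A ⊗[ℂ] (A ⊗[ℂ] A) →ₗ[ℂ] tObj X (tObj Y Z) :=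
  (tEquiv X _).toLinearMap ∘ₗ map (actOn x) (act₂ y z)

@[simp] theorem act₃_tmul {X Y Z : FGModuleCat.{0} A} (x : X) (y : Y) (z : Z) (a b c : A) :
    act₃ x y z (a ⊗ₜ (b ⊗ₜ c)) = tmk (a • x) (tmk (b • y) (c • z)) := rfl

theorem smul_tmk_tmk {X Y Z : FGModuleCat.{0} A} (a : A) (x : X) (y : Y) (z : Z) :
    a • tmk x (tmk y z) = act₃ x y z (map .id comul (comul a)) := by
  rw [smul_tmk]
  generalize comul (R := ℂ) a = t
  induction t with
  | zero => simp
  | add s₁ s₂ h₁ h₂ => simp only [map_add, h₁, h₂]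
  | tmul b c =>
    rw [act₂_tmul, smul_tmk, map_tmul]
    rfl

theorem assocEquiv_smul_tmk {X Y Z : FGModuleCat.{0} A} (a : A) (x : X) (y : Y) (z : Z) :
    assocEquiv X Y Z (a • tmk (tmk x y) z) =
      act₃ x y z (TensorProduct.assoc ℂ A A A (map comul .id (comul a))) := by
  rw [smul_tmk]
  generalize comul (R := ℂ) a = t
  induction t with
  | zero => simp
  | add s₁ s₂ h₁ h₂ => simp only [map_add, h₁, h₂]
  | tmul b c =>
    rw [act₂_tmul, smul_tmk, map_tmul]
    generalize comul (R := ℂ) b = t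
    induction t with
    | zero => simp [tmk]
    | add s₁ s₂ h₁ h₂ =>
      rw [map_add, add_tmul, map_add, map_add, ← h₁, ← h₂, ← map_add]
      simp [tmk, add_tmul]
    | tmul b d => rw [act₂_tmul, assocEquiv_tmk]; rfl

/-- The associativity equivalence is linear over `A` since the comultiplication is coassociative.
-/
theorem assocEquiv_smul {X Y Z : FGModuleCat.{0} A} (a : A) (t : tObj (tObj X Y) Z) :
    assocEquiv X Y Z (a • t) = a • assocEquiv X Y Z t := by
  refine tObj_induction (P := fun t => assocEquiv X Y Z (a • t) = a • assocEquiv X Y Z t) t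
    (fun s z => ?_) fun s t hs ht => by rw [smul_add, map_add, map_add, smul_add, hs, ht]
  refine tObj_induction
    (P := fun s => assocEquiv X Y Z (a • tmk s z) = a • assocEquiv X Y Z (tmk s z)) s
    (fun x y => ?_) fun s t hs ht => ?_
  · rw [assocEquiv_smul_tmk, assocEquiv_tmk, smul_tmk_tmk]
    congr 1
    exact Coalgebra.coassoc_apply a
  · have : tmk (s + t) z = tmk s z + tmk t z := by simp [tmk, add_tmul]
    rw [this, smul_add, map_add, map_add, smul_add, hs, ht]

/-- The left unit equivalence. -/
def lunitEquiv (X : FGModuleCat.{0} A) : tObj (uObj A) X ≃ₗ[ℂ] X :=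
  (tEquiv _ _).symm ≪≫ₗ congr (uEquiv A).symm (.refl ℂ X) ≪≫ₗ TensorProduct.lid ℂ X

theorem lunitEquiv_tmk {X : FGModuleCat.{0} A} (c : ℂ) (x : X) :
    lunitEquiv X (tmk (uEquiv A c) x) = c • x := by
  simp [lunitEquiv, tEquiv_symm_tmk]

/-- The right unit equivalence. -/
def runitEquiv (X : FGModuleCat.{0} A) : tObj X (uObj A) ≃ₗ[ℂ] X :=
  (tEquiv _ _).symm ≪≫ₗ congr (.refl ℂ X) (uEquiv A).symm ≪≫ₗ TensorProduct.rid ℂ X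

theorem runitEquiv_tmk {X : FGModuleCat.{0} A} (x : X) (c : ℂ) :
    runitEquiv X (tmk x (uEquiv A c)) = c • x := by
  simp [runitEquiv, tEquiv_symm_tmk]

theorem lunitEquiv_smul {X : FGModuleCat.{0} A} (a : A) (t : tObj (uObj A) X) :
    lunitEquiv X (a • t) = a • lunitEquiv X t := by
  refine tObj_induction (P := fun t => lunitEquiv X (a • t) = a • lunitEquiv X t) t
    (fun s x => ?_) fun s t hs ht => by rw [smul_add, map_add, map_add, smul_add, hs, ht]
  obtain ⟨c, rfl⟩ := (uEquiv A).surjective s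
  rw [lunitEquiv_tmk, smul_tmk]
  have h : ∀ t : A ⊗[ℂ] A, lunitEquiv X (act₂ (uEquiv A c) x t) =
      c • TensorProduct.lid ℂ A (counit.rTensor A t) • x := by
    intro t
    induction t with
    | zero => simp
    | add s₁ s₂ h₁ h₂ => simp only [map_add, h₁, h₂, add_smul, smul_add]
    | tmul a b =>
      rw [act₂_tmul, smul_uEquiv, lunitEquiv_tmk, LinearMap.rTensor_tmul, lid_tmul, smul_assoc,
        smul_smul, mul_comm]
  rw [h, Coalgebra.rTensor_counit_comul, lid_tmul, one_smul, smul_comm]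

theorem runitEquiv_smul {X : FGModuleCat.{0} A} (a : A) (t : tObj X (uObj A)) :
    runitEquiv X (a • t) = a • runitEquiv X t := by
  refine tObj_induction (P := fun t => runitEquiv X (a • t) = a • runitEquiv X t) t
    (fun x s => ?_) fun s t hs ht => by rw [smul_add, map_add, map_add, smul_add, hs, ht]
  obtain ⟨c, rfl⟩ := (uEquiv A).surjective s
  rw [runitEquiv_tmk, smul_tmk]
  have h : ∀ t : A ⊗[ℂ] A, runitEquiv X (act₂ x (uEquiv A c) t) =
      c • TensorProduct.rid ℂ A (counit.lTensor A t) • x := by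
    intro t
    induction t with
    | zero => simp
    | add s₁ s₂ h₁ h₂ => simp only [map_add, h₁, h₂, add_smul, smul_add]
    | tmul a b =>
      rw [act₂_tmul, smul_uEquiv, runitEquiv_tmk, LinearMap.lTensor_tmul, rid_tmul, smul_assoc,
        smul_smul, mul_comm]
  rw [h, Coalgebra.lTensor_counit_comul, rid_tmul, one_smul, smul_comm]

/-- The associativity isomorphism. -/
def aIso (X Y Z : FGModuleCat.{0} A) : tObj (tObj X Y) Z ≅ tObj X (tObj Y Z) :=
  mkIso (assocEquiv X Y Z) assocEquiv_smul

/-- The left unit isomorphism. -/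
def lIso (X : FGModuleCat.{0} A) : tObj (uObj A) X ≅ X := mkIso (lunitEquiv X) lunitEquiv_smul

/-- The right unit isomorphism. -/
def rIso (X : FGModuleCat.{0} A) : tObj X (uObj A) ≅ X := mkIso (runitEquiv X) runitEquiv_smul

@[simp] theorem aIso_tmk {X Y Z : FGModuleCat.{0} A} (x : X) (y : Y) (z : Z) :
    (aIso X Y Z).hom.hom.hom (tmk (tmk x y) z) = tmk x (tmk y z) := assocEquiv_tmk x y z

@[simp] theorem aIso_inv_tmk {X Y Z : FGModuleCat.{0} A} (x : X) (y : Y) (z : Z) :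
    (aIso X Y Z).inv.hom.hom (tmk x (tmk y z)) = tmk (tmk x y) z := by
  apply (assocEquiv X Y Z).injective
  rw [assocEquiv_tmk]
  exact (assocEquiv X Y Z).apply_symm_apply _

@[simp] theorem lIso_tmk {X : FGModuleCat.{0} A} (c : ℂ) (x : X) :
    (lIso X).hom.hom.hom (tmk (uEquiv A c) x) = c • x := lunitEquiv_tmk c x

@[simp] theorem rIso_tmk {X : FGModuleCat.{0} A} (c : ℂ) (x : X) :
    (rIso X).hom.hom.hom (tmk x (uEquiv A c)) = c • x := runitEquiv_tmk x c

theorem tHom_id (X Y : FGModuleCat.{0} A) : tHom (𝟙 X) (𝟙 Y) = 𝟙 (tObj X Y) :=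
  tObj_hom_ext fun x y => by simp

theorem tHom_comp {X Y Z X' Y' Z' : FGModuleCat.{0} A} (f : X ⟶ Y) (g : X' ⟶ Y') (f' : Y ⟶ Z)
    (g' : Y' ⟶ Z') : tHom f g ≫ tHom f' g' = tHom (f ≫ f') (g ≫ g') :=
  tObj_hom_ext fun x y => by simp

theorem aIso_naturality {X Y Z X' Y' Z' : FGModuleCat.{0} A} (f : X ⟶ X') (g : Y ⟶ Y')
    (h : Z ⟶ Z') :
    tHom (tHom f g) h ≫ (aIso X' Y' Z').hom = (aIso X Y Z).hom ≫ tHom f (tHom g h) :=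
  tObj_hom_ext₃ fun x y z => by simp

theorem lIso_naturality {X Y : FGModuleCat.{0} A} (f : X ⟶ Y) :
    tHom (𝟙 (uObj A)) f ≫ (lIso Y).hom = (lIso X).hom ≫ f :=
  tObj_hom_ext fun s x => by
    obtain ⟨c, rfl⟩ := (uEquiv A).surjective s
    simp

theorem rIso_naturality {X Y : FGModuleCat.{0} A} (f : X ⟶ Y) :
    tHom f (𝟙 (uObj A)) ≫ (rIso Y).hom = (rIso X).hom ≫ f :=
  tObj_hom_ext fun x s => by
    obtain ⟨c, rfl⟩ := (uEquiv A).surjective s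
    simp

theorem pentagon_aIso (W X Y Z : FGModuleCat.{0} A) :
    tHom (aIso W X Y).hom (𝟙 Z) ≫ (aIso W (tObj X Y) Z).hom ≫ tHom (𝟙 W) (aIso X Y Z).hom =
      (aIso (tObj W X) Y Z).hom ≫ (aIso W X (tObj Y Z)).hom :=
  tObj_hom_ext₄ fun w x y z => by simp

theorem smul_tmk_left {X Y : FGModuleCat.{0} A} (c : ℂ) (x : X) (y : Y) :
    tmk (c • x) y = c • tmk x y := by
  rw [tmk, ← smul_tmul', map_smul, tmk]

theorem smul_tmk_right {X Y : FGModuleCat.{0} A} (c : ℂ) (x : X) (y : Y) :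
    tmk x (c • y) = c • tmk x y := by
  rw [tmk, tmul_smul, map_smul, tmk]

theorem triangle_aIso (X Y : FGModuleCat.{0} A) :
    (aIso X (uObj A) Y).hom ≫ tHom (𝟙 X) (lIso Y).hom = tHom (rIso X).hom (𝟙 Y) :=
  tObj_hom_ext₃ fun x s y => by
    obtain ⟨c, rfl⟩ := (uEquiv A).surjective s
    simp [smul_tmk_left, smul_tmk_right]

/-- The tensor product over `ℂ`, with the action through the comultiplication. -/
instance : MonoidalCategoryStruct (FGModuleCat.{0} A) where
  tensorObj := tObj
  whiskerLeft X _ _ f := tHom (𝟙 X) f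
  whiskerRight f Y := tHom f (𝟙 Y)
  tensorHom := tHom
  tensorUnit := uObj A
  associator := aIso
  leftUnitor := lIso
  rightUnitor := rIso

/-- The monoidal category of finite-dimensional modules over a bialgebra. -/
instance : MonoidalCategory (FGModuleCat.{0} A) :=
  MonoidalCategory.ofTensorHom
    (id_tensorHom_id := tHom_id)
    (id_tensorHom := fun _ _ _ _ => rfl)
    (tensorHom_id := fun _ _ => rfl)
    (tensorHom_comp_tensorHom := tHom_comp)
    (associator_naturality := aIso_naturality)
    (leftUnitor_naturality := lIso_naturality)
    (rightUnitor_naturality := rIso_naturality)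
    (pentagon := pentagon_aIso)
    (triangle := triangle_aIso)

end HopfModule

end NicholsDouble
end

noncomputable section
set_option linter.unusedSectionVars false

namespace NicholsDouble

open Coalgebra (comul counit)

namespace HopfModule
open TensorProduct MonoidalCategory
open scoped ModuleCat

/-! ### Linearity of the tensor product, and the braiding -/

section Linear
variable {A : Type} [Ring A] [Bialgebra ℂ A] [Module.Finite ℂ A]

theorem tmk_add {X Y : FGModuleCat.{0} A} (x : X) (y y' : Y) :
    tmk x (y + y') = tmk x y + tmk x y' := by rw [tmk, tmul_add, map_add]; rfl

theorem add_tmk {X Y : FGModuleCat.{0} A} (x x' : X) (y : Y) :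
    tmk (x + x') y = tmk x y + tmk x' y := by rw [tmk, add_tmul, map_add]; rfl

theorem tmk_sum {ι : Type*} (s : Finset ι) {X Y : FGModuleCat.{0} A} (x : X) (y : ι → Y) :
    tmk x (∑ i ∈ s, y i) = ∑ i ∈ s, tmk x (y i) := by
  simp only [tmk, tmul_sum, map_sum]

theorem sum_tmk {ι : Type*} (s : Finset ι) {X Y : FGModuleCat.{0} A} (x : ι → X) (y : Y) :
    tmk (∑ i ∈ s, x i) y = ∑ i ∈ s, tmk (x i) y := by
  simp only [tmk, sum_tmul, map_sum]

instance : MonoidalPreadditive (FGModuleCat.{0} A) where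
  whiskerLeft_zero {X Y Z} := tObj_hom_ext fun x y => by
    refine (tHom_tmk (𝟙 X) (0 : Y ⟶ Z) x y).trans ?_
    change tEquiv X Z (x ⊗ₜ 0) = 0
    rw [tmul_zero, map_zero]
  zero_whiskerRight {X Y Z} := tObj_hom_ext fun x y => by
    refine (tHom_tmk (0 : Y ⟶ Z) (𝟙 X) x y).trans ?_
    change tEquiv Z X (0 ⊗ₜ y) = 0
    rw [zero_tmul, map_zero]
  whiskerLeft_add {X Y Z} f g := tObj_hom_ext fun x y => by
    refine (tHom_tmk (𝟙 X) (f + g) x y).trans ((tmk_add _ _ _).trans ?_)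
    exact (congrArg₂ (· + ·) (tHom_tmk (𝟙 X) f x y) (tHom_tmk (𝟙 X) g x y)).symm
  add_whiskerRight {X Y Z} f g := tObj_hom_ext fun x y => by
    refine (tHom_tmk (f + g) (𝟙 X) x y).trans ((add_tmk _ _ _).trans ?_)
    exact (congrArg₂ (· + ·) (tHom_tmk f (𝟙 X) x y) (tHom_tmk g (𝟙 X) x y)).symm

instance : MonoidalLinear ℂ (FGModuleCat.{0} A) where
  whiskerLeft_smul X {Y Z} c f := tObj_hom_ext fun x y => by
    refine (tHom_tmk (𝟙 X) (c • f) x y).trans ((smul_tmk_right c x (f.hom.hom y)).trans ?_)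
    exact (congrArg (c • ·) (tHom_tmk (𝟙 X) f x y)).symm
  smul_whiskerRight c {Y Z} f X := tObj_hom_ext fun x y => by
    refine (tHom_tmk (c • f) (𝟙 X) x y).trans ((smul_tmk_left c (f.hom.hom x) y).trans ?_)
    exact (congrArg (c • ·) (tHom_tmk f (𝟙 X) x y)).symm

end Linear

section Braiding
variable {A : Type} [Ring A] [Bialgebra ℂ A] [Module.Finite ℂ A]
  {ι : Type} [Fintype ι] {u v : ι → A}

/-- The action of an invertible element of `A ⊗ A`. -/
def actEquiv (s : (A ⊗[ℂ] A)ˣ) (X Y : FGModuleCat.{0} A) : X ⊗[ℂ] Y ≃ₗ[ℂ] X ⊗[ℂ] Y :=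
  .ofLinearMap (tensorAct X Y s) (tensorAct X Y ↑s⁻¹)
    (LinearMap.ext fun t => by
      rw [LinearMap.comp_apply, ← tensorAct_mul, Units.mul_inv, tensorAct_one, LinearMap.id_apply])
    (LinearMap.ext fun t => by
      rw [LinearMap.comp_apply, ← tensorAct_mul, Units.inv_mul, tensorAct_one, LinearMap.id_apply])

/-- `t ↦ τ(Rt)`, with `τ` the flip. -/
def braidEquiv (h : IsUniversalR u v) (X Y : FGModuleCat.{0} A) : tObj X Y ≃ₗ[ℂ] tObj Y X :=
  (tEquiv X Y).symm ≪≫ₗ actEquiv h.isUnit.unit X Y ≪≫ₗ TensorProduct.comm ℂ X Y ≪≫ₗ tEquiv Y X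

theorem braidEquiv_tEquiv (h : IsUniversalR u v) {X Y : FGModuleCat.{0} A} (t : X ⊗[ℂ] Y) :
    braidEquiv h X Y (tEquiv X Y t) =
      tEquiv Y X (TensorProduct.comm ℂ X Y (tensorAct X Y (∑ i, u i ⊗ₜ v i) t)) := by
  simp only [braidEquiv, LinearEquiv.trans_apply, LinearEquiv.symm_apply_apply]
  rfl

theorem braidEquiv_tmk (h : IsUniversalR u v) {X Y : FGModuleCat.{0} A} (x : X) (y : Y) :
    braidEquiv h X Y (tmk x y) = ∑ i, tmk (v i • y) (u i • x) := by
  rw [tmk, braidEquiv_tEquiv, map_sum, LinearMap.sum_apply, map_sum, map_sum]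
  exact Finset.sum_congr rfl fun i _ => by rw [tensorAct_tmul, comm_tmul, tEquiv_tmul]

/-- The braiding is linear over `A` since `R` intertwines the comultiplication with its opposite.
-/
theorem braidEquiv_smul (h : IsUniversalR u v) {X Y : FGModuleCat.{0} A} (a : A) (t : tObj X Y) :
    braidEquiv h X Y (a • t) = a • braidEquiv h X Y t := by
  obtain ⟨t, rfl⟩ := (tEquiv X Y).surjective t
  rw [smul_tEquiv, braidEquiv_tEquiv, braidEquiv_tEquiv, smul_tEquiv, ← tensorAct_mul,
    h.intertwine, tensorAct_mul, comm_tensorAct, comm_tensorAct, TensorProduct.comm_comm]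

/-- The braiding. -/
def bIso (h : IsUniversalR u v) (X Y : FGModuleCat.{0} A) : tObj X Y ≅ tObj Y X :=
  mkIso (braidEquiv h X Y) (braidEquiv_smul h)

theorem bIso_tmk (h : IsUniversalR u v) {X Y : FGModuleCat.{0} A} (x : X) (y : Y) :
    (bIso h X Y).hom.hom.hom (tmk x y) = ∑ i, tmk (v i • y) (u i • x) := braidEquiv_tmk h x y

theorem bIso_naturality (h : IsUniversalR u v) {X X' Y Y' : FGModuleCat.{0} A} (f : X ⟶ X')
    (g : Y ⟶ Y') : tHom f g ≫ (bIso h X' Y').hom = (bIso h X Y).hom ≫ tHom g f :=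
  tObj_hom_ext fun x y => by simp [bIso_tmk]

theorem aIso_act₂ {X Y Z : FGModuleCat.{0} A} (x : X) (y : Y) (z : Z) (s : A ⊗[ℂ] A) (c : A) :
    (aIso X Y Z).hom.hom.hom (tmk (act₂ x y s) (c • z)) =
      act₃ x y z (TensorProduct.assoc ℂ A A A (s ⊗ₜ c)) := by
  induction s with
  | zero => simp [tmk]
  | add s₁ s₂ h₁ h₂ => rw [map_add, add_tmk, map_add, h₁, h₂, add_tmul, map_add, map_add]
  | tmul a b => rw [act₂_tmul, aIso_tmk, assoc_tmul, act₃_tmul]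

/-- The formula for `(id ⊗ Δ)(R)` is the first hexagon identity. -/
theorem hexagon_forward (h : IsUniversalR u v) (X Y Z : FGModuleCat.{0} A) :
    (aIso X Y Z).hom ≫ (bIso h X (tObj Y Z)).hom ≫ (aIso Y Z X).hom =
      tHom (bIso h X Y).hom (𝟙 Z) ≫ (aIso Y X Z).hom ≫ tHom (𝟙 Y) (bIso h X Z).hom :=
  tObj_hom_ext₃ fun x y z => by
    have key : ∑ i, act₃ y z x (TensorProduct.assoc ℂ A A A (comul (v i) ⊗ₜ u i)) =
        ∑ i, ∑ j, tmk (v j • y) (tmk (v i • z) ((u i * u j) • x)) := by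
      have := congrArg (fun t => act₃ y z x (TensorProduct.assoc ℂ A A A
        (TensorProduct.comm ℂ A (A ⊗[ℂ] A) t))) h.comul_right
      simpa only [map_sum, comm_tmul, assoc_tmul, act₃_tmul] using this
    simp only [FGModuleCat.hom_hom_comp, LinearMap.comp_apply, aIso_tmk, bIso_tmk, tHom_tmk,
      map_sum, smul_tmk, aIso_act₂, sum_tmk, FGModuleCat.hom_hom_id, LinearMap.id_apply, tmk_sum]
    rw [key, Finset.sum_comm]
    simp only [mul_smul]

/-- The formula for `(Δ ⊗ id)(R)` is the second hexagon identity. -/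
theorem hexagon_reverse (h : IsUniversalR u v) (X Y Z : FGModuleCat.{0} A) :
    (aIso X Y Z).inv ≫ (bIso h (tObj X Y) Z).hom ≫ (aIso Z X Y).inv =
      tHom (𝟙 X) (bIso h Y Z).hom ≫ (aIso X Z Y).inv ≫ tHom (bIso h X Z).hom (𝟙 Y) :=
  tObj_hom_ext₃' fun x y z => by
    have key : ∑ i, act₃ z x y (v i ⊗ₜ comul (u i)) =
        ∑ i, ∑ j, tmk ((v i * v j) • z) (tmk (u i • x) (u j • y)) := by
      have := congrArg (fun t => act₃ z x y (TensorProduct.comm ℂ (A ⊗[ℂ] A) A t)) h.comul_left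
      simpa only [map_sum, comm_tmul, act₃_tmul] using this
    have e (i : ι) : tmk (v i • z) (u i • tmk x y) = act₃ z x y (v i ⊗ₜ comul (u i)) := by
      rw [smul_tmk]; rfl
    simp only [FGModuleCat.hom_hom_comp, LinearMap.comp_apply, aIso_inv_tmk, bIso_tmk, tHom_tmk,
      map_sum, e, sum_tmk, FGModuleCat.hom_hom_id, LinearMap.id_apply, tmk_sum]
    rw [← map_sum, key, map_sum, Finset.sum_comm]
    simp only [map_sum, aIso_inv_tmk, mul_smul]

/-- The braiding given by a universal `R`-matrix. -/
@[reducible]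
def braidedCategory (h : IsUniversalR u v) : BraidedCategory (FGModuleCat.{0} A) where
  braiding := bIso h
  braiding_naturality_right X _ _ f := bIso_naturality h (𝟙 X) f
  braiding_naturality_left f Z := bIso_naturality h f (𝟙 Z)
  hexagon_forward := hexagon_forward h
  hexagon_reverse := hexagon_reverse h

/-- The braided monoidal structure given by a universal `R`-matrix is the one prescribed by
`BraidedTensorData`. -/
def braidedTensorData (h : IsUniversalR u v) :
    letI := braidedCategory h
    BraidedTensorData (comul : A →ₗ[ℂ] A ⊗[ℂ] A) (counit : A →ₗ[ℂ] ℂ) (∑ i, u i ⊗ₜ v i) :=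
  letI := braidedCategory h
  { tensorEquiv := tEquiv
    unitEquiv := uEquiv A
    smul_tensor := smul_tEquiv
    smul_unit := smul_uEquiv
    tensor_hom := tHom_tmk
    associator := fun _ _ _ => aIso_tmk
    leftUnitor := fun _ x => (lIso_tmk 1 x).trans (one_smul _ _)
    rightUnitor := fun _ x => (rIso_tmk 1 x).trans (one_smul _ _)
    braiding := fun _ _ => braidEquiv_tEquiv h }

end Braiding
end HopfModule

end NicholsDouble
end

noncomputable section
set_option linter.unusedSectionVars false

namespace NicholsDouble

open Coalgebra (comul counit)

namespace HopfModule
open TensorProduct MonoidalCategory HopfAlgebra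
open scoped ModuleCat

/-! ### Finiteness conditions, the unit object, and dual modules -/

section Finiteness
variable {A : Type} [Ring A] [Algebra ℂ A] [Module.Finite ℂ A]

theorem hom_smul {X Y : FGModuleCat.{0} A} (f : X ⟶ Y) (c : ℂ) (x : X) :
    f.hom.hom (c • x) = c • f.hom.hom x := map_smul (lin f) c x

theorem hom_sum {ι : Type*} (s : Finset ι) {X Y : FGModuleCat.{0} A} (f : ι → (X ⟶ Y)) (x : X) :
    (∑ i ∈ s, f i).hom.hom x = ∑ i ∈ s, (f i).hom.hom x :=
  map_sum ({ toFun := fun f => f.hom.hom x, map_zero' := rfl, map_add' := fun _ _ => rfl } :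
    (X ⟶ Y) →+ Y) f s

theorem finite_hom (X Y : FGModuleCat.{0} A) : Module.Finite ℂ (X ⟶ Y) := by
  have : Module.Finite ℂ X := Module.Finite.trans A X
  have : Module.Finite ℂ Y := Module.Finite.trans A Y
  let F : (X ⟶ Y) →ₗ[ℂ] (X →ₗ[ℂ] Y) :=
    { toFun := lin
      map_add' := fun _ _ => rfl
      map_smul' := fun _ _ => rfl }
  refine Module.Finite.of_injective F fun f g h => ?_
  ext x
  exact LinearMap.congr_fun h x

variable [IsNoetherianRing A]

/-- The image of a subobject is a submodule, and this is strictly monotone. -/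
theorem strictMono_range_arrow (X : FGModuleCat.{0} A) :
    StrictMono fun S : Subobject X => LinearMap.range S.arrow.hom.hom := by
  intro S T hST
  have comm (s : (S : FGModuleCat.{0} A)) :
      T.arrow.hom.hom ((Subobject.ofLE S T hST.le).hom.hom s) = S.arrow.hom.hom s :=
    congrArg (fun f => f.hom.hom s) (Subobject.ofLE_arrow hST.le)
  refine lt_of_le_of_ne ?_ fun heq => hST.not_ge ?_
  · rintro _ ⟨s, rfl⟩
    exact ⟨_, comm s⟩
  · have hepi : Epi (Subobject.ofLE S T hST.le) := by
      refine (fg_epi_iff _).2 fun t => ?_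
      have heq' : LinearMap.range S.arrow.hom.hom = LinearMap.range T.arrow.hom.hom := heq
      obtain ⟨s, hs⟩ := heq'.ge (LinearMap.mem_range_self _ t)
      exact ⟨s, (fg_mono_iff T.arrow).1 inferInstance ((comm s).trans hs)⟩
    have : IsIso (Subobject.ofLE S T hST.le) := isIso_of_mono_of_epi _
    exact Subobject.le_of_comm (inv (Subobject.ofLE S T hST.le)) (by
      rw [IsIso.inv_comp_eq, Subobject.ofLE_arrow])

theorem isNoetherianObject (X : FGModuleCat.{0} A) : IsNoetherianObject X :=
  ⟨(strictMono_range_arrow X).wellFoundedGT⟩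

theorem isArtinianObject (X : FGModuleCat.{0} A) : IsArtinianObject X :=
  have : IsArtinianRing A := .of_finite ℂ A
  ⟨(strictMono_range_arrow X).wellFoundedLT⟩

end Finiteness

section Unit
variable {A : Type} [Ring A] [Bialgebra ℂ A] [Module.Finite ℂ A] [IsNoetherianRing A]

theorem simple_uObj : Simple (uObj A) := by
  rw [fg_simple_iff, isSimpleModule_iff_toSpanSingleton_surjective]
  refine ⟨(uEquiv A).symm.toEquiv.nontrivial, fun x hx y => ?_⟩
  obtain ⟨c, rfl⟩ := (uEquiv A).surjective x
  obtain ⟨d, rfl⟩ := (uEquiv A).surjective y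
  have hc : c ≠ 0 := fun h => hx (by rw [h, map_zero])
  refine ⟨algebraMap ℂ A (d / c), ?_⟩
  rw [LinearMap.toSpanSingleton_apply, smul_uEquiv, Bialgebra.counit_algebraMap,
    div_mul_cancel₀ _ hc]

attribute [local instance] Limits.HasFiniteBiproducts.of_hasFiniteProducts

/-- A module on which the algebra acts through the counit is a sum of copies of the unit object. -/
theorem exists_iso_biproduct_unit (X : FGModuleCat.{0} A)
    (h : ∀ (a : A) (x : X), a • x = counit (R := ℂ) a • x) :
    ∃ m : ℕ, Nonempty (X ≅ ⨁ fun _ : Fin m => 𝟙_ (FGModuleCat.{0} A)) := by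
  have := finite_complex X
  let b := Module.finBasis ℂ X
  let B : Limits.Bicone fun _ : Fin (Module.finrank ℂ X) => uObj A :=
    { pt := X
      π := fun i => mkHom ((uEquiv A).toLinearMap ∘ₗ b.coord i) fun a x => by
        rw [h, map_smul, LinearMap.comp_apply, LinearEquiv.coe_coe, smul_uEquiv, ← smul_eq_mul,
          map_smul]
      ι := fun i => mkHom (LinearMap.toSpanSingleton ℂ X (b i) ∘ₗ (uEquiv A).symm.toLinearMap)
        fun a x => by
          obtain ⟨c, rfl⟩ := (uEquiv A).surjective x
          rw [smul_uEquiv, h, LinearMap.comp_apply, LinearMap.comp_apply, LinearEquiv.coe_coe,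
            LinearEquiv.symm_apply_apply, LinearEquiv.symm_apply_apply, ← smul_eq_mul, map_smul]
      ι_π := fun i j => by
        ext x
        obtain ⟨c, rfl⟩ := (uEquiv A).surjective x
        by_cases hij : i = j
        · subst hij
          simp [← map_smul]
        · simp [hij] }
  have hB : B.IsBilimit := Limits.isBilimitOfTotal B (by
    ext x
    rw [hom_sum]
    exact (Finset.sum_congr rfl fun i _ => by simp [B]).trans (b.sum_repr x))
  exact ⟨_, ⟨Limits.biproduct.uniqueUpToIso _ hB⟩⟩

end Unit

section Dual
variable {A : Type} [Ring A] [HopfAlgebra ℂ A] [Module.Finite ℂ A]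

/-- The space underlying the dual of a module over a Hopf algebra. -/
def DualCarrier (X : FGModuleCat.{0} A) : Type := Module.Dual ℂ X

instance (X : FGModuleCat.{0} A) : AddCommGroup (DualCarrier X) :=
  inferInstanceAs (AddCommGroup (Module.Dual ℂ X))

/-- The action `(a f)(x) = f(S(a) x)` on the dual space. -/
@[reducible]
def dualModule (X : FGModuleCat.{0} A) : Module A (Module.Dual ℂ X) where
  smul a f := f ∘ₗ Algebra.lsmul ℂ ℂ X (antipode ℂ a)
  one_smul f := LinearMap.ext fun x => by
    change f (antipode ℂ (1 : A) • x) = f x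
    rw [antipode_one, one_smul]
  mul_smul a b f := LinearMap.ext fun x => by
    change f (antipode ℂ (a * b) • x) = f (antipode ℂ b • antipode ℂ a • x)
    rw [antipode_mul_antidistrib, mul_smul]
  smul_zero _ := rfl
  smul_add _ _ _ := rfl
  add_smul a b f := LinearMap.ext fun x => by
    change f (antipode ℂ (a + b) • x) = f (antipode ℂ a • x) + f (antipode ℂ b • x)
    rw [map_add, add_smul, map_add]
  zero_smul f := LinearMap.ext fun x => by
    change f (antipode ℂ (0 : A) • x) = 0
    rw [map_zero, zero_smul, map_zero]

instance (X : FGModuleCat.{0} A) : Module A (DualCarrier X) := dualModule X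

theorem dualModule_algebraMap_smul (X : FGModuleCat.{0} A) (c : ℂ) (f : Module.Dual ℂ X) :
    (dualModule X).toSMul.smul (algebraMap ℂ A c) f = c • f := LinearMap.ext fun x => by
  change f (antipode ℂ (algebraMap ℂ A c) • x) = c • f x
  rw [Algebra.algebraMap_eq_smul_one, map_smul (antipode ℂ), antipode_one, smul_assoc, one_smul]
  exact map_smul f c x

instance (X : FGModuleCat.{0} A) : Module.Finite A (DualCarrier X) :=
  have := finite_complex X
  @finite_of_algebraMap_smul A _ _ _ (Module.Dual ℂ X) _ _ (dualModule X) _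
    (dualModule_algebraMap_smul X)

/-- The dual module. -/
def dObj (X : FGModuleCat.{0} A) : FGModuleCat.{0} A := FGModuleCat.of A (DualCarrier X)

/-- The identification of the dual module with the dual vector space. -/
def dEquiv (X : FGModuleCat.{0} A) : Module.Dual ℂ X ≃ₗ[ℂ] dObj X where
  toFun f := f
  invFun f := f
  left_inv _ := rfl
  right_inv _ := rfl
  map_add' _ _ := rfl
  map_smul' c f := (dualModule_algebraMap_smul X c f).symm

theorem smul_dEquiv {X : FGModuleCat.{0} A} (a : A) (f : Module.Dual ℂ X) :
    a • dEquiv X f = dEquiv X (f ∘ₗ Algebra.lsmul ℂ ℂ X (antipode ℂ a)) := rfl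

/-- The evaluation `f ⊗ x ↦ f(x)`, as a linear map. -/
def evLin (X : FGModuleCat.{0} A) : tObj (dObj X) X →ₗ[ℂ] uObj A :=
  (uEquiv A).toLinearMap ∘ₗ contractLeft ℂ X ∘ₗ
    (congr (dEquiv X).symm (.refl ℂ X)).toLinearMap ∘ₗ (tEquiv _ _).symm.toLinearMap

theorem evLin_tmk {X : FGModuleCat.{0} A} (f : Module.Dual ℂ X) (x : X) :
    evLin X (tmk (dEquiv X f) x) = uEquiv A (f x) := by
  simp [evLin, tEquiv_symm_tmk]

theorem evLin_act₂ {X : FGModuleCat.{0} A} (f : Module.Dual ℂ X) (x : X) (s : A ⊗[ℂ] A) :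
    evLin X (act₂ (dEquiv X f) x s) =
      uEquiv A (f (LinearMap.mul' ℂ A ((antipode ℂ).rTensor A s) • x)) := by
  induction s with
  | zero => simp
  | add s₁ s₂ h₁ h₂ => simp only [map_add, h₁, h₂, add_smul]
  | tmul a b =>
    rw [act₂_tmul, smul_dEquiv, evLin_tmk, LinearMap.rTensor_tmul, LinearMap.mul'_apply, mul_smul]
    rfl

/-- The evaluation. -/
def ev (X : FGModuleCat.{0} A) : tObj (dObj X) X ⟶ uObj A :=
  mkHom (evLin X) fun a t => by
    refine tObj_induction (P := fun t => evLin X (a • t) = a • evLin X t) t (fun f x => ?_)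
      fun s t hs ht => by rw [smul_add, map_add, map_add, smul_add, hs, ht]
    obtain ⟨f, rfl⟩ := (dEquiv X).surjective f
    rw [smul_tmk, evLin_act₂, mul_antipode_rTensor_comul_apply, evLin_tmk, smul_uEquiv,
      algebraMap_smul, map_smul, smul_eq_mul]

@[simp] theorem ev_tmk {X : FGModuleCat.{0} A} (f : Module.Dual ℂ X) (x : X) :
    (ev X).hom.hom (tmk (dEquiv X f) x) = uEquiv A (f x) := evLin_tmk f x

/-- The canonical element `∑ eᵢ ⊗ eⁱ`. -/
def coevElt (X : FGModuleCat.{0} A) : tObj X (dObj X) :=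
  have := finite_complex X
  ∑ i, tmk (Module.finBasis ℂ X i) (dEquiv X ((Module.finBasis ℂ X).coord i))

/-- On the canonical element of `X ⊗ X^*`, an element `a ⊗ b` acts as `a S(b) ⊗ 1`. -/
theorem sum_act₂_coev {X : FGModuleCat.{0} A} [Module.Finite ℂ X] (s : A ⊗[ℂ] A) :
    ∑ i, act₂ (Module.finBasis ℂ X i) (dEquiv X ((Module.finBasis ℂ X).coord i)) s =
      ∑ i, tmk (LinearMap.mul' ℂ A ((antipode ℂ).lTensor A s) • Module.finBasis ℂ X i)
        (dEquiv X ((Module.finBasis ℂ X).coord i)) := by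
  set b := Module.finBasis ℂ X
  induction s with
  | zero => simp [tmk]
  | add s₁ s₂ h₁ h₂ =>
    simp only [map_add, Finset.sum_add_distrib, h₁, h₂, add_smul, add_tmk]
  | tmul a c =>
    have h1 (i) : antipode ℂ c • b i = ∑ j, b.coord j (antipode ℂ c • b i) • b j :=
      (b.sum_repr _).symm
    have h2 (j) : b.coord j ∘ₗ Algebra.lsmul ℂ ℂ X (antipode ℂ c) =
        ∑ i, b.coord j (antipode ℂ c • b i) • b.coord i :=
      (b.sum_dual_apply_smul_coord _).symm
    simp only [act₂_tmul, LinearMap.lTensor_tmul, LinearMap.mul'_apply, smul_dEquiv, h2, map_sum,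
      map_smul, tmk_sum, smul_tmk_right, mul_smul]
    rw [Finset.sum_comm]
    refine Finset.sum_congr rfl fun i _ => ?_
    conv_rhs => rw [h1, Finset.smul_sum, sum_tmk]
    exact Finset.sum_congr rfl fun j _ => by rw [smul_comm a, smul_tmk_left]

theorem smul_coevElt (X : FGModuleCat.{0} A) (a : A) :
    a • coevElt X = counit (R := ℂ) a • coevElt X := by
  have := finite_complex X
  rw [coevElt, Finset.smul_sum]
  simp only [smul_tmk]
  rw [sum_act₂_coev, mul_antipode_lTensor_comul_apply, Finset.smul_sum]
  simp only [algebraMap_smul, smul_tmk_left]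

/-- The coevaluation. -/
def coev (X : FGModuleCat.{0} A) : uObj A ⟶ tObj X (dObj X) :=
  mkHom (LinearMap.toSpanSingleton ℂ _ (coevElt X) ∘ₗ (uEquiv A).symm.toLinearMap) fun a t => by
    obtain ⟨c, rfl⟩ := (uEquiv A).surjective t
    rw [smul_uEquiv]
    simp only [LinearMap.comp_apply, LinearEquiv.coe_coe, LinearEquiv.symm_apply_apply,
      LinearMap.toSpanSingleton_apply]
    rw [smul_comm a, smul_coevElt, smul_smul, mul_comm]

@[simp] theorem coev_apply {X : FGModuleCat.{0} A} (c : ℂ) :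
    (coev X).hom.hom (uEquiv A c) = c • coevElt X := by
  simp [coev]

theorem coev_ev (X : FGModuleCat.{0} A) :
    tHom (𝟙 (dObj X)) (coev X) ≫ (aIso (dObj X) X (dObj X)).inv ≫ tHom (ev X) (𝟙 (dObj X)) =
      (rIso (dObj X)).hom ≫ (lIso (dObj X)).inv := by
  have := finite_complex X
  rw [Iso.eq_comp_inv]
  refine tObj_hom_ext fun f s => ?_
  obtain ⟨c, rfl⟩ := (uEquiv A).surjective s
  obtain ⟨f, rfl⟩ := (dEquiv X).surjective f
  have h := (Module.finBasis ℂ X).sum_dual_apply_smul_coord f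
  simp only [Category.assoc, FGModuleCat.hom_hom_comp, LinearMap.comp_apply, tHom_tmk,
    FGModuleCat.hom_hom_id, LinearMap.id_apply, coev_apply, smul_tmk_right, rIso_tmk]
  simp only [coevElt, tmk_sum, map_sum, hom_smul, aIso_inv_tmk, tHom_tmk, ev_tmk,
    FGModuleCat.hom_hom_id, LinearMap.id_apply, lIso_tmk]
  simp only [← map_smul, ← map_sum, h]

theorem ev_coev (X : FGModuleCat.{0} A) :
    tHom (coev X) (𝟙 X) ≫ (aIso X (dObj X) X).hom ≫ tHom (𝟙 X) (ev X) =
      (lIso X).hom ≫ (rIso X).inv := by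
  have := finite_complex X
  rw [Iso.eq_comp_inv]
  refine tObj_hom_ext fun s x => ?_
  obtain ⟨c, rfl⟩ := (uEquiv A).surjective s
  have h := (Module.finBasis ℂ X).sum_repr x
  simp only [Category.assoc, FGModuleCat.hom_hom_comp, LinearMap.comp_apply, tHom_tmk,
    FGModuleCat.hom_hom_id, LinearMap.id_apply, coev_apply, smul_tmk_left, lIso_tmk]
  simp only [coevElt, sum_tmk, map_sum, hom_smul, aIso_tmk, tHom_tmk, ev_tmk,
    FGModuleCat.hom_hom_id, LinearMap.id_apply, rIso_tmk, Module.Basis.coord_apply, h]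

/-- The right dual of a module over a Hopf algebra. -/
@[reducible]
def hasRightDual (X : FGModuleCat.{0} A) : HasRightDual X where
  rightDual := dObj X
  exact :=
    { coevaluation' := coev X
      evaluation' := ev X
      coevaluation_evaluation' := coev_ev X
      evaluation_coevaluation' := ev_coev X }

/-- `a ⊗ 1 = ∑ a₁ ⊗ a₂ S(a₃)`. -/
theorem sum_comul_mul_antipode (a : A) :
    TensorProduct.lift (((LinearMap.mul ℂ (A ⊗[ℂ] A)).compl₁₂ comul
      (TensorProduct.mk ℂ A A 1 ∘ₗ antipode ℂ))) (comul a) = a ⊗ₜ[ℂ] 1 := by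
  have h1 : ∀ s : A ⊗[ℂ] A, TensorProduct.lift (((LinearMap.mul ℂ (A ⊗[ℂ] A)).compl₁₂ comul
      (TensorProduct.mk ℂ A A 1 ∘ₗ antipode ℂ))) s =
      map .id (LinearMap.mul' ℂ A ∘ₗ (antipode ℂ).lTensor A)
        (TensorProduct.assoc ℂ A A A (comul.rTensor A s)) := by
    intro s
    induction s with
    | zero => simp
    | add s₁ s₂ h₁ h₂ => simp only [map_add, h₁, h₂]
    | tmul b c =>
      rw [LinearMap.rTensor_tmul, TensorProduct.lift.tmul, LinearMap.compl₁₂_apply,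
        LinearMap.mul_apply']
      generalize comul (R := ℂ) b = s
      induction s with
      | zero => simp
      | add s₁ s₂ h₁ h₂ => simp only [add_mul, add_tmul, map_add, h₁, h₂]
      | tmul b d => simp
  have h2 : ∀ s : A ⊗[ℂ] A, map .id (LinearMap.mul' ℂ A ∘ₗ (antipode ℂ).lTensor A)
      ((comul (R := ℂ)).lTensor A s) = TensorProduct.rid ℂ A (counit.lTensor A s) ⊗ₜ[ℂ] 1 := by
    intro s
    induction s with
    | zero => simp
    | add s₁ s₂ h₁ h₂ => simp only [add_tmul, map_add, h₁, h₂]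
    | tmul b c =>
      simp [mul_antipode_lTensor_comul_apply, Algebra.algebraMap_eq_smul_one, smul_tmul]
  rw [h1, Coalgebra.coassoc_apply, h2, Coalgebra.lTensor_counit_comul, rid_tmul, one_smul]

/-- An invariant form satisfies `e(a y, x) = e(y, S(a) x)`. -/
theorem hom_unit_smul_tmk {X Y : FGModuleCat.{0} A} (e : tObj Y X ⟶ uObj A) (a : A) (y : Y)
    (x : X) :
    e.hom.hom (tmk (a • y) x) = e.hom.hom (tmk y (antipode ℂ a • x)) := by
  have h1 : ∀ s : A ⊗[ℂ] A, e.hom.hom (act₂ y x (TensorProduct.lift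
      (((LinearMap.mul ℂ (A ⊗[ℂ] A)).compl₁₂ comul
      (TensorProduct.mk ℂ A A 1 ∘ₗ antipode ℂ))) s)) =
      e.hom.hom (tmk y (antipode ℂ (TensorProduct.lid ℂ A (counit.rTensor A s)) • x)) := by
    intro s
    induction s with
    | zero => simp [tmk]
    | add s₁ s₂ h₁ h₂ => simp only [map_add, add_smul, tmk_add, h₁, h₂]
    | tmul b c =>
      have h3 : ∀ t : A ⊗[ℂ] A, act₂ y x (t * (1 ⊗ₜ antipode ℂ c)) =
          act₂ y (antipode ℂ c • x) t := by
        intro t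
        induction t with
        | zero => simp
        | add s₁ s₂ h₁ h₂ => simp only [add_mul, map_add, h₁, h₂]
        | tmul b d => simp [mul_smul]
      rw [TensorProduct.lift.tmul, LinearMap.compl₁₂_apply, LinearMap.mul_apply',
        LinearMap.comp_apply, TensorProduct.mk_apply, h3, ← smul_tmk, map_smul]
      obtain ⟨r, hr⟩ := (uEquiv A).surjective (e.hom.hom (tmk y (antipode ℂ c • x)))
      rw [← hr, smul_uEquiv, LinearMap.rTensor_tmul, lid_tmul, map_smul, smul_assoc,
        smul_tmk_right, ← smul_eq_mul, map_smul, hr]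
      exact (map_smul (lin e) _ _).symm
  have h := h1 (comul a)
  rwa [sum_comul_mul_antipode, Coalgebra.rTensor_counit_comul, lid_tmul, one_smul, act₂_tmul,
    one_smul] at h

end Dual
end HopfModule

end NicholsDouble
end

noncomputable section
set_option linter.unusedSectionVars false

namespace NicholsDouble

open Coalgebra (comul counit)

/-! ### The modular structure -/

namespace HopfModule
open TensorProduct MonoidalCategory HopfAlgebra
open scoped ModuleCat

attribute [local instance] Abelian.hasFiniteBiproducts

variable {A : Type} [Ring A] [HopfAlgebra ℂ A] [Module.Finite ℂ A]

/-- The natural automorphism of the identity functor given by an invertible central element. -/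
def twistIso (t : Aˣ) (ht : ∀ a : A, a * t = t * a) : 𝟭 (FGModuleCat.{0} A) ≅ 𝟭 _ :=
  NatIso.ofComponents
    (fun X => mkIso (X := X) (Y := X)
      (.ofLinearMap (Algebra.lsmul ℂ ℂ X (t : A)) (Algebra.lsmul ℂ ℂ X (↑t⁻¹ : A))
        (LinearMap.ext fun x => by simp [← mul_smul])
        (LinearMap.ext fun x => by simp [← mul_smul]))
      fun a x => by
        change (t : A) • a • x = a • (t : A) • x
        rw [← mul_smul, ← ht, mul_smul])
    fun {X Y} f => by
      ext x
      exact (map_smul f.hom.hom (t : A) x).symm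

theorem twistIso_apply (t : Aˣ) (ht : ∀ a : A, a * t = t * a) (X : FGModuleCat.{0} A) (x : X) :
    ((twistIso t ht).hom.app X).hom.hom x = (t : A) • x := rfl

variable {ι : Type} [Fintype ι] {u v : ι → A}

/-- The double braiding is the action of `R₂₁ R`. -/
theorem bIso_bIso_tmk (h : IsUniversalR u v) {X Y : FGModuleCat.{0} A} (x : X) (y : Y) :
    ((bIso h X Y).hom ≫ (bIso h Y X).hom).hom.hom (tmk x y) =
      act₂ x y ((∑ i, v i ⊗ₜ u i) * ∑ i, u i ⊗ₜ v i) := by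
  simp only [FGModuleCat.hom_hom_comp, LinearMap.comp_apply, bIso_tmk, map_sum, Finset.sum_mul,
    Finset.mul_sum, Algebra.TensorProduct.tmul_mul_tmul, act₂_tmul, mul_smul]

/-- The formula `Δ(t) = R₂₁ R (t ⊗ t)` is the compatibility of the twist with the tensor product.
-/
theorem twistIso_tensor (h : IsUniversalR u v) (t : Aˣ) (ht : ∀ a : A, a * t = t * a)
    (hΔ : comul (R := ℂ) (t : A) = (∑ i, v i ⊗ₜ u i) * (∑ i, u i ⊗ₜ v i) * (t : A) ⊗ₜ (t : A))
    (X Y : FGModuleCat.{0} A) :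
    (twistIso t ht).hom.app (tObj X Y) =
      tHom ((twistIso t ht).hom.app X) ((twistIso t ht).hom.app Y) ≫
        (bIso h X Y).hom ≫ (bIso h Y X).hom :=
  tObj_hom_ext fun x y => by
    have h3 : ∀ s : A ⊗[ℂ] A, act₂ x y (s * (t : A) ⊗ₜ (t : A)) =
        act₂ ((t : A) • x) ((t : A) • y) s := by
      intro s
      induction s with
      | zero => simp
      | add s₁ s₂ h₁ h₂ => simp only [add_mul, map_add, h₁, h₂]
      | tmul b d => simp [mul_smul]
    rw [FGModuleCat.hom_hom_comp, LinearMap.comp_apply, tHom_tmk]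
    refine Eq.trans ?_ (bIso_bIso_tmk h _ _).symm
    rw [twistIso_apply, smul_tmk, hΔ, h3]
    rfl

/-- For any right dual, `S(t) = t` makes the dual of the twist the twist of the dual: both sides
agree after evaluation, by `hom_unit_smul_tmk`. -/
theorem twistIso_dual (t : Aˣ) (ht : ∀ a : A, a * t = t * a) (hS : antipode ℂ (t : A) = t)
    (X : FGModuleCat.{0} A) [HasRightDual X] :
    rightAdjointMate (X := X) (Y := X) ((twistIso t ht).hom.app X) =
      (twistIso t ht).hom.app (HasRightDual.rightDual X) := by
  rw [← cancel_mono (λ_ _).inv, ← tensorRightHomEquiv_whiskerLeft_comp_evaluation,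
    ← tensorRightHomEquiv_whiskerRight_comp_evaluation]
  congr 1
  symm
  refine tObj_hom_ext fun y x => ?_
  have h := hom_unit_smul_tmk (ExactPairing.evaluation X (HasRightDual.rightDual X)) (t : A) y x
  rw [hS] at h
  refine (congrArg (ExactPairing.evaluation X (HasRightDual.rightDual X)).hom.hom
    (tHom_tmk ((twistIso t ht).hom.app (HasRightDual.rightDual X)) (𝟙 X) y x)).trans
    (Eq.trans ?_ (congrArg (ExactPairing.evaluation X (HasRightDual.rightDual X)).hom.hom
      (tHom_tmk (𝟙 _) ((twistIso t ht).hom.app X) y x)).symm)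
  exact h

variable [IsNoetherianRing A]

/-- Right duals come from the antipode, and left duals from right duals by the braiding. -/
theorem isFiniteTensorCategory (h : IsUniversalR u v)
    (hs : {c : Quotient (isIsomorphicSetoid (FGModuleCat.{0} A)) |
      ∃ X : FGModuleCat.{0} A, Quotient.mk _ X = c ∧ Simple X}.Finite) :
    IsFiniteTensorCategory (FGModuleCat.{0} A) where
  finite_hom := finite_hom
  noetherian := isNoetherianObject
  artinian := isArtinianObject
  enoughProjectives := fg_enoughProjectives
  finite_simple := hs
  monoidalPreadditive := inferInstance
  monoidalLinear := inferInstance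
  hasRightDual X := ⟨hasRightDual X⟩
  hasLeftDual X :=
    letI := braidedCategory h
    letI := hasRightDual X
    ⟨BraidedCategory.hasLeftDualOfHasRightDual⟩
  simple_unit := simple_uObj

variable (A) in
/-- The regular module. -/
def regObj : FGModuleCat.{0} A := FGModuleCat.of A A

variable (A) in
/-- The identification of the regular module with the algebra. -/
def regMap : regObj A →ₗ[ℂ] A where
  toFun a := a
  map_add' _ _ := rfl
  map_smul' c a := (Algebra.smul_def (A := A) c a).symm

variable (A) in
/-- The generator of the regular module. -/
def regOne : regObj A := (1 : A)

@[simp] theorem regMap_smul_regOne (a : A) : regMap A (a • regOne A) = a := mul_one a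

end HopfModule

namespace DoubledNichols
open TensorProduct MonoidalCategory HopfAlgebra HopfModule DrinfeldDouble
open scoped ModuleCat

attribute [local instance] Abelian.hasFiniteBiproducts
variable {n : ℕ}

theorem finite_simple : {c : _root_.Quotient (isIsomorphicSetoid (DKMod n)) |
    ∃ X : DKMod n, Quotient.mk _ X = c ∧ Simple X}.Finite := by
  have : Finite Sgn := Finite.of_surjective (fun b : Bool => if b then Sgn.pos else Sgn.neg)
    fun s => s.eq_pos_or_eq_neg.elim (fun h => ⟨true, h.symm⟩) fun h => ⟨false, h.symm⟩
  refine ((Set.finite_range fun s => Quotient.mk (isIsomorphicSetoid (DKMod n)) (charObj n s)).union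
    (Set.finite_range fun s =>
      Quotient.mk (isIsomorphicSetoid (DKMod n)) (steinbergObj n s))).subset ?_
  rintro _ ⟨X, rfl, hX⟩
  obtain ⟨s, hs⟩ | ⟨s, hs⟩ := simple_classification X
  · exact Or.inl ⟨s, Quotient.sound hs⟩
  · exact Or.inr ⟨s, Quotient.sound hs⟩

/-- If the double braiding of `X` with the regular module is trivial, then the double acts on `X`
through the counit: the coefficients of `R₂₁R` in the first factor form a basis. -/
theorem smul_eq_counit_smul (X : DKMod n)
    (h : ∀ Y : DKMod n, (bIso isUniversalR X Y).hom ≫ (bIso isUniversalR Y X).hom = 𝟙 (tObj X Y))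
    (a : DoubledNichols n) (x : X) : a • x = counit (R := ℂ) a • x := by
  -- the braidings are inverse to each other in either order
  have hYX : (bIso isUniversalR (regObj _) X).hom ≫ (bIso isUniversalR X (regObj _)).hom =
      𝟙 (tObj (regObj (DoubledNichols n)) X) := by
    have := h (regObj _)
    rw [← Iso.eq_inv_comp, Category.comp_id] at this
    rw [this, Iso.inv_hom_id]
  have key (g : Nichols n) (ψ : Module.Dual ℂ (Nichols n)) (x : X) :
      ofHopf ℂ _ g • ofDual ℂ _ ψ • x = (counit (R := ℂ) g * ψ 1) • x := by
    -- the coefficient functional `φ ⊗ h ↦ φ(g) ψ(h)` of the double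
    let L : DoubledNichols n →ₗ[ℂ] ℂ :=
      LinearMap.mul' ℂ ℂ ∘ₗ map (LinearMap.applyₗ g) ψ ∘ₗ
        (DrinfeldDouble.equiv ℂ (Nichols n)).symm.toLinearMap
    have hL (φ : Module.Dual ℂ (Nichols n)) (h : Nichols n) :
        L (ofDual ℂ _ φ * ofHopf ℂ _ h) = φ g * ψ h := by
      rw [ofDual_mul_ofHopf]
      simp [L]
    let M : tObj (regObj (DoubledNichols n)) X →ₗ[ℂ] X := (TensorProduct.lid ℂ X).toLinearMap ∘ₗ
      map (L ∘ₗ regMap (DoubledNichols n)) .id ∘ₗ (tEquiv _ X).symm.toLinearMap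
    have hM (y : regObj (DoubledNichols n)) (x : X) : M (tmk y x) = L (regMap _ y) • x := by
      simp only [M, LinearMap.comp_apply, LinearEquiv.coe_coe, tEquiv_symm_tmk, map_tmul, lid_tmul,
        LinearMap.id_apply]
    have h1 : M (act₂ (regOne (DoubledNichols n)) x
        ((∑ i, rSnd i ⊗ₜ rFst i) * ∑ i, rFst i ⊗ₜ rSnd i)) = L 1 • x := by
      rw [← bIso_bIso_tmk isUniversalR, hYX, FGModuleCat.hom_hom_id, LinearMap.id_apply, hM,
        ← one_smul (DoubledNichols n) (regOne _), regMap_smul_regOne]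
    have hg := (Nichols.basis n).sum_repr g
    have hψ := (Nichols.basis n).sum_dual_apply_smul_coord ψ
    have hL1 : L 1 = counit (R := ℂ) g * ψ 1 := by
      have := hL counit 1
      rwa [ofDual_counit, ofHopf_one, one_mul] at this
    simp only [Finset.sum_mul, Finset.mul_sum, Algebra.TensorProduct.tmul_mul_tmul, map_sum,
      act₂_tmul, hM, regMap_smul_regOne, hL1, rFst, rSnd, hL] at h1
    rw [← h1]
    conv_lhs => rw [← hg, ← hψ]
    simp only [map_sum, map_smul, Finset.sum_smul, Finset.smul_sum]
    refine Finset.sum_congr rfl fun i _ => Finset.sum_congr rfl fun j _ => ?_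
    rw [smul_assoc, smul_assoc, mul_smul, mul_smul,
      smul_comm (ofHopf ℂ (Nichols n) (Nichols.basis n j)) (ψ (Nichols.basis n i)),
      Module.Basis.coord_apply]
  induction a using DrinfeldDouble.induction_on with
  | hadd a b ha hb => rw [add_smul, ha, hb, map_add, add_smul]
  | hm φ g =>
    have h1 (g : Nichols n) (x : X) : ofHopf ℂ _ g • x = counit (R := ℂ) g • x := by
      have := key g counit x
      rwa [ofDual_counit, one_smul, Bialgebra.counit_one, mul_one] at this
    have h2 (φ : Module.Dual ℂ (Nichols n)) (x : X) : ofDual ℂ _ φ • x = φ 1 • x := by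
      have := key 1 φ x
      rwa [ofHopf_one, one_smul, Bialgebra.counit_one, one_mul] at this
    rw [mul_smul, h2, h1, smul_smul, counit_eq, doubleCounit_mk]

/-- For even `n`, the modules over the double with the braiding given by `R` and the twist given by
the action of `twistElt n`. -/
def modularStructure (hn : Even n) : ModularStructure (DKMod n) :=
  letI := braidedCategory (isUniversalR (n := n))
  { isFiniteTensorCategory := isFiniteTensorCategory isUniversalR finite_simple
    twist := twistIso (isUnit_twistElt n).unit mul_twistElt
    twist_tensor := twistIso_tensor isUniversalR _ _ (comul_twistElt n)
    twist_dual := fun X _ => twistIso_dual _ _ (antipode_twistElt hn) X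
    nondegenerate := fun X h => exists_iso_biproduct_unit X (smul_eq_counit_smul X h) }

theorem isStandard_modularStructure (hn : Even n) : IsStandard (modularStructure hn) := by
  have := braidedTensorData (isUniversalR (n := n))
  rw [← rMatrix_eq] at this
  exact ⟨this⟩

end DoubledNichols
end NicholsDouble
end

noncomputable section
set_option linter.unusedSectionVars false

namespace NicholsDouble

/-! ### The trivial module -/

namespace DoubledNichols
open DrinfeldDouble HopfModule
open scoped ModuleCat
variable {n : ℕ}

theorem simple_of_isTrivialModule {V : DKMod n} (hV : IsTrivialModule V) : Simple V := by
  rw [fg_simple_iff, isSimpleModule_iff_toSpanSingleton_surjective]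
  refine ⟨Module.nontrivial_of_finrank_pos (R := ℂ) (hV.1 ▸ one_pos), fun x hx y => ?_⟩
  obtain ⟨c, rfl⟩ := exists_smul_eq_of_finrank_eq_one hV.1 hx y
  exact ⟨algebraMap ℂ _ c, by rw [LinearMap.toSpanSingleton_apply, algebraMap_smul]⟩

/-- The trivial module is one of the one-dimensional simple modules. -/
theorem exists_charObj_iso_of_isTrivialModule {V : DKMod n} (hV : IsTrivialModule V) :
    ∃ s, Nonempty (charObj n s ≅ V) := by
  have := simple_of_isTrivialModule hV
  refine (simple_classification V).resolve_right ?_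
  rintro ⟨s, ⟨f⟩⟩
  let e : leftIdeal (idemSimple n s.1) ≃ₗ[DoubledNichols n] V := FGModuleCat.isoToLinearEquiv f
  -- `C` acts by `-1` on the projective simple modules and by `1` on the trivial one
  have h0 : leftGen (idemSimple n s.1) ≠ 0 := leftGen_ne_zero (idemSimple_ne_zero s.2)
  have h1 := hV.2 C (e (leftGen _))
  rw [← map_smul, C_smul_leftIdeal, C, doubleCounit_mul, doubleCounit_chi, doubleCounit_K, one_mul,
    one_smul] at h1
  exact h0 (eq_zero_of_eq_neg (e.injective h1).symm)

theorem isTrivialModule_uObj : IsTrivialModule (uObj (DoubledNichols n)) :=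
  ⟨(uEquiv (DoubledNichols n)).symm.finrank_eq.trans (Module.finrank_self ℂ), fun a v => by
    obtain ⟨c, rfl⟩ := (uEquiv (DoubledNichols n)).surjective v
    rw [smul_uEquiv, ← smul_eq_mul, map_smul]
    rfl⟩

theorem exists_isProjectiveCover_isTrivialModule (n : ℕ) :
    ∃ (V P : DKMod n) (π : P ⟶ V), IsTrivialModule V ∧ IsProjectiveCover π := by
  obtain ⟨s, ⟨e⟩⟩ := exists_charObj_iso_of_isTrivialModule (isTrivialModule_uObj (n := n))
  exact ⟨_, _, _, isTrivialModule_uObj, (isProjectiveCover_coverMap s).comp_iso e⟩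

theorem isGreatest_of_isTrivialModule (hn : 0 < n) {V P : DKMod n} {π : P ⟶ V}
    (hV : IsTrivialModule V) (hπ : IsProjectiveCover π) :
    IsGreatest {s : ℕ | ∃ S : Finset (End P), S.card = s ∧ IsNilpotentProductSet S} n := by
  obtain ⟨s, ⟨e⟩⟩ := exists_charObj_iso_of_isTrivialModule hV
  have := simple_of_isTrivialModule hV
  exact isGreatest_of_isProjectiveCover hπ fun h =>
    not_projective_charObj hn s (Projective.of_iso e.symm h)

theorem isEmpty_equivalence {m : ℕ} (hn : 0 < n) (hm : 0 < m) (h : n ≠ m) :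
    IsEmpty (DKMod n ≌ DKMod m) :=
  ⟨fun F => h ((le_of_equivalence hn F).antisymm (le_of_equivalence hm F.symm))⟩

end DoubledNichols
end NicholsDouble
end

theorem mainTheorem6 :
    (∀ n m : ℕ, 0 < n → 0 < m → n ≠ m →
      IsEmpty (NicholsDouble.DKMod n ≌ NicholsDouble.DKMod m)) ∧
    (∀ n : ℕ, 0 < n →
      (∃ (V P : NicholsDouble.DKMod n) (π : P ⟶ V),
        NicholsDouble.IsTrivialModule V ∧ NicholsDouble.IsProjectiveCover π) ∧
      ∀ (V P : NicholsDouble.DKMod n) (π : P ⟶ V),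
        NicholsDouble.IsTrivialModule V → NicholsDouble.IsProjectiveCover π →
          IsGreatest {s : ℕ | ∃ S : Finset (End P),
            S.card = s ∧ NicholsDouble.IsNilpotentProductSet S} n) ∧
    (∀ n : ℕ, 0 < n → NicholsDouble.totalRank (NicholsDouble.DKMod n) = 6) ∧
    (∀ n : ℕ, 0 < n → Even n →
      ∃ M : NicholsDouble.ModularStructure (NicholsDouble.DKMod n), NicholsDouble.IsStandard M) ∧
    (∃ B : ℕ → NicholsDouble.ModularCategory.{0, 1},
      (∀ i, NicholsDouble.totalRank (B i).carrier = 6) ∧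
      ∀ i j, i ≠ j → IsEmpty ((B i).carrier ≌ (B j).carrier)) := by
  refine ⟨fun n m hn hm h => NicholsDouble.DoubledNichols.isEmpty_equivalence hn hm h,
    fun n hn => ⟨NicholsDouble.DoubledNichols.exists_isProjectiveCover_isTrivialModule n,
      fun V P π hV hπ => NicholsDouble.DoubledNichols.isGreatest_of_isTrivialModule hn hV hπ⟩,
    fun n hn => NicholsDouble.DoubledNichols.totalRank_eq_six hn,
    fun n _ hn => ⟨NicholsDouble.DoubledNichols.modularStructure hn,
      NicholsDouble.DoubledNichols.isStandard_modularStructure hn⟩,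
    fun i => ⟨NicholsDouble.DKMod (2 * (i + 1)),
      NicholsDouble.DoubledNichols.modularStructure (even_two_mul _)⟩,
    fun i => NicholsDouble.DoubledNichols.totalRank_eq_six (by omega),
    fun i j h => NicholsDouble.DoubledNichols.isEmpty_equivalence (by omega) (by omega) (by omega)⟩
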